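/- Consider trees $T$ on the vertex set $\{0,\dots,n-1\}$ whose edges $e$ have real lengths $l(e)>0$, and integers $1\le k\le n$. Each edge is regarded as a segment of length $l(e)$, so a point of $T$ is a vertex or a point of an edge, and $d(x,v)$ is the length of the path of $T$ from the point $x$ to the vertex $v$. A $k$-subtree is a subtree of $T$ with exactly $k$ vertices. For a point $x$ of $T$ put $$\phi(x,T)=\min_{T^k}\ \max_{v\in V(T^k)} d(x,v),$$ where the minimum is over all $k$-subtrees $T^k$ of $T$. The unweighted connected $k$-vertex one-center problem asks for a point $x^*$ of $T$ that minimizes $\phi(x,T)$ over all points $x$ of $T$, for the value $\lambda^*=\phi(x^*,T)$, and for a $k$-subtree $T^*$ with $\max_{v\in V(T^*)}d(x^*,v)=\lambda^*$. The model of computation is a real RAM: integer words hold the numbers below $(n+1)^c$ for a constant $c$, with unit-cost word arithmetic and indirect addressing; real numbers can be copied, added, subtracted, halved and compared at unit cost (and cannot be rounded or turned into integers). The input consists of $n$, $k$ and a list of the $n-1$ edges, in any order, with their two ends and their lengths; a point is output as a vertex, or as an edge $uv$ with the distance of the point from $u$. **Theorem.** The unweighted connected $k$-vertex one-center problem on trees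 can be solved in $O(n\log^2 n)$ time. That is, there are a single program and constants $c$ and $C$ such that, for all $n\ge 1$, all $1\le k\le n$, all such trees $T$ with $n$ vertices and all positive edge lengths, the program halts with $x^*$, $\lambda^*$ and $V(T^*)$, and for $n\ge 2$ it does so after at most $C\,n\log^2 n$ steps. -/

import Mathlib

namespace PartialCenter

/-! ## Graphs with edge lengths, their points, and the connected k-vertex one-center problem -/

/-- The length of a walk when the edge `e` has length `len e`. -/
def walkLength {V : Type*} {G : SimpleGraph V} (len : Sym2 V → ℝ) {u v : V}
    (p : G.Walk u v) : ℝ :=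
  (p.edges.map len).sum

/-- The distance `d(u, v)` of two vertices: the length of a shortest walk between them. -/
noncomputable def vertexDist {V : Type*} (G : SimpleGraph V) (len : Sym2 V → ℝ) (u v : V) : ℝ :=
  ⨅ p : G.Walk u v, walkLength len p

/-- A point of the graph, every edge being regarded as a segment: a vertex, or the point of the
edge `uv` at distance `t` from `u` along that edge. -/
inductive Point {V : Type*} (G : SimpleGraph V) (len : Sym2 V → ℝ) : Type _
  | vertex (v : V) : Point G len
  | onEdge (u v : V) (adj : G.Adj u v) (t : ℝ) (nonneg : 0 ≤ t) (le : t ≤ len s(u, v)) :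
      Point G len

/-- The distance from a point to a vertex. A path that starts at a point of the edge `uv` leaves
that edge through `u` or through `v`. -/
noncomputable def Point.dist {V : Type*} {G : SimpleGraph V} {len : Sym2 V → ℝ} :
    Point G len → V → ℝ
  | .vertex v, w => vertexDist G len v w
  | .onEdge u v _ t _ _, w =>
      min (t + vertexDist G len u w) ((len s(u, v) - t) + vertexDist G len v w)

/-- The `k`-subtrees of `G`: subgraphs that are trees with exactly `k` vertices. -/
def KSubtree {V : Type*} (G : SimpleGraph V) (k : ℕ) : Type _ :=
  {H : G.Subgraph // H.coe.IsTree ∧ H.verts.ncard = k}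

/-- The largest distance from the point `x` to a vertex of `H` (all vertex weights are one). -/
noncomputable def coverRadius {V : Type*} {G : SimpleGraph V} {len : Sym2 V → ℝ} {k : ℕ}
    (x : Point G len) (H : KSubtree G k) : ℝ :=
  ⨆ v : H.1.verts, x.dist v.1

/-- The objective `φ(x, T)` of the unweighted connected `k`-vertex one-center problem on a tree `T`.
The only shortest path tree of a point of `T` is `T`, so the minimum is over all `k`-subtrees. -/
noncomputable def phi {V : Type*} {T : SimpleGraph V} {len : Sym2 V → ℝ} (k : ℕ)
    (x : Point T len) : ℝ :=
  ⨅ H : KSubtree T k, coverRadius x H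

/-- `x` is a partial center: it minimizes `φ` over all points of the tree. -/
def IsPartialCenter {V : Type*} {T : SimpleGraph V} {len : Sym2 V → ℝ} (k : ℕ)
    (x : Point T len) : Prop :=
  ∀ y : Point T len, phi k x ≤ phi k y

/-! ## The machine: a real RAM with integer words of bounded size

A program is a fixed finite text. It names finitely many integer arrays and finitely many real
arrays (a scalar variable is entry `0` of an array) and accesses their entries by computed indices.
Integers are words, that is, numbers below a bound `W`, with arithmetic modulo `W`. Reals can only
be copied, added, subtracted, halved and compared; they cannot be rounded or turned into integers.
Each operation, memory access, comparison, assignment and branching costs one unit of time. -/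

/-- Integer expressions. `get a i` is entry `i` of the integer array `a`. -/
inductive IExp : Type
  | lit (c : ℕ) : IExp
  | get (a : ℕ) (i : IExp) : IExp
  | add (e f : IExp) : IExp
  | sub (e f : IExp) : IExp
  | mul (e f : IExp) : IExp
  | div (e f : IExp) : IExp

/-- Real expressions. `get a i` is entry `i` of the real array `a`. -/
inductive RExp : Type
  | zero : RExp
  | get (a : ℕ) (i : IExp) : RExp
  | add (e f : RExp) : RExp
  | sub (e f : RExp) : RExp
  | half (e : RExp) : RExp

/-- Tests. -/
inductive BExp : Type
  | ilt (e f : IExp) : BExp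
  | ieq (e f : IExp) : BExp
  | rlt (e f : RExp) : BExp
  | not (b : BExp) : BExp
  | and (b c : BExp) : BExp

/-- Programs. `iset a i e` stores `e` in entry `i` of the integer array `a`; `rset` does the same
for real arrays; `loop b p` repeats `p` as long as the test `b` holds. -/
inductive Prog : Type
  | skip : Prog
  | iset (a : ℕ) (i e : IExp) : Prog
  | rset (a : ℕ) (i : IExp) (e : RExp) : Prog
  | seq (p q : Prog) : Prog
  | ite (b : BExp) (p q : Prog) : Prog
  | loop (b : BExp) (p : Prog) : Prog

/-- The contents of the memory: `ints a i` and `reals a i` are the entries `i` of the integer array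
and of the real array with name `a`. -/
structure Mem : Type where
  ints : ℕ → ℕ → ℕ
  reals : ℕ → ℕ → ℝ

/-- Replaces entry `i` of the integer array `a` by `x`. -/
def Mem.setInt (s : Mem) (a i x : ℕ) : Mem :=
  { s with ints := Function.update s.ints a (Function.update (s.ints a) i x) }

/-- Replaces entry `i` of the real array `a` by `x`. -/
def Mem.setReal (s : Mem) (a i : ℕ) (x : ℝ) : Mem :=
  { s with reals := Function.update s.reals a (Function.update (s.reals a) i x) }

/-- The value of an integer expression on a machine with words below `W`. Subtraction is truncated
at `0`, division is rounded down. -/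
def IExp.val (W : ℕ) (s : Mem) : IExp → ℕ
  | .lit c => c % W
  | .get a i => s.ints a (i.val W s)
  | .add e f => (e.val W s + f.val W s) % W
  | .sub e f => e.val W s - f.val W s
  | .mul e f => (e.val W s * f.val W s) % W
  | .div e f => e.val W s / f.val W s

/-- The value of a real expression. -/
noncomputable def RExp.val (W : ℕ) (s : Mem) : RExp → ℝ
  | .zero => 0
  | .get a i => s.reals a (i.val W s)
  | .add e f => e.val W s + f.val W s
  | .sub e f => e.val W s - f.val W s
  | .half e => e.val W s / 2

/-- The truth of a test. -/
def BExp.Holds (W : ℕ) (s : Mem) : BExp → Prop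
  | .ilt e f => e.val W s < f.val W s
  | .ieq e f => e.val W s = f.val W s
  | .rlt e f => e.val W s < f.val W s
  | .not b => ¬ b.Holds W s
  | .and b c => b.Holds W s ∧ c.Holds W s

/-- The time for evaluating an integer expression. -/
def IExp.cost : IExp → ℕ
  | .lit _ => 1
  | .get _ i => i.cost + 1
  | .add e f => e.cost + f.cost + 1
  | .sub e f => e.cost + f.cost + 1
  | .mul e f => e.cost + f.cost + 1
  | .div e f => e.cost + f.cost + 1

/-- The time for evaluating a real expression. -/
def RExp.cost : RExp → ℕ
  | .zero => 1
  | .get _ i => i.cost + 1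
  | .add e f => e.cost + f.cost + 1
  | .sub e f => e.cost + f.cost + 1
  | .half e => e.cost + 1

/-- The time for evaluating a test. -/
def BExp.cost : BExp → ℕ
  | .ilt e f => e.cost + f.cost + 1
  | .ieq e f => e.cost + f.cost + 1
  | .rlt e f => e.cost + f.cost + 1
  | .not b => b.cost + 1
  | .and b c => b.cost + c.cost + 1

/-- `Runs W p s s' t`: on a machine with words below `W`, the program `p` started with memory `s`
halts after `t` units of time with memory `s'`. -/
inductive Runs (W : ℕ) : Prog → Mem → Mem → ℕ → Prop
  | skip (s : Mem) : Runs W .skip s s 1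
  | iset (s : Mem) (a : ℕ) (i e : IExp) :
      Runs W (.iset a i e) s (s.setInt a (i.val W s) (e.val W s)) (i.cost + e.cost + 1)
  | rset (s : Mem) (a : ℕ) (i : IExp) (e : RExp) :
      Runs W (.rset a i e) s (s.setReal a (i.val W s) (e.val W s)) (i.cost + e.cost + 1)
  | seq {p q : Prog} {s s' s'' : Mem} {t t' : ℕ} (hp : Runs W p s s' t)
      (hq : Runs W q s' s'' t') : Runs W (.seq p q) s s'' (t + t')
  | iteTrue {b : BExp} {p q : Prog} {s s' : Mem} {t : ℕ} (hb : b.Holds W s)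
      (hp : Runs W p s s' t) : Runs W (.ite b p q) s s' (b.cost + 1 + t)
  | iteFalse {b : BExp} {p q : Prog} {s s' : Mem} {t : ℕ} (hb : ¬ b.Holds W s)
      (hq : Runs W q s s' t) : Runs W (.ite b p q) s s' (b.cost + 1 + t)
  | loopEnd {b : BExp} {p : Prog} {s : Mem} (hb : ¬ b.Holds W s) :
      Runs W (.loop b p) s s (b.cost + 1)
  | loopStep {b : BExp} {p : Prog} {s s' s'' : Mem} {t t' : ℕ} (hb : b.Holds W s)
      (hp : Runs W p s s' t) (hl : Runs W (.loop b p) s' s'' t') :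
      Runs W (.loop b p) s s'' (b.cost + 1 + t + t')

/-! ## Input and output -/

/-- `ends` lists the edges of `T`, in any order and with any order of the two ends. -/
def IsEdgeList {n : ℕ} (T : SimpleGraph (Fin n)) (ends : Fin (n - 1) → Fin n × Fin n) : Prop :=
  ∀ u v : Fin n, T.Adj u v ↔ ∃ i, ends i = (u, v) ∨ ends i = (v, u)

/-- The initial memory: `n` and `k` are the entries `0` of the integer arrays `0` and `1`, the two
ends of the `i`-th edge are the entries `i` of the integer arrays `2` and `3`, its length is the
entry `i` of the real array `0`, and everything else is `0`. -/
noncomputable def inputMem {n : ℕ} (k : ℕ) (len : Sym2 (Fin n) → ℝ)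
    (ends : Fin (n - 1) → Fin n × Fin n) : Mem where
  ints a i :=
    if a = 0 ∧ i = 0 then n
    else if a = 1 ∧ i = 0 then k
    else if h : i < n - 1 then
      if a = 2 then (ends ⟨i, h⟩).1 else if a = 3 then (ends ⟨i, h⟩).2 else 0
    else 0
  reals a i :=
    if h : i < n - 1 then
      if a = 0 then len s((ends ⟨i, h⟩).1, (ends ⟨i, h⟩).2) else 0
    else 0

/-- The memory `s` presents the point `x`: the entries `0` of the integer arrays `4`, `5` and of the
real array `1` are `u`, `v`, `t` for the point of the edge `uv` at distance `t` from `u`, and they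
are `v`, `v`, `0` for the vertex `v`. -/
def OutputsPoint {n : ℕ} {T : SimpleGraph (Fin n)} {len : Sym2 (Fin n) → ℝ} (s : Mem) :
    Point T len → Prop
  | .vertex v => s.ints 4 0 = v ∧ s.ints 5 0 = v ∧ s.reals 1 0 = 0
  | .onEdge u v _ t _ _ => s.ints 4 0 = u ∧ s.ints 5 0 = v ∧ s.reals 1 0 = t

/-- The memory `s` holds a solution: a partial center `x`, the optimal value `φ(x, T)` (entry `0` of
the real array `2`), and an optimal `k`-subtree, as the list of its vertices (the first `k` entries
of the integer array `6`). -/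
def OutputsSolution {n : ℕ} (k : ℕ) (T : SimpleGraph (Fin n)) (len : Sym2 (Fin n) → ℝ)
    (s : Mem) : Prop :=
  ∃ (x : Point T len) (H : KSubtree T k),
    IsPartialCenter k x ∧ coverRadius x H = phi k x ∧
    OutputsPoint s x ∧ s.reals 2 0 = phi k x ∧
    ∀ v : Fin n, v ∈ H.1.verts ↔ ∃ i < k, s.ints 6 i = v

end PartialCenter

namespace PartialCenter

/-! ## Reasoning about programs -/

-- Root the tree at vertex 0 and renumber the vertices by increasing depth, so that every parent has
-- a smaller number than its children. Call `D` feasible at `u` (`Feas`) if at least `k` of the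
-- vertices numbered up to `u` lie within distance `D` of `u`. The optimal value is half of the
-- least feasible `D ≥ 0`. In one direction, a `k`-subtree covered from a point with radius `r`
-- makes `2r` feasible at its last vertex, by the triangle inequality through that point
-- (`Models.exists_feas`). In the other direction, go from `u` towards the root by `D / 2`, stopping
-- at the root. The point reached covers every vertex `v ≤ u` with `d(u, v) ≤ D`: a vertex below the
-- point is at most as deep as `u`, and the path from `u` to any other vertex runs through the point
-- (`Models.dist_vertex_le`, `Models.dist_onEdge_le`). The `k` vertices nearest to `u` among those
-- up to `u` form a subtree, because the path to `u` only meets nearer vertices with numbers at most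
-- `u` (`Models.exists_kSubtree`). Thus `Models.isPartialCenter` reduces the problem to a search for
-- a number that is 0 or one of the pairwise distances.
--
-- The pairwise distances are stored implicitly by a centroid decomposition. A subtree with `m`
-- edges is split at its centroid `c`: some branches below `c`, with between one third and about
-- five sixths of the edges, are marked. The marked vertices become the columns and the other
-- vertices except `c` the rows of a node, a matrix whose entries `X i + Y j` are the distances
-- through `c`. Rows are sorted by distance. Columns need no sorting: a marked vertex lies below
-- `c`, so its distance from `c` is a difference of depths, and the numbering already sorts depths.
-- The two parts share only `c` and are treated in the same way. Hence each pair of vertices is an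
-- entry of exactly one node (`Closed.nodeAt`), and the nodes have total size `O(n log n)`
-- (`cost_split`). The only sorting per node is that of its rows, which gives `O(n log² n)` in all
-- (`decompProg_spec`).
--
-- Feasibility of a given `D` is decided in time linear in the size of the nodes
-- (`decideProg_spec`). In a node the columns within reach of a row form an initial segment that
-- shrinks from row to row, so one pointer finds them all. Each close pair has to be credited to its
-- larger vertex. For row `i` the first `p i` columns have smaller numbers than the row, so the row
-- gets the minimum of `p i` and its reach, and the remaining columns in reach form an interval that
-- is credited through a difference array (`pairCount_eq`).
--
-- The least feasible `D` is found by a search in sorted matrices with a refining grid. Only every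
-- `g`-th row and column is looked at, with `g` halved from about `n` down to 1. A bracket from `lo`
-- to `hi` contains the answer. When `g` is halved, the number of grid entries strictly inside the
-- bracket grows at most fourfold, apart from a term for the diagonals of the coarse grid
-- (`card_gridPos_le`), and three probes by binary search divide it by eight (`halveProg_spec`).
-- Hence about `N / g + M` entries stay open for `M` nodes of total size `N`. Listing and sorting
-- them costs a geometric sum plus `M` terms per level. There are `O(log n)` probes of cost `O(n log
-- n)`, and at `g = 1` the search runs until nothing is open (`searchProg_spec`,
-- `Bracket.le_of_feas`).
--
-- The tree itself is rooted without adjacency lists. Each vertex keeps its degree, the sum of its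
-- neighbours and the total length of its edges; at a leaf these name the parent and the edge to it,
-- and removing leaves one by one finds all parents (`leavesProg_spec`).
--
-- All programs are verified with triples that bound the running time as well (`Ends`). Loops are
-- handled by an invariant together with a potential that pays for the time (`Ends.loop`).

infixr:60 " ;; " => Prog.seq

instance : Add IExp := ⟨.add⟩
instance : Sub IExp := ⟨.sub⟩
instance : Mul IExp := ⟨.mul⟩
instance : Div IExp := ⟨.div⟩
instance (c : ℕ) : OfNat IExp c := ⟨.lit c⟩
instance : Add RExp := ⟨.add⟩
instance : Sub RExp := ⟨.sub⟩

/-- The integer scalar with name `a`. -/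
abbrev IExp.var (a : ℕ) : IExp := .get a 0
/-- The real scalar with name `a`. -/
abbrev RExp.var (a : ℕ) : RExp := .get a 0
/-- Assignment to an integer scalar. -/
abbrev Prog.ivar (a : ℕ) (e : IExp) : Prog := .iset a 0 e
/-- Assignment to a real scalar. -/
abbrev Prog.rvar (a : ℕ) (e : RExp) : Prog := .rset a 0 e

/-! ### Evaluation of expressions and memory updates, as rewrite rules. -/

section Values
variable (W : ℕ) (s : Mem)

@[simp] theorem val_get (a : ℕ) (i : IExp) : (IExp.get a i).val W s = s.ints a (i.val W s) := rfl
@[simp] theorem val_num (c : ℕ) : (no_index (OfNat.ofNat c) : IExp).val W s = c % W := rfl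
@[simp] theorem val_add (e f : IExp) : (e + f).val W s = (e.val W s + f.val W s) % W := rfl
@[simp] theorem val_sub (e f : IExp) : (e - f).val W s = e.val W s - f.val W s := rfl
@[simp] theorem val_mul (e f : IExp) : (e * f).val W s = (e.val W s * f.val W s) % W := rfl
@[simp] theorem val_div (e f : IExp) : (e / f).val W s = e.val W s / f.val W s := rfl
@[simp] theorem rval_zero : RExp.zero.val W s = 0 := rfl
@[simp] theorem rval_get (a : ℕ) (i : IExp) : (RExp.get a i).val W s = s.reals a (i.val W s) := rfl
@[simp] theorem rval_add (e f : RExp) : (e + f).val W s = e.val W s + f.val W s := rfl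
@[simp] theorem rval_sub (e f : RExp) : (e - f).val W s = e.val W s - f.val W s := rfl
@[simp] theorem rval_half (e : RExp) : e.half.val W s = e.val W s / 2 := rfl
@[simp] theorem holds_ilt (e f : IExp) : (BExp.ilt e f).Holds W s ↔ e.val W s < f.val W s := .rfl
@[simp] theorem holds_ieq (e f : IExp) : (BExp.ieq e f).Holds W s ↔ e.val W s = f.val W s := .rfl
@[simp] theorem holds_rlt (e f : RExp) : (BExp.rlt e f).Holds W s ↔ e.val W s < f.val W s := .rfl
@[simp] theorem holds_not (b : BExp) : b.not.Holds W s ↔ ¬ b.Holds W s := .rfl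
@[simp] theorem holds_and (b c : BExp) : (b.and c).Holds W s ↔ b.Holds W s ∧ c.Holds W s := .rfl

@[simp] theorem ints_setInt (a i x b j : ℕ) :
    (s.setInt a i x).ints b j = if b = a ∧ j = i then x else s.ints b j := by
  unfold Mem.setInt
  by_cases h : b = a
  · subst h
    by_cases h' : j = i <;> simp [h']
  · simp [h]

@[simp] theorem reals_setInt (a i x : ℕ) : (s.setInt a i x).reals = s.reals := rfl
@[simp] theorem ints_setReal (a i : ℕ) (x : ℝ) : (s.setReal a i x).ints = s.ints := rfl

@[simp] theorem reals_setReal (a i : ℕ) (x : ℝ) (b j : ℕ) :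
    (s.setReal a i x).reals b j = if b = a ∧ j = i then x else s.reals b j := by
  unfold Mem.setReal
  by_cases h : b = a
  · subst h
    by_cases h' : j = i <;> simp [h']
  · simp [h]

end Values

/-! ### Loop-free programs. -/

/-- Whether a program is free of loops. -/
def Prog.flat : Prog → Bool
  | .seq p q => p.flat && q.flat
  | .ite _ p q => p.flat && q.flat
  | .loop _ _ => false
  | _ => true

/-- A bound for the running time of a program without loops. -/
def Prog.time : Prog → ℕ
  | .skip => 1
  | .iset _ i e => i.cost + e.cost + 1
  | .rset _ i e => i.cost + e.cost + 1
  | .seq p q => p.time + q.time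
  | .ite b p q => b.cost + 1 + (p.time + q.time)
  | .loop _ _ => 0

open Classical in
/-- The effect of a program without loops. -/
noncomputable def Prog.exec (W : ℕ) : Prog → Mem → Mem
  | .skip, s => s
  | .iset a i e, s => s.setInt a (i.val W s) (e.val W s)
  | .rset a i e, s => s.setReal a (i.val W s) (e.val W s)
  | .seq p q, s => q.exec W (p.exec W s)
  | .ite b p q, s => if b.Holds W s then p.exec W s else q.exec W s
  | .loop _ _, s => s

/-- Loop-free code is verified by computation: `exec` unfolds under `simp` and `time` evaluates by
`decide`. The time of a conditional is bounded by the sum of both branches, which is crude but costs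
only a constant factor. -/
theorem Prog.runs_exec (W : ℕ) (p : Prog) (s : Mem) (h : p.flat = true) :
    ∃ t ≤ p.time, Runs W p s (p.exec W s) t := by
  induction p generalizing s with
  | skip => exact ⟨1, le_rfl, .skip s⟩
  | iset a i e => exact ⟨_, le_rfl, .iset s a i e⟩
  | rset a i e => exact ⟨_, le_rfl, .rset s a i e⟩
  | seq p q hp hq =>
    simp only [Prog.flat, Bool.and_eq_true] at h
    obtain ⟨t, ht, h1⟩ := hp s h.1
    obtain ⟨t', ht', h2⟩ := hq (p.exec W s) h.2
    exact ⟨t + t', Nat.add_le_add ht ht', .seq h1 h2⟩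
  | ite b p q hp hq =>
    simp only [Prog.flat, Bool.and_eq_true] at h
    by_cases hb : b.Holds W s
    · obtain ⟨t, ht, h1⟩ := hp s h.1
      refine ⟨b.cost + 1 + t, by simp only [Prog.time]; omega, ?_⟩
      simp only [Prog.exec, if_pos hb]
      exact .iteTrue hb h1
    · obtain ⟨t, ht, h1⟩ := hq s h.2
      refine ⟨b.cost + 1 + t, by simp only [Prog.time]; omega, ?_⟩
      simp only [Prog.exec, if_neg hb]
      exact .iteFalse hb h1
  | loop b p => simp [Prog.flat] at h

/-! ### Frame conditions. -/

/-- The integer arrays that a program may change. -/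
def Prog.wi : Prog → List ℕ
  | .iset a _ _ => [a]
  | .seq p q => p.wi ++ q.wi
  | .ite _ p q => p.wi ++ q.wi
  | .loop _ p => p.wi
  | _ => []

/-- The real arrays that a program may change. -/
def Prog.wr : Prog → List ℕ
  | .rset a _ _ => [a]
  | .seq p q => p.wr ++ q.wr
  | .ite _ p q => p.wr ++ q.wr
  | .loop _ p => p.wr
  | _ => []

/-- `s` and `s'` agree on the arrays that `p` does not change. -/
def Same (p : Prog) (s s' : Mem) : Prop :=
  (∀ a, a ∉ p.wi → s'.ints a = s.ints a) ∧ ∀ a, a ∉ p.wr → s'.reals a = s.reals a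

/-- The side condition is a closed computation on the list of written arrays, so `rfl` discharges it
and every frame argument becomes a rewrite. -/
theorem Same.int {p : Prog} {s s' : Mem} (h : Same p s s') (a : ℕ)
    (ha : (p.wi.contains a) = false := by rfl) : s'.ints a = s.ints a :=
  h.1 a (by simpa using ha)

theorem Same.real {p : Prog} {s s' : Mem} (h : Same p s s') (a : ℕ)
    (ha : (p.wr.contains a) = false := by rfl) : s'.reals a = s.reals a :=
  h.2 a (by simpa using ha)

theorem Same.refl (p : Prog) (s : Mem) : Same p s s := ⟨fun _ _ => rfl, fun _ _ => rfl⟩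

theorem Same.trans {p : Prog} {s s' s'' : Mem} (h : Same p s s') (h' : Same p s' s'') :
    Same p s s'' :=
  ⟨fun a ha => (h'.1 a ha).trans (h.1 a ha), fun a ha => (h'.2 a ha).trans (h.2 a ha)⟩

theorem Runs.same {W : ℕ} {p : Prog} {s s' : Mem} {t : ℕ} (h : Runs W p s s' t) :
    Same p s s' := by
  induction h with
  | skip s => exact Same.refl _ _
  | iset s a i e =>
    refine ⟨fun b hb => ?_, fun _ _ => rfl⟩
    have : b ≠ a := by simpa [Prog.wi] using hb
    funext j
    simp [this]
  | rset s a i e =>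
    refine ⟨fun _ _ => rfl, fun b hb => ?_⟩
    have : b ≠ a := by simpa [Prog.wr] using hb
    funext j
    simp [this]
  | seq _ _ h1 h2 =>
    refine ⟨fun a ha => ?_, fun a ha => ?_⟩
    · simp only [Prog.wi, List.mem_append, not_or] at ha
      exact (h2.1 a ha.2).trans (h1.1 a ha.1)
    · simp only [Prog.wr, List.mem_append, not_or] at ha
      exact (h2.2 a ha.2).trans (h1.2 a ha.1)
  | iteTrue _ _ h1 =>
    refine ⟨fun a ha => ?_, fun a ha => ?_⟩
    · simp only [Prog.wi, List.mem_append, not_or] at ha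
      exact h1.1 a ha.1
    · simp only [Prog.wr, List.mem_append, not_or] at ha
      exact h1.2 a ha.1
  | iteFalse _ _ h1 =>
    refine ⟨fun a ha => ?_, fun a ha => ?_⟩
    · simp only [Prog.wi, List.mem_append, not_or] at ha
      exact h1.1 a ha.2
    · simp only [Prog.wr, List.mem_append, not_or] at ha
      exact h1.2 a ha.2
  | loopEnd _ => exact Same.refl _ _
  | loopStep _ _ _ h1 h2 =>
    exact ⟨fun a ha => (h2.1 a ha).trans (h1.1 a ha), fun a ha => (h2.2 a ha).trans (h1.2 a ha)⟩

theorem exec_same (W : ℕ) (p : Prog) (s : Mem) (h : p.flat = true := by rfl) :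
    Same p s (p.exec W s) :=
  let ⟨_, _, h⟩ := p.runs_exec W s h
  h.same

/-! ### Total correctness with running times. -/

/-- `p` started with `s` halts, and its final memory and running time satisfy `Q`. -/
def Ends (W : ℕ) (p : Prog) (s : Mem) (Q : Mem → ℕ → Prop) : Prop :=
  ∃ s' t, Runs W p s s' t ∧ Q s' t

section Rules
variable {W : ℕ} {p q : Prog} {s : Mem} {Q R : Mem → ℕ → Prop}

/-- The consequence rule hands over the frame condition of the run, so specifications need not list
what stays unchanged. -/
theorem Ends.mono (h : Ends W p s Q) (hQ : ∀ s' t, Same p s s' → Q s' t → R s' t) :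
    Ends W p s R := by
  obtain ⟨s', t, h1, h2⟩ := h
  exact ⟨s', t, h1, hQ s' t h1.same h2⟩

theorem Ends.seq (h : Ends W p s fun s' t => Ends W q s' fun s'' t' => Q s'' (t + t')) :
    Ends W (p ;; q) s Q := by
  obtain ⟨s', t, h1, s'', t', h2, h3⟩ := h
  exact ⟨s'', t + t', .seq h1 h2, h3⟩

theorem Ends.flat (hp : p.flat = true) (h : ∀ t, t ≤ p.time → Q (p.exec W s) t) :
    Ends W p s Q := by
  obtain ⟨t, ht, h1⟩ := p.runs_exec W s hp
  exact ⟨_, t, h1, h t ht⟩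

theorem Ends.ite {b : BExp} (h1 : b.Holds W s → Ends W p s fun s' t => Q s' (b.cost + 1 + t))
    (h2 : ¬ b.Holds W s → Ends W q s fun s' t => Q s' (b.cost + 1 + t)) :
    Ends W (.ite b p q) s Q := by
  by_cases hb : b.Holds W s
  · obtain ⟨s', t, h, h'⟩ := h1 hb
    exact ⟨s', _, .iteTrue hb h, h'⟩
  · obtain ⟨s', t, h, h'⟩ := h2 hb
    exact ⟨s', _, .iteFalse hb h, h'⟩

/-- The rule for loops: an invariant `I` with a ghost parameter and a potential `Φ` of the ghost
parameter that pays for the running time. -/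
theorem Ends.loop {γ : Type*} (I : γ → Mem → Prop) (Φ : γ → ℕ) {b : BExp} (g : γ) (hI : I g s)
    (h : ∀ g s', I g s' → b.Holds W s' → Same p s s' →
      Ends W p s' fun s'' t => ∃ g', I g' s'' ∧ t + b.cost + 1 + Φ g' ≤ Φ g) :
    Ends W (.loop b p) s fun s' t =>
      ∃ g', I g' s' ∧ ¬ b.Holds W s' ∧ t + Φ g' ≤ Φ g + b.cost + 1 := by
  -- Induction on a bound for the potential. Each round pays at least one unit, so the potential
  -- drops strictly; this also gives termination.
  suffices H : ∀ N g s', Φ g ≤ N → I g s' → Same p s s' → Ends W (.loop b p) s' fun s'' t =>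
      ∃ g', I g' s'' ∧ ¬ b.Holds W s'' ∧ t + Φ g' ≤ Φ g + b.cost + 1 from
    H _ g s le_rfl hI (Same.refl _ _)
  intro N
  induction N with
  | zero =>
    intro g s' hN hI hs
    by_cases hb : b.Holds W s'
    · obtain ⟨s'', t, h1, g', h2, h3⟩ := h g s' hI hb hs
      omega
    · exact ⟨s', _, .loopEnd hb, g, hI, hb, by omega⟩
  | succ N ih =>
    intro g s' hN hI hs
    by_cases hb : b.Holds W s'
    · obtain ⟨s'', t, h1, g', h2, h3⟩ := h g s' hI hb hs
      obtain ⟨s3, t', h4, g'', h5, h6, h7⟩ := ih g' s'' (by omega) h2 (hs.trans h1.same)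
      exact ⟨s3, _, .loopStep hb h1 h4, g'', h5, h6, by omega⟩
    · exact ⟨s', _, .loopEnd hb, g, hI, hb, by omega⟩

/-- The rule for counting loops: `I i` holds before round `i`, and a round takes at most `K` units
of time together with its test. -/
theorem Ends.count (I : ℕ → Mem → Prop) (K : ℕ) {b : BExp} (i m : ℕ) (him : i ≤ m) (hI : I i s)
    (hb : ∀ i s', i ≤ m → I i s' → (b.Holds W s' ↔ i < m))
    (h : ∀ i s', i < m → I i s' → Same p s s' →
      Ends W p s' fun s'' t => I (i + 1) s'' ∧ t + b.cost + 1 ≤ K) :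
    Ends W (.loop b p) s fun s' t => I m s' ∧ t ≤ K * (m - i) + b.cost + 1 := by
  refine (Ends.loop (fun i s' => i ≤ m ∧ I i s') (fun i => K * (m - i)) i ⟨him, hI⟩ ?_).mono ?_
  · rintro i s' ⟨h1, h2⟩ hbs hs
    have him : i < m := (hb i s' h1 h2).1 hbs
    refine (h i s' him h2 hs).mono ?_
    rintro s'' t - ⟨h3, h4⟩
    refine ⟨i + 1, ⟨him, h3⟩, ?_⟩
    obtain ⟨d, rfl⟩ := Nat.exists_eq_add_of_lt him
    have e1 : i + d + 1 - i = d + 1 := by omega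
    have e2 : i + d + 1 - (i + 1) = d := by omega
    rw [e1, e2, Nat.mul_succ]
    omega
  · rintro s' t - ⟨g, ⟨h1, h2⟩, h3, h4⟩
    have : g = m := by
      by_contra hne
      exact h3 ((hb g s' h1 h2).2 (lt_of_le_of_ne h1 hne))
    subst this
    exact ⟨h2, by omega⟩

/-- The rule for counting loops whose body is free of loops. -/
theorem Ends.count_flat (I : ℕ → Mem → Prop) (K : ℕ) {b : BExp} (i m : ℕ) (him : i ≤ m)
    (hI : I i s) (hb : ∀ i s', i ≤ m → I i s' → (b.Holds W s' ↔ i < m))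
    (h : ∀ i s', i < m → I i s' → Same p s s' → I (i + 1) (p.exec W s'))
    (hp : p.flat = true := by rfl) (hK : p.time + b.cost + 1 ≤ K := by decide) :
    Ends W (.loop b p) s fun s' t => I m s' ∧ t ≤ K * (m - i) + K :=
  (Ends.count I K i m him hI hb fun i s' h1 h2 h3 => .flat hp fun _ ht =>
    ⟨h i s' h1 h2 h3, by omega⟩).mono fun _ _ _ h => ⟨h.1, by omega⟩

end Rules

end PartialCenter

set_option linter.unusedSimpArgs false

namespace PartialCenter

/-! ## Sorting -/

/-- The smaller one of two numbers. -/
abbrev IExp.min (e f : IExp) : IExp := e - (e - f)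

/-- The multiset of the entries of `f` at the positions from `b` to `e - 1`. -/
def items {α : Type*} (f : ℕ → α) (b e : ℕ) : Multiset α := ∑ x ∈ Finset.Ico b e, {f x}

/-! ### The entries of a stretch of an array as a multiset. -/

section Items
variable {α : Type*} {f g : ℕ → α}

theorem items_self (b : ℕ) : items f b b = 0 := by simp [items]

theorem items_succ {b e : ℕ} (h : b ≤ e) : items f b (e + 1) = items f b e + {f e} :=
  Finset.sum_Ico_succ_top h _

theorem items_add {b m e : ℕ} (h1 : b ≤ m) (h2 : m ≤ e) :
    items f b m + items f m e = items f b e :=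
  Finset.sum_Ico_consecutive _ h1 h2

theorem items_congr {b e : ℕ} (h : ∀ x, b ≤ x → x < e → f x = g x) : items f b e = items g b e :=
  Finset.sum_congr rfl fun x hx => by
    rw [h x (Finset.mem_Ico.1 hx).1 (Finset.mem_Ico.1 hx).2]

theorem mem_items {b e : ℕ} {a : α} : a ∈ items f b e ↔ ∃ x, b ≤ x ∧ x < e ∧ f x = a := by
  simp [items, Multiset.mem_sum, eq_comm, and_assoc]

theorem sum_items {β : Type*} [AddCommMonoid β] (h : α → β) (b e : ℕ) :
    ((items f b e).map h).sum = ∑ x ∈ Finset.Ico b e, h (f x) := by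
  simp only [items, Finset.sum_eq_multiset_sum]
  induction (Finset.Ico b e).val using Multiset.induction_on with
  | empty => simp
  | cons a t ih => simp [ih]

theorem card_items (b e : ℕ) : (items f b e).card = e - b := by
  simp [items]

end Items

/-! ### Bottom-up merge sort. -/

/-- Opens the next pair of runs when the current pair is exhausted. -/
def mergeOpen : Prog :=
  .ite (.ieq (.var 14) (.var 18))
    (.ivar 15 (.var 14) ;; .ivar 16 (.min (.var 12) (.var 14 + .var 13)) ;;
      .ivar 17 (.var 16) ;; .ivar 18 (.min (.var 12) (.var 16 + .var 13))) .skip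

/-- Moves the smaller one of the two next entries to entry `o` of the output. -/
def mergePut : Prog :=
  .ite (.and (.ilt (.var 15) (.var 16))
      (.not (.and (.ilt (.var 17) (.var 18)) (.rlt (.get 10 (.var 17)) (.get 10 (.var 15))))))
    (.rset 11 (.var 14) (.get 10 (.var 15)) ;; .iset 11 (.var 14) (.get 10 (.var 15)) ;;
      .ivar 15 (.var 15 + 1))
    (.rset 11 (.var 14) (.get 10 (.var 17)) ;; .iset 11 (.var 14) (.get 10 (.var 17)) ;;
      .ivar 17 (.var 17 + 1)) ;;
  .ivar 14 (.var 14 + 1)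

/-- Copies the output of a merging pass back. -/
def copyStep : Prog :=
  .rset 10 (.var 14) (.get 11 (.var 14)) ;; .iset 10 (.var 14) (.get 11 (.var 14)) ;;
  .ivar 14 (.var 14 + 1)

/-- One pass of merge sort: runs of length `w` are merged in pairs. -/
def mergePass : Prog :=
  (.ivar 14 0 ;; .ivar 15 0 ;; .ivar 16 0 ;; .ivar 17 0 ;; .ivar 18 0) ;;
  .loop (.ilt (.var 14) (.var 12)) (mergeOpen ;; mergePut) ;;
  .ivar 14 0 ;;
  .loop (.ilt (.var 14) (.var 12)) copyStep ;;
  .ivar 13 (.var 13 + .var 13)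

/-- Merge sort: sorts the first entries of the real array `10`, together with those of the integer
array `10`; their number is the integer scalar `12`. -/
def sortProg : Prog :=
  .ivar 13 1 ;; .loop (.ilt (.var 13) (.var 12)) mergePass

/-- Every block of `w` consecutive entries of `K` is sorted. -/
def SortedBlocks (K : ℕ → ℝ) (w len : ℕ) : Prop :=
  ∀ q x y, q * w ≤ x → x ≤ y → y < (q + 1) * w → y < len → K x ≤ K y

/-- The pairs of keys and payloads that are to be sorted. -/
abbrev Mem.recs (s : Mem) (a : ℕ) : ℕ → ℝ × ℕ := fun x => (s.reals a x, s.ints a x)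

/-- The invariant of a merging pass. -/
structure MergeInv (K : ℕ → ℝ) (R : ℕ → ℝ × ℕ) (w len o : ℕ) (s : Mem) (β i m j e : ℕ) :
    Prop where
  ho : s.ints 14 0 = o
  hi : s.ints 15 0 = i
  hm : s.ints 16 0 = m
  hj : s.ints 17 0 = j
  he : s.ints 18 0 = e
  bi : 2 * w * β ≤ i
  im : i ≤ m
  mj : m ≤ j
  je : j ≤ e
  el : e ≤ len
  eb : e ≤ 2 * w * β + 2 * w
  nxt : (∃ γ, e = 2 * w * γ) ∨ e = len
  pos : o + m = i + j
  run1 : ∀ x y, 2 * w * β ≤ x → x ≤ y → y < m → K x ≤ K y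
  run2 : ∀ x y, m ≤ x → x ≤ y → y < e → K x ≤ K y
  le1 : ∀ x y, 2 * w * β ≤ x → x < o → i ≤ y → y < m → s.reals 11 x ≤ K y
  le2 : ∀ x y, 2 * w * β ≤ x → x < o → j ≤ y → y < e → s.reals 11 x ≤ K y
  out : ∀ q x y, q * (2 * w) ≤ x → x ≤ y → y < (q + 1) * (2 * w) → y < o →
    s.reals 11 x ≤ s.reals 11 y
  cont : items (s.recs 11) 0 o = items R 0 i + items R m j

/-- Whichever run supplies the entry, its key is at most everything left in both runs and at least
everything already written for the present pair (`key1`, `key2`, `key3`). These bounds keep the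
output sorted. -/
theorem MergeInv.push {K : ℕ → ℝ} {R : ℕ → ℝ × ℕ} {w len o : ℕ} {s s' : Mem} {β i m j e : ℕ}
    (h : MergeInv K R w len o s β i m j e) (hK : ∀ x, (R x).1 = K x) (c i' j' : ℕ)
    (hoe : o < e)
    (ho : s'.ints 14 0 = o + 1) (hi : s'.ints 15 0 = i') (hm : s'.ints 16 0 = m)
    (hj : s'.ints 17 0 = j') (he : s'.ints 18 0 = e)
    (hT : ∀ x, s'.recs 11 x = if x = o then R c else s.recs 11 x)
    (hc : (c = i ∧ i < m ∧ i' = i + 1 ∧ j' = j ∧ (j < e → K i ≤ K j)) ∨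
      (c = j ∧ j < e ∧ i' = i ∧ j' = j + 1 ∧ (i < m → K j ≤ K i))) :
    MergeInv K R w len (o + 1) s' β i' m j' e := by
  obtain ⟨-, -, -, -, -, bi, im, mj, je, el, eb, nxt, pos, run1, run2, le1, le2, out, cont⟩ := h
  have hT1 : ∀ x, s'.reals 11 x = if x = o then K c else s.reals 11 x := by
    intro x
    have := congrArg Prod.fst (hT x)
    by_cases hx : x = o
    · simpa [hx, hK] using this
    · simpa [hx] using this
  have key1 : ∀ y, i' ≤ y → y < m → K c ≤ K y := by
    intro y h1 h2
    rcases hc with ⟨rfl, h3, rfl, rfl, h4⟩ | ⟨rfl, h3, rfl, rfl, h4⟩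
    · exact run1 _ _ bi (by omega) h2
    · exact (h4 (by omega)).trans (run1 _ _ bi h1 h2)
  have key2 : ∀ y, j' ≤ y → y < e → K c ≤ K y := by
    intro y h1 h2
    rcases hc with ⟨rfl, h3, rfl, rfl, h4⟩ | ⟨rfl, h3, rfl, rfl, h4⟩
    · exact (h4 (by omega)).trans (run2 _ _ mj h1 h2)
    · exact run2 _ _ mj (by omega) h2
  have key3 : ∀ x, 2 * w * β ≤ x → x < o → s.reals 11 x ≤ K c := by
    intro x h1 h2
    rcases hc with ⟨rfl, h3, rfl, rfl, h4⟩ | ⟨rfl, h3, rfl, rfl, h4⟩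
    · exact le1 _ _ h1 h2 le_rfl h3
    · exact le2 _ _ h1 h2 le_rfl h3
  have hii : i ≤ i' ∧ i' ≤ m ∧ j ≤ j' ∧ j' ≤ e ∧ o + 1 + m = i' + j' := by
    rcases hc with ⟨rfl, h3, rfl, rfl, h4⟩ | ⟨rfl, h3, rfl, rfl, h4⟩ <;> omega
  refine ⟨ho, hi, hm, hj, he, by omega, by omega, by omega, by omega, el, eb, nxt, by omega,
    run1, run2, ?_, ?_, ?_, ?_⟩
  · intro x y h1 h2 h3 h4
    rw [hT1]
    split_ifs with hx
    · exact key1 y h3 h4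
    · exact le1 x y h1 (by omega) (by omega) h4
  · intro x y h1 h2 h3 h4
    rw [hT1]
    split_ifs with hx
    · exact key2 y h3 h4
    · exact le2 x y h1 (by omega) (by omega) h4
  · intro q x y h1 h2 h3 h4
    rw [hT1, hT1]
    have hbo : 2 * w * β ≤ o := by omega
    by_cases hy : y = o
    · subst hy
      by_cases hx : x = y
      · simp [hx]
      · rw [if_neg hx, if_pos rfl]
        refine key3 x ?_ (by omega)
        -- The output block that contains position `o` cannot end before the present pair of runs
        -- begins, so all of its earlier positions belong to this pair.
        have h5 : β < q + 1 := by
          by_contra h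
          have := Nat.mul_le_mul_right (2 * w) (not_lt.1 h)
          rw [mul_comm β] at this
          omega
        have := Nat.mul_le_mul_right (2 * w) (Nat.lt_succ_iff.1 h5)
        rw [mul_comm β] at this
        omega
    · rw [if_neg hy, if_neg (by omega)]
      exact out q x y h1 h2 h3 (by omega)
  · rw [items_succ (Nat.zero_le _), hT o, if_pos rfl,
      items_congr (g := s.recs 11) (fun x _ h2 => by rw [hT, if_neg (by omega)]), cont]
    rcases hc with ⟨rfl, h3, rfl, rfl, h4⟩ | ⟨rfl, h3, rfl, rfl, h4⟩
    · rw [items_succ (Nat.zero_le _), add_right_comm]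
    · rw [items_succ mj, add_assoc]

/-- The part of a merging step that opens the next pair of runs. -/
theorem MergeInv.open {K : ℕ → ℝ} {R : ℕ → ℝ × ℕ} {w len o : ℕ} {s s' : Mem} {β i m j e : ℕ}
    (h : MergeInv K R w len o s β i m j e) (hoe : o = e) (hol : o < len)
    (hb : SortedBlocks K w len)
    (ho : s'.ints 14 0 = o) (hi : s'.ints 15 0 = o) (hm : s'.ints 16 0 = min len (o + w))
    (hj : s'.ints 17 0 = min len (o + w)) (he : s'.ints 18 0 = min len (min len (o + w) + w))
    (hT : s'.recs 11 = s.recs 11) :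
    ∃ β, MergeInv K R w len o s' β o (min len (o + w)) (min len (o + w))
      (min len (min len (o + w) + w)) := by
  obtain ⟨-, -, -, -, -, bi, im, mj, je, el, eb, nxt, pos, run1, run2, le1, le2, out, cont⟩ := h
  -- A pair that does not end at a multiple of `2 * w` ends at `len`, and `o < len` excludes this;
  -- so the new pair is aligned with the blocks.
  obtain ⟨γ, hγ⟩ : ∃ γ, e = 2 * w * γ := nxt.resolve_right (by omega)
  clear nxt
  have e1 : 2 * γ * w = o := by rw [hoe, hγ]; ring
  have e2 : (2 * γ + 1) * w = o + w := by rw [add_mul, e1, one_mul]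
  have e3 : (2 * γ + 1 + 1) * w = o + w + w := by rw [add_mul, e2, one_mul]
  have hT1 : s'.reals 11 = s.reals 11 := funext fun x => congrArg Prod.fst (congrFun hT x)
  have e4 : 2 * w * (γ + 1) = o + w + w := by rw [mul_add, ← hγ, ← hoe]; ring
  refine ⟨γ, ho, hi, hm, hj, he, ?_, ?_, ?_, ?_, ?_, ?_, ?_, ?_, ?_, ?_, ?_, ?_, ?_, ?_⟩
  any_goals omega
  · by_cases hl : o + w + w ≤ len
    · exact .inl ⟨γ + 1, by omega⟩
    · exact .inr (by omega)
  · intro x y h1 h2 h3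
    exact hb (2 * γ) x y (by omega) h2 (by omega) (by omega)
  · intro x y h1 h2 h3
    exact hb (2 * γ + 1) x y (by omega) h2 (by omega) (by omega)
  · intro q x y h1 h2 h3 h4
    rw [hT1]
    exact out q x y h1 h2 h3 h4
  · rw [hT, cont, items_self]
    have : i = m := by omega
    have : j = e := by omega
    subst_vars
    rw [items_add (Nat.zero_le _) mj, add_zero]

theorem mergeStep_spec {W : ℕ} {K : ℕ → ℝ} {R : ℕ → ℝ × ℕ} {w len o : ℕ} {s : Mem}
    {β i m j e : ℕ} (hW : 4 * len + 4 ≤ W) (hw : w ≤ len)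
    (h : MergeInv K R w len o s β i m j e) (hol : o < len) (h12 : s.ints 12 0 = len)
    (h13 : s.ints 13 0 = w) (hR : s.recs 10 = R) (hRK : ∀ x, (R x).1 = K x)
    (hw0 : 0 < w) (hb : SortedBlocks K w len) :
    ∃ β i m j e, MergeInv K R w len (o + 1) ((mergeOpen ;; mergePut).exec W s) β i m j e := by
  -- Once the pair of runs is not exhausted, a step is a single comparison; opening a pair reduces
  -- to this case.
  have second : ∀ (s' : Mem) (β i m j e : ℕ), MergeInv K R w len o s' β i m j e → o < e →
      s'.recs 10 = R → ∃ i j, MergeInv K R w len (o + 1) (mergePut.exec W s') β i m j e := by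
    intro s' β i m j e h hoe hR'
    have hK' : ∀ x, s'.reals 10 x = K x := fun x => by rw [← hRK, ← hR']
    have hRx : ∀ x, R x = (s'.reals 10 x, s'.ints 10 x) := fun x => by rw [← hR']
    have b1 := h.im
    have b2 := h.mj
    have b3 := h.je
    have b4 := h.el
    have b5 := h.pos
    simp only [mergePut, Prog.exec]
    split_ifs with hc
    · simp only [holds_and, holds_ilt, holds_not, holds_rlt, val_get, val_num, rval_get,
        Nat.zero_mod, h.hi, h.hm, h.hj, h.he, not_and, not_lt] at hc
      refine ⟨i + 1, j, h.push hRK i _ _ hoe ?_ ?_ ?_ ?_ ?_ ?_ (.inl ⟨rfl, hc.1, rfl, rfl, ?_⟩)⟩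
      all_goals try simp (disch := omega) [h.hi, h.hm, h.hj, h.he, h.ho, Nat.mod_eq_of_lt]
      · intro x
        by_cases hx : x = o <;> simp [hx, hRx]
      · intro hje
        rw [← hK', ← hK']
        exact hc.2 hje
    · simp only [holds_and, holds_ilt, holds_not, holds_rlt, val_get, val_num, rval_get,
        Nat.zero_mod, h.hi, h.hm, h.hj, h.he, not_and, not_not] at hc
      have hje : j < e := by
        by_contra hje
        exact hc (by omega) fun h => absurd h hje
      refine ⟨i, j + 1, h.push hRK j _ _ hoe ?_ ?_ ?_ ?_ ?_ ?_ (.inr ⟨rfl, hje, rfl, rfl, ?_⟩)⟩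
      all_goals try simp (disch := omega) [h.hi, h.hm, h.hj, h.he, h.ho, Nat.mod_eq_of_lt]
      · intro x
        by_cases hx : x = o <;> simp [h.hj, h.ho, hx, hRx]
      · intro him
        rw [← hK', ← hK']
        by_contra hlt
        exact hc him fun _ h => hlt h.le
  rw [show (mergeOpen ;; mergePut).exec W s = mergePut.exec W (mergeOpen.exec W s) from rfl]
  by_cases hoe : o = e
  · obtain ⟨β', h'⟩ := h.open (s' := mergeOpen.exec W s) hoe hol hb
      (by simp [mergeOpen, Prog.exec, h.ho, h.he, hoe])
      (by simp [mergeOpen, Prog.exec, h.ho, h.he, hoe])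
      (by
        simp (disch := omega) [mergeOpen, Prog.exec, h.ho, h.he, hoe, h12, h13, Nat.mod_eq_of_lt]
        omega)
      (by
        simp (disch := omega) [mergeOpen, Prog.exec, h.ho, h.he, hoe, h12, h13, Nat.mod_eq_of_lt]
        omega)
      (by
        simp (disch := omega) [mergeOpen, Prog.exec, h.ho, h.he, hoe, h12, h13, Nat.mod_eq_of_lt]
        omega)
      (by
        funext x
        simp [mergeOpen, Prog.exec, h.ho, h.he, hoe])
    obtain ⟨i', j', h2⟩ := second _ _ _ _ _ _ h' (by omega)
      (by
        rw [← hR]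
        funext x
        simp [mergeOpen, Prog.exec, h.ho, h.he, hoe])
    exact ⟨_, _, _, _, _, h2⟩
  · have h1 : mergeOpen.exec W s = s := by
      simp [mergeOpen, Prog.exec, h.ho, h.he, hoe]
    rw [h1]
    have a1 := h.pos
    have a2 := h.je
    have a3 := h.im
    obtain ⟨i', j', h2⟩ := second _ _ _ _ _ _ h (by omega) hR
    exact ⟨_, _, _, _, _, h2⟩

theorem mergePass_spec {W w len : ℕ} {s : Mem} (hW : 4 * len + 4 ≤ W) (hw : w ≤ len)
    (h12 : s.ints 12 0 = len) (h13 : s.ints 13 0 = w) (hw0 : 0 < w)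
    (hb : SortedBlocks (s.reals 10) w len) :
    Ends W mergePass s fun s' t => t ≤ 200 * (len + 1) ∧ s'.ints 13 0 = 2 * w ∧
      s'.ints 12 0 = len ∧ items (s'.recs 10) 0 len = items (s.recs 10) 0 len ∧
      SortedBlocks (s'.reals 10) (2 * w) len := by
  refine .seq (.flat rfl fun t1 ht1 => ?_)
  generalize hs1 : Prog.exec W _ s = s1
  have hR1 : s1.recs 10 = s.recs 10 := by
    subst hs1
    funext x
    simp [Prog.exec]
  have hr10 : s1.reals 10 = s.reals 10 := by subst hs1; rfl
  have h12' : s1.ints 12 0 = len := by subst hs1; simpa [Prog.exec] using h12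
  have h13' : s1.ints 13 0 = w := by subst hs1; simpa [Prog.exec] using h13
  have hinit : MergeInv (s.reals 10) (s.recs 10) w len 0 s1 0 0 0 0 0 := by
    subst hs1
    refine ⟨?_, ?_, ?_, ?_, ?_, ?_, ?_, ?_, ?_, ?_, ?_, ?_, ?_, ?_, ?_, ?_, ?_, ?_, ?_⟩
    all_goals simp [Prog.exec, items_self]
  clear hs1
  refine .seq ((Ends.count_flat (fun o s' => ∃ β i m j e,
    MergeInv (s.reals 10) (s.recs 10) w len o s' β i m j e ∧ s'.ints 12 0 = len)
    130 0 len (Nat.zero_le _) ⟨0, 0, 0, 0, 0, hinit, h12'⟩ ?_ ?_).mono ?_)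
  · rintro o s' - ⟨β, i, m, j, e, h, h'⟩
    simp [h.ho, h']
  · rintro o s' hol ⟨β, i, m, j, e, h, h'⟩ hs
    obtain ⟨β, i, m, j, e, h1⟩ := mergeStep_spec hW hw h hol h' ((congrFun (hs.int 13) 0).trans h13')
      (by rw [← hR1]; unfold Mem.recs; rw [hs.int 10, hs.real 10])
      (fun x => rfl) hw0 hb
    refine ⟨β, i, m, j, e, h1, ?_⟩
    rw [(exec_same W (mergeOpen ;; mergePut) s').int 12]
    exact h'
  rintro s2 t2 hs2 ⟨⟨β, i, m, j, e, h, h2⟩, ht2⟩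
  have q1 := h.pos
  have q2 := h.im
  have q3 := h.mj
  have q4 := h.je
  have q5 := h.el
  have hcont : items (s2.recs 11) 0 len = items (s.recs 10) 0 len := by
    -- At `o = len` the equation `o + m = i + j` with `i ≤ m` and `j ≤ e ≤ len` leaves no other
    -- possibility: both runs are used up.
    have e1 : i = m := by omega
    have e2 : j = len := by omega
    rw [h.cont, e1, e2, items_add (Nat.zero_le _) (by omega)]
  have hout := h.out
  clear q1 q2 q3 q4 q5 h
  refine .seq (.flat rfl fun t3 ht3 => ?_)
  have hs3 := exec_same W (.ivar 14 0) s2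
  have h14 : (Prog.exec W (.ivar 14 0) s2).ints 14 0 = 0 := by simp [Prog.exec]
  generalize Prog.exec W _ s2 = s3 at hs3 h14
  refine .seq ((Ends.count_flat (fun o s' => (s'.ints 14 0 = o ∧
    ∀ x < o, s'.recs 10 x = s2.recs 11 x) ∧ s'.ints 12 0 = len) 40 0 len (Nat.zero_le _) ⟨⟨h14, ?_⟩, ?_⟩ ?_ ?_).mono ?_)
  · simp
  · rw [hs3.int 12, h2]
  · rintro o s' ho ⟨⟨h1, -⟩, h3⟩
    simp [h1, h3]
  · rintro o s' ho ⟨⟨h1, h2⟩, h3⟩ hs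
    refine ⟨⟨?_, ?_⟩, by rwa [(exec_same W copyStep s').int 12]⟩
    · simp (disch := omega) [copyStep, Prog.exec, h1, Nat.mod_eq_of_lt]
    · intro x hx
      have e1 : s'.reals 11 = s2.reals 11 := by rw [hs.real 11, hs3.real 11]
      have e2 : s'.ints 11 = s2.ints 11 := by rw [hs.int 11, hs3.int 11]
      by_cases hxo : x = o
      · simp [copyStep, Prog.exec, h1, hxo, e1, e2]
      · simpa [copyStep, Prog.exec, h1, hxo] using h2 x (by omega)
  rintro s4 t4 hs4 ⟨⟨⟨h4, h5⟩, -⟩, ht4⟩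
  refine .flat rfl fun t5 ht5 => ?_
  have hs5 := exec_same W (.ivar 13 (.var 13 + .var 13)) s4
  have hx : items (s4.recs 10) 0 len = items (s2.recs 11) 0 len := items_congr fun x _ => h5 x
  have hk : ∀ x < len, s4.reals 10 x = s2.reals 11 x := fun x h => congrArg Prod.fst (h5 x h)
  have h13 : s4.ints 13 0 = w := by rw [hs4.int 13, hs3.int 13, hs2.int 13, h13']
  have h12 : s4.ints 12 0 = len := by rw [hs4.int 12, hs3.int 12, h2]
  refine ⟨?_, ?_, ?_, ?_, ?_⟩
  · have e1 : (Prog.ivar 14 0 ;; .ivar 15 0 ;; .ivar 16 0 ;; .ivar 17 0 ;; .ivar 18 0).time ≤ 20 :=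
      by decide
    have e2 : (Prog.ivar 14 0).time ≤ 20 := by decide
    have e3 : (Prog.ivar 13 (.var 13 + .var 13)).time ≤ 20 := by decide
    omega
  · simp (disch := omega) [Prog.exec, h13, Nat.mod_eq_of_lt]
    omega
  · rwa [hs5.int 12]
  · rw [← hcont, ← hx]
    unfold Mem.recs
    rw [hs5.int 10, hs5.real 10]
  · intro q x y a1 a2 a3 a4
    rw [hs5.real 10, hk x (by omega), hk y a4]
    exact hout q x y a1 a2 a3 a4

/-- The correctness and the running time of merge sort. -/
theorem sortProg_spec {W len L : ℕ} {s : Mem} (hW : 4 * len + 4 ≤ W)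
    (h12 : s.ints 12 0 = len) (hL : len ≤ 2 ^ L) :
    Ends W sortProg s fun s' t => t ≤ 300 * (len + 1) * (L + 1) ∧
      items (s'.recs 10) 0 len = items (s.recs 10) 0 len ∧
      ∀ x y, x ≤ y → y < len → s'.reals 10 x ≤ s'.reals 10 y := by
  refine .seq (.flat rfl fun t1 ht1 => ?_)
  have hs1 := exec_same W (.ivar 13 1) s
  have h13 : (Prog.exec W (.ivar 13 1) s).ints 13 0 = 1 := by
    simp (disch := omega) [Prog.exec, Nat.mod_eq_of_lt]
  generalize Prog.exec W _ s = s1 at hs1 h13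
  refine (Ends.loop (fun p s' => s'.ints 13 0 = 2 ^ p ∧ s'.ints 12 0 = len ∧
    items (s'.recs 10) 0 len = items (s.recs 10) 0 len ∧ SortedBlocks (s'.reals 10) (2 ^ p) len)
    (fun p => (L - p) * (220 * (len + 1))) 0 ⟨h13, ?_, ?_, ?_⟩ ?_).mono ?_
  · rw [hs1.int 12, h12]
  · unfold Mem.recs
    rw [hs1.int 10, hs1.real 10]
  · intro q x y a1 a2 a3 a4
    have : x = y := by omega
    rw [this]
  · rintro p s' ⟨a1, a2, a3, a4⟩ hb hs
    have hlt : 2 ^ p < len := by simpa [a1, a2] using hb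
    -- A pass is only made while `2 ^ p < len ≤ 2 ^ L`, which limits the number of passes to `L`.
    have hp : p < L := (Nat.pow_lt_pow_iff_right one_lt_two).1 (hlt.trans_le hL)
    refine (mergePass_spec hW hlt.le a2 a1 (by positivity) a4).mono ?_
    rintro s2 t2 - ⟨b1, b2, b3, b4, b5⟩
    refine ⟨p + 1, ⟨by rw [b2]; ring, b3, b4.trans a3, by rw [pow_succ, mul_comm]; exact b5⟩, ?_⟩
    have e1 : (BExp.ilt (.var 13) (.var 12)).cost + 1 ≤ 20 := by decide
    obtain ⟨d, rfl⟩ := Nat.exists_eq_add_of_lt hp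
    rw [show p + d + 1 - (p + 1) = d by omega, show p + d + 1 - p = d + 1 by omega]
    have e2 : (d + 1) * (220 * (len + 1)) = d * (220 * (len + 1)) + 220 * (len + 1) :=
      Nat.succ_mul _ _
    omega
  · rintro s' t - ⟨p, ⟨a1, a2, a3, a4⟩, hb, ht⟩
    have hlt : len ≤ 2 ^ p := by simpa [a1, a2] using hb
    refine ⟨?_, a3, fun x y h1 h2 => a4 0 x y (by omega) h1 (by omega) h2⟩
    have e1 : (BExp.ilt (.var 13) (.var 12)).cost + 1 ≤ 20 := by decide
    have e2 : (Prog.ivar 13 1).time ≤ 20 := by decide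
    have e3 : (L - 0) * (220 * (len + 1)) = 220 * ((len + 1) * L) := by
      rw [Nat.sub_zero]; ring
    have e4 : 300 * (len + 1) * (L + 1) = 300 * ((len + 1) * L) + 300 * (len + 1) := by ring
    omega

end PartialCenter

namespace PartialCenter

/-! ## Rooted trees on `0, …, n - 1`, numbered by increasing depth -/

/-- `par` and `dep` are the parents and the depths of a tree with root `0`. -/
structure RTree (n : ℕ) (par : ℕ → ℕ) (dep : ℕ → ℝ) : Prop where
  par_lt : ∀ i, 0 < i → i < n → par i < i
  dep_lt : ∀ i, 0 < i → i < n → dep (par i) < dep i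
  mono : ∀ i j, i ≤ j → j < n → dep i ≤ dep j
  dep_zero : dep 0 = 0

/-- The distance of two vertices of a rooted tree. -/
noncomputable def rd (par : ℕ → ℕ) (dep : ℕ → ℝ) (i j : ℕ) : ℝ :=
  if i = j then 0
  else if i < j then
    if par j < j then rd par dep i (par j) + (dep j - dep (par j)) else 0
  else
    if par i < i then rd par dep (par i) j + (dep i - dep (par i)) else 0
termination_by i + j

/-- `Anc par w v`: the vertex `w` is `v` or an ancestor of `v`. -/
inductive Anc (par : ℕ → ℕ) (w : ℕ) : ℕ → Prop
  | refl : Anc par w w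
  | step (v : ℕ) (hv : 0 < v) (h : Anc par w (par v)) : Anc par w v

theorem rd_self (par : ℕ → ℕ) (dep : ℕ → ℝ) (i : ℕ) : rd par dep i i = 0 := by
  rw [rd, if_pos rfl]

theorem rd_comm (par : ℕ → ℕ) (dep : ℕ → ℝ) (i j : ℕ) : rd par dep i j = rd par dep j i := by
  induction h : i + j using Nat.strong_induction_on generalizing i j with
  | _ N ih =>
    rw [rd]
    conv_rhs => rw [rd]
    rcases lt_trichotomy i j with h1 | h1 | h1
    · rw [if_neg h1.ne, if_pos h1, if_neg h1.ne', if_neg h1.not_gt]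
      split_ifs with h2
      · rw [ih (i + par j) (by omega) i (par j) rfl]
      · rfl
    · simp [h1]
    · rw [if_neg h1.ne', if_neg h1.not_gt, if_neg h1.ne, if_pos h1]
      split_ifs with h2
      · rw [ih (par i + j) (by omega) (par i) j rfl]
      · rfl

/-! ### Distances in a rooted tree. -/

namespace RTree
variable {n : ℕ} {par : ℕ → ℕ} {dep : ℕ → ℝ} (h : RTree n par dep)
include h

/-- Parents have smaller numbers, so the larger of two distinct vertices is never an ancestor of the
other and the path leaves it through its parent. The guards in the definition of `rd` only serve
termination. -/
theorem rd_right {i j : ℕ} (hij : i < j) (hj : j < n) :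
    rd par dep i j = rd par dep i (par j) + (dep j - dep (par j)) := by
  rw [rd, if_neg hij.ne, if_pos hij, if_pos (h.par_lt j (by omega) hj)]

theorem rd_left {i j : ℕ} (hij : j < i) (hi : i < n) :
    rd par dep i j = rd par dep (par i) j + (dep i - dep (par i)) := by
  rw [rd_comm, h.rd_right hij hi, rd_comm]

theorem rd_nonneg {i j : ℕ} (hi : i < n) (hj : j < n) : 0 ≤ rd par dep i j := by
  induction e : i + j using Nat.strong_induction_on generalizing i j with
  | _ N ih =>
    rcases lt_trichotomy i j with h1 | h1 | h1
    · have h2 := h.par_lt j (by omega) hj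
      have h3 := h.dep_lt j (by omega) hj
      have := ih (i + par j) (by omega) hi (h2.trans hj) rfl
      rw [h.rd_right h1 hj]
      linarith
    · rw [h1, rd_self]
    · have h2 := h.par_lt i (by omega) hi
      have h3 := h.dep_lt i (by omega) hi
      have := ih (par i + j) (by omega) (h2.trans hi) hj rfl
      rw [h.rd_left h1 hi]
      linarith

theorem rd_pos {i j : ℕ} (hi : i < n) (hj : j < n) (hij : i ≠ j) : 0 < rd par dep i j := by
  rcases lt_or_gt_of_ne hij with h1 | h1
  · have h2 := h.par_lt j (by omega) hj
    have h3 := h.dep_lt j (by omega) hj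
    rw [h.rd_right h1 hj]
    have := h.rd_nonneg hi (h2.trans hj)
    linarith
  · have h2 := h.par_lt i (by omega) hi
    have h3 := h.dep_lt i (by omega) hi
    rw [h.rd_left h1 hi]
    have := h.rd_nonneg (h2.trans hi) hj
    linarith

theorem anc_le {w v : ℕ} (ha : Anc par w v) (hv : v < n) : w ≤ v := by
  induction ha with
  | refl => exact le_rfl
  | step v hv0 _ ih =>
    have := h.par_lt v hv0 hv
    exact (ih (this.trans hv)).trans this.le

theorem rd_anc {w v : ℕ} (ha : Anc par w v) (hv : v < n) : rd par dep w v = dep v - dep w := by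
  induction ha with
  | refl => rw [rd_self, sub_self]
  | step v hv0 ha ih =>
    have h1 := h.par_lt v hv0 hv
    have h2 := h.anc_le ha (h1.trans hv)
    rw [h.rd_right (h2.trans_lt h1) hv, ih (h1.trans hv)]
    ring

/-- A path from a vertex of the subtree below `w` to a vertex outside of it passes through `w` and
its parent. -/
theorem rd_of_not_anc {w u v : ℕ} (hw : 0 < w) (hu : Anc par w u) (hv : ¬ Anc par w v) (hun : u < n)
    (hvn : v < n) : rd par dep u v = rd par dep (par w) v + (dep u - dep (par w)) := by
  induction e : u + v using Nat.strong_induction_on generalizing u v with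
  | _ N ih =>
    rcases lt_trichotomy u v with h1 | rfl | h1
    · have h2 := h.par_lt v (by omega) hvn
      have h3 := h.anc_le hu hun
      have h4 : ¬ Anc par w (par v) := fun h5 => hv (.step v (by omega) h5)
      rw [h.rd_right h1 hvn, ih (u + par v) (by omega) hu h4 hun (h2.trans hvn) rfl,
        h.rd_right ((h.par_lt w hw (by omega)).trans_le (h3.trans h1.le)) hvn]
      ring
    · exact absurd hu hv
    · have h2 := h.par_lt u (by omega) hun
      rw [h.rd_left h1 hun]
      cases hu with
      | refl => rfl
      | step _ h5 h6 =>
        rw [ih (par u + v) (by omega) h6 hv (h2.trans hun) hvn rfl]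
        ring

/-- Moving along an edge changes the distance to a fixed vertex by at most its length: the induction
step for comparing `rd` with the length of a walk. Depending on whether `v` lies below `u`, one of
the inequalities is an equation. -/
theorem rd_par {u v : ℕ} (hu : 0 < u) (hun : u < n) (hvn : v < n) :
    rd par dep u v ≤ rd par dep (par u) v + (dep u - dep (par u)) ∧
      rd par dep (par u) v ≤ rd par dep u v + (dep u - dep (par u)) := by
  have h1 := h.dep_lt u hu hun
  by_cases ha : Anc par u v
  · have h2 : Anc par (par u) v := by
      induction ha with
      | refl => exact .step u hu .refl
      | step v hv0 _ ih => exact .step v hv0 (ih ((h.par_lt v hv0 hvn).trans hvn))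
    rw [h.rd_anc ha hvn, h.rd_anc h2 hvn]
    constructor <;> linarith
  · rw [h.rd_of_not_anc hu .refl ha hun hvn]
    constructor <;> linarith

theorem rd_zero {v : ℕ} (hv : v < n) : rd par dep 0 v = dep v := by
  have : Anc par 0 v := by
    induction v using Nat.strong_induction_on with
    | _ v ih =>
      rcases Nat.eq_zero_or_pos v with rfl | h0
      · exact .refl
      · have := h.par_lt v h0 hv
        exact .step v h0 (ih _ this (this.trans hv))
  rw [h.rd_anc this hv, h.dep_zero, sub_zero]

end RTree

/-! ## Distances in graphs with edge lengths -/

section Graph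
variable {V : Type*} {G : SimpleGraph V} {len : Sym2 V → ℝ}

theorem walkLength_nonneg (hl : ∀ e ∈ G.edgeSet, 0 ≤ len e) {u v : V} (p : G.Walk u v) :
    0 ≤ walkLength len p :=
  List.sum_nonneg fun x hx => by
    obtain ⟨e, he, rfl⟩ := List.mem_map.1 hx
    exact hl e (p.edges_subset_edgeSet he)

theorem walkLength_append {u v w : V} (p : G.Walk u v) (q : G.Walk v w) :
    walkLength len (p.append q) = walkLength len p + walkLength len q := by
  simp [walkLength]

theorem vertexDist_le (hl : ∀ e ∈ G.edgeSet, 0 ≤ len e) {u v : V} (p : G.Walk u v) :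
    vertexDist G len u v ≤ walkLength len p :=
  ciInf_le ⟨0, by rintro _ ⟨q, rfl⟩; exact walkLength_nonneg hl q⟩ p

theorem vertexDist_triangle (hG : G.Connected) (hl : ∀ e ∈ G.edgeSet, 0 ≤ len e) (u v w : V) :
    vertexDist G len u w ≤ vertexDist G len u v + vertexDist G len v w := by
  have i1 : Nonempty (G.Walk u v) := hG.preconnected u v
  have i2 : Nonempty (G.Walk v w) := hG.preconnected v w
  rw [← sub_le_iff_le_add]
  refine le_ciInf fun p => ?_
  rw [sub_le_comm]
  refine le_ciInf fun q => ?_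
  rw [sub_le_iff_le_add', ← walkLength_append]
  exact vertexDist_le hl _

theorem vertexDist_comm (u v : V) : vertexDist G len u v = vertexDist G len v u := by
  have : ∀ p : G.Walk u v, walkLength len p.reverse = walkLength len p := fun p => by
    simp [walkLength, List.sum_reverse]
  unfold vertexDist
  refine (Equiv.iInf_congr ⟨SimpleGraph.Walk.reverse, SimpleGraph.Walk.reverse,
    fun p => p.reverse_reverse, fun p => p.reverse_reverse⟩ fun p => ?_)
  exact this p

theorem vertexDist_adj (hl : ∀ e ∈ G.edgeSet, 0 ≤ len e) {u v : V} (h : G.Adj u v) :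
    vertexDist G len u v ≤ len s(u, v) := by
  simpa [walkLength] using vertexDist_le hl h.toWalk

theorem vertexDist_nonneg (hG : G.Connected) (hl : ∀ e ∈ G.edgeSet, 0 ≤ len e) (u v : V) :
    0 ≤ vertexDist G len u v :=
  have : Nonempty (G.Walk u v) := hG.preconnected u v
  le_ciInf fun p => walkLength_nonneg hl p

theorem Point.dist_nonneg (hG : G.Connected) (hl : ∀ e ∈ G.edgeSet, 0 ≤ len e) (x : Point G len)
    (v : V) : 0 ≤ x.dist v := by
  have h := vertexDist_nonneg hG hl
  cases x with
  | vertex u => exact h u v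
  | onEdge a b hab t h0 h1 =>
    exact le_min (by linarith [h a v]) (by linarith [h b v])

/-- If both vertices are reached through the same end of the edge, the triangle inequality at that
end suffices. If they are reached through different ends, the two pieces of the edge add up to its
length, which bounds the distance of its ends. -/
theorem vertexDist_le_dist_add_dist (hG : G.Connected) (hl : ∀ e ∈ G.edgeSet, 0 ≤ len e)
    (x : Point G len) (u v : V) : vertexDist G len u v ≤ x.dist u + x.dist v := by
  have tri := vertexDist_triangle hG hl
  cases x with
  | vertex w =>
    have := tri u w v
    rw [vertexDist_comm u w] at this
    exact this
  | onEdge a b hab t h0 h1 =>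
    have e1 := tri u a v
    have e2 := tri u b v
    have e3 := tri a b v
    have e4 := tri b a v
    have e5 := vertexDist_adj hl hab
    have e6 := vertexDist_comm (G := G) (len := len) u a
    have e7 := vertexDist_comm (G := G) (len := len) u b
    have e8 := vertexDist_comm (G := G) (len := len) a b
    simp only [Point.dist]
    rcases min_choice (t + vertexDist G len a u) (len s(a, b) - t + vertexDist G len b u)
      with h3 | h3 <;>
    rcases min_choice (t + vertexDist G len a v) (len s(a, b) - t + vertexDist G len b v)
      with h4 | h4 <;> rw [h3, h4] <;> linarith

end Graph

/-! ### Graph trees described by parents and depths. -/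

/-- `par` and `dep` describe the tree `T` after a renumbering `lab` of its vertices. -/
structure Models {n : ℕ} (T : SimpleGraph (Fin n)) (len : Sym2 (Fin n) → ℝ) (lab : Fin n ≃ Fin n)
    (par : ℕ → ℕ) (dep : ℕ → ℝ) : Prop where
  tree : RTree n par dep
  adj : ∀ i j : Fin n, T.Adj (lab i) (lab j) ↔
    (0 < (j : ℕ) ∧ par j = i) ∨ (0 < (i : ℕ) ∧ par i = j)
  len_eq : ∀ i j : Fin n, 0 < (j : ℕ) → par j = i → len s(lab i, lab j) = dep j - dep i

namespace Models
variable {n : ℕ} {T : SimpleGraph (Fin n)} {len : Sym2 (Fin n) → ℝ} {lab : Fin n ≃ Fin n}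
  {par : ℕ → ℕ} {dep : ℕ → ℝ} (h : Models T len lab par dep)
include h

theorem len_nonneg : ∀ e ∈ T.edgeSet, 0 ≤ len e := by
  intro e
  induction e using Sym2.ind with
  | _ a b =>
    intro hab
    obtain ⟨i, rfl⟩ := lab.surjective a
    obtain ⟨j, rfl⟩ := lab.surjective b
    rcases (h.adj i j).1 hab with ⟨h0, h1⟩ | ⟨h0, h1⟩
    · rw [h.len_eq i j h0 h1, ← h1]
      linarith [h.tree.dep_lt j h0 j.2]
    · rw [Sym2.eq_swap, h.len_eq j i h0 h1, ← h1]
      linarith [h.tree.dep_lt i h0 i.2]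

theorem rd_le_walkLength {a b : Fin n} (p : T.Walk a b) :
    rd par dep (lab.symm a) (lab.symm b) ≤ walkLength len p := by
  induction p with
  | nil => simp [rd_self, walkLength]
  | @cons a b c hab p ih =>
    obtain ⟨i, rfl⟩ := lab.surjective a
    obtain ⟨j, rfl⟩ := lab.surjective b
    obtain ⟨k, rfl⟩ := lab.surjective c
    simp only [Equiv.symm_apply_apply] at ih ⊢
    have e : walkLength len (p.cons hab) = len s(lab i, lab j) + walkLength len p := by
      simp [walkLength]
    rw [e]
    rcases (h.adj i j).1 hab with ⟨h0, h1⟩ | ⟨h0, h1⟩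
    · have := (h.tree.rd_par h0 j.2 k.2).2
      rw [h1] at this
      rw [h.len_eq i j h0 h1]
      linarith
    · have := (h.tree.rd_par h0 i.2 k.2).1
      rw [h1] at this
      rw [Sym2.eq_swap, h.len_eq j i h0 h1]
      linarith

/-- The recursion of `rd` spells out a walk: the end with the larger number is always moved to its
parent. -/
theorem exists_walk (i j : Fin n) : ∃ p : T.Walk (lab i) (lab j), walkLength len p = rd par dep i j := by
  induction e : (i : ℕ) + j using Nat.strong_induction_on generalizing i j with
  | _ N ih =>
    rcases lt_trichotomy (i : ℕ) j with h1 | h1 | h1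
    · have h2 := h.tree.par_lt j (by omega) j.2
      obtain ⟨p, hp⟩ := ih (i + par j) (by omega) i ⟨par j, h2.trans j.2⟩ rfl
      refine ⟨p.concat ((h.adj _ _).2 (.inl ⟨by omega, rfl⟩)), ?_⟩
      rw [h.tree.rd_right h1 j.2, ← h.len_eq ⟨par j, h2.trans j.2⟩ j (by omega) rfl, ← hp]
      simp [walkLength, SimpleGraph.Walk.edges_concat]
    · obtain rfl := Fin.ext h1
      exact ⟨.nil, by simp [rd_self, walkLength]⟩
    · have h2 := h.tree.par_lt i (by omega) i.2
      obtain ⟨p, hp⟩ := ih (par i + j) (by omega) ⟨par i, h2.trans i.2⟩ j rfl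
      refine ⟨p.cons ((h.adj _ _).2 (.inr ⟨by omega, rfl⟩)), ?_⟩
      rw [h.tree.rd_left h1 i.2, ← h.len_eq ⟨par i, h2.trans i.2⟩ i (by omega) rfl, ← hp,
        Sym2.eq_swap]
      simp [walkLength, add_comm]

theorem vertexDist_eq (i j : Fin n) : vertexDist T len (lab i) (lab j) = rd par dep i j := by
  obtain ⟨p, hp⟩ := h.exists_walk i j
  refine le_antisymm (hp ▸ vertexDist_le h.len_nonneg p) ?_
  have : Nonempty (T.Walk (lab i) (lab j)) := ⟨p⟩
  refine le_ciInf fun q => ?_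
  simpa using h.rd_le_walkLength q

end Models

end PartialCenter

namespace PartialCenter

/-! ## Partial centers of rooted trees -/

/-- At least `k` of the vertices up to `u` have distance at most `D` from `u`. -/
def Feas (n k : ℕ) (par : ℕ → ℕ) (dep : ℕ → ℝ) (D : ℝ) (u : ℕ) : Prop :=
  u < n ∧ k ≤ ((Finset.range (u + 1)).filter fun v => rd par dep u v ≤ D).card

theorem Anc.exists_child {par : ℕ → ℕ} {w u : ℕ} (h : Anc par w u) (hne : w ≠ u) :
    ∃ j, 0 < j ∧ par j = w ∧ Anc par j u := by
  induction h with
  | refl => exact absurd rfl hne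
  | step v hv h ih =>
    by_cases hw : w = par v
    · exact ⟨v, hv, hw.symm, .refl⟩
    · obtain ⟨j, h1, h2, h3⟩ := ih hw
      exact ⟨j, h1, h2, .step v hv h3⟩

section
variable {n k : ℕ} {T : SimpleGraph (Fin n)} {len : Sym2 (Fin n) → ℝ}

instance finite_verts (H : KSubtree T k) : Finite H.1.verts := Subtype.finite

theorem bddAbove_dist (x : Point T len) (H : KSubtree T k) :
    BddAbove (Set.range fun v : H.1.verts => x.dist v.1) :=
  (Set.finite_range _).bddAbove

theorem dist_le_coverRadius (x : Point T len) (H : KSubtree T k) {v : Fin n}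
    (hv : v ∈ H.1.verts) : x.dist v ≤ coverRadius x H :=
  le_ciSup (bddAbove_dist x H) ⟨v, hv⟩

end

namespace Models
variable {n : ℕ} {T : SimpleGraph (Fin n)} {len : Sym2 (Fin n) → ℝ} {lab : Fin n ≃ Fin n}
  {par : ℕ → ℕ} {dep : ℕ → ℝ} (h : Models T len lab par dep)
include h

/-- The lower bound for the problem. The witness is the vertex of the subtree with the largest
number; the others have smaller numbers and are reached from it through `y` within twice the
covering radius. -/
theorem exists_feas (hT : T.IsTree) {k : ℕ} (hk : 1 ≤ k) (y : Point T len) (H : KSubtree T k) :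
    0 ≤ coverRadius y H ∧ ∃ u, Feas n k par dep (2 * coverRadius y H) u := by
  classical
  obtain ⟨hH, hcard⟩ := H.2
  have hne : H.1.verts.Nonempty := by
    rw [← Set.ncard_pos (Set.toFinite _)]
    omega
  obtain ⟨v0, hv0⟩ := hne
  refine ⟨(y.dist_nonneg hT.connected h.len_nonneg v0).trans (dist_le_coverRadius y H hv0), ?_⟩
  set S : Finset (Fin n) := Finset.univ.filter fun i => lab i ∈ H.1.verts with hS
  have hSne : S.Nonempty := ⟨lab.symm v0, by simpa [hS] using hv0⟩
  have hSc : S.card = k := by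
    rw [← hcard, ← Set.ncard_coe_finset]
    have : lab '' (S : Set (Fin n)) = H.1.verts := by
      ext v
      constructor
      · rintro ⟨i, hi, rfl⟩
        simpa [hS] using hi
      · intro hv
        exact ⟨lab.symm v, by simpa [hS] using hv, by simp⟩
    rw [← this, Set.ncard_image_of_injective _ lab.injective]
  refine ⟨S.max' hSne, (S.max' hSne).2, ?_⟩
  refine hSc.symm.le.trans ?_
  rw [← Finset.card_map Fin.valEmbedding]
  refine Finset.card_le_card fun v hv => ?_
  obtain ⟨i, hi, rfl⟩ := Finset.mem_map.1 hv
  have hi' : lab i ∈ H.1.verts := by simpa [hS] using hi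
  have hu : lab (S.max' hSne) ∈ H.1.verts := by simpa [hS] using S.max'_mem hSne
  rw [Finset.mem_filter, Finset.mem_range, Nat.lt_succ_iff]
  refine ⟨S.le_max' i hi, ?_⟩
  have e1 := vertexDist_le_dist_add_dist hT.connected h.len_nonneg y (lab (S.max' hSne)) (lab i)
  rw [h.vertexDist_eq] at e1
  have e2 := dist_le_coverRadius y H hi'
  have e3 := dist_le_coverRadius y H hu
  simp only [Fin.valEmbedding_apply]
  linarith

/-- From any vertex up to `u` the first step of the path to `u` leads to a strictly nearer vertex,
again numbered at most `u`. A set that is closed under strictly nearer vertices is therefore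
connected, however ties are broken. -/
theorem exists_kSubtree (hT : T.IsTree) {u : ℕ} (hu : u < n) {S : Finset ℕ}
    (hS : ∀ v ∈ S, v ≤ u) (hne : S.Nonempty)
    (hcl : ∀ v ∈ S, ∀ w ≤ u, rd par dep u w < rd par dep u v → w ∈ S) :
    ∃ H : KSubtree T S.card, ∀ i : Fin n, lab i ∈ H.1.verts ↔ (i : ℕ) ∈ S := by
  set A : Set (Fin n) := {v | (lab.symm v : ℕ) ∈ S} with hA
  have hmem : ∀ i : Fin n, lab i ∈ A ↔ (i : ℕ) ∈ S := fun i => by simp [hA]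
  have huS : u ∈ S := by
    obtain ⟨v, hv⟩ := hne
    by_cases hvu : v = u
    · rwa [← hvu]
    · refine hcl v hv u le_rfl ?_
      rw [rd_self]
      exact h.tree.rd_pos hu (by have := hS v hv; omega) (Ne.symm hvu)
  have reach : ∀ N (i : Fin n) (hi : lab i ∈ A),
      (S.filter fun w => rd par dep u w < rd par dep u i).card = N →
      (T.induce A).Reachable ⟨lab i, hi⟩ ⟨lab ⟨u, hu⟩, (hmem _).2 huS⟩ := by
    intro N
    induction N using Nat.strong_induction_on with
    | _ N ih =>
      intro i hi hN
      by_cases hiu : (i : ℕ) = u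
      · obtain rfl : i = ⟨u, hu⟩ := Fin.ext hiu
        exact .refl _
      have hiS := (hmem i).1 hi
      have hile := hS _ hiS
      -- The next vertex on the path to `u` is the child towards `u` if `i` is an ancestor of `u`,
      -- and the parent of `i` otherwise.
      obtain ⟨j, hj, hadj, hlt⟩ : ∃ j : Fin n, (j : ℕ) ≤ u ∧ T.Adj (lab i) (lab j) ∧
          rd par dep u j < rd par dep u i := by
        by_cases ha : Anc par i u
        · obtain ⟨j, j1, j2, j3⟩ := ha.exists_child hiu
          have j4 := h.tree.anc_le j3 hu
          refine ⟨⟨j, j4.trans_lt hu⟩, j4, (h.adj _ _).2 (.inl ⟨j1, j2⟩), ?_⟩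
          have := h.tree.dep_lt j j1 (j4.trans_lt hu)
          rw [rd_comm, h.tree.rd_anc j3 hu, rd_comm, h.tree.rd_anc ha hu, ← j2]
          linarith
        · have i0 : 0 < (i : ℕ) := by
            rcases Nat.eq_zero_or_pos (i : ℕ) with h0 | h0
            · exfalso
              apply ha
              rw [h0]
              clear * - hu h
              induction u using Nat.strong_induction_on with
              | _ v ih =>
                rcases Nat.eq_zero_or_pos v with rfl | h0
                · exact .refl
                · have := h.tree.par_lt v h0 hu
                  exact .step v h0 (ih _ this (this.trans hu))
            · exact h0
          have j4 := h.tree.par_lt i i0 i.2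
          refine ⟨⟨par i, j4.trans i.2⟩, by simp only; omega, (h.adj _ _).2 (.inr ⟨i0, rfl⟩), ?_⟩
          have := h.tree.dep_lt i i0 i.2
          rw [rd_comm par dep u i, h.tree.rd_of_not_anc i0 .refl ha i.2 hu,
            rd_comm par dep u]
          linarith
      have hjS := hcl _ hiS j hj hlt
      have hjA := (hmem j).2 hjS
      have step : (T.induce A).Adj ⟨lab i, hi⟩ ⟨lab j, hjA⟩ := hadj
      refine step.reachable.trans (ih _ ?_ j hjA rfl)
      rw [← hN]
      refine Finset.card_lt_card ⟨fun w hw => ?_, fun hsub => ?_⟩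
      · rw [Finset.mem_filter] at hw ⊢
        exact ⟨hw.1, hw.2.trans hlt⟩
      · have := hsub (Finset.mem_filter.2 ⟨hjS, hlt⟩)
        exact lt_irrefl _ (Finset.mem_filter.1 this).2
  have htree : (T.induce A).IsTree := by
    refine ⟨(SimpleGraph.connected_iff _).2 ⟨fun a b => ?_, ⟨⟨lab ⟨u, hu⟩, (hmem _).2 huS⟩⟩⟩,
      hT.isAcyclic.induce A⟩
    obtain ⟨a, ha⟩ := a
    obtain ⟨b, hb⟩ := b
    obtain ⟨i, rfl⟩ := lab.surjective a
    obtain ⟨j, rfl⟩ := lab.surjective b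
    exact (reach _ i ha rfl).trans (reach _ j hb rfl).symm
  refine ⟨⟨(⊤ : T.Subgraph).induce A, ?_, ?_⟩, fun i => ?_⟩
  · rwa [SimpleGraph.induce_eq_coe_induce_top] at htree
  · rw [SimpleGraph.Subgraph.induce_verts, ← Set.ncard_coe_finset]
    have e1 : (fun v : Fin n => ((lab.symm v : Fin n) : ℕ)) '' A = (S : Set ℕ) := by
      ext x
      constructor
      · rintro ⟨v, hv, rfl⟩
        exact hv
      · intro hx
        have := hS x hx
        exact ⟨lab ⟨x, by omega⟩, (hmem _).2 hx, by simp⟩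
    rw [← e1, Set.ncard_image_of_injective]
    exact Fin.val_injective.comp lab.symm.injective
  · exact hmem i

/-- The solution that belongs to the least feasible diameter `D`. -/
theorem isPartialCenter (hT : T.IsTree) {k u : ℕ} (hk : 1 ≤ k) {D : ℝ}
    (hu : Feas n k par dep D u)
    (hmin : ∀ D' u', 0 ≤ D' → Feas n k par dep D' u' → D ≤ D')
    (x : Point T len) (hx : ∀ v : Fin n, (v : ℕ) ≤ u → rd par dep u v ≤ D → x.dist (lab v) ≤ D / 2)
    {S : Finset ℕ} (hSc : S.card = k) (hS : ∀ v ∈ S, v ≤ u)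
    (hcl : ∀ v ∈ S, ∀ w ≤ u, rd par dep u w < rd par dep u v → w ∈ S) :
    ∃ H : KSubtree T k, IsPartialCenter k x ∧ coverRadius x H = phi k x ∧ phi k x = D / 2 ∧
      ∀ i : Fin n, lab i ∈ H.1.verts ↔ (i : ℕ) ∈ S := by
  have hne : S.Nonempty := by
    rw [← Finset.card_pos]
    omega
  obtain ⟨H, hH⟩ : ∃ H : KSubtree T k, ∀ i : Fin n, lab i ∈ H.1.verts ↔ (i : ℕ) ∈ S := by
    subst hSc
    exact h.exists_kSubtree hT hu.1 hS hne hcl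
  -- If a member were farther away than `D`, closure would put all of the at least `k` vertices
  -- within `D` into `S` besides it, which is too many for a set of `k` elements.
  have hSD : ∀ v ∈ S, rd par dep u v ≤ D := by
    intro v hv
    by_contra hlt
    rw [not_le] at hlt
    have hsub : ((Finset.range (u + 1)).filter fun v => rd par dep u v ≤ D) ⊂ S := by
      refine ⟨fun w hw => ?_, fun hsub => ?_⟩
      · rw [Finset.mem_filter, Finset.mem_range, Nat.lt_succ_iff] at hw
        exact hcl v hv w hw.1 (hw.2.trans_lt hlt)
      · exact hlt.not_ge (Finset.mem_filter.1 (hsub hv)).2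
    have := Finset.card_lt_card hsub
    have := hu.2
    omega
  have : Nonempty (KSubtree T k) := ⟨H⟩
  have lower : ∀ (y : Point T len) (H : KSubtree T k), D / 2 ≤ coverRadius y H := by
    intro y H
    obtain ⟨h0, u', hu'⟩ := h.exists_feas hT hk y H
    have := hmin _ _ (by positivity) hu'
    linarith
  have lower' : ∀ y : Point T len, D / 2 ≤ phi k y := fun y => le_ciInf (lower y)
  have bdd : ∀ y : Point T len, BddBelow (Set.range fun H : KSubtree T k => coverRadius y H) :=
    fun y => ⟨D / 2, by rintro _ ⟨H, rfl⟩; exact lower y H⟩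
  have hne' : Nonempty H.1.verts := by
    obtain ⟨v, hv⟩ := hne
    have := hS v hv
    have := hu.1
    exact ⟨⟨lab ⟨v, by omega⟩, (hH _).2 hv⟩⟩
  have upper : coverRadius x H ≤ D / 2 := by
    refine ciSup_le fun v => ?_
    obtain ⟨v, hv⟩ := v
    obtain ⟨i, rfl⟩ := lab.surjective v
    have hi := (hH i).1 hv
    exact hx i (hS _ hi) (hSD _ hi)
  have e1 : phi k x = D / 2 := le_antisymm ((ciInf_le (bdd x) H).trans upper) (lower' x)
  refine ⟨H, fun y => e1 ▸ lower' y, ?_, e1, hH⟩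
  rw [e1]
  exact le_antisymm upper (lower x H)

/-- The case in which going up from `u` by `D / 2` would leave the tree: the root serves as the
center, since depths increase with the numbers. -/
theorem dist_vertex_le {u : ℕ} (hu : u < n) {D : ℝ} (hD : dep u ≤ D / 2) (h0 : 0 < n) (v : Fin n)
    (hv : (v : ℕ) ≤ u) : (Point.vertex (len := len) (G := T) (lab ⟨0, h0⟩)).dist (lab v) ≤ D / 2 := by
  simp only [Point.dist]
  rw [h.vertexDist_eq, h.tree.rd_zero v.2]
  exact (h.tree.mono v u hv hu).trans hD

/-- The point lies `D / 2` above `u`, on the edge from `w` to its parent. A vertex below `w` is no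
deeper than `u`, hence no farther from the point than `u`. For any other vertex the path from `u`
passes through the point, which leaves `rd par dep u v - D / 2 ≤ D / 2`. -/
theorem dist_onEdge_le {u w : ℕ} (hu : u < n) {D : ℝ} (hw0 : 0 < w) (hwn : w < n)
    (hpn : par w < n) (ha : Anc par w u)
    (hadj : T.Adj (lab ⟨w, hwn⟩) (lab ⟨par w, hpn⟩)) (ht0 : 0 ≤ D / 2 - (dep u - dep w))
    (ht1 : D / 2 - (dep u - dep w) ≤ len s(lab ⟨w, hwn⟩, lab ⟨par w, hpn⟩)) (v : Fin n)
    (hv : (v : ℕ) ≤ u) (hvD : rd par dep u v ≤ D) :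
    (Point.onEdge (lab ⟨w, hwn⟩) (lab ⟨par w, hpn⟩) hadj (D / 2 - (dep u - dep w)) ht0 ht1).dist
      (lab v) ≤ D / 2 := by
  simp only [Point.dist]
  rw [h.vertexDist_eq, h.vertexDist_eq]
  by_cases hav : Anc par w v
  · refine (min_le_left _ _).trans ?_
    have := h.tree.mono v u hv hu
    have e := h.tree.rd_anc hav v.2
    simp only
    rw [e]
    linarith
  · refine (min_le_right _ _).trans ?_
    have e := h.tree.rd_of_not_anc hw0 ha hav hu v.2
    have e2 := h.len_eq ⟨par w, hpn⟩ ⟨w, hwn⟩ hw0 rfl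
    rw [Sym2.eq_swap, e2]
    simp only
    linarith

end Models

end PartialCenter

set_option linter.unusedSimpArgs false

namespace PartialCenter

/-! ## Counting close pairs -/

/-- The tables of the decision procedure in the memory: for each node `κ < M` two lists of vertices
`a` and `b`, at the positions from `oa κ` and from `ob κ`, with numbers `X` and `Y`. -/
structure Tab (n k M : ℕ) (oa ob a p b : ℕ → ℕ) (X Y : ℕ → ℝ) (s : Mem) : Prop where
  hn : s.ints 0 0 = n
  hk : s.ints 1 0 = k
  ha : s.ints 60 = a
  hp : s.ints 61 = p
  hb : s.ints 62 = b
  hoa : s.ints 63 = oa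
  hob : s.ints 64 = ob
  hM : s.ints 65 0 = M
  hX : s.reals 60 = X
  hY : s.reals 61 = Y

/-- The properties of the tables: each pair of an entry of `a` and an entry of `b` of the same node
is a pair of vertices, and its distance is the sum of the numbers of its entries. -/
structure Nodes (n M : ℕ) (oa ob a p b : ℕ → ℕ) (X Y : ℕ → ℝ) (d : ℕ → ℕ → ℝ) : Prop where
  oa_zero : oa 0 = 0
  ob_zero : ob 0 = 0
  oa_le : ∀ κ < M, oa κ ≤ oa (κ + 1)
  ob_le : ∀ κ < M, ob κ ≤ ob (κ + 1)
  oa_len : ∀ κ < M, oa (κ + 1) ≤ oa κ + n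
  ob_len : ∀ κ < M, ob (κ + 1) ≤ ob κ + n
  a_lt : ∀ κ < M, ∀ i, oa κ ≤ i → i < oa (κ + 1) → a i < n
  b_lt : ∀ κ < M, ∀ j, ob κ ≤ j → j < ob (κ + 1) → b j < n
  X_mono : ∀ κ < M, ∀ i i', oa κ ≤ i → i ≤ i' → i' < oa (κ + 1) → X i ≤ X i'
  Y_mono : ∀ κ < M, ∀ j j', ob κ ≤ j → j ≤ j' → j' < ob (κ + 1) → Y j ≤ Y j'
  p_le : ∀ κ < M, ∀ i, oa κ ≤ i → i < oa (κ + 1) → ob κ + p i ≤ ob (κ + 1)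
  p_iff : ∀ κ < M, ∀ i j, oa κ ≤ i → i < oa (κ + 1) → ob κ ≤ j → j < ob (κ + 1) →
    (j < ob κ + p i ↔ b j < a i)
  ne : ∀ κ < M, ∀ i j, oa κ ≤ i → i < oa (κ + 1) → ob κ ≤ j → j < ob (κ + 1) → a i ≠ b j
  dist : ∀ κ < M, ∀ i j, oa κ ≤ i → i < oa (κ + 1) → ob κ ≤ j → j < ob (κ + 1) →
    X i + Y j = d (a i) (b j)

theorem Tab.of_same {n k M : ℕ} {oa ob a p b : ℕ → ℕ} {X Y : ℕ → ℝ} {s s' : Mem} {pr : Prog}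
    (ht : Tab n k M oa ob a p b X Y s) (h : Same pr s s')
    (hc : (([0, 1, 60, 61, 62, 63, 64, 65].all fun a => !pr.wi.contains a) &&
      [60, 61].all fun a => !pr.wr.contains a) = true := by rfl) :
    Tab n k M oa ob a p b X Y s' := by
  simp only [Bool.and_eq_true, List.all_eq_true, Bool.not_eq_true', List.mem_cons,
    List.not_mem_nil, or_false] at hc
  have e : ∀ x ∈ [0, 1, 60, 61, 62, 63, 64, 65], s'.ints x = s.ints x := fun x hx =>
    h.int x (hc.1 x (by simpa using hx))
  have e' : ∀ x ∈ [60, 61], s'.reals x = s.reals x := fun x hx =>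
    h.real x (hc.2 x (by simpa using hx))
  obtain ⟨h1, h2, h3, h4, h5, h6, h7, h8, h9, h10⟩ := ht
  refine ⟨?_, ?_, ?_, ?_, ?_, ?_, ?_, ?_, ?_, ?_⟩
  iterate 8 · rw [e _ (by simp)]; assumption
  iterate 2 · rw [e' _ (by simp)]; assumption

/-! ### Pointers that only move down, and thresholds. -/

/-- Decreases the scalar `q` as long as it is positive and `b` holds. -/
def scanDown (q : ℕ) (b : BExp) : Prog :=
  .loop (.and (.ilt 0 (.var q)) b) (.ivar q (.var q - 1))

/-- The time is proportional to the distance moved. If the pointer is never raised between scans,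
the total time telescopes. -/
theorem scanDown_spec {W q : ℕ} {b : BExp} {s : Mem} (hW : 1 < W) (c : ℕ) (hc : c ≤ s.ints q 0)
    (hb : ∀ s', Same (.ivar q (.var q - 1)) s s' → 0 < s'.ints q 0 → s'.ints q 0 ≤ s.ints q 0 →
      (b.Holds W s' ↔ c < s'.ints q 0)) :
    Ends W (scanDown q b) s fun s' t => s'.ints q 0 = c ∧
      t ≤ (b.cost + 20) * (s.ints q 0 - c) + (b.cost + 20) := by
  have hcost : (BExp.and (.ilt 0 (.var q)) b).cost = b.cost + 5 := by
    simp only [BExp.cost, show (IExp.var q).cost = 2 from rfl, show (0 : IExp).cost = 1 from rfl]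
    omega
  have hone : (1 : ℕ) % W = 1 := Nat.mod_eq_of_lt hW
  refine (Ends.loop (fun x s' => s'.ints q 0 = x ∧ c ≤ x ∧ x ≤ s.ints q 0)
    (fun x => (b.cost + 20) * (x - c)) (s.ints q 0) ⟨rfl, hc, le_rfl⟩ ?_).mono ?_
  · rintro x s' ⟨rfl, h1, h2⟩ hh hs
    simp only [holds_and, holds_ilt, val_num, Nat.zero_mod, val_get] at hh
    have hlt := (hb s' hs hh.1 h2).1 hh.2
    refine .flat rfl fun t ht => ⟨s'.ints q 0 - 1, ⟨by simp [Prog.exec, hone], by omega, by omega⟩, ?_⟩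
    have e1 : (Prog.ivar q (.var q - 1)).time = 6 := rfl
    obtain ⟨d, hd⟩ := Nat.exists_eq_add_of_lt hlt
    rw [hcost, hd, show c + d + 1 - 1 - c = d by omega, show c + d + 1 - c = d + 1 by omega,
      Nat.mul_succ]
    omega
  · rintro s' t hs ⟨x, ⟨rfl, h1, h2⟩, hh, ht⟩
    have : s'.ints q 0 = c := by
      by_contra hne
      apply hh
      simp only [holds_and, holds_ilt, val_num, Nat.zero_mod, val_get]
      exact ⟨by omega, (hb s' hs (by omega) h2).2 (by omega)⟩
    refine ⟨this, ?_⟩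
    rw [hcost, this] at ht
    omega

/-- A downward closed property holds exactly below the number of its solutions; this turns counts
into pointer positions. -/
theorem lt_card_filter_iff {m : ℕ} {P : ℕ → Prop} [DecidablePred P]
    (hP : ∀ i j, i ≤ j → j < m → P j → P i) {j : ℕ} (hj : j < m) :
    j < ((Finset.range m).filter P).card ↔ P j := by
  constructor
  · intro h
    by_contra hn
    have : (Finset.range m).filter P ⊆ Finset.range j := fun x hx => by
      rw [Finset.mem_filter, Finset.mem_range] at hx
      rw [Finset.mem_range]
      by_contra hle
      exact hn (hP j x (by omega) hx.1 hx.2)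
    have := Finset.card_le_card this
    rw [Finset.card_range] at this
    omega
  · intro h
    have : Finset.range (j + 1) ⊆ (Finset.range m).filter P := fun x hx => by
      rw [Finset.mem_range] at hx
      rw [Finset.mem_filter, Finset.mem_range]
      exact ⟨by omega, hP x j (by omega) hj h⟩
    have := Finset.card_le_card this
    rw [Finset.card_range] at this
    omega

/-- The number of vertices that a row of a node reaches within the distance `D`. -/
noncomputable def cut (X Y : ℕ → ℝ) (D : ℝ) (o nb i : ℕ) : ℕ :=
  ((Finset.range nb).filter fun j => X i + Y (o + j) ≤ D).card

theorem cut_le (X Y : ℕ → ℝ) (D : ℝ) (o nb i : ℕ) : cut X Y D o nb i ≤ nb :=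
  (Finset.card_filter_le _ _).trans (Finset.card_range nb).le

theorem lt_cut_iff {X Y : ℕ → ℝ} {D : ℝ} {o nb i j : ℕ}
    (hY : ∀ j j', o ≤ j → j ≤ j' → j' < o + nb → Y j ≤ Y j') (hj : j < nb) :
    j < cut X Y D o nb i ↔ X i + Y (o + j) ≤ D :=
  lt_card_filter_iff (P := fun j => X i + Y (o + j) ≤ D) (fun x y h1 h2 h3 => by
    have := hY (o + x) (o + y) (by omega) (by omega) (by omega)
    linarith) hj

/-- Clears the counters of the columns. -/
def clearCols : Prog :=
  .ivar 79 0 ;;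
  .loop (.ilt (.var 79) (.get 64 (.var 73 + 1) - .get 64 (.var 73) + 1))
    (.iset 71 (.var 79) 0 ;; .iset 72 (.var 79) 0 ;; .ivar 79 (.var 79 + 1))

/-- The body of the loop over the rows of a node, after the column pointer is set. -/
def rowBody : Prog :=
  .ivar 76 (.min (.var 75) (.get 61 (.var 74))) ;;
  .iset 70 (.get 60 (.var 74)) (.get 70 (.get 60 (.var 74)) + .var 76) ;;
  .iset 71 (.var 76) (.get 71 (.var 76) + 1) ;;
  .iset 72 (.var 75) (.get 72 (.var 75) + 1) ;;
  .ivar 74 (.var 74 + 1)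

/-- The pairs of a node that are counted at the entry of the row. -/
def countRows : Prog :=
  (.ivar 75 (.get 64 (.var 73 + 1) - .get 64 (.var 73)) ;; .ivar 74 (.get 63 (.var 73))) ;;
  .loop (.ilt (.var 74) (.get 63 (.var 73 + 1)))
    (scanDown 75 (.rlt (.var 70) (.get 60 (.var 74) + .get 61 (.get 64 (.var 73) + (.var 75 - 1)))) ;;
      rowBody)

/-- The pairs of a node that are counted at the entry of the column. -/
def countCols : Prog :=
  (.ivar 77 0 ;; .ivar 79 0) ;;
  .loop (.ilt (.var 79) (.get 64 (.var 73 + 1) - .get 64 (.var 73)))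
    (.ivar 77 (.var 77 + .get 71 (.var 79) - .get 72 (.var 79)) ;;
      .iset 70 (.get 62 (.get 64 (.var 73) + .var 79))
        (.get 70 (.get 62 (.get 64 (.var 73) + .var 79)) + .var 77) ;;
      .ivar 79 (.var 79 + 1))

section Count
variable {W n k M : ℕ} {oa ob a p b : ℕ → ℕ} {X Y : ℕ → ℝ} {d : ℕ → ℕ → ℝ}

/-- The number of pairs of the node `κ` with distance at most `D` whose larger vertex is `u`. -/
noncomputable def pairCount (oa ob a b : ℕ → ℕ) (X Y : ℕ → ℝ) (D : ℝ) (κ u : ℕ) : ℕ :=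
  ∑ i ∈ Finset.Ico (oa κ) (oa (κ + 1)), ∑ j ∈ Finset.range (ob (κ + 1) - ob κ),
    if X i + Y (ob κ + j) ≤ D ∧ max (a i) (b (ob κ + j)) = u then 1 else 0

/-- The number of times that the node `κ` has the pair of `u` and `v`. -/
def pairHits (oa ob a b : ℕ → ℕ) (κ u v : ℕ) : ℕ :=
  ∑ i ∈ Finset.Ico (oa κ) (oa (κ + 1)), ∑ j ∈ Finset.range (ob (κ + 1) - ob κ),
    if (a i = u ∧ b (ob κ + j) = v) ∨ (a i = v ∧ b (ob κ + j) = u) then 1 else 0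

theorem clearCols_spec {s : Mem} {κ : ℕ} (hN : Nodes n M oa ob a p b X Y d)
    (hW : 2 * n + M + 10 ≤ W) (hT : Tab n k M oa ob a p b X Y s) (hκ : κ < M)
    (h73 : s.ints 73 0 = κ) :
    Ends W clearCols s fun s' t => t ≤ 50 * (ob (κ + 1) - ob κ) + 110 ∧
      ∀ j ≤ ob (κ + 1) - ob κ, s'.ints 71 j = 0 ∧ s'.ints 72 j = 0 := by
  have h1 := hN.ob_len κ hκ
  refine .seq (.flat rfl fun t1 ht1 => ?_)
  have hs1 := exec_same W (.ivar 79 0) s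
  have h79 : (Prog.exec W (.ivar 79 0) s).ints 79 0 = 0 := by simp [Prog.exec]
  generalize Prog.exec W _ s = s1 at hs1 h79
  have hT1 := hT.of_same hs1
  have h73' : s1.ints 73 0 = κ := by rw [hs1.int 73, h73]
  refine (Ends.count_flat (fun j s' => s'.ints 79 0 = j ∧ Tab n k M oa ob a p b X Y s' ∧
    s'.ints 73 0 = κ ∧ ∀ x < j, s'.ints 71 x = 0 ∧ s'.ints 72 x = 0) 50 0 (ob (κ + 1) - ob κ + 1)
    (Nat.zero_le _) ⟨h79, hT1, h73', by simp⟩ ?_ ?_).mono ?_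
  · rintro j s' hj ⟨i1, i2, i3, i4⟩
    simp (disch := omega) [i1, i2.hob, i3, Nat.mod_eq_of_lt]
  · rintro j s' hj ⟨i1, i2, i3, i4⟩ hs
    refine ⟨?_, i2.of_same (exec_same W _ s'), ?_, ?_⟩
    · simp (disch := omega) [Prog.exec, i1, Nat.mod_eq_of_lt]
    · simp [Prog.exec, i3]
    · intro x hx
      by_cases hxj : x = j
      · simp [Prog.exec, i1, hxj]
      · simpa [Prog.exec, i1, hxj] using i4 x (by omega)
  · rintro s' t - ⟨⟨i1, i2, i3, i4⟩, ht⟩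
    have e2 : (Prog.ivar 79 0).time ≤ 10 := by decide
    exact ⟨by omega, fun j hj => i4 j (by omega)⟩

/-- The invariant of the loop over the rows of a node. -/
structure RowInv (s0 : Mem) (a p : ℕ → ℕ) (c : ℕ → ℕ) (lo nb i : ℕ) (s : Mem) : Prop where
  hi : s.ints 74 0 = i
  cnt : ∀ u, s.ints 70 u = s0.ints 70 u +
    ∑ x ∈ Finset.Ico lo i, if a x = u then min (c x) (p x) else 0
  add : ∀ x ≤ nb, s.ints 71 x = ((Finset.Ico lo i).filter fun y => min (c y) (p y) = x).card
  sub : ∀ x ≤ nb, s.ints 72 x = ((Finset.Ico lo i).filter fun y => c y = x).card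

theorem card_filter_Ico_succ {lo i : ℕ} (h : lo ≤ i) (P : ℕ → Prop) [DecidablePred P] :
    ((Finset.Ico lo (i + 1)).filter P).card =
      ((Finset.Ico lo i).filter P).card + if P i then 1 else 0 := by
  rw [Finset.card_filter, Finset.card_filter, Finset.sum_Ico_succ_top h]

/-- Of the `c i` columns in reach, the first `p i` have smaller numbers than the row and are
credited to it. The rest is the interval from `min (c i) (p i)` to `c i`, whose start and end are
recorded in the arrays `71` and `72`. The bound `hcnt` keeps the modular additions exact. -/
theorem rowBody_spec {s0 s : Mem} {lo up nb i : ℕ} {c : ℕ → ℕ} (hW : 2 * n + 10 ≤ W)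
    (hT : Tab n k M oa ob a p b X Y s) (hlo : lo ≤ i) (hi : i < up) (hn : up ≤ lo + n)
    (h75 : s.ints 75 0 = c i) (hc : c i ≤ nb)
    (hcnt : s0.ints 70 (a i) +
      ∑ x ∈ Finset.Ico lo up, (if a x = a i then min (c x) (p x) else 0) < W)
    (h : RowInv s0 a p c lo nb i s) (hnb : nb ≤ n) (hiW : up < W) :
    RowInv s0 a p c lo nb (i + 1) (rowBody.exec W s) := by
  have hm : c i - (c i - p i) = min (c i) (p i) := by omega
  have hle : min (c i) (p i) ≤ nb := (min_le_left _ _).trans hc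
  have hle' : min (c i) (p i) ≤ n := by omega
  have bnd : ∀ P : ℕ → Prop, ∀ [DecidablePred P], ((Finset.Ico lo i).filter P).card ≤ n := by
    intro P _
    refine (Finset.card_filter_le _ _).trans ?_
    rw [Nat.card_Ico]
    omega
  have b1 := bnd fun y => min (c y) (p y) = min (c i) (p i)
  have b2 := bnd fun y => c y = c i
  have hsub : ∑ x ∈ Finset.Ico lo (i + 1), (if a x = a i then min (c x) (p x) else 0) ≤
      ∑ x ∈ Finset.Ico lo up, (if a x = a i then min (c x) (p x) else 0) :=
    Finset.sum_le_sum_of_subset (Finset.Ico_subset_Ico_right hi)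
  rw [Finset.sum_Ico_succ_top hlo, if_pos rfl] at hsub
  have e1 := h.cnt (a i)
  have e2 := h.add _ hle
  have e3 := h.sub _ hc
  refine ⟨?_, fun u => ?_, fun x hx => ?_, fun x hx => ?_⟩
  · simp (disch := omega) [rowBody, Prog.exec, h.hi, Nat.mod_eq_of_lt]
  · rw [Finset.sum_Ico_succ_top hlo, ← add_assoc, ← h.cnt u]
    by_cases hu : u = a i
    · subst hu
      simp (disch := omega) [rowBody, Prog.exec, h.hi, hT.ha, hT.hp, h75, hm, Nat.mod_eq_of_lt]
    · simp (disch := omega) [rowBody, Prog.exec, h.hi, hT.ha, hT.hp, h75, hm, Nat.mod_eq_of_lt, hu,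
        Ne.symm hu]
  · rw [card_filter_Ico_succ hlo, ← h.add x hx]
    by_cases hxm : x = min (c i) (p i)
    · subst hxm
      simp (disch := omega) [rowBody, Prog.exec, h.hi, hT.ha, hT.hp, h75, hm, Nat.mod_eq_of_lt]
    · simp (disch := omega) [rowBody, Prog.exec, h.hi, hT.ha, hT.hp, h75, hm, Nat.mod_eq_of_lt, hxm,
        Ne.symm hxm]
  · rw [card_filter_Ico_succ hlo, ← h.sub x hx]
    by_cases hxm : x = c i
    · subst hxm
      simp (disch := omega) [rowBody, Prog.exec, h.hi, hT.ha, hT.hp, h75, hm, Nat.mod_eq_of_lt]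
    · simp (disch := omega) [rowBody, Prog.exec, h.hi, hT.ha, hT.hp, h75, hm, Nat.mod_eq_of_lt, hxm,
        Ne.symm hxm]

theorem countRows_spec {s : Mem} {κ : ℕ} {D : ℝ} (hN : Nodes n M oa ob a p b X Y d)
    (hW : 2 * n + M + 10 ≤ W) (hoW : oa (κ + 1) + ob (κ + 1) < W)
    (hT : Tab n k M oa ob a p b X Y s) (hκ : κ < M)
    (h73 : s.ints 73 0 = κ) (hD : s.reals 70 0 = D)
    (h0 : ∀ j ≤ ob (κ + 1) - ob κ, s.ints 71 j = 0 ∧ s.ints 72 j = 0)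
    (hcnt : ∀ u < n, s.ints 70 u + ∑ x ∈ Finset.Ico (oa κ) (oa (κ + 1)),
      (if a x = u then min (cut X Y D (ob κ) (ob (κ + 1) - ob κ) x) (p x) else 0) < W) :
    Ends W countRows s fun s' t =>
      t ≤ 200 * (oa (κ + 1) - oa κ) + 100 * (ob (κ + 1) - ob κ) + 100 ∧
      RowInv s a p (cut X Y D (ob κ) (ob (κ + 1) - ob κ)) (oa κ) (ob (κ + 1) - ob κ)
        (oa (κ + 1)) s' := by
  set c := cut X Y D (ob κ) (ob (κ + 1) - ob κ) with hc
  set nb := ob (κ + 1) - ob κ with hnb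
  have l1 := hN.ob_len κ hκ
  have l2 := hN.ob_le κ hκ
  have l3 := hN.oa_len κ hκ
  have l4 := hN.oa_le κ hκ
  have hcle : ∀ i, c i ≤ nb := fun i => cut_le _ _ _ _ _ _
  have hcut : ∀ i j, j < nb → (j < c i ↔ X i + Y (ob κ + j) ≤ D) := fun i j hj =>
    lt_cut_iff (fun j j' h1 h2 h3 => hN.Y_mono κ hκ j j' h1 h2 (by omega)) hj
  -- Rows are sorted by distance, so a later row reaches no more columns. Hence the pointer starts
  -- at the last column, only moves down, and its potential of 60 per position pays for all scans.
  have hanti : ∀ i i', oa κ ≤ i → i ≤ i' → i' < oa (κ + 1) → c i' ≤ c i := by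
    intro i i' h1 h2 h3
    have h4 := hN.X_mono κ hκ i i' h1 h2 h3
    by_contra hlt
    have h5 : c i < nb := by have := hcle i'; omega
    have h6 := (hcut i' (c i) h5).1 (by omega)
    have := (hcut i (c i) h5).2 (by linarith)
    omega
  refine .seq (.flat rfl fun t1 ht1 => ?_)
  have hs1 := exec_same W (.ivar 75 (.get 64 (.var 73 + 1) - .get 64 (.var 73)) ;;
    .ivar 74 (.get 63 (.var 73))) s
  have h75 : (Prog.exec W (.ivar 75 (.get 64 (.var 73 + 1) - .get 64 (.var 73)) ;;
    .ivar 74 (.get 63 (.var 73))) s).ints 75 0 = nb := by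
    simp (disch := omega) [Prog.exec, h73, hT.hob, Nat.mod_eq_of_lt, hnb]
  have h74 : (Prog.exec W (.ivar 75 (.get 64 (.var 73 + 1) - .get 64 (.var 73)) ;;
    .ivar 74 (.get 63 (.var 73))) s).ints 74 0 = oa κ := by
    simp (disch := omega) [Prog.exec, h73, hT.hoa, Nat.mod_eq_of_lt]
  generalize Prog.exec W _ s = s1 at hs1 h75 h74
  refine (Ends.loop (fun (g : ℕ × ℕ) s' => RowInv s a p c (oa κ) nb g.1 s' ∧ s'.ints 75 0 = g.2 ∧
    oa κ ≤ g.1 ∧ g.1 ≤ oa (κ + 1) ∧ g.2 ≤ nb ∧ (∀ i, g.1 ≤ i → i < oa (κ + 1) → c i ≤ g.2) ∧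
    Tab n k M oa ob a p b X Y s' ∧ s'.ints 73 0 = κ ∧ s'.reals 70 0 = D)
    (fun g => 200 * (oa (κ + 1) - g.1) + 60 * g.2) (oa κ, nb)
    ⟨⟨h74, fun u => ?_, fun x hx => ?_, fun x hx => ?_⟩, h75, le_rfl, l4, le_rfl,
      fun i _ _ => hcle i, hT.of_same hs1, ?_, ?_⟩ ?_).mono ?_
  · simp [hs1.int 70]
  · simp [hs1.int 71, h0 x hx]
  · simp [hs1.int 72, h0 x hx]
  · rw [hs1.int 73, h73]
  · rw [hs1.real 70, hD]
  · rintro ⟨i, q⟩ s' ⟨i1, i2, i3, i4, i5, i6, i7, i8, i9⟩ hb -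
    simp only at i1 i2 i3 i4 i5 i6
    have hi : i < oa (κ + 1) := by
      simp (disch := omega) [i1.hi, i7.hoa, i8, Nat.mod_eq_of_lt] at hb
      omega
    refine .seq ((scanDown_spec (by omega) (c i) (by rw [i2]; exact i6 i le_rfl hi) ?_).mono ?_)
    · intro s2 hs2 q1 q2
      have j1 : s2.ints 74 0 = i := by rw [hs2.int 74, i1.hi]
      have j2 := i7.of_same hs2
      have j3 : s2.ints 73 0 = κ := by rw [hs2.int 73, i8]
      have j4 : s2.reals 70 0 = D := by rw [hs2.real 70, i9]
      rw [i2] at q2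
      have := hcut i (s2.ints 75 0 - 1) (by omega)
      simp (disch := omega) only [holds_rlt, rval_get, val_get, val_num, Nat.zero_mod, rval_add,
        val_add, val_sub, j1, j2.hX, j2.hY, j2.hob, j3, j4, Nat.mod_eq_of_lt]
      rw [← not_le, ← this]
      omega
    · rintro s2 t2 hs2 ⟨q1, q2⟩
      have j2 := i7.of_same hs2
      refine .flat rfl fun t3 ht3 => ⟨(i + 1, c i), ⟨?_, ?_, by simp only; omega, by simp only; omega,
        by simp only; exact hcle i, ?_, j2.of_same (exec_same W rowBody s2), ?_, ?_⟩, ?_⟩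
      · refine rowBody_spec (up := oa (κ + 1)) (by omega) j2 i3 hi l3 q1 (hcle i)
          (hcnt _ (hN.a_lt κ hκ i i3 hi))
          ⟨?_, ?_, ?_, ?_⟩ (by omega) (by omega)
        · rw [hs2.int 74, i1.hi]
        · rw [hs2.int 70]; exact i1.cnt
        · rw [hs2.int 71]; exact i1.add
        · rw [hs2.int 72]; exact i1.sub
      · rw [(exec_same W rowBody s2).int 75, q1]
      · intro i' h1 h2
        exact hanti i i' i3 (by simp only at h1; omega) h2
      · rw [(exec_same W rowBody s2).int 73, hs2.int 73, i8]
      · rw [(exec_same W rowBody s2).real 70, hs2.real 70, i9]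
      · have e1 : rowBody.time ≤ 90 := by decide
        have e2 : (BExp.rlt (.var 70) (.get 60 (.var 74) +
          .get 61 (.get 64 (.var 73) + (.var 75 - 1)))).cost ≤ 30 := by decide
        have e3 : (BExp.ilt (.var 74) (.get 63 (.var 73 + 1))).cost ≤ 20 := by decide
        have e4 := i6 i le_rfl hi
        rw [i2] at q2
        have e5 : ((BExp.rlt (.var 70) (.get 60 (.var 74) +
          .get 61 (.get 64 (.var 73) + (.var 75 - 1)))).cost + 20) * (q - c i) ≤ 50 * (q - c i) :=
          Nat.mul_le_mul_right _ (by omega)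
        simp only
        omega
  · rintro s' t - ⟨⟨i, q⟩, ⟨i1, i2, i3, i4, i5, i6, i7, i8, i9⟩, hb, ht⟩
    simp only at i1 i2 i3 i4 i5 i6 ht
    have hi : i = oa (κ + 1) := by
      simp (disch := omega) [i1.hi, i7.hoa, i8, Nat.mod_eq_of_lt] at hb
      omega
    subst hi
    have e1 : (Prog.ivar 75 (.get 64 (.var 73 + 1) - .get 64 (.var 73)) ;;
      .ivar 74 (.get 63 (.var 73))).time ≤ 30 := by decide
    have e3 : (BExp.ilt (.var 74) (.get 63 (.var 73 + 1))).cost ≤ 20 := by decide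
    exact ⟨by omega, i1⟩

/-- The number of rows whose pair with column `j` is counted at the column. -/
def colCount (p c : ℕ → ℕ) (lo up j : ℕ) : ℕ :=
  ((Finset.Ico lo up).filter fun i => p i ≤ j ∧ j < c i).card

/-- A row is credited at column `j` if its interval has started and not yet ended; so the count is
the number of starts minus the number of ends up to `j`. -/
theorem colCount_add (p c : ℕ → ℕ) (lo up j : ℕ) :
    colCount p c lo up j + ((Finset.Ico lo up).filter fun i => c i < j + 1).card =
      ((Finset.Ico lo up).filter fun i => min (c i) (p i) < j + 1).card := by
  rw [colCount, Finset.card_filter, Finset.card_filter, Finset.card_filter, ← Finset.sum_add_distrib]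
  refine Finset.sum_congr rfl fun i _ => ?_
  split_ifs <;> omega

theorem card_filter_lt_succ {A : Finset ℕ} (f : ℕ → ℕ) (j : ℕ) :
    (A.filter fun i => f i < j + 1).card =
      (A.filter fun i => f i < j).card + (A.filter fun i => f i = j).card := by
  rw [Finset.card_filter, Finset.card_filter, Finset.card_filter, ← Finset.sum_add_distrib]
  refine Finset.sum_congr rfl fun i _ => ?_
  split_ifs <;> omega

theorem countCols_spec {s : Mem} {κ : ℕ} {c : ℕ → ℕ} (hN : Nodes n M oa ob a p b X Y d)
    (hW : 3 * n + M + 10 ≤ W) (hoW : oa (κ + 1) + ob (κ + 1) < W)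
    (hT : Tab n k M oa ob a p b X Y s) (hκ : κ < M) (h73 : s.ints 73 0 = κ)
    (hadd : ∀ x ≤ ob (κ + 1) - ob κ, s.ints 71 x =
      ((Finset.Ico (oa κ) (oa (κ + 1))).filter fun y => min (c y) (p y) = x).card)
    (hsub : ∀ x ≤ ob (κ + 1) - ob κ, s.ints 72 x =
      ((Finset.Ico (oa κ) (oa (κ + 1))).filter fun y => c y = x).card)
    (hcnt : ∀ u < n, s.ints 70 u + ∑ j ∈ Finset.range (ob (κ + 1) - ob κ),
      (if b (ob κ + j) = u then colCount p c (oa κ) (oa (κ + 1)) j else 0) < W) :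
    Ends W countCols s fun s' t => t ≤ 100 * (ob (κ + 1) - ob κ) + 120 ∧
      ∀ u, s'.ints 70 u = s.ints 70 u + ∑ j ∈ Finset.range (ob (κ + 1) - ob κ),
        if b (ob κ + j) = u then colCount p c (oa κ) (oa (κ + 1)) j else 0 := by
  set nb := ob (κ + 1) - ob κ with hnb
  have l1 := hN.ob_len κ hκ
  have l2 := hN.ob_le κ hκ
  have l3 := hN.oa_len κ hκ
  have l4 := hN.oa_le κ hκ
  have bnd : ∀ P : ℕ → Prop, ∀ [DecidablePred P],
      ((Finset.Ico (oa κ) (oa (κ + 1))).filter P).card ≤ n := by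
    intro P _
    refine (Finset.card_filter_le _ _).trans ?_
    rw [Nat.card_Ico]
    omega
  refine .seq (.flat rfl fun t1 ht1 => ?_)
  have hs1 := exec_same W (.ivar 77 0 ;; .ivar 79 0) s
  have h77 : (Prog.exec W (.ivar 77 0 ;; .ivar 79 0) s).ints 77 0 = 0 := by simp [Prog.exec]
  have h79 : (Prog.exec W (.ivar 77 0 ;; .ivar 79 0) s).ints 79 0 = 0 := by simp [Prog.exec]
  generalize Prog.exec W _ s = s1 at hs1 h77 h79
  refine (Ends.count_flat (fun j s' => s'.ints 79 0 = j ∧ Tab n k M oa ob a p b X Y s' ∧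
    s'.ints 73 0 = κ ∧ s'.ints 77 0 + ((Finset.Ico (oa κ) (oa (κ + 1))).filter fun i =>
      c i < j).card = ((Finset.Ico (oa κ) (oa (κ + 1))).filter fun i => min (c i) (p i) < j).card ∧
    ∀ u, s'.ints 70 u = s.ints 70 u + ∑ j ∈ Finset.range j,
        if b (ob κ + j) = u then colCount p c (oa κ) (oa (κ + 1)) j else 0) 100 0 nb
    (Nat.zero_le _) ⟨h79, hT.of_same hs1, ?_, ?_, ?_⟩ ?_ ?_).mono ?_
  · rw [hs1.int 73, h73]
  · simp [h77]
  · simp [hs1.int 70]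
  · rintro j s' hj ⟨i1, i2, i3, i4⟩
    simp (disch := omega) [i1, i2.hob, i3, Nat.mod_eq_of_lt, hnb]
  · rintro j s' hj ⟨i1, i2, i3, i4, i5⟩ hs
    have j1 : s'.ints 71 j = _ := (congrFun ((hs.int 71).trans (hs1.int 71)) j).trans (hadd j hj.le)
    have j2 : s'.ints 72 j = _ := (congrFun ((hs.int 72).trans (hs1.int 72)) j).trans (hsub j hj.le)
    have e1 := colCount_add p c (oa κ) (oa (κ + 1)) j
    have e2 := card_filter_lt_succ (A := Finset.Ico (oa κ) (oa (κ + 1))) c j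
    have e3 := card_filter_lt_succ (A := Finset.Ico (oa κ) (oa (κ + 1))) (fun i => min (c i) (p i)) j
    have e4 := bnd fun i => min (c i) (p i) < j + 1
    -- The starts are added before the ends are subtracted; in this order the truncated subtraction
    -- is exact.
    have e5 : s'.ints 77 0 + s'.ints 71 j - s'.ints 72 j = colCount p c (oa κ) (oa (κ + 1)) j := by
      omega
    have hcnt' := hcnt (b (ob κ + j)) (hN.b_lt κ hκ _ (by omega) (by omega))
    have e6 : ∑ x ∈ Finset.range (j + 1), (if b (ob κ + x) = b (ob κ + j) then
        colCount p c (oa κ) (oa (κ + 1)) x else 0) ≤ ∑ x ∈ Finset.range nb,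
        (if b (ob κ + x) = b (ob κ + j) then colCount p c (oa κ) (oa (κ + 1)) x else 0) :=
      Finset.sum_le_sum_of_subset (Finset.range_subset_range.2 hj)
    rw [Finset.sum_range_succ, if_pos rfl] at e6
    have e7 := i5 (b (ob κ + j))
    refine ⟨?_, i2.of_same (exec_same W _ s'), ?_, ?_, ?_⟩
    · simp (disch := omega) [Prog.exec, i1, Nat.mod_eq_of_lt]
    · simp [Prog.exec, i3]
    · refine (congrArg (· + _) (?_ : _ = colCount p c (oa κ) (oa (κ + 1)) j)).trans e1
      rw [← e5]
      simp (disch := omega) [Prog.exec, i1, Nat.mod_eq_of_lt]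
    · intro u
      rw [Finset.sum_range_succ, ← add_assoc, ← i5 u]
      by_cases hu : u = b (ob κ + j)
      · subst hu
        simp (disch := omega) [Prog.exec, i1, i2.hob, i2.hb, i3, e5, Nat.mod_eq_of_lt]
      · simp (disch := omega) [Prog.exec, i1, i2.hob, i2.hb, i3, e5, Nat.mod_eq_of_lt, hu,
          Ne.symm hu]
  · rintro s' t - ⟨⟨i1, i2, i3, i4, i5⟩, ht⟩
    have e2 : (Prog.ivar 77 0 ;; .ivar 79 0).time ≤ 20 := by decide
    exact ⟨by omega, i5⟩

/-- Entry by entry, a close pair contributes to exactly one of the two sums: to the row if `j < p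
i`, where the row has the larger number, and to the column otherwise. -/
theorem pairCount_eq (hN : Nodes n M oa ob a p b X Y d) {κ : ℕ} (hκ : κ < M) (D : ℝ) (u : ℕ) :
    (∑ i ∈ Finset.Ico (oa κ) (oa (κ + 1)),
        if a i = u then min (cut X Y D (ob κ) (ob (κ + 1) - ob κ) i) (p i) else 0) +
      (∑ j ∈ Finset.range (ob (κ + 1) - ob κ), if b (ob κ + j) = u then
        colCount p (cut X Y D (ob κ) (ob (κ + 1) - ob κ)) (oa κ) (oa (κ + 1)) j else 0) =
    pairCount oa ob a b X Y D κ u := by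
  set nb := ob (κ + 1) - ob κ with hnb
  set c := cut X Y D (ob κ) nb with hc
  have l2 := hN.ob_le κ hκ
  have e1 : ∀ j ∈ Finset.range nb, (if b (ob κ + j) = u then
      colCount p c (oa κ) (oa (κ + 1)) j else 0) = ∑ i ∈ Finset.Ico (oa κ) (oa (κ + 1)),
        if b (ob κ + j) = u ∧ p i ≤ j ∧ j < c i then 1 else 0 := by
    intro j _
    by_cases hb : b (ob κ + j) = u
    · simp [hb, colCount]
    · simp [hb]
  rw [Finset.sum_congr rfl e1, Finset.sum_comm, ← Finset.sum_add_distrib, pairCount]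
  refine Finset.sum_congr rfl fun i hi => ?_
  rw [Finset.mem_Ico] at hi
  have e2 : (if a i = u then min (c i) (p i) else 0) =
      ∑ j ∈ Finset.range nb, if a i = u ∧ j < c i ∧ j < p i then 1 else 0 := by
    by_cases ha : a i = u
    · simp only [ha, if_true, true_and]
      rw [← Finset.card_filter]
      have : (Finset.range nb).filter (fun j => j < c i ∧ j < p i) =
          Finset.range (min (c i) (p i)) := by
        ext j
        have : c i ≤ nb := cut_le X Y D (ob κ) nb i
        simp only [Finset.mem_filter, Finset.mem_range, lt_min_iff]
        constructor
        · exact fun h => h.2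
        · exact fun h => ⟨by omega, h⟩
      rw [this, Finset.card_range]
    · simp [ha]
  rw [e2, ← Finset.sum_add_distrib]
  refine Finset.sum_congr rfl fun j hj => ?_
  rw [Finset.mem_range] at hj
  have h1 := lt_cut_iff (X := X) (Y := Y) (D := D) (i := i) (o := ob κ) (nb := nb)
    (fun j j' h1 h2 h3 => hN.Y_mono κ hκ j j' h1 h2 (by omega)) hj
  have h2 := hN.p_iff κ hκ i (ob κ + j) hi.1 hi.2 (by omega) (by omega)
  have h3 := hN.ne κ hκ i (ob κ + j) hi.1 hi.2 (by omega) (by omega)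
  have hX : X i + Y (ob κ + j) ≤ D ↔ j < c i := h1.symm
  by_cases hpj : j < p i
  · have h4 := h2.1 (by omega)
    rw [max_eq_left h4.le]
    by_cases hau : a i = u <;> by_cases hjc : j < c i <;>
      simp [hX, hau, hjc, hpj, not_le.2 hpj]
  · have h4 : a i < b (ob κ + j) := by
      have : ¬ b (ob κ + j) < a i := fun h => hpj (by have := h2.2 h; omega)
      omega
    rw [max_eq_right h4.le]
    by_cases hau : b (ob κ + j) = u <;> by_cases hjc : j < c i <;>
      simp [hX, hau, hjc, hpj, not_lt.1 hpj]

/-- Exchange the order of summation: each `v < u` within distance `D` is counted once for every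
entry that holds the pair, and by `hcov` there is just one such entry in all nodes. -/
theorem sum_pairCount (hN : Nodes n M oa ob a p b X Y d) (hd : ∀ u v, d u v = d v u)
    (hcov : ∀ u v, v < u → u < n → ∑ κ ∈ Finset.range M, pairHits oa ob a b κ u v = 1) (D : ℝ)
    {u : ℕ} (hu : u < n) :
    ∑ κ ∈ Finset.range M, pairCount oa ob a b X Y D κ u =
      ((Finset.range u).filter fun v => d u v ≤ D).card := by
  have e1 : ∀ κ ∈ Finset.range M, pairCount oa ob a b X Y D κ u =
      ∑ v ∈ Finset.range u, if d u v ≤ D then pairHits oa ob a b κ u v else 0 := by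
    intro κ hκ
    rw [Finset.mem_range] at hκ
    have l2 := hN.ob_le κ hκ
    simp only [pairHits, pairCount]
    have : ∀ v ∈ Finset.range u, (if d u v ≤ D then ∑ i ∈ Finset.Ico (oa κ) (oa (κ + 1)),
        ∑ j ∈ Finset.range (ob (κ + 1) - ob κ), (if (a i = u ∧ b (ob κ + j) = v) ∨
          (a i = v ∧ b (ob κ + j) = u) then 1 else 0) else 0) =
        ∑ i ∈ Finset.Ico (oa κ) (oa (κ + 1)), ∑ j ∈ Finset.range (ob (κ + 1) - ob κ),
          (if d u v ≤ D ∧ ((a i = u ∧ b (ob κ + j) = v) ∨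
            (a i = v ∧ b (ob κ + j) = u)) then 1 else 0) := by
      intro v _
      by_cases h : d u v ≤ D <;> simp [h]
    rw [Finset.sum_congr rfl this]
    refine Eq.trans ?_ Finset.sum_comm
    refine Finset.sum_congr rfl fun i hi => ?_
    refine Eq.trans ?_ Finset.sum_comm
    refine Finset.sum_congr rfl fun j hj => ?_
    rw [Finset.mem_Ico] at hi
    rw [Finset.mem_range] at hj
    have h3 := hN.ne κ hκ i (ob κ + j) hi.1 hi.2 (by omega) (by omega)
    have h4 := hN.dist κ hκ i (ob κ + j) hi.1 hi.2 (by omega) (by omega)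
    rw [h4]
    by_cases hmax : max (a i) (b (ob κ + j)) = u
    -- When the larger end of the entry is `u`, the only partner that it counts for is the smaller
    -- end.
    · rw [Finset.sum_eq_single_of_mem (min (a i) (b (ob κ + j)))
        (Finset.mem_range.2 (by omega))]
      · rcases lt_or_gt_of_ne h3 with h5 | h5
        · rw [max_eq_right h5.le] at hmax ⊢
          rw [min_eq_left h5.le, ← hmax, hd (a i)]
          simp
        · rw [max_eq_left h5.le] at hmax ⊢
          rw [min_eq_right h5.le, ← hmax]
          simp
      · intro v hv hne
        rw [Finset.mem_range] at hv
        rw [if_neg]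
        rintro ⟨-, h | h⟩ <;> omega
    · rw [if_neg (fun h => hmax h.2), Finset.sum_eq_zero]
      intro v hv
      rw [Finset.mem_range] at hv
      rw [if_neg]
      rintro ⟨-, h | h⟩ <;> omega
  rw [Finset.sum_congr rfl e1, Finset.sum_comm, Finset.card_filter]
  refine Finset.sum_congr rfl fun v hv => ?_
  by_cases h : d u v ≤ D
  · simp only [h, if_true]
    exact hcov u v (Finset.mem_range.1 hv) hu
  · simp [h]

/-- Counts the close pairs of one node. -/
def countNode : Prog := clearCols ;; countRows ;; countCols ;; .ivar 73 (.var 73 + 1)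

theorem countNode_spec {s : Mem} {κ : ℕ} {D : ℝ} (hN : Nodes n M oa ob a p b X Y d)
    (hW : 3 * n + M + 10 ≤ W) (hoW : oa (κ + 1) + ob (κ + 1) < W)
    (hT : Tab n k M oa ob a p b X Y s) (hκ : κ < M)
    (h73 : s.ints 73 0 = κ) (hD : s.reals 70 0 = D)
    (hcnt : ∀ u < n, s.ints 70 u + pairCount oa ob a b X Y D κ u < W) :
    Ends W countNode s fun s' t =>
      t ≤ 200 * (oa (κ + 1) - oa κ) + 250 * (ob (κ + 1) - ob κ) + 350 ∧
      s'.ints 73 0 = κ + 1 ∧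
      ∀ u, s'.ints 70 u = s.ints 70 u + pairCount oa ob a b X Y D κ u := by
  have hpc := pairCount_eq hN hκ D
  refine .seq ((clearCols_spec hN (by omega) hT hκ h73).mono ?_)
  rintro s1 t1 hs1 ⟨ht1, h0⟩
  have hT1 := hT.of_same hs1
  have h73' : s1.ints 73 0 = κ := by rw [hs1.int 73, h73]
  refine .seq ((countRows_spec (D := D) hN (by omega) hoW hT1 hκ h73' ?_ h0 ?_).mono ?_)
  · rw [hs1.real 70, hD]
  · intro u hu
    have := hcnt u hu
    rw [← hpc] at this
    rw [hs1.int 70]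
    omega
  rintro s2 t2 hs2 ⟨ht2, hr⟩
  have hT2 := hT1.of_same hs2
  have h73' : s2.ints 73 0 = κ := by rw [hs2.int 73, h73']
  refine .seq ((countCols_spec hN hW hoW hT2 hκ h73' hr.add hr.sub ?_).mono ?_)
  · intro u hu
    have := hcnt u hu
    rw [← hpc] at this
    rw [hr.cnt, hs1.int 70]
    omega
  rintro s3 t3 hs3 ⟨ht3, h3⟩
  have h73' : s3.ints 73 0 = κ := by rw [hs3.int 73, h73']
  refine .flat rfl fun t4 ht4 => ⟨?_, ?_, fun u => ?_⟩
  · have : (Prog.ivar 73 (.var 73 + 1)).time ≤ 20 := by decide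
    omega
  · simp (disch := omega) [Prog.exec, h73', Nat.mod_eq_of_lt]
  · rw [(exec_same W (.ivar 73 (.var 73 + 1)) s3).int 70, h3, hr.cnt, hs1.int 70, ← hpc, add_assoc]

/-! ### Feasibility of a given diameter. -/

/-- Decides whether the number in the real scalar `70` is a feasible diameter. The answer, `0` or
`1`, is the integer scalar `80`, and a vertex that shows it the scalar `81`. -/
def decideProg : Prog :=
  .ivar 82 0 ;;
  .loop (.ilt (.var 82) (.var 0)) (.iset 70 (.var 82) 0 ;; .ivar 82 (.var 82 + 1)) ;;
  .ivar 73 0 ;;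
  .loop (.ilt (.var 73) (.var 65)) countNode ;;
  (.ivar 80 0 ;; .ivar 82 0) ;;
  .loop (.ilt (.var 82) (.var 0))
    (.ite (.ilt (.get 70 (.var 82) + 1) (.var 1)) .skip (.ivar 80 1 ;; .ivar 81 (.var 82)) ;;
      .ivar 82 (.var 82 + 1))

theorem Nodes.oa_mono (hN : Nodes n M oa ob a p b X Y d) {κ κ' : ℕ} (h : κ ≤ κ') (h' : κ' ≤ M) :
    oa κ ≤ oa κ' := by
  induction κ', h using Nat.le_induction with
  | base => exact le_rfl
  | succ m _ ih => exact (ih (by omega)).trans (hN.oa_le m (by omega))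

theorem Nodes.ob_mono (hN : Nodes n M oa ob a p b X Y d) {κ κ' : ℕ} (h : κ ≤ κ') (h' : κ' ≤ M) :
    ob κ ≤ ob κ' := by
  induction κ', h using Nat.le_induction with
  | base => exact le_rfl
  | succ m _ ih => exact (ih (by omega)).trans (hN.ob_le m (by omega))

/-- The vertex `u` counts itself in `Feas` but never occurs as a pair; hence the extra one. -/
theorem feas_iff {par : ℕ → ℕ} {dep : ℕ → ℝ} {D : ℝ} (hD : 0 ≤ D) (u : ℕ) :
    Feas n k par dep D u ↔ u < n ∧
      k ≤ ((Finset.range u).filter fun v => rd par dep u v ≤ D).card + 1 := by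
  rw [Feas, Finset.range_add_one, Finset.filter_insert, if_pos (by rw [rd_self]; exact hD),
    Finset.card_insert_of_notMem (by simp)]

/-- The correctness and the running time of the decision procedure. -/
theorem decideProg_spec {s : Mem} {par : ℕ → ℕ} {dep : ℕ → ℝ} {D : ℝ}
    (hN : Nodes n M oa ob a p b X Y (rd par dep))
    (hcov : ∀ u v, v < u → u < n → ∑ κ ∈ Finset.range M, pairHits oa ob a b κ u v = 1)
    (hW : 4 * n + M + 10 ≤ W) (hoW : oa M + ob M < W) (hT : Tab n k M oa ob a p b X Y s)
    (hD : s.reals 70 0 = D) (hD0 : 0 ≤ D) :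
    Ends W decideProg s fun s' t => t ≤ 200 * oa M + 250 * ob M + 400 * M + 200 * n + 200 ∧
      (s'.ints 80 0 = 1 → Feas n k par dep D (s'.ints 81 0)) ∧
      (s'.ints 80 0 ≠ 1 → ∀ u, ¬ Feas n k par dep D u) := by
  refine .seq (.flat rfl fun t1 ht1 => ?_)
  have hs1 := exec_same W (.ivar 82 0) s
  have h82 : (Prog.exec W (.ivar 82 0) s).ints 82 0 = 0 := by simp [Prog.exec]
  generalize Prog.exec W _ s = s1 at hs1 h82
  refine .seq ((Ends.count_flat (fun i s' => s'.ints 82 0 = i ∧ s'.ints 0 0 = n ∧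
    ∀ u < i, s'.ints 70 u = 0) 50 0 n (Nat.zero_le _) ⟨h82, ?_, by simp⟩ ?_ ?_).mono ?_)
  · rw [hs1.int 0, hT.hn]
  · rintro i s' hi ⟨i1, i2, i3⟩
    simp [i1, i2]
  · rintro i s' hi ⟨i1, i2, i3⟩ hs
    refine ⟨?_, ?_, ?_⟩
    · simp (disch := omega) [Prog.exec, i1, Nat.mod_eq_of_lt]
    · simp [Prog.exec, i2]
    · intro x hx
      by_cases hxi : x = i
      · simp [Prog.exec, i1, hxi]
      · simpa [Prog.exec, i1, hxi] using i3 x (by omega)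
  rintro s2 t2 hs2 ⟨⟨-, -, hz⟩, ht2⟩
  have hT2 := (hT.of_same hs1).of_same hs2
  have hD2 : s2.reals 70 0 = D := by rw [hs2.real 70, hs1.real 70, hD]
  refine .seq (.flat rfl fun t3 ht3 => ?_)
  have hs3 := exec_same W (.ivar 73 0) s2
  have h73 : (Prog.exec W (.ivar 73 0) s2).ints 73 0 = 0 := by simp [Prog.exec]
  generalize Prog.exec W _ s2 = s3 at hs3 h73
  have hsum := fun u (hu : u < n) => sum_pairCount hN (rd_comm par dep) hcov D hu
  have hzero : ∀ u, n ≤ u → ∀ κ < M, pairCount oa ob a b X Y D κ u = 0 := by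
    intro u hu κ hκ
    refine Finset.sum_eq_zero fun i hi => Finset.sum_eq_zero fun j hj => if_neg ?_
    rw [Finset.mem_Ico] at hi
    rw [Finset.mem_range] at hj
    have h1 := hN.a_lt κ hκ i hi.1 hi.2
    have h2 := hN.b_lt κ hκ (ob κ + j) (by omega) (by omega)
    omega
  -- Every intermediate counter is part of a count of vertices, so it stays below the word bound.
  have hle : ∀ u κ, κ < M → ∑ x ∈ Finset.range (κ + 1), pairCount oa ob a b X Y D x u ≤ n := by
    intro u κ hκ
    by_cases hu : u < n
    · refine (Finset.sum_le_sum_of_subset (Finset.range_subset_range.2 hκ)).trans ?_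
      rw [hsum u hu]
      refine (Finset.card_filter_le _ _).trans ?_
      rw [Finset.card_range]
      omega
    · rw [Finset.sum_eq_zero fun x hx => hzero u (by omega) x (by
        rw [Finset.mem_range] at hx
        omega)]
      omega
  refine .seq ((Ends.loop (fun κ s' => s'.ints 73 0 = κ ∧ κ ≤ M ∧ Tab n k M oa ob a p b X Y s' ∧
    s'.reals 70 0 = D ∧ ∀ u < n, s'.ints 70 u = ∑ x ∈ Finset.range κ, pairCount oa ob a b X Y D x u)
    (fun κ => 200 * (oa M - oa κ) + 250 * (ob M - ob κ) + 370 * (M - κ)) 0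
    ⟨h73, Nat.zero_le _, hT2.of_same hs3, ?_, ?_⟩ ?_).mono ?_)
  · rw [hs3.real 70, hD2]
  · intro u hu
    rw [hs3.int 70, hz u hu]
    simp
  · rintro κ s' ⟨i1, i2, i3, i4, i5⟩ hb -
    have hκ : κ < M := by simpa [i1, i3.hM] using hb
    have m1 := hN.oa_mono (κ := κ + 1) (κ' := M) hκ le_rfl
    have m2 := hN.ob_mono (κ := κ + 1) (κ' := M) hκ le_rfl
    have m3 := hN.oa_le κ hκ
    have m4 := hN.ob_le κ hκ
    refine (countNode_spec hN (by omega) (by omega) i3 hκ i1 i4 ?_).mono ?_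
    · intro u hu
      have := hle u κ hκ
      rw [Finset.sum_range_succ] at this
      rw [i5 u hu]
      omega
    · rintro s2 t2 hs2 ⟨ht2, j1, j2⟩
      refine ⟨κ + 1, ⟨j1, hκ, i3.of_same hs2, ?_, ?_⟩, ?_⟩
      · rw [hs2.real 70, i4]
      · intro u hu
        rw [j2, i5 u hu, Finset.sum_range_succ]
      · have e1 : (BExp.ilt (.var 73) (.var 65)).cost + 1 ≤ 20 := by decide
        omega
  rintro s4 t4 hs4 ⟨κ, ⟨i1, i2, i3, i4, i5⟩, hb, ht4⟩
  obtain rfl : κ = M := by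
    simp [i1, i3.hM] at hb
    omega
  clear hb
  refine .seq (.flat rfl fun t5 ht5 => ?_)
  have hs5 := exec_same W (.ivar 80 0 ;; .ivar 82 0) s4
  have h80 : (Prog.exec W (.ivar 80 0 ;; .ivar 82 0) s4).ints 80 0 = 0 := by simp [Prog.exec]
  have h82 : (Prog.exec W (.ivar 80 0 ;; .ivar 82 0) s4).ints 82 0 = 0 := by simp [Prog.exec]
  generalize Prog.exec W _ s4 = s5 at hs5 h80 h82
  have hcnt : ∀ u < n, s5.ints 70 u = ((Finset.range u).filter fun v => rd par dep u v ≤ D).card := by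
    intro u hu
    rw [hs5.int 70, i5 u hu, hsum u hu]
  have hF : ∀ u < n, (Feas n k par dep D u ↔ k ≤ s5.ints 70 u + 1) := by
    intro u hu
    rw [feas_iff hD0, hcnt u hu]
    simp [hu]
  have hsmall : ∀ u < n, s5.ints 70 u + 1 < W := by
    intro u hu
    rw [hcnt u hu]
    have := Finset.card_filter_le (Finset.range u) fun v => rd par dep u v ≤ D
    rw [Finset.card_range] at this
    omega
  have hT5 := i3.of_same hs5
  refine (Ends.count_flat (fun i s' => s'.ints 82 0 = i ∧ s'.ints 0 0 = n ∧ s'.ints 1 0 = k ∧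
    s'.ints 70 = s5.ints 70 ∧ (s'.ints 80 0 = 1 → Feas n k par dep D (s'.ints 81 0)) ∧
    (s'.ints 80 0 ≠ 1 → ∀ u < i, ¬ Feas n k par dep D u)) 60 0 n (Nat.zero_le _)
    ⟨h82, hT5.hn, hT5.hk, rfl, by simp [h80], by simp⟩ ?_ ?_).mono ?_
  · rintro i s' hi ⟨i1, i2, -⟩
    simp [i1, i2]
  · rintro i s' hi ⟨i1, i2, i3, i4, i5, i6⟩ hs
    have hsm := hsmall i hi
    have hFi := hF i hi
    by_cases hk : s5.ints 70 i + 1 < k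
    · have hc : BExp.Holds W s' (.ilt (.get 70 (.var 82) + 1) (.var 1)) := by
        simp (disch := omega) [i1, i3, i4, Nat.mod_eq_of_lt]
        exact hk
      simp only [Prog.exec, if_pos hc]
      refine ⟨?_, ?_, ?_, ?_, ?_, ?_⟩
      · simp (disch := omega) [i1, Nat.mod_eq_of_lt]
      · simp [i2]
      · simp [i3]
      · rw [← i4]; funext; simp
      · simpa using i5
      · intro h u hu
        by_cases hui : u = i
        · rw [hui, hFi]
          omega
        · exact i6 (by simpa using h) u (by omega)
    · have hc : ¬ BExp.Holds W s' (.ilt (.get 70 (.var 82) + 1) (.var 1)) := by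
        simp (disch := omega) [i1, i3, i4, Nat.mod_eq_of_lt]
        omega
      simp only [Prog.exec, if_neg hc]
      refine ⟨?_, ?_, ?_, ?_, ?_, ?_⟩
      · simp (disch := omega) [i1, Nat.mod_eq_of_lt]
      · simp [i2]
      · simp [i3]
      · rw [← i4]; funext; simp
      · intro _
        simp [i1]
        rw [hFi]
        omega
      · intro h
        exact absurd (by simp (disch := omega) [Nat.mod_eq_of_lt]) h
  · rintro s' t - ⟨⟨i1, i2, i3, i4, i5, i6⟩, ht⟩
    refine ⟨?_, i5, fun h u hu => i6 h u hu.1 hu⟩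
    have e1 : (Prog.ivar 82 0).time ≤ 10 := by decide
    have e2 : (Prog.ivar 73 0).time ≤ 10 := by decide
    have e3 : (Prog.ivar 80 0 ;; .ivar 82 0).time ≤ 20 := by decide
    have e4 : (BExp.ilt (.var 73) (.var 65)).cost ≤ 10 := by decide
    rw [hN.oa_zero, hN.ob_zero] at ht4
    omega

end Count

end PartialCenter

set_option linter.unusedSimpArgs false

namespace PartialCenter

/-! ## Listing the candidates on a grid -/

/-- The number of multiples of `g` below `m`. -/
def gridLen (m g : ℕ) : ℕ := (m + (g - 1)) / g

theorem lt_gridLen {m g x : ℕ} (hg : 0 < g) : x < gridLen m g ↔ x * g < m := by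
  rw [gridLen, Nat.lt_iff_add_one_le, Nat.le_div_iff_mul_le hg, Nat.succ_mul]
  omega

theorem gridLen_le {m g : ℕ} : gridLen m g ≤ m / g + 1 := by
  rcases Nat.eq_zero_or_pos g with rfl | hg
  · simp [gridLen]
  · rw [gridLen, ← Nat.add_div_right _ hg]
    exact Nat.div_le_div_right (by omega)

/-- The numbers strictly between `lo` and `hi` in the row `x` of a grid. -/
noncomputable def gridRow (v : ℕ → ℕ → ℝ) (lo hi : ℝ) (nc x : ℕ) : Multiset ℝ :=
  ∑ j ∈ Finset.range nc, if lo < v x j ∧ v x j < hi then {v x j} else 0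

/-- The entry of the grid of width `g` in the row `x` and the column `j` of the node `κ`. -/
def gridVal (oa ob : ℕ → ℕ) (X Y : ℕ → ℝ) (g κ x j : ℕ) : ℝ := X (oa κ + x * g) + Y (ob κ + j * g)

/-- The candidates strictly between `lo` and `hi` on the grid of width `g` of the node `κ`. -/
noncomputable def gridNode (oa ob : ℕ → ℕ) (X Y : ℕ → ℝ) (lo hi : ℝ) (g κ : ℕ) : Multiset ℝ :=
  ∑ x ∈ Finset.range (gridLen (oa (κ + 1) - oa κ) g),
    gridRow (gridVal oa ob X Y g κ) lo hi (gridLen (ob (κ + 1) - ob κ) g) x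

/-- In a sorted row the entries inside the bracket occupy consecutive columns; this is what makes
listing them cost no more than their number. -/
theorem gridRow_eq {v : ℕ → ℕ → ℝ} {lo hi : ℝ} {nc x : ℕ} {cl ch : ℕ} (hch : ch ≤ nc)
    (h1 : ∀ j < nc, j < ch ↔ v x j < hi) (h2 : ∀ j < ch, cl ≤ j ↔ lo < v x j) :
    gridRow v lo hi nc x = ∑ j ∈ Finset.Ico cl ch, {v x j} := by
  rw [gridRow, ← Finset.sum_filter]
  refine Finset.sum_congr ?_ fun _ _ => rfl
  ext j
  simp only [Finset.mem_filter, Finset.mem_range, Finset.mem_Ico]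
  constructor
  · rintro ⟨a, b, c⟩
    have := (h1 j a).2 c
    exact ⟨(h2 j this).2 b, this⟩
  · rintro ⟨a, b⟩
    exact ⟨by omega, (h2 j b).1 a, (h1 j (by omega)).1 b⟩

theorem items_map {α β : Type*} (f : ℕ → α) (h : α → β) (b e : ℕ) :
    (items f b e).map h = items (fun x => h (f x)) b e := by
  simp only [items, Finset.sum_eq_multiset_sum]
  induction (Finset.Ico b e).val using Multiset.induction_on with
  | empty => simp
  | cons a t ih => simp [ih]

/-- Lists the entries of one row of a grid, from the column `75` down. -/
def emitRow : Prog :=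
  .ivar 79 (.var 75) ;;
  .loop (.and (.ilt 0 (.var 79)) (.rlt (.var 71)
      (.get 60 (.var 74) + .get 61 (.get 64 (.var 73) + (.var 79 - 1) * .var 90))))
    (.ivar 79 (.var 79 - 1) ;;
      .rset 10 (.var 12) (.get 60 (.var 74) + .get 61 (.get 64 (.var 73) + .var 79 * .var 90)) ;;
      .ivar 12 (.var 12 + 1))

/-- Lists the candidates on the grid of one node. -/
def enumNode : Prog :=
  (.ivar 75 ((.get 64 (.var 73 + 1) - .get 64 (.var 73) + (.var 90 - 1)) / .var 90) ;;
    .ivar 74 (.get 63 (.var 73))) ;;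
  .loop (.ilt (.var 74) (.get 63 (.var 73 + 1)))
    (scanDown 75 (.not (.rlt
        (.get 60 (.var 74) + .get 61 (.get 64 (.var 73) + (.var 75 - 1) * .var 90)) (.var 72))) ;;
      emitRow ;; .ivar 74 (.var 74 + .var 90)) ;;
  .ivar 73 (.var 73 + 1)

/-- Lists all the candidates strictly between the real scalars `71` and `72` on the grids whose
width is the integer scalar `90`. -/
def enumProg : Prog :=
  (.ivar 12 0 ;; .ivar 73 0) ;; .loop (.ilt (.var 73) (.var 65)) enumNode

section Enum
variable {W n k M : ℕ} {oa ob a p b : ℕ → ℕ} {X Y : ℕ → ℝ} {d : ℕ → ℕ → ℝ}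

theorem emitRow_spec {s : Mem} {κ g x ch nb : ℕ} {lo hi : ℝ} (hW : 2 < W)
    (hT : Tab n k M oa ob a p b X Y s) (h73 : s.ints 73 0 = κ) (h74 : s.ints 74 0 = oa κ + x * g)
    (h90 : s.ints 90 0 = g) (hg : 0 < g) (h71 : s.reals 71 0 = lo) (h75 : s.ints 75 0 = ch)
    (hch : ch ≤ gridLen nb g) (hbW : ob κ + nb < W)
    (hY : ∀ j j', ob κ ≤ j → j ≤ j' → j' < ob κ + nb → Y j ≤ Y j')
    (h1 : ∀ j < gridLen nb g, j < ch ↔ gridVal oa ob X Y g κ x j < hi)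
    (hlen : s.ints 12 0 + (gridRow (gridVal oa ob X Y g κ) lo hi (gridLen nb g) x).card < W) :
    Ends W emitRow s fun s' t =>
      t ≤ 100 * (gridRow (gridVal oa ob X Y g κ) lo hi (gridLen nb g) x).card + 100 ∧
      s'.ints 12 0 = s.ints 12 0 + (gridRow (gridVal oa ob X Y g κ) lo hi (gridLen nb g) x).card ∧
      items (s'.reals 10) 0 (s'.ints 12 0) = items (s.reals 10) 0 (s.ints 12 0) +
        gridRow (gridVal oa ob X Y g κ) lo hi (gridLen nb g) x := by
  set v := gridVal oa ob X Y g κ with hv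
  have hjg : ∀ j < gridLen nb g, j * g < nb := fun j hj => (lt_gridLen hg).1 hj
  set cl := ((Finset.range ch).filter fun j => v x j ≤ lo).card with hcl
  have h2 : ∀ j < ch, cl ≤ j ↔ lo < v x j := by
    intro j hj
    rw [← not_lt, hcl, lt_card_filter_iff (P := fun j => v x j ≤ lo) ?_ hj, not_le]
    intro i j h1 h2 h3
    have e1 := hjg j (by omega)
    have e2 := Nat.mul_le_mul_right g h1
    have := hY (ob κ + i * g) (ob κ + j * g) (by omega) (by omega) (by omega)
    simp only [hv, gridVal] at h3 ⊢
    linarith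
  have hclch : cl ≤ ch := (Finset.card_filter_le _ _).trans (Finset.card_range ch).le
  have hrow := gridRow_eq hch h1 h2
  have hcard : (gridRow v lo hi (gridLen nb g) x).card = ch - cl := by
    rw [hrow]
    simp
  rw [hcard, hrow]
  rw [hcard] at hlen
  refine .seq (.flat rfl fun t1 ht1 => ?_)
  have hs1 := exec_same W (.ivar 79 (.var 75)) s
  have h79 : (Prog.exec W (.ivar 79 (.var 75)) s).ints 79 0 = ch := by simp [Prog.exec, h75]
  generalize Prog.exec W _ s = s1 at hs1 h79
  refine (Ends.loop (fun j s' => s'.ints 79 0 = j ∧ cl ≤ j ∧ j ≤ ch ∧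
    s'.ints 12 0 + j = s.ints 12 0 + ch ∧
    items (s'.reals 10) 0 (s'.ints 12 0) = items (s.reals 10) 0 (s.ints 12 0) +
      ∑ y ∈ Finset.Ico j ch, {v x y}) (fun j => 100 * (j - cl)) ch
    ⟨h79, hclch, le_rfl, by rw [hs1.int 12], by rw [hs1.int 12, hs1.real 10]; simp⟩ ?_).mono ?_
  · rintro j s' ⟨i1, i2, i3, i4, i5⟩ hb hs
    have hT' := (hT.of_same hs1).of_same hs
    have k73 : s'.ints 73 0 = κ := by rw [hs.int 73, hs1.int 73, h73]
    have k74 : s'.ints 74 0 = oa κ + x * g := by rw [hs.int 74, hs1.int 74, h74]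
    have k90 : s'.ints 90 0 = g := by rw [hs.int 90, hs1.int 90, h90]
    have k71 : s'.reals 71 0 = lo := by rw [hs.real 71, hs1.real 71, h71]
    have hj0 : 0 < j := by
      have := hb.1
      simpa [i1] using this
    have e1 := hjg (j - 1) (by omega)
    have hlt : cl ≤ j - 1 := by
      refine (h2 (j - 1) (by omega)).2 ?_
      have := hb.2
      simp (disch := omega) [i1, hT'.hX, hT'.hY, hT'.hob, k73, k74, k90, k71,
        Nat.mod_eq_of_lt] at this
      exact this
    refine .flat rfl fun t ht => ⟨j - 1, ⟨?_, hlt, by omega, ?_, ?_⟩, ?_⟩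
    · simp (disch := omega) [Prog.exec, i1, Nat.mod_eq_of_lt]
    · simp (disch := omega) [Prog.exec, Nat.mod_eq_of_lt]
      omega
    · rw [show j - 1 = j - 1 from rfl, Finset.sum_eq_sum_Ico_succ_bot (by omega : j - 1 < ch),
        show j - 1 + 1 = j by omega, add_comm {v x (j - 1)}, ← add_assoc, ← i5]
      simp (disch := omega) [Prog.exec, i1, hT'.hX, hT'.hY, hT'.hob, k73, k74, k90,
        Nat.mod_eq_of_lt]
      rw [items_succ (Nat.zero_le _)]
      congr 1
      · exact items_congr fun y _ hy => by
          simp (disch := omega) [Prog.exec]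
          intro h
          omega
      · simp (disch := omega) [hv, gridVal]
    · have e1 : Prog.time (.ivar 79 (.var 79 - 1) ;;
        .rset 10 (.var 12) (.get 60 (.var 74) + .get 61 (.get 64 (.var 73) + .var 79 * .var 90)) ;;
        .ivar 12 (.var 12 + 1)) ≤ 50 := by decide
      have e2 : (BExp.and (.ilt 0 (.var 79)) (.rlt (.var 71)
        (.get 60 (.var 74) + .get 61 (.get 64 (.var 73) + (.var 79 - 1) * .var 90)))).cost ≤ 40 := by
        decide
      omega
  · rintro s' t hs ⟨j, ⟨i1, i2, i3, i4, i5⟩, hb, ht⟩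
    have hT' := (hT.of_same hs1).of_same hs
    have k73 : s'.ints 73 0 = κ := by rw [hs.int 73, hs1.int 73, h73]
    have k74 : s'.ints 74 0 = oa κ + x * g := by rw [hs.int 74, hs1.int 74, h74]
    have k90 : s'.ints 90 0 = g := by rw [hs.int 90, hs1.int 90, h90]
    have k71 : s'.reals 71 0 = lo := by rw [hs.real 71, hs1.real 71, h71]
    have hj : j = cl := by
      by_contra hne
      have e1 := hjg (j - 1) (by omega)
      have := (h2 (j - 1) (by omega)).1 (by omega)
      apply hb
      refine ⟨?_, ?_⟩
      · simp [i1]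
        omega
      · simp (disch := omega) [i1, hT'.hX, hT'.hY, hT'.hob, k73, k74, k90, k71, Nat.mod_eq_of_lt]
        exact this
    subst hj
    have e2 : (BExp.and (.ilt 0 (.var 79)) (.rlt (.var 71)
      (.get 60 (.var 74) + .get 61 (.get 64 (.var 73) + (.var 79 - 1) * .var 90)))).cost ≤ 40 := by
      decide
    have e3 : (Prog.ivar 79 (.var 75)).time ≤ 10 := by decide
    exact ⟨by omega, by omega, i5⟩

/-- The time is output-sensitive: one unit, up to a constant, for each grid row, each grid column
and each listed entry. The pointer to the upper bound only moves down over the rows, and from it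
each row is listed downwards until `lo` is met. -/
theorem enumNode_spec {s : Mem} {κ g : ℕ} {lo hi : ℝ} (hN : Nodes n M oa ob a p b X Y d)
    (hW : 2 * n + M + 10 + g ≤ W) (hoW : oa (κ + 1) + ob (κ + 1) + g < W) (hκ : κ < M)
    (hT : Tab n k M oa ob a p b X Y s) (h73 : s.ints 73 0 = κ)
    (h90 : s.ints 90 0 = g) (hg : 0 < g) (h71 : s.reals 71 0 = lo) (h72 : s.reals 72 0 = hi)
    (hlen : s.ints 12 0 + (gridNode oa ob X Y lo hi g κ).card < W) :
    Ends W enumNode s fun s' t =>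
      t ≤ 400 * ((oa (κ + 1) - oa κ) / g) + 100 * ((ob (κ + 1) - ob κ) / g) +
        100 * (gridNode oa ob X Y lo hi g κ).card + 700 ∧
      s'.ints 73 0 = κ + 1 ∧
      s'.ints 12 0 = s.ints 12 0 + (gridNode oa ob X Y lo hi g κ).card ∧
      items (s'.reals 10) 0 (s'.ints 12 0) = items (s.reals 10) 0 (s.ints 12 0) +
        gridNode oa ob X Y lo hi g κ := by
  have l1 := hN.ob_len κ hκ
  have l2 := hN.ob_le κ hκ
  have l3 := hN.oa_len κ hκ
  have l4 := hN.oa_le κ hκ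
  have l5 := gridLen_le (m := oa (κ + 1) - oa κ) (g := g)
  have l6 := gridLen_le (m := ob (κ + 1) - ob κ) (g := g)
  set v := gridVal oa ob X Y g κ with hv
  set nc := gridLen (ob (κ + 1) - ob κ) g with hnc
  set nr := gridLen (oa (κ + 1) - oa κ) g with hnr
  have hjg : ∀ j < nc, j * g < ob (κ + 1) - ob κ := fun j hj => (lt_gridLen hg).1 hj
  have hxg : ∀ x < nr, x * g < oa (κ + 1) - oa κ := fun j hj => (lt_gridLen hg).1 hj
  let ch : ℕ → ℕ := fun x => ((Finset.range nc).filter fun j => v x j < hi).card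
  have hch : ∀ x, ch x ≤ nc := fun x => (Finset.card_filter_le _ _).trans (Finset.card_range nc).le
  have hcut : ∀ x, ∀ j < nc, j < ch x ↔ v x j < hi := fun x j hj =>
    lt_card_filter_iff (P := fun j => v x j < hi) (fun i j h1 h2 h3 => by
      have e1 := hjg j h2
      have e2 := Nat.mul_le_mul_right g h1
      have := hN.Y_mono κ hκ (ob κ + i * g) (ob κ + j * g) (by omega) (by omega) (by omega)
      simp only [hv, gridVal] at h3 ⊢
      linarith) hj
  -- The grid inherits the order of the rows, so the position of the upper bound does not increase.
  have hanti : ∀ x y, x ≤ y → y < nr → ch y ≤ ch x := by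
    intro x y h1 h2
    have e1 := hxg y h2
    have e2 := Nat.mul_le_mul_right g h1
    have e3 := hN.X_mono κ hκ (oa κ + x * g) (oa κ + y * g) (by omega) (by omega) (by omega)
    by_contra hlt
    have h5 : ch x < nc := by have := hch y; omega
    have h6 := (hcut y (ch x) h5).1 (by omega)
    have := (hcut x (ch x) h5).2 (by simp only [hv, gridVal] at h6 ⊢; linarith)
    omega
  have hnode : gridNode oa ob X Y lo hi g κ = ∑ x ∈ Finset.range nr, gridRow v lo hi nc x := rfl
  refine .seq (.flat rfl fun t1 ht1 => ?_)
  have hs1 := exec_same W (.ivar 75 ((.get 64 (.var 73 + 1) - .get 64 (.var 73) + (.var 90 - 1)) /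
    .var 90) ;; .ivar 74 (.get 63 (.var 73))) s
  have h75 : (Prog.exec W (.ivar 75 ((.get 64 (.var 73 + 1) - .get 64 (.var 73) + (.var 90 - 1)) /
    .var 90) ;; .ivar 74 (.get 63 (.var 73))) s).ints 75 0 = nc := by
    simp (disch := omega) [Prog.exec, h73, h90, hT.hob, Nat.mod_eq_of_lt, hnc, gridLen]
  have h74 : (Prog.exec W (.ivar 75 ((.get 64 (.var 73 + 1) - .get 64 (.var 73) + (.var 90 - 1)) /
    .var 90) ;; .ivar 74 (.get 63 (.var 73))) s).ints 74 0 = oa κ := by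
    simp (disch := omega) [Prog.exec, h73, hT.hoa, Nat.mod_eq_of_lt]
  generalize Prog.exec W _ s = s1 at hs1 h75 h74
  refine .seq ((Ends.loop (fun (c : ℕ × ℕ) s' => s'.ints 74 0 = oa κ + c.1 * g ∧ s'.ints 75 0 = c.2 ∧
    c.1 ≤ nr ∧ c.2 ≤ nc ∧ (∀ x, c.1 ≤ x → x < nr → ch x ≤ c.2) ∧
    s'.ints 12 0 = s.ints 12 0 + (∑ x ∈ Finset.range c.1, gridRow v lo hi nc x).card ∧
    items (s'.reals 10) 0 (s'.ints 12 0) = items (s.reals 10) 0 (s.ints 12 0) +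
      ∑ x ∈ Finset.range c.1, gridRow v lo hi nc x)
    (fun c => 400 * (nr - c.1) + 100 * c.2 +
      100 * ∑ x ∈ Finset.Ico c.1 nr, (gridRow v lo hi nc x).card) (0, nc)
    ⟨by simpa using h74, h75, Nat.zero_le _, le_rfl, fun x _ _ => hch x, ?_, ?_⟩ ?_).mono ?_)
  · simp [hs1.int 12]
  · simp [hs1.int 12, hs1.real 10]
  · rintro ⟨x, q⟩ s' ⟨i1, i2, i3, i4, i5, i6, i7⟩ hb hs
    simp only at i1 i2 i3 i4 i5 i6 i7
    have hT' := (hT.of_same hs1).of_same hs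
    have k73 : s'.ints 73 0 = κ := by rw [hs.int 73, hs1.int 73, h73]
    have k90 : s'.ints 90 0 = g := by rw [hs.int 90, hs1.int 90, h90]
    have k71 : s'.reals 71 0 = lo := by rw [hs.real 71, hs1.real 71, h71]
    have k72 : s'.reals 72 0 = hi := by rw [hs.real 72, hs1.real 72, h72]
    have hx : x < nr := by
      rw [hnr, lt_gridLen hg]
      simp (disch := omega) [i1, hT'.hoa, k73, Nat.mod_eq_of_lt] at hb
      omega
    have hxg' := hxg x hx
    refine .seq ((scanDown_spec (by omega) (ch x) (by rw [i2]; exact i5 x le_rfl hx) ?_).mono ?_)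
    · intro s2 hs2 q1 q2
      have j1 : s2.ints 74 0 = oa κ + x * g := by rw [hs2.int 74, i1]
      have j2 := hT'.of_same hs2
      have j3 : s2.ints 73 0 = κ := by rw [hs2.int 73, k73]
      have j4 : s2.reals 72 0 = hi := by rw [hs2.real 72, k72]
      have j5 : s2.ints 90 0 = g := by rw [hs2.int 90, k90]
      rw [i2] at q2
      have e1 := hcut x (s2.ints 75 0 - 1) (by omega)
      have e2 := hjg (s2.ints 75 0 - 1) (by omega)
      simp (disch := omega) only [holds_rlt, holds_not, rval_get, val_get, val_num, Nat.zero_mod,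
        rval_add, val_add, val_sub, val_mul, j1, j2.hX, j2.hY, j2.hob, j3, j4, j5,
        Nat.mod_eq_of_lt]
      rw [← not_le, not_not]
      change hi ≤ v x (s2.ints 75 0 - 1) ↔ _
      rw [← not_lt, ← e1]
      omega
    rintro s2 t2 hs2 ⟨q1, q2⟩
    have hT2 := hT'.of_same hs2
    have hsub : (∑ y ∈ Finset.range (x + 1), gridRow v lo hi nc y).card ≤
        (gridNode oa ob X Y lo hi g κ).card := by
      rw [hnode, Multiset.card_sum, Multiset.card_sum]
      exact Finset.sum_le_sum_of_subset (Finset.range_subset_range.2 hx)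
    rw [Finset.sum_range_succ, Multiset.card_add] at hsub
    refine .seq ((emitRow_spec (κ := κ) (g := g) (x := x) (ch := ch x) (nb := ob (κ + 1) - ob κ)
      (lo := lo) (hi := hi) (by omega) hT2 ?_ ?_ ?_ hg ?_ q1 (hch x) (by omega)
      (fun j j' h1 h2 h3 => hN.Y_mono κ hκ j j' h1 h2 (by omega)) (hcut x) ?_).mono ?_)
    · rw [hs2.int 73, k73]
    · rw [hs2.int 74, i1]
    · rw [hs2.int 90, k90]
    · rw [hs2.real 71, k71]
    · rw [hs2.int 12, i6]
      change _ + (gridRow v lo hi nc x).card < W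
      omega
    rintro s3 t3 hs3 ⟨r1, r2, r3⟩
    change t3 ≤ 100 * (gridRow v lo hi nc x).card + 100 at r1
    have k74 : s3.ints 74 0 = oa κ + x * g := by rw [hs3.int 74, hs2.int 74, i1]
    have k90 : s3.ints 90 0 = g := by rw [hs3.int 90, hs2.int 90, k90]
    have hs4 := exec_same W (.ivar 74 (.var 74 + .var 90)) s3
    refine .flat rfl fun t4 ht4 => ⟨(x + 1, ch x), ⟨?_, ?_, hx, hch x, ?_, ?_, ?_⟩, ?_⟩
    · simp (disch := omega) [Prog.exec, k74, k90, Nat.mod_eq_of_lt]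
      ring
    · rw [hs4.int 75, hs3.int 75, q1]
    · intro y h1 h2
      exact hanti x y (by simp only at h1; omega) h2
    · simp only
      rw [Finset.sum_range_succ, Multiset.card_add, hs4.int 12, r2, hs2.int 12, i6, add_assoc]
    · simp only
      rw [Finset.sum_range_succ, hs4.int 12, hs4.real 10, r3, hs2.int 12, hs2.real 10, i7, add_assoc]
    · have e1 : (Prog.ivar 74 (.var 74 + .var 90)).time ≤ 20 := by decide
      have e2 : (BExp.not (.rlt (.get 60 (.var 74) + .get 61 (.get 64 (.var 73) +
        (.var 75 - 1) * .var 90)) (.var 72))).cost ≤ 40 := by decide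
      have e3 : (BExp.ilt (.var 74) (.get 63 (.var 73 + 1))).cost ≤ 20 := by decide
      have e4 := i5 x le_rfl hx
      rw [i2] at q2
      have e5 : ((BExp.not (.rlt (.get 60 (.var 74) + .get 61 (.get 64 (.var 73) +
        (.var 75 - 1) * .var 90)) (.var 72))).cost + 20) * (q - ch x) ≤ 60 * (q - ch x) :=
        Nat.mul_le_mul_right _ (by omega)
      simp only
      rw [Finset.sum_eq_sum_Ico_succ_bot hx]
      omega
  rintro s2 t2 hs2 ⟨⟨x, q⟩, ⟨i1, i2, i3, i4, i5, i6, i7⟩, hb, ht⟩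
  simp only at i1 i2 i3 i4 i5 i6 i7 ht
  have hT' := (hT.of_same hs1).of_same hs2
  have k73 : s2.ints 73 0 = κ := by rw [hs2.int 73, hs1.int 73, h73]
  obtain rfl : x = nr := by
    by_contra hne
    have := hxg x (by omega)
    apply hb
    simp (disch := omega) [i1, hT'.hoa, k73, Nat.mod_eq_of_lt]
    omega
  have hs3 := exec_same W (.ivar 73 (.var 73 + 1)) s2
  refine .flat rfl fun t3 ht3 => ⟨?_, ?_, ?_, ?_⟩
  · have e1 : (Prog.ivar 73 (.var 73 + 1)).time ≤ 20 := by decide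
    have e2 : (Prog.ivar 75 ((.get 64 (.var 73 + 1) - .get 64 (.var 73) + (.var 90 - 1)) /
      .var 90) ;; .ivar 74 (.get 63 (.var 73))).time ≤ 40 := by decide
    have e3 : (BExp.ilt (.var 74) (.get 63 (.var 73 + 1))).cost ≤ 20 := by decide
    rw [hnode, Multiset.card_sum]
    rw [Nat.Ico_zero_eq_range] at ht
    omega
  · simp (disch := omega) [Prog.exec, k73, Nat.mod_eq_of_lt]
  · rw [hs3.int 12, i6, hnode]
  · rw [hs3.int 12, hs3.real 10, i7, hnode]

/-- All the candidates strictly between `lo` and `hi` on the grids of width `g`. -/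
noncomputable def gridAll (M : ℕ) (oa ob : ℕ → ℕ) (X Y : ℕ → ℝ) (lo hi : ℝ) (g : ℕ) :
    Multiset ℝ :=
  ∑ κ ∈ Finset.range M, gridNode oa ob X Y lo hi g κ

theorem enumProg_spec {s : Mem} {g : ℕ} {lo hi : ℝ} (hN : Nodes n M oa ob a p b X Y d)
    (hW : 2 * n + M + 10 + g ≤ W) (hoW : oa M + ob M + g < W)
    (hT : Tab n k M oa ob a p b X Y s) (h90 : s.ints 90 0 = g) (hg : 0 < g)
    (h71 : s.reals 71 0 = lo) (h72 : s.reals 72 0 = hi)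
    (hlen : (gridAll M oa ob X Y lo hi g).card < W) :
    Ends W enumProg s fun s' t =>
      t ≤ 400 * (oa M / g) + 100 * (ob M / g) + 100 * (gridAll M oa ob X Y lo hi g).card +
        800 * M + 100 ∧
      s'.ints 12 0 = (gridAll M oa ob X Y lo hi g).card ∧
      items (s'.reals 10) 0 (s'.ints 12 0) = gridAll M oa ob X Y lo hi g := by
  -- Division rounded down is superadditive, so the numbers of grid rows of the nodes are paid by a
  -- potential that telescopes to `oa M / g`; likewise for columns. The roundings up are paid by the
  -- constant per node.
  have hdiv : ∀ u v : ℕ, u ≤ v → (v - u) / g + u / g ≤ v / g := by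
    intro u v h
    refine Nat.div_add_div_le_add_div.trans ?_
    rw [Nat.sub_add_cancel h]
  refine .seq (.flat rfl fun t1 ht1 => ?_)
  have hs1 := exec_same W (.ivar 12 0 ;; .ivar 73 0) s
  have h12 : (Prog.exec W (.ivar 12 0 ;; .ivar 73 0) s).ints 12 0 = 0 := by simp [Prog.exec]
  have h73 : (Prog.exec W (.ivar 12 0 ;; .ivar 73 0) s).ints 73 0 = 0 := by simp [Prog.exec]
  generalize Prog.exec W _ s = s1 at hs1 h12 h73
  refine (Ends.loop (fun κ s' => s'.ints 73 0 = κ ∧ κ ≤ M ∧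
    s'.ints 12 0 = (gridAll κ oa ob X Y lo hi g).card ∧
    items (s'.reals 10) 0 (s'.ints 12 0) = gridAll κ oa ob X Y lo hi g)
    (fun κ => 400 * (oa M / g - oa κ / g) + 100 * (ob M / g - ob κ / g) +
      100 * ((gridAll M oa ob X Y lo hi g).card - (gridAll κ oa ob X Y lo hi g).card) +
      750 * (M - κ)) 0 ⟨h73, Nat.zero_le _, ?_, ?_⟩ ?_).mono ?_
  · simp [gridAll, h12]
  · simp [gridAll, h12, items_self]
  · rintro κ s' ⟨i1, i2, i3, i4⟩ hb hs
    have hT' := (hT.of_same hs1).of_same hs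
    have hκ : κ < M := by simpa [i1, hT'.hM] using hb
    have m1 := hN.oa_mono (κ := κ + 1) (κ' := M) hκ le_rfl
    have m2 := hN.ob_mono (κ := κ + 1) (κ' := M) hκ le_rfl
    have m3 := hN.oa_le κ hκ
    have m4 := hN.ob_le κ hκ
    have hsucc : gridAll (κ + 1) oa ob X Y lo hi g =
        gridAll κ oa ob X Y lo hi g + gridNode oa ob X Y lo hi g κ := by
      rw [gridAll, gridAll, Finset.sum_range_succ]
    have hcard := congrArg Multiset.card hsucc
    rw [Multiset.card_add] at hcard
    have hle : (gridAll (κ + 1) oa ob X Y lo hi g).card ≤ (gridAll M oa ob X Y lo hi g).card := by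
      rw [gridAll, gridAll, Multiset.card_sum, Multiset.card_sum]
      exact Finset.sum_le_sum_of_subset (Finset.range_subset_range.2 hκ)
    refine (enumNode_spec (lo := lo) (hi := hi) hN hW (by omega) hκ hT' i1 ?_ hg ?_ ?_ ?_).mono ?_
    · rw [hs.int 90, hs1.int 90, h90]
    · rw [hs.real 71, hs1.real 71, h71]
    · rw [hs.real 72, hs1.real 72, h72]
    · omega
    rintro s2 t2 hs2 ⟨ht2, j1, j2, j3⟩
    refine ⟨κ + 1, ⟨j1, hκ, ?_, ?_⟩, ?_⟩
    · rw [j2, i3, hcard]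
    · rw [j3, i4, hsucc]
    · have e1 : (BExp.ilt (.var 73) (.var 65)).cost + 1 ≤ 20 := by decide
      have d1 := hdiv _ _ m3
      have d2 := hdiv _ _ m4
      have d3 := Nat.div_le_div_right (c := g) m1
      have d4 := Nat.div_le_div_right (c := g) m2
      omega
  rintro s2 t2 hs2 ⟨κ, ⟨i1, i2, i3, i4⟩, hb, ht⟩
  have hT' := (hT.of_same hs1).of_same hs2
  obtain rfl : κ = M := by
    simp [i1, hT'.hM] at hb
    omega
  have e1 : (BExp.ilt (.var 73) (.var 65)).cost + 1 ≤ 20 := by decide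
  have e2 : (Prog.ivar 12 0 ;; .ivar 73 0).time ≤ 20 := by decide
  refine ⟨?_, i3, i4⟩
  have d1 : (gridAll 0 oa ob X Y lo hi g).card = 0 := by simp [gridAll]
  rw [d1, hN.oa_zero, hN.ob_zero, Nat.zero_div] at ht
  omega

end Enum

end PartialCenter

set_option linter.unusedSimpArgs false

namespace PartialCenter

/-! ## Refining a grid -/

section Grid
variable {v : ℕ → ℕ → ℝ} {lo hi : ℝ}

/-- The positions of a grid whose entries lie strictly between `lo` and `hi`. -/
noncomputable def gridPos (v : ℕ → ℕ → ℝ) (lo hi : ℝ) (nr nc : ℕ) : Finset (ℕ × ℕ) :=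
  (Finset.range nr ×ˢ Finset.range nc).filter fun c => lo < v c.1 c.2 ∧ v c.1 c.2 < hi

theorem mem_gridPos {nr nc : ℕ} {c : ℕ × ℕ} :
    c ∈ gridPos v lo hi nr nc ↔ (c.1 < nr ∧ c.2 < nc) ∧ lo < v c.1 c.2 ∧ v c.1 c.2 < hi := by
  simp [gridPos]

/-- Halving the width of a monotone grid: the new positions strictly between `lo` and `hi` lie in
cells whose corner is such a position of the old grid, or in one cell for each diagonal. -/
theorem card_gridPos_le {nr nc nr2 nc2 : ℕ}
    (hv : ∀ x x' j j', x ≤ x' → j ≤ j' → x' < nr → j' < nc → v x j ≤ v x' j')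
    (hr : ∀ x, x < nr2 ↔ 2 * x < nr) (hc : ∀ x, x < nc2 ↔ 2 * x < nc) :
    (gridPos v lo hi nr nc).card ≤
      4 * ((gridPos (fun r c => v (2 * r) (2 * c)) lo hi nr2 nc2).card + (nr2 + nc2 - 1)) := by
  classical
  set S := gridPos v lo hi nr nc with hS
  let f : ℕ × ℕ → ℕ × ℕ := fun c => (c.1 / 2, c.2 / 2)
  -- A cell of the coarse grid consists of at most four positions of the fine grid.
  have h4 : S.card ≤ 4 * (S.image f).card := by
    refine Finset.card_le_mul_card_image S 4 fun c _ => ?_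
    have hsub : (S.filter fun x => f x = c) ⊆
        Finset.Ico (2 * c.1) (2 * c.1 + 2) ×ˢ Finset.Ico (2 * c.2) (2 * c.2 + 2) := by
      intro x hx
      have hx := (Finset.mem_filter.1 hx).2
      rw [← hx]
      simp only [f, Finset.mem_product, Finset.mem_Ico]
      omega
    refine (Finset.card_le_card hsub).trans ?_
    rw [Finset.card_product]
    simp
  refine h4.trans (Nat.mul_le_mul_left 4 ?_)
  -- The corner is the smallest entry of its cell. If it exceeds `lo`, it is itself inside the
  -- bracket; the other cells are counted by diagonals.
  rw [← Finset.card_filter_add_card_filter_not (s := S.image f) (fun c => lo < v (2 * c.1) (2 * c.2))]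
  have key : ∀ c ∈ S.image f, ∃ x ∈ S, f x = c ∧ c.1 < nr2 ∧ c.2 < nc2 := by
    intro c hc'
    obtain ⟨x, hx, rfl⟩ := Finset.mem_image.1 hc'
    have := (mem_gridPos.1 hx).1
    refine ⟨x, hx, rfl, ?_, ?_⟩
    · rw [hr]; simp only [f]; omega
    · rw [hc]; simp only [f]; omega
  refine Nat.add_le_add (Finset.card_le_card ?_) ?_
  · intro c hc'
    obtain ⟨h1, h2⟩ := Finset.mem_filter.1 hc'
    obtain ⟨x, hx, rfl, h3, h4⟩ := key c h1
    have hx := mem_gridPos.1 hx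
    refine mem_gridPos.2 ⟨⟨h3, h4⟩, h2, lt_of_le_of_lt (hv _ _ _ _ ?_ ?_ hx.1.1 hx.1.2) hx.2.2⟩
    · simp only [f]; omega
    · simp only [f]; omega
  · rw [← Finset.card_range (nr2 + nc2 - 1)]
    -- This number is constant exactly on the diagonals, and there are `nr2 + nc2 - 1` of them.
    refine Finset.card_le_card_of_injOn (fun c => c.1 + (nc2 - 1 - c.2)) ?_ ?_
    · intro c hc'
      obtain ⟨x, -, -, h3, h4⟩ := key c (Finset.mem_filter.1 hc').1
      simp only [Finset.coe_range, Set.mem_Iio]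
      omega
    -- Of two cells on a diagonal, the corner of the later one dominates all entries of the earlier
    -- one, and one of these exceeds `lo`. So a second such cell would have its corner above `lo`.
    · have aux : ∀ c c' : ℕ × ℕ, c ∈ S.image f → c' ∈ S.image f →
          ¬ lo < v (2 * c'.1) (2 * c'.2) →
          c.1 + (nc2 - 1 - c.2) = c'.1 + (nc2 - 1 - c'.2) → ¬ c.1 < c'.1 := by
        intro c c' h1 h2 h3 h4 h5
        obtain ⟨x, hx, rfl, e3, e4⟩ := key c h1
        obtain ⟨x', hx', rfl, e5, e6⟩ := key c' h2
        have hx := mem_gridPos.1 hx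
        have hx' := mem_gridPos.1 hx'
        refine h3 (lt_of_lt_of_le hx.2.1 (hv _ _ _ _ ?_ ?_ ?_ ?_))
        all_goals simp only [f] at *
        all_goals omega
      intro c hc1 c' hc2 he
      obtain ⟨a1, a2⟩ := Finset.mem_filter.1 hc1
      obtain ⟨b1, b2⟩ := Finset.mem_filter.1 hc2
      obtain ⟨x, -, -, h3, h4⟩ := key c a1
      obtain ⟨x', -, -, h5, h6⟩ := key c' b1
      simp only at he
      have n1 := aux c c' a1 b1 b2 he
      have n2 := aux c' c b1 a1 a2 he.symm
      refine Prod.ext (by omega) (by omega)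

end Grid

/-! ### The grids of all nodes together. -/

section GridAll
variable {n M : ℕ} {oa ob a p b : ℕ → ℕ} {X Y : ℕ → ℝ} {d : ℕ → ℕ → ℝ} {lo hi : ℝ}

theorem card_gridNode (g κ : ℕ) : (gridNode oa ob X Y lo hi g κ).card =
    (gridPos (gridVal oa ob X Y g κ) lo hi (gridLen (oa (κ + 1) - oa κ) g)
      (gridLen (ob (κ + 1) - ob κ) g)).card := by
  rw [gridPos, Finset.card_filter, Finset.sum_product, gridNode, Multiset.card_sum]
  refine Finset.sum_congr rfl fun x _ => ?_
  rw [gridRow, Multiset.card_sum]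
  refine Finset.sum_congr rfl fun y _ => ?_
  split_ifs <;> simp

theorem card_gridNode_le (hN : Nodes n M oa ob a p b X Y d) {g κ : ℕ} (hg : 0 < g) (hκ : κ < M) :
    (gridNode oa ob X Y lo hi g κ).card ≤ 4 * ((gridNode oa ob X Y lo hi (2 * g) κ).card +
      ((oa (κ + 1) - oa κ) / (2 * g) + (ob (κ + 1) - ob κ) / (2 * g) + 1)) := by
  rw [card_gridNode, card_gridNode]
  have l5 := gridLen_le (m := oa (κ + 1) - oa κ) (g := 2 * g)
  have l6 := gridLen_le (m := ob (κ + 1) - ob κ) (g := 2 * g)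
  have hl : ∀ m x, x < gridLen m (2 * g) ↔ 2 * x < gridLen m g := fun m x => by
    rw [lt_gridLen (by omega), lt_gridLen hg, show x * (2 * g) = 2 * x * g by ring]
  have h1 := hN.oa_le κ hκ
  have h2 := hN.ob_le κ hκ
  refine (card_gridPos_le (nr2 := gridLen (oa (κ + 1) - oa κ) (2 * g))
    (nc2 := gridLen (ob (κ + 1) - ob κ) (2 * g)) ?_ (hl _) (hl _)).trans ?_
  · intro x x' j j' e1 e2 e3 e4
    rw [lt_gridLen hg] at e3 e4
    have e5 := Nat.mul_le_mul_right g e1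
    have e6 := Nat.mul_le_mul_right g e2
    have e7 := hN.X_mono κ hκ (oa κ + x * g) (oa κ + x' * g) (by omega) (by omega) (by omega)
    have e8 := hN.Y_mono κ hκ (ob κ + j * g) (ob κ + j' * g) (by omega) (by omega) (by omega)
    simp only [gridVal]
    linarith
  · have e : (fun r c => gridVal oa ob X Y g κ (2 * r) (2 * c)) = gridVal oa ob X Y (2 * g) κ := by
      funext r c
      simp only [gridVal]
      rw [show 2 * r * g = r * (2 * g) by ring, show 2 * c * g = c * (2 * g) by ring]
    rw [e]
    generalize (oa (κ + 1) - oa κ) / (2 * g) = u at *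
    generalize (ob (κ + 1) - ob κ) / (2 * g) = w at *
    omega

theorem sum_div_le {f : ℕ → ℕ} {g : ℕ} (hf : ∀ κ < M, f κ ≤ f (κ + 1)) :
    ∑ κ ∈ Finset.range M, (f (κ + 1) - f κ) / g ≤ f M / g := by
  induction M with
  | zero => simp
  | succ M ih =>
    rw [Finset.sum_range_succ]
    have h1 := ih fun κ hκ => hf κ (by omega)
    have h2 : (f (M + 1) - f M) / g + f M / g ≤ f (M + 1) / g := by
      refine Nat.div_add_div_le_add_div.trans ?_
      rw [Nat.sub_add_cancel (hf M (by omega))]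
    omega

/-- The diagonals of all the nodes sum up to the total length over `2 * g`, with one more per node
for rounding. -/
theorem card_gridAll_le (hN : Nodes n M oa ob a p b X Y d) {g : ℕ} (hg : 0 < g) :
    (gridAll M oa ob X Y lo hi g).card ≤ 4 * ((gridAll M oa ob X Y lo hi (2 * g)).card +
      ((oa M + ob M) / (2 * g) + M)) := by
  rw [gridAll, gridAll, Multiset.card_sum, Multiset.card_sum]
  refine (Finset.sum_le_sum fun κ hκ => card_gridNode_le hN hg (Finset.mem_range.1 hκ)).trans ?_
  rw [← Finset.mul_sum, Finset.sum_add_distrib, Finset.sum_add_distrib, Finset.sum_add_distrib]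
  have h1 := sum_div_le (g := 2 * g) hN.oa_le
  have h2 := sum_div_le (g := 2 * g) hN.ob_le
  have h3 : oa M / (2 * g) + ob M / (2 * g) ≤ (oa M + ob M) / (2 * g) :=
    Nat.div_add_div_le_add_div
  simp only [Finset.sum_const, Finset.card_range, smul_eq_mul, mul_one]
  omega

/-- At such a width a node has at most one grid row and one grid column. This is the start of the
refinement. -/
theorem card_gridAll_wide (hN : Nodes n M oa ob a p b X Y d) {g : ℕ} (hg : n ≤ g) :
    (gridAll M oa ob X Y lo hi g).card ≤ M := by
  have hl : ∀ m ≤ n, gridLen m g ≤ 1 := by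
    intro m hm
    rw [gridLen]
    rcases Nat.eq_zero_or_pos g with rfl | h0
    · simp
    · exact Nat.le_of_lt_succ ((Nat.div_lt_iff_lt_mul h0).2 (by omega))
  rw [gridAll, Multiset.card_sum]
  refine (Finset.sum_le_card_nsmul _ _ 1 fun κ hκ => ?_).trans (by simp)
  have h1 := hN.oa_len κ (Finset.mem_range.1 hκ)
  have h2 := hN.ob_len κ (Finset.mem_range.1 hκ)
  rw [card_gridNode]
  refine (Finset.card_filter_le _ _).trans ?_
  rw [Finset.card_product, Finset.card_range, Finset.card_range]
  have h3 := hl (oa (κ + 1) - oa κ) (by omega)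
  have h4 := hl (ob (κ + 1) - ob κ) (by omega)
  nlinarith

theorem sum_map_sum {ι α : Type*} (f : α → ℕ) (s : Finset ι) (m : ι → Multiset α) :
    ((∑ i ∈ s, m i).map f).sum = ∑ i ∈ s, ((m i).map f).sum := by
  classical
  induction s using Finset.induction_on with
  | empty => simp
  | insert a s ha ih => rw [Finset.sum_insert ha, Finset.sum_insert ha, ← ih]; simp

/-- The candidates between narrower bounds, counted among those between wider bounds. -/
theorem card_gridAll_shrink {lo' hi' : ℝ} (h1 : lo ≤ lo') (h2 : hi' ≤ hi) (g : ℕ) :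
    (gridAll M oa ob X Y lo' hi' g).card =
      ((gridAll M oa ob X Y lo hi g).map fun x => if lo' < x ∧ x < hi' then 1 else 0).sum := by
  rw [gridAll, gridAll, sum_map_sum, Multiset.card_sum]
  refine Finset.sum_congr rfl fun κ _ => ?_
  rw [gridNode, gridNode, sum_map_sum, Multiset.card_sum]
  refine Finset.sum_congr rfl fun x _ => ?_
  rw [gridRow, gridRow, sum_map_sum, Multiset.card_sum]
  refine Finset.sum_congr rfl fun j _ => ?_
  set y := gridVal oa ob X Y g κ x j
  by_cases h : lo' < y ∧ y < hi'
  · rw [if_pos h, if_pos ⟨by linarith, by linarith⟩]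
    simp [h]
  · rw [if_neg h]
    split_ifs
    · simp only [Multiset.map_singleton, Multiset.sum_singleton, if_neg h, Multiset.card_zero]
    · simp

theorem of_mem_gridAll {x : ℝ} {g : ℕ} (h : x ∈ gridAll M oa ob X Y lo hi g) :
    lo < x ∧ x < hi := by
  rw [gridAll, Multiset.mem_sum] at h
  obtain ⟨κ, -, h⟩ := h
  rw [gridNode, Multiset.mem_sum] at h
  obtain ⟨y, -, h⟩ := h
  rw [gridRow, Multiset.mem_sum] at h
  obtain ⟨j, -, h⟩ := h
  split_ifs at h with h'
  · rw [Multiset.mem_singleton.1 h]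
    exact h'
  · simp at h

/-- At width 1 the grid is the whole matrix, so an empty list at the end of the search rules out
every remaining distance. -/
theorem mem_gridAll {κ i j : ℕ} (hκ : κ < M) (hi1 : oa κ ≤ i) (hi2 : i < oa (κ + 1))
    (hj1 : ob κ ≤ j) (hj2 : j < ob (κ + 1)) (h1 : lo < X i + Y j) (h2 : X i + Y j < hi) :
    X i + Y j ∈ gridAll M oa ob X Y lo hi 1 := by
  have e : gridVal oa ob X Y 1 κ (i - oa κ) (j - ob κ) = X i + Y j := by
    rw [gridVal, mul_one, mul_one, Nat.add_sub_cancel' hi1, Nat.add_sub_cancel' hj1]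
  rw [gridAll, Multiset.mem_sum]
  refine ⟨κ, Finset.mem_range.2 hκ, ?_⟩
  rw [gridNode, Multiset.mem_sum]
  refine ⟨i - oa κ, Finset.mem_range.2 ?_, ?_⟩
  · rw [lt_gridLen one_pos]; omega
  rw [gridRow, Multiset.mem_sum]
  refine ⟨j - ob κ, Finset.mem_range.2 ?_, ?_⟩
  · rw [lt_gridLen one_pos]; omega
  rw [e, if_pos ⟨h1, h2⟩, Multiset.mem_singleton]

end GridAll

end PartialCenter

set_option linter.unusedSimpArgs false

namespace PartialCenter

/-! ## The search for the optimal diameter -/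

/-- No feasible diameter lies strictly below `hi`, except those above `lo`; and `hi` is feasible. -/
structure Bracket (n k : ℕ) (par : ℕ → ℕ) (dep : ℕ → ℝ) (lo hi : ℝ) : Prop where
  lo_nonneg : 0 ≤ lo
  hi_nonneg : 0 ≤ hi
  feas : ∃ u, Feas n k par dep hi u
  low : ∀ D u, 0 ≤ D → Feas n k par dep D u → hi ≤ D ∨ lo < D

theorem Feas.mono {n k : ℕ} {par : ℕ → ℕ} {dep : ℕ → ℝ} {D D' : ℝ} {u : ℕ} (h : D ≤ D')
    (hF : Feas n k par dep D u) : Feas n k par dep D' u :=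
  ⟨hF.1, hF.2.trans (Finset.card_le_card fun v hv => by
    rw [Finset.mem_filter] at hv ⊢
    exact ⟨hv.1, hv.2.trans h⟩)⟩

/-- Tries the middle one of the keys between the positions `91` and `92`. -/
def probeProg : Prog :=
  (.ivar 94 ((.var 91 + .var 92) / 2) ;; .rvar 70 (.get 10 (.var 94))) ;;
  decideProg ;;
  .ite (.ieq (.var 80) 1) (.rvar 72 (.var 70) ;; .ivar 92 (.var 94))
    (.rvar 71 (.var 70) ;; .ivar 91 (.var 94 + 1)) ;;
  .ivar 93 (.var 93 + 1)

/-- Binary search among the sorted keys: at most three rounds if the grid has a width above one. -/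
def halveProg : Prog :=
  (.ivar 91 0 ;; .ivar 92 (.var 12) ;; .ivar 93 0) ;;
  .loop (.and (.ilt (.var 91) (.var 92)) (.not (.and (.ilt 1 (.var 90)) (.ilt 2 (.var 93)))))
    probeProg

/-- One width of the search. -/
def levelProg : Prog :=
  enumProg ;; sortProg ;; halveProg ;; .ivar 90 (.var 90 / 2)

/-- Computes the optimal diameter in the real scalar `72`. -/
def searchProg : Prog :=
  (.rvar 71 .zero ;;
    .ite (.ilt (.var 1) 2) (.rvar 72 .zero)
      (.rvar 72 (.get 30 (.var 0 - 1) + .get 30 (.var 0 - 1))) ;;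
    .ivar 90 1) ;;
  .loop (.ilt (.var 90) (.var 0)) (.ivar 90 (.var 90 + .var 90)) ;;
  .loop (.ilt 0 (.var 90)) levelProg

section Search
variable {W n k M : ℕ} {oa ob a p b : ℕ → ℕ} {X Y : ℕ → ℝ} {par : ℕ → ℕ} {dep : ℕ → ℝ}

/-- A feasible middle key becomes the upper end of the bracket and an infeasible one the lower end;
the range of open keys is at least halved, and keys outside of it are settled by the new bracket. -/
theorem probeProg_spec {s : Mem} {K : ℕ → ℝ} {lo hi : ℝ} {l h r z : ℕ}
    (hN : Nodes n M oa ob a p b X Y (rd par dep))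
    (hcov : ∀ u v, v < u → u < n → ∑ κ ∈ Finset.range M, pairHits oa ob a b κ u v = 1)
    (hW : 4 * n + M + 10 ≤ W) (hoW : oa M + ob M < W) (hT : Tab n k M oa ob a p b X Y s)
    (hz : 2 * z + 2 < W) (hr : r + 1 < W) (hK : s.reals 10 = K)
    (hsort : ∀ x y, x ≤ y → y < z → K x ≤ K y) (hpos : ∀ x < z, 0 ≤ K x)
    (hB : Bracket n k par dep lo hi) (h91 : s.ints 91 0 = l) (h92 : s.ints 92 0 = h)
    (h93 : s.ints 93 0 = r) (h71 : s.reals 71 0 = lo) (h72 : s.reals 72 0 = hi)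
    (hlh : l < h) (hhz : h ≤ z) (hin : ∀ x, l ≤ x → x < h → lo ≤ K x ∧ K x ≤ hi) :
    Ends W probeProg s fun s' t =>
      t ≤ 200 * oa M + 250 * ob M + 400 * M + 200 * n + 300 ∧
      ∃ l' h' lo' hi', Bracket n k par dep lo' hi' ∧ s'.ints 91 0 = l' ∧ s'.ints 92 0 = h' ∧
        s'.ints 93 0 = r + 1 ∧ s'.reals 71 0 = lo' ∧ s'.reals 72 0 = hi' ∧
        l ≤ l' ∧ l' ≤ h' ∧ h' ≤ h ∧ 2 * (h' - l') ≤ h - l ∧ lo ≤ lo' ∧ hi' ≤ hi ∧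
        (∀ x, l ≤ x → x < l' → K x ≤ lo') ∧ (∀ x, h' ≤ x → x < h → hi' ≤ K x) ∧
        (∀ x, l' ≤ x → x < h' → lo' ≤ K x ∧ K x ≤ hi') := by
  refine .seq (.flat rfl fun t1 ht1 => ?_)
  have hs1 := exec_same W (.ivar 94 ((.var 91 + .var 92) / 2) ;; .rvar 70 (.get 10 (.var 94))) s
  have h94 : (Prog.exec W (.ivar 94 ((.var 91 + .var 92) / 2) ;;
      .rvar 70 (.get 10 (.var 94))) s).ints 94 0 = (l + h) / 2 := by
    simp (disch := omega) [Prog.exec, h91, h92, Nat.mod_eq_of_lt]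
  have h70 : (Prog.exec W (.ivar 94 ((.var 91 + .var 92) / 2) ;;
      .rvar 70 (.get 10 (.var 94))) s).reals 70 0 = K ((l + h) / 2) := by
    simp (disch := omega) [Prog.exec, h91, h92, hK, Nat.mod_eq_of_lt]
  have e1 : Prog.time (.ivar 94 ((.var 91 + .var 92) / 2) ;; .rvar 70 (.get 10 (.var 94))) ≤ 30 := by
    decide
  generalize Prog.exec W _ s = s1 at hs1 h94 h70
  set m := (l + h) / 2 with hm
  have hml : l ≤ m := by omega
  have hmh : m < h := by omega
  obtain ⟨hm1, hm2⟩ := hin m hml hmh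
  have hm0 := hpos m (by omega)
  refine .seq ((decideProg_spec hN hcov hW hoW (hT.of_same hs1) h70 hm0).mono ?_)
  rintro s2 t2 hs2 ⟨ht2, hyes, hno⟩
  have k94 : s2.ints 94 0 = m := by rw [hs2.int 94, h94]
  have k91 : s2.ints 91 0 = l := by rw [hs2.int 91, hs1.int 91, h91]
  have k92 : s2.ints 92 0 = h := by rw [hs2.int 92, hs1.int 92, h92]
  have k93 : s2.ints 93 0 = r := by rw [hs2.int 93, hs1.int 93, h93]
  have k70 : s2.reals 70 0 = K m := by rw [hs2.real 70, h70]
  have k71 : s2.reals 71 0 = lo := by rw [hs2.real 71, hs1.real 71, h71]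
  have k72 : s2.reals 72 0 = hi := by rw [hs2.real 72, hs1.real 72, h72]
  have e2 : Prog.time (.ite (.ieq (.var 80) 1) (.rvar 72 (.var 70) ;; .ivar 92 (.var 94))
    (.rvar 71 (.var 70) ;; .ivar 91 (.var 94 + 1)) ;; .ivar 93 (.var 93 + 1)) ≤ 70 := by decide
  refine .flat rfl fun t3 ht3 => ⟨by omega, ?_⟩
  have h1W : 1 % W = 1 := Nat.mod_eq_of_lt (by omega)
  by_cases hc : s2.ints 80 0 = 1
  · have hc' : BExp.Holds W s2 (.ieq (.var 80) 1) := by simp [hc, h1W]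
    simp only [Prog.exec, if_pos hc']
    refine ⟨l, m, lo, K m, ⟨hB.lo_nonneg, hm0, ⟨_, hyes hc⟩, fun D u hD hF => ?_⟩, ?_, ?_, ?_, ?_, ?_,
      le_rfl, hml, hmh.le, by omega, le_rfl, hm2, fun x h1 h2 => by omega,
      fun x h1 h2 => hsort m x h1 (by omega), fun x h1 h2 => ⟨(hin x h1 (by omega)).1,
        hsort x m (by omega) (by omega)⟩⟩
    · rcases hB.low D u hD hF with h1 | h1
      · exact .inl (hm2.trans h1)
      · exact .inr h1
    · simp [k91]
    · simp [k94]
    · simp (disch := omega) [k93, Nat.mod_eq_of_lt]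
    · simp [k71]
    · simp [k70]
  · have hc' : ¬ BExp.Holds W s2 (.ieq (.var 80) 1) := by simp [hc, h1W]
    simp only [Prog.exec, if_neg hc']
    refine ⟨m + 1, h, K m, hi, ⟨hm0, hB.hi_nonneg, hB.feas, fun D u hD hF => ?_⟩,
      ?_, ?_, ?_, ?_, ?_,
      by omega, by omega, le_rfl, by omega, hm1, le_rfl,
      fun x h1 h2 => hsort x m (by omega) (by omega), fun x h1 h2 => by omega,
      fun x h1 h2 => ⟨hsort m x (by omega) (by omega), (hin x (by omega) h2).2⟩⟩
    -- Feasibility is monotone: a feasible number that does not exceed the key would make the key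
    -- feasible.
    · right
      by_contra hle
      exact hno hc u (hF.mono (not_lt.1 hle))
    · simp (disch := omega) [k94, Nat.mod_eq_of_lt]
    · simp [k92]
    · simp (disch := omega) [k93, Nat.mod_eq_of_lt]
    · simp [k70]
    · simp [k72]

/-- Three halvings leave at most one eighth of the keys open. At width 1 the search continues until
none is open, which takes at most `L + 1` probes. -/
theorem halveProg_spec {s : Mem} {K : ℕ → ℝ} {lo hi : ℝ} {g z L : ℕ}
    (hN : Nodes n M oa ob a p b X Y (rd par dep))
    (hcov : ∀ u v, v < u → u < n → ∑ κ ∈ Finset.range M, pairHits oa ob a b κ u v = 1)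
    (hW : 4 * n + M + 10 ≤ W) (hoW : oa M + ob M < W) (hT : Tab n k M oa ob a p b X Y s)
    (hz : 2 * z + 2 < W) (hL : z ≤ 2 ^ L) (hLW : L + 10 ≤ W) (hK : s.reals 10 = K)
    (hsort : ∀ x y, x ≤ y → y < z → K x ≤ K y) (h12 : s.ints 12 0 = z)
    (hitems : items K 0 z = gridAll M oa ob X Y lo hi g)
    (hB : Bracket n k par dep lo hi) (h90 : s.ints 90 0 = g)
    (h71 : s.reals 71 0 = lo) (h72 : s.reals 72 0 = hi) :
    Ends W halveProg s fun s' t =>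
      t ≤ (if 1 < g then 3 else L + 1) *
        (200 * oa M + 250 * ob M + 400 * M + 200 * n + 350) + 100 ∧
      ∃ lo' hi', Bracket n k par dep lo' hi' ∧ s'.reals 71 0 = lo' ∧ s'.reals 72 0 = hi' ∧
        if 1 < g then 8 * (gridAll M oa ob X Y lo' hi' g).card ≤ z
        else (gridAll M oa ob X Y lo' hi' g).card = 0 := by
  have hin0 : ∀ x < z, lo < K x ∧ K x < hi := fun x hx =>
    of_mem_gridAll (by rw [← hitems]; exact mem_items.2 ⟨x, Nat.zero_le _, hx, rfl⟩)
  refine .seq (.flat rfl fun t1 ht1 => ?_)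
  have e1 : Prog.time (.ivar 91 0 ;; .ivar 92 (.var 12) ;; .ivar 93 0) ≤ 20 := by decide
  have hs1 := exec_same W (.ivar 91 0 ;; .ivar 92 (.var 12) ;; .ivar 93 0) s
  have h91 : (Prog.exec W (.ivar 91 0 ;; .ivar 92 (.var 12) ;; .ivar 93 0) s).ints 91 0 = 0 := by
    simp [Prog.exec]
  have h92 : (Prog.exec W (.ivar 91 0 ;; .ivar 92 (.var 12) ;; .ivar 93 0) s).ints 92 0 = z := by
    simp [Prog.exec, h12]
  have h93 : (Prog.exec W (.ivar 91 0 ;; .ivar 92 (.var 12) ;; .ivar 93 0) s).ints 93 0 = 0 := by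
    simp [Prog.exec]
  generalize Prog.exec W _ s = s1 at hs1 h91 h92 h93
  set R := if 1 < g then 3 else L + 1 with hR
  set Dc := 200 * oa M + 250 * ob M + 400 * M + 200 * n + 350 with hDc
  have e2 : (BExp.and (.ilt (.var 91) (.var 92))
    (.not (.and (.ilt 1 (.var 90)) (.ilt 2 (.var 93))))).cost ≤ 30 := by decide
  have hguard : ∀ (s' : Mem) l h r, s'.ints 91 0 = l → s'.ints 92 0 = h → s'.ints 93 0 = r →
      s'.ints 90 0 = g → (BExp.Holds W s' (.and (.ilt (.var 91) (.var 92))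
        (.not (.and (.ilt 1 (.var 90)) (.ilt 2 (.var 93))))) ↔ l < h ∧ ¬ (1 < g ∧ 2 < r)) := by
    intro s' l h r a1 a2 a3 a4
    simp (disch := omega) [a1, a2, a3, a4, Nat.mod_eq_of_lt]
  refine (Ends.loop (fun (c : (ℕ × ℕ × ℕ) × ℝ × ℝ) s' => Bracket n k par dep c.2.1 c.2.2 ∧
    s'.ints 91 0 = c.1.1 ∧ s'.ints 92 0 = c.1.2.1 ∧ s'.ints 93 0 = c.1.2.2 ∧
    s'.reals 71 0 = c.2.1 ∧ s'.reals 72 0 = c.2.2 ∧ c.1.1 ≤ c.1.2.1 ∧ c.1.2.1 ≤ z ∧ c.1.2.2 ≤ R ∧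
    (c.1.2.1 - c.1.1) * 2 ^ c.1.2.2 ≤ z ∧ lo ≤ c.2.1 ∧ c.2.2 ≤ hi ∧
    (∀ x < c.1.1, K x ≤ c.2.1) ∧ (∀ x, c.1.2.1 ≤ x → x < z → c.2.2 ≤ K x) ∧
    (∀ x, c.1.1 ≤ x → x < c.1.2.1 → c.2.1 ≤ K x ∧ K x ≤ c.2.2))
    (fun c => (R - c.1.2.2) * Dc) ((0, z, 0), lo, hi)
    ⟨hB, h91, h92, h93, by rw [hs1.real 71, h71], by rw [hs1.real 72, h72], Nat.zero_le _, le_rfl,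
      Nat.zero_le _, by simp, le_rfl, le_rfl, by simp, fun x h1 h2 => by simp only at h1; omega,
      fun x _ hx => ⟨(hin0 x hx).1.le, (hin0 x hx).2.le⟩⟩ ?_).mono ?_
  · rintro ⟨⟨l, h, r⟩, lo1, hi1⟩ s' ⟨j1, j2, j3, j4, j5, j6, j7, j8, j9, j10, j11, j12, j13, j14, j15⟩
      hb hs
    simp only at j1 j2 j3 j4 j5 j6 j7 j8 j9 j10 j11 j12 j13 j14 j15
    rw [hguard s' l h r j2 j3 j4 (by rw [hs.int 90, hs1.int 90, h90])] at hb
    -- At width 1 a nonempty range after `r` rounds forces `2 ^ r ≤ z ≤ 2 ^ L`, which bounds the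
    -- number of rounds.
    have hrR : r < R := by
      rw [hR]
      split_ifs with hg
      · omega
      · have h1 : 2 ^ r ≤ 2 ^ L := by
          have : 1 * 2 ^ r ≤ (h - l) * 2 ^ r := Nat.mul_le_mul_right _ (by omega)
          omega
        have := (Nat.pow_le_pow_iff_right (by norm_num : 1 < 2)).1 h1
        omega
    have hRL : R ≤ L + 3 := by
      rw [hR]
      split_ifs <;> omega
    refine (probeProg_spec (z := z) hN hcov hW hoW ((hT.of_same hs1).of_same hs) hz (by omega)
      (by rw [hs.real 10, hs1.real 10, hK]) hsort
      (fun x hx => hB.lo_nonneg.trans (hin0 x hx).1.le) j1 j2 j3 j4 j5 j6 hb.1 j8 j15).mono ?_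
    rintro s2 t2 hs2 ⟨ht2, l', h', lo', hi', q1, q2, q3, q4, q5, q6, q7, q8, q9, q10, q11, q12, q13,
      q14, q15⟩
    refine ⟨((l', h', r + 1), lo', hi'), ⟨q1, q2, q3, q4, q5, q6, q8, q9.trans j8, hrR, ?_,
      j11.trans q11, q12.trans j12, ?_, ?_, q15⟩, ?_⟩
    · calc (h' - l') * 2 ^ (r + 1) = 2 * (h' - l') * 2 ^ r := by ring
        _ ≤ (h - l) * 2 ^ r := Nat.mul_le_mul_right _ q10
        _ ≤ z := j10
    · intro x hx
      by_cases hxl : x < l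
      · exact (j13 x hxl).trans q11
      · exact q13 x (by omega) hx
    · intro x h1 h2
      by_cases hxl : x < h
      · exact q14 x h1 hxl
      · exact q12.trans (j14 x (by omega) h2)
    · simp only
      obtain ⟨e, he⟩ := Nat.exists_eq_add_of_lt hrR
      rw [he, show r + e + 1 - r = e + 1 by omega, show r + e + 1 - (r + 1) = e by omega,
        Nat.succ_mul]
      omega
  · rintro s2 t2 hs2 ⟨⟨⟨l, h, r⟩, lo1, hi1⟩, ⟨j1, j2, j3, j4, j5, j6, j7, j8, j9, j10, j11, j12, j13, j14,
      j15⟩, hb, ht⟩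
    simp only at j1 j2 j3 j4 j5 j6 j7 j8 j9 j10 j11 j12 j13 j14 j15 ht
    rw [hguard s2 l h r j2 j3 j4 (by rw [hs2.int 90, hs1.int 90, h90])] at hb
    -- Keys before `l` are at most the new lower end and keys from `h` on at least the new upper
    -- end; so only the positions between can hold keys strictly inside the bracket.
    have hcard : (gridAll M oa ob X Y lo1 hi1 g).card ≤ h - l := by
      rw [card_gridAll_shrink j11 j12, ← hitems, sum_items, ← Finset.card_filter, ← Nat.card_Ico]
      refine Finset.card_le_card fun x hx => ?_
      rw [Finset.mem_filter, Finset.mem_Ico] at hx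
      rw [Finset.mem_Ico]
      constructor
      · by_contra hlt
        have := j13 x (by omega)
        linarith [hx.2.1]
      · by_contra hlt
        have := j14 x (by omega) hx.1.2
        linarith [hx.2.2]
    refine ⟨?_, lo1, hi1, j1, j5, j6, ?_⟩
    · rw [Nat.sub_zero] at ht
      omega
    · split_ifs with hg
      · by_cases hlh : l < h
        · have h3 : 2 < r := by by_contra h; exact hb ⟨hlh, fun h' => h h'.2⟩
          have : (h - l) * 2 ^ 3 ≤ (h - l) * 2 ^ r :=
            Nat.mul_le_mul_left _ (Nat.pow_le_pow_right (by norm_num) h3)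
          omega
        · omega
      · have : ¬ l < h := fun h => hb ⟨h, fun h' => hg h'.1⟩
        omega

theorem levelProg_spec {s : Mem} {lo hi : ℝ} {g z L : ℕ}
    (hN : Nodes n M oa ob a p b X Y (rd par dep))
    (hcov : ∀ u v, v < u → u < n → ∑ κ ∈ Finset.range M, pairHits oa ob a b κ u v = 1)
    (hW : 4 * n + M + 10 ≤ W) (hoW : oa M + ob M + g < W) (hgW : g ≤ 2 * n)
    (hT : Tab n k M oa ob a p b X Y s)
    (hz : 4 * z + 4 < W) (hL : z ≤ 2 ^ L) (hLW : L + 10 ≤ W)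
    (hzg : (gridAll M oa ob X Y lo hi g).card ≤ z)
    (hB : Bracket n k par dep lo hi) (h90 : s.ints 90 0 = g) (hg : 0 < g)
    (h71 : s.reals 71 0 = lo) (h72 : s.reals 72 0 = hi) :
    Ends W levelProg s fun s' t =>
      t ≤ 400 * (oa M / g) + 100 * (ob M / g) + 400 * (z + 1) * (L + 1) + 800 * M + 300 +
        (if 1 < g then 3 else L + 1) * (200 * oa M + 250 * ob M + 400 * M + 200 * n + 350) ∧
      s'.ints 90 0 = g / 2 ∧
      ∃ lo' hi', Bracket n k par dep lo' hi' ∧ s'.reals 71 0 = lo' ∧ s'.reals 72 0 = hi' ∧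
        if 1 < g then 8 * (gridAll M oa ob X Y lo' hi' g).card ≤ z
        else (gridAll M oa ob X Y lo' hi' g).card = 0 := by
  refine .seq ((enumProg_spec hN (by omega) hoW hT h90 hg h71 h72 (by omega)).mono ?_)
  rintro s1 t1 hs1 ⟨ht1, h12, hit⟩
  set c := (gridAll M oa ob X Y lo hi g).card with hc
  refine .seq ((sortProg_spec (W := W) (len := c) (L := L) (by omega) h12 (by omega)).mono ?_)
  rintro s2 t2 hs2 ⟨ht2, hrec, hsort⟩
  have hit2 : items (s2.reals 10) 0 c = gridAll M oa ob X Y lo hi g := by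
    have := congrArg (Multiset.map Prod.fst) hrec
    rw [items_map, items_map] at this
    rw [← hit, h12]
    exact this
  refine .seq ((halveProg_spec (g := g) (z := c) (L := L) hN hcov hW (by omega)
    ((hT.of_same hs1).of_same hs2) (by omega)
    (by omega) hLW rfl hsort (by rw [hs2.int 12, h12]) hit2 hB (by rw [hs2.int 90, hs1.int 90, h90])
    (by rw [hs2.real 71, hs1.real 71, h71]) (by rw [hs2.real 72, hs1.real 72, h72])).mono ?_)
  rintro s3 t3 hs3 ⟨ht3, lo', hi', q1, q2, q3, q4⟩
  have k90 : s3.ints 90 0 = g := by rw [hs3.int 90, hs2.int 90, hs1.int 90, h90]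
  have hs4 := exec_same W (.ivar 90 (.var 90 / 2)) s3
  refine .flat rfl fun t4 ht4 => ⟨?_, ?_, lo', hi', q1, ?_, ?_, ?_⟩
  · have e1 : (Prog.ivar 90 (.var 90 / 2)).time ≤ 10 := by decide
    have e2 : 300 * (c + 1) * (L + 1) ≤ 300 * ((z + 1) * (L + 1)) := by
      rw [mul_assoc]
      exact Nat.mul_le_mul_left _ (Nat.mul_le_mul_right _ (by omega))
    have e3 : (z + 1) * 1 ≤ (z + 1) * (L + 1) := Nat.mul_le_mul_left _ (by omega)
    rw [mul_assoc 400]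
    generalize (z + 1) * (L + 1) = B at *
    generalize oa M / g = B1 at *
    generalize ob M / g = B2 at *
    omega
  · simp (disch := omega) [Prog.exec, k90, Nat.mod_eq_of_lt]
  · rw [hs4.real 71, q2]
  · rw [hs4.real 72, q3]
  · split_ifs at q4 ⊢ with h
    · omega
    · exact q4

/-! ### The initial and the final bracket. -/

theorem RTree.rd_le (hR : RTree n par dep) {i j : ℕ} (hi : i < n) (hj : j < n) :
    rd par dep i j ≤ dep i + dep j := by
  induction e : i + j using Nat.strong_induction_on generalizing i j with
  | _ N ih =>
    have h0 : ∀ i < n, 0 ≤ dep i := fun i hi => by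
      rw [← hR.dep_zero]
      exact hR.mono 0 i (Nat.zero_le _) hi
    rcases lt_trichotomy i j with h1 | rfl | h1
    · have := hR.par_lt j (by omega) hj
      rw [hR.rd_right h1 hj]
      linarith [ih (i + par j) (by omega) hi (by omega) rfl]
    · rw [rd_self]
      linarith [h0 i hi]
    · have := hR.par_lt i (by omega) hi
      rw [hR.rd_left h1 hi]
      linarith [ih (par i + j) (by omega) (by omega) hj rfl]

theorem RTree.bracket_one (hn : 1 ≤ n) : Bracket n 1 par dep 0 0 :=
  ⟨le_rfl, le_rfl, ⟨0, by omega, by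
    refine Finset.card_pos.2 ⟨0, Finset.mem_filter.2 ⟨by simp, ?_⟩⟩
    rw [rd_self]⟩, fun D _ hD _ => .inl hD⟩

/-- Twice the largest depth bounds every distance, so the last vertex reaches all of them. For `k ≥
2` the number 0 is infeasible, since distinct vertices have positive distance. -/
theorem RTree.bracket (hR : RTree n par dep) (hk : 2 ≤ k) (hkn : k ≤ n) :
    Bracket n k par dep 0 (dep (n - 1) + dep (n - 1)) := by
  have h0 : 0 ≤ dep (n - 1) := by
    rw [← hR.dep_zero]
    exact hR.mono 0 _ (Nat.zero_le _) (by omega)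
  refine ⟨le_rfl, by linarith, ⟨n - 1, by omega, ?_⟩, ?_⟩
  · rw [Finset.filter_true_of_mem, Finset.card_range]
    · omega
    · intro v hv
      rw [Finset.mem_range] at hv
      have := hR.mono v (n - 1) (by omega) (by omega)
      linarith [hR.rd_le (i := n - 1) (j := v) (by omega) (by omega)]
  · intro D u hD hF
    right
    rcases hD.lt_or_eq with h | rfl
    · exact h
    · exfalso
      have : (Finset.range (u + 1)).filter (fun v => rd par dep u v ≤ 0) ⊆ {u} := by
        intro v hv
        rw [Finset.mem_filter, Finset.mem_range] at hv
        rw [Finset.mem_singleton]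
        by_contra hne
        linarith [hR.rd_pos (i := u) (j := v) hF.1 (by have := hF.1; omega) (Ne.symm hne)]
      have := Finset.card_le_card this
      rw [Finset.card_singleton] at this
      have := hF.2
      omega

/-- If no candidate is left then the upper end of the bracket is the optimal diameter. -/
theorem Bracket.le_of_feas {lo hi : ℝ} (hB : Bracket n k par dep lo hi)
    (hR : RTree n par dep) (hN : Nodes n M oa ob a p b X Y (rd par dep))
    (hcov : ∀ u v, v < u → u < n → ∑ κ ∈ Finset.range M, pairHits oa ob a b κ u v = 1)
    (h0 : (gridAll M oa ob X Y lo hi 1).card = 0) {D : ℝ} {u : ℕ} (hD : 0 ≤ D)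
    (hF : Feas n k par dep D u) : hi ≤ D := by
  by_contra hlt
  set S := (Finset.range (u + 1)).filter fun v => rd par dep u v ≤ D with hS
  have hne : S.Nonempty := ⟨u, Finset.mem_filter.2 ⟨by simp, by rw [rd_self]; exact hD⟩⟩
  obtain ⟨v, hv, hmax⟩ := S.exists_max_image (fun v => rd par dep u v) hne
  obtain ⟨hv1, hv2⟩ := Finset.mem_filter.1 hv
  rw [Finset.mem_range] at hv1
  have hun := hF.1
  -- Shrinking a feasible `D` to the largest distance that it admits keeps it feasible. So it
  -- suffices to exclude pairwise distances and 0.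
  have hF' : Feas n k par dep (rd par dep u v) u := ⟨hun, hF.2.trans (Finset.card_le_card
    fun w hw => Finset.mem_filter.2 ⟨(Finset.mem_filter.1 hw).1, hmax w hw⟩)⟩
  rcases hB.low _ u (hR.rd_nonneg hun (by omega)) hF' with h1 | h1
  · linarith
  · have hvu : v < u := by
      rcases Nat.lt_or_ge v u with h | h
      · exact h
      · rw [show v = u by omega, rd_self] at h1
        linarith [hB.lo_nonneg]
    have hpos : ∑ κ ∈ Finset.range M, pairHits oa ob a b κ u v ≠ 0 := by
      rw [hcov u v hvu hun]
      exact one_ne_zero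
    obtain ⟨κ, hκ, hne⟩ := Finset.exists_ne_zero_of_sum_ne_zero hpos
    obtain ⟨i, hrow, hne⟩ := Finset.exists_ne_zero_of_sum_ne_zero hne
    obtain ⟨j, hj, hne⟩ := Finset.exists_ne_zero_of_sum_ne_zero hne
    rw [Finset.mem_range] at hκ hj
    rw [Finset.mem_Ico] at hrow
    have hd := hN.dist κ hκ i (ob κ + j) hrow.1 hrow.2 (by omega) (by omega)
    have hd' : X i + Y (ob κ + j) = rd par dep u v := by
      rw [hd]
      by_contra hne'
      apply hne
      rw [if_neg]
      rintro (⟨e1, e2⟩ | ⟨e1, e2⟩)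
      · rw [e1, e2] at hne'
        exact hne' rfl
      · rw [e1, e2, rd_comm] at hne'
        exact hne' rfl
    have := mem_gridAll (lo := lo) (hi := hi) hκ hrow.1 hrow.2 (by omega : ob κ ≤ ob κ + j) (by omega)
      (by rw [hd']; exact h1) (by rw [hd']; linarith)
    rw [Multiset.card_eq_zero] at h0
    rw [h0] at this
    exact absurd this (Multiset.notMem_zero _)

/-- The potential has three parts: a geometric sum for listing and sorting the open entries, a fixed
amount per level for three probes and the roundings, and the probes of the last level. With total
size `N` and about `L` levels this is of order `L * (N + L * M + n)`. -/
theorem searchProg_spec {s : Mem} {L : ℕ} (hR : RTree n par dep)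
    (hN : Nodes n M oa ob a p b X Y (rd par dep))
    (hcov : ∀ u v, v < u → u < n → ∑ κ ∈ Finset.range M, pairHits oa ob a b κ u v = 1)
    (hk : 1 ≤ k) (hkn : k ≤ n) (hT : Tab n k M oa ob a p b X Y s) (hdep : s.reals 30 = dep)
    (hL : 8 * (oa M + ob M) + 8 * M + n ≤ 2 ^ L) (hLW : 4 * 2 ^ L + 10 < W) :
    Ends W searchProg s fun s' t =>
      t ≤ 10000 * (L + 1) * (oa M + ob M + (L + 1) * (M + 1) + n + 1) ∧
      0 ≤ s'.reals 72 0 ∧ (∃ u, Feas n k par dep (s'.reals 72 0) u) ∧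
      ∀ D u, 0 ≤ D → Feas n k par dep D u → s'.reals 72 0 ≤ D := by
  have hLL : L < 2 ^ L := Nat.lt_two_pow_self
  have h2W : 2 % W = 2 := Nat.mod_eq_of_lt (by omega)
  have h1W : 1 % W = 1 := Nat.mod_eq_of_lt (by omega)
  set init : Prog := (.rvar 71 .zero ;;
    .ite (.ilt (.var 1) 2) (.rvar 72 .zero)
      (.rvar 72 (.get 30 (.var 0 - 1) + .get 30 (.var 0 - 1))) ;;
    .ivar 90 1) with hinit
  refine .seq (.flat rfl fun t1 ht1 => ?_)
  have e1 : init.time ≤ 60 := by decide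
  have hs1 := exec_same W init s
  have h90 : (Prog.exec W init s).ints 90 0 = 2 ^ 0 := by simp [init, Prog.exec, h1W]
  have h71 : (Prog.exec W init s).reals 71 0 = 0 := by
    by_cases hc : k < 2 <;> simp [init, Prog.exec, hT.hk, h2W, hc]
  have hB : Bracket n k par dep 0 ((Prog.exec W init s).reals 72 0) := by
    by_cases hc : k < 2
    · have : (Prog.exec W init s).reals 72 0 = 0 := by simp [init, Prog.exec, hT.hk, h2W, hc]
      rw [this, show k = 1 by omega]
      exact RTree.bracket_one (by omega)
    · have : (Prog.exec W init s).reals 72 0 = dep (n - 1) + dep (n - 1) := by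
        simp [init, Prog.exec, hT.hk, hT.hn, hdep, h2W, h1W, hc]
      rw [this]
      exact hR.bracket (by omega) hkn
  generalize Prog.exec W _ s = s1 at hs1 h90 h71 hB
  clear_value init
  refine .seq ((Ends.loop (fun j s' => s'.ints 90 0 = 2 ^ j ∧ 2 ^ j ≤ 2 * n ∧ j ≤ L)
    (fun j => (L - j) * 30) 0 ⟨h90, by omega, Nat.zero_le _⟩ ?_).mono ?_)
  · rintro j s' ⟨i1, i2, i3⟩ hb hs
    have h0 : s'.ints 0 0 = n := by rw [hs.int 0, hs1.1 0 (by rw [hinit]; decide), hT.hn]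
    have hlt : 2 ^ j < n := by simpa [i1, h0] using hb
    have hjL : j < L := by
      by_contra h
      have := Nat.pow_le_pow_right (n := 2) (by norm_num) (not_lt.1 h)
      omega
    refine .flat rfl fun t ht => ⟨j + 1, ⟨?_, by omega, hjL⟩, ?_⟩
    · simp (disch := omega) [Prog.exec, i1, Nat.mod_eq_of_lt]
      omega
    · have e1 : Prog.time (.ivar 90 (.var 90 + .var 90)) ≤ 15 := by decide
      have e2 : (BExp.ilt (.var 90) (.var 0)).cost ≤ 10 := by decide
      obtain ⟨e, he⟩ := Nat.exists_eq_add_of_lt hjL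
      rw [he, show j + e + 1 - j = e + 1 by omega, show j + e + 1 - (j + 1) = e by omega]
      omega
  rintro s2 t2 hs2 ⟨J, ⟨i1, i2, i3⟩, hb, ht2⟩
  have hTs1 : Tab n k M oa ob a p b X Y s1 := by
    rw [hinit] at hs1
    exact hT.of_same hs1
  have hT2 := hTs1.of_same hs2
  have hJn : n ≤ 2 ^ J := by simpa [i1, hT2.hn] using hb
  have k71 : s2.reals 71 0 = 0 := by rw [hs2.real 71, h71]
  have k72 : s2.reals 72 0 = s1.reals 72 0 := by rw [hs2.real 72]
  set N := oa M + ob M with hNdef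
  set Dc := 200 * oa M + 250 * ob M + 400 * M + 200 * n + 350 with hDc
  set A := 3200 * (M * (L + 1)) + 400 * (L + 1) + 800 * M + 320 + 3 * Dc with hA
  -- The next width is `2 ^ e / 2`, while `2 ^ e` is the last width treated. At `e = 0` the quotient
  -- is 0, which ends the loop.
  refine (Ends.loop (fun e s' => s'.ints 90 0 = 2 ^ e / 2 ∧ e ≤ J + 1 ∧
    ∃ lo hi, Bracket n k par dep lo hi ∧ s'.reals 71 0 = lo ∧ s'.reals 72 0 = hi ∧
      if e = 0 then (gridAll M oa ob X Y lo hi 1).card = 0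
      else (gridAll M oa ob X Y lo hi (2 ^ e)).card ≤ N / 2 ^ e + M)
    (fun e => (3600 * (L + 1)) * ∑ i ∈ Finset.range e, N / 2 ^ i + e * A +
      if e = 0 then 0 else (L + 1) * Dc) (J + 1) ⟨?_, le_rfl, 0, _, hB, k71, k72, ?_⟩ ?_).mono ?_
  · rw [i1, Nat.pow_succ, Nat.mul_div_cancel _ (by norm_num)]
  · rw [if_neg (by omega)]
    refine (card_gridAll_wide hN ?_).trans (Nat.le_add_left _ _)
    rw [Nat.pow_succ]
    omega
  · rintro e s' ⟨j1, j2, lo, hi, j3, j4, j5, j6⟩ hb hs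
    have hT' := hT2.of_same hs
    obtain ⟨f, rfl⟩ : ∃ f, e = f + 1 := by
      refine Nat.exists_eq_succ_of_ne_zero fun h0 => ?_
      rw [h0] at j1
      simp [j1] at hb
    rw [if_neg (by omega)] at j6
    rw [Nat.pow_succ, Nat.mul_div_cancel _ (by norm_num)] at j1
    have hf : 2 ^ f ≤ 2 ^ J := Nat.pow_le_pow_right (by norm_num) (by omega)
    have hf0 : 0 < 2 ^ f := by positivity
    have hz1 := card_gridAll_le (lo := lo) (hi := hi) hN (g := 2 ^ f) hf0
    rw [show 2 * 2 ^ f = 2 ^ (f + 1) by rw [Nat.pow_succ]; omega, ← hNdef] at hz1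
    have hd1 : N / 2 ^ (f + 1) ≤ N / 2 ^ f :=
      Nat.div_le_div_left (Nat.pow_le_pow_right (by norm_num) (by omega)) hf0
    have hd2 : N / 2 ^ f ≤ N := Nat.div_le_self _ _
    have hd3 : oa M / 2 ^ f + ob M / 2 ^ f ≤ N / 2 ^ f := Nat.div_add_div_le_add_div
    -- The bound `N / 2 ^ (f + 1) + M` for the open entries, increased by the same amount for the
    -- diagonals and multiplied by four, gives this number; one eighth of it is again within the
    -- bound of the invariant.
    refine (levelProg_spec (z := 8 * (N / 2 ^ (f + 1)) + 8 * M) (L := L) hN hcov (by omega)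
      (by omega) (by omega) hT' (by omega) (by omega) (by omega) (by omega) j3 j1 hf0 j4 j5).mono ?_
    rintro s3 t3 hs3 ⟨ht3, q1, lo', hi', q2, q3, q4, q5⟩
    refine ⟨f, ⟨q1, by omega, lo', hi', q2, q3, q4, ?_⟩, ?_⟩
    · rcases Nat.eq_zero_or_pos f with rfl | hf1
      · simpa using q5
      · rw [if_neg (by omega)]
        rw [if_pos (Nat.one_lt_two_pow (by omega))] at q5
        omega
    · rw [Finset.sum_range_succ, if_neg (by omega : f + 1 ≠ 0)]
      have e1 : (BExp.ilt 0 (.var 90)).cost ≤ 10 := by decide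
      have e2 : (if 1 < 2 ^ f then 3 else L + 1) * Dc + (if f = 0 then 0 else (L + 1) * Dc) ≤
          3 * Dc + (L + 1) * Dc := by
        rcases Nat.eq_zero_or_pos f with rfl | hf1
        · simp
        · rw [if_pos (Nat.one_lt_two_pow (by omega)), if_neg (by omega)]
      have e3 : 400 * (8 * (N / 2 ^ (f + 1)) + 8 * M + 1) * (L + 1) + 400 * (oa M / 2 ^ f) +
          100 * (ob M / 2 ^ f) ≤
          3600 * (L + 1) * (N / 2 ^ f) + 3200 * (M * (L + 1)) + 400 * (L + 1) := by
        generalize oa M / 2 ^ f = B1 at *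
        generalize ob M / 2 ^ f = B2 at *
        generalize N / 2 ^ (f + 1) = B3 at *
        generalize N / 2 ^ f = B4 at *
        have : B3 * (L + 1) ≤ B4 * (L + 1) := Nat.mul_le_mul_right _ hd1
        have : B4 * 1 ≤ B4 * (L + 1) := Nat.mul_le_mul_left _ (by omega)
        have : 400 * (8 * B3 + 8 * M + 1) * (L + 1) =
          3200 * (B3 * (L + 1)) + 3200 * (M * (L + 1)) + 400 * (L + 1) := by ring
        have : 3600 * (L + 1) * B4 = 3600 * (B4 * (L + 1)) := by ring
        omega
      rw [← hDc] at ht3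
      have hA' : 3200 * (M * (L + 1)) + 400 * (L + 1) + 800 * M + 320 + 3 * Dc = A := rfl
      clear_value A Dc N
      rw [Nat.mul_add (3600 * (L + 1)), Nat.succ_mul f A]
      clear * - ht3 e1 e2 e3 hA'
      omega
  · rintro s3 t3 hs3 ⟨e, ⟨j1, j2, lo, hi, j3, j4, j5, j6⟩, hb', ht3⟩
    have he : e = 0 := by
      by_contra h0
      obtain ⟨f, rfl⟩ := Nat.exists_eq_succ_of_ne_zero h0
      rw [Nat.pow_succ, Nat.mul_div_cancel _ (by norm_num)] at j1
      apply hb'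
      simp [j1]
    subst he
    rw [if_pos rfl] at j6
    subst j5
    refine ⟨?_, j3.hi_nonneg, j3.feas, fun D u hD hF => j3.le_of_feas hR hN hcov j6 hD hF⟩
    have e2 : (BExp.ilt (.var 90) (.var 0)).cost ≤ 10 := by decide
    have e3 : (BExp.ilt 0 (.var 90)).cost ≤ 10 := by decide
    -- Halving the width doubles the size of the grid, so the last level dominates the listing.
    have hgeo : ∑ i ∈ Finset.range (J + 1), N / 2 ^ i ≤ 2 * N :=
      (Nat.geom_sum_le le_rfl N (J + 1)).trans (by simp [mul_comm])
    rw [if_neg (by omega : J + 1 ≠ 0)] at ht3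
    have h1 : 3600 * (L + 1) * ∑ i ∈ Finset.range (J + 1), N / 2 ^ i ≤
      3600 * (L + 1) * (2 * N) := Nat.mul_le_mul_left _ hgeo
    have h2 : (J + 1) * A ≤ (L + 1) * A := Nat.mul_le_mul_right _ (by omega)
    have h3 : Dc ≤ 250 * N + 400 * M + 200 * n + 350 := by omega
    have h4 : t1 + (t2 + t3) ≤ 60 + 30 * L + 30 + 3600 * (L + 1) * (2 * N) + (L + 1) * A +
        (L + 1) * Dc := by
      rw [← hinit] at ht1
      clear_value A Dc N
      clear * - ht1 e1 ht2 e2 e3 ht3 h1 h2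
      simp only [Nat.sub_zero] at ht2
      omega
    refine h4.trans ?_
    have h5 : L ≤ L + 1 := Nat.le_succ L
    have h6 : 1 ≤ L + 1 := Nat.le_add_left 1 L
    clear_value N Dc
    rw [hA]
    clear * - h3 h5 h6
    generalize L + 1 = l at *
    have h7 : l * 1 ≤ l * l := Nat.mul_le_mul_left _ h6
    have h8 : M * (l * 1) ≤ M * (l * l) := Nat.mul_le_mul_left _ h7
    have h9 : l * Dc ≤ l * (250 * N + 400 * M + 200 * n + 350) := Nat.mul_le_mul_left _ h3
    nlinarith

end Search

end PartialCenter

set_option linter.unusedSimpArgs false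

namespace PartialCenter

/-! ## Splitting a subtree at a centroid -/

/-- The vertices `e st, …, e (en - 1)`, in increasing order, together with the vertex `t` above
them, are the vertices of a subtree. -/
structure Seg (n : ℕ) (par e : ℕ → ℕ) (st en t : ℕ) : Prop where
  lt : ∀ i, st ≤ i → i < en → e i < n
  mono : ∀ i j, st ≤ i → i < j → j < en → e i < e j
  top_lt : ∀ i, st ≤ i → i < en → t < e i
  par_mem : ∀ i, st ≤ i → i < en → par (e i) = t ∨ ∃ j, st ≤ j ∧ j < en ∧ e j = par (e i)

/-- `x` is a vertex of the subtree. -/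
def InSeg (e : ℕ → ℕ) (st en t x : ℕ) : Prop := x = t ∨ ∃ j, st ≤ j ∧ j < en ∧ e j = x

theorem Seg.congr {n : ℕ} {par e e' : ℕ → ℕ} {st en t : ℕ} (h : Seg n par e st en t)
    (he : ∀ i, st ≤ i → i < en → e' i = e i) : Seg n par e' st en t := by
  refine ⟨fun i h1 h2 => ?_, fun i j h1 h2 h3 => ?_, fun i h1 h2 => ?_, fun i h1 h2 => ?_⟩
  · rw [he i h1 h2]; exact h.lt i h1 h2
  · rw [he i h1 (by omega), he j (by omega) h3]; exact h.mono i j h1 h2 h3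
  · rw [he i h1 h2]; exact h.top_lt i h1 h2
  · rw [he i h1 h2]
    rcases h.par_mem i h1 h2 with h3 | ⟨j, h3, h4, h5⟩
    · exact .inl h3
    · exact .inr ⟨j, h3, h4, by rw [he j h3 h4, h5]⟩

theorem inSeg_congr {e e' : ℕ → ℕ} {st en t x : ℕ} (he : ∀ i, st ≤ i → i < en → e' i = e i) :
    InSeg e' st en t x ↔ InSeg e st en t x := by
  refine or_congr_right (exists_congr fun j => ?_)
  constructor <;> rintro ⟨h1, h2, h3⟩
  · exact ⟨h1, h2, by rw [← he j h1 h2, h3]⟩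
  · exact ⟨h1, h2, by rw [he j h1 h2, h3]⟩

namespace Seg
variable {n : ℕ} {par e : ℕ → ℕ} {st en t : ℕ} {dep : ℕ → ℝ} (h : Seg n par e st en t)
include h

theorem inj {i j : ℕ} (h1 : st ≤ i) (h2 : i < en) (h3 : st ≤ j) (h4 : j < en) (h5 : e i = e j) :
    i = j := by
  rcases lt_trichotomy i j with h6 | h6 | h6
  · have := h.mono i j h1 h6 h4; omega
  · exact h6
  · have := h.mono j i h3 h6 h2; omega

theorem mono_iff {i j : ℕ} (h1 : st ≤ i) (h2 : i < en) (h3 : st ≤ j) (h4 : j < en) :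
    e i < e j ↔ i < j := by
  constructor
  · intro h5
    by_contra h6
    rcases (not_lt.1 h6).lt_or_eq with h7 | h7
    · have := h.mono j i h3 h7 h2; omega
    · rw [h7] at h5; omega
  · exact fun h5 => h.mono i j h1 h5 h4

variable (hR : RTree n par dep)
include hR

theorem par_pos {i : ℕ} (h1 : st ≤ i) (h2 : i < en) :
    par (e i) = t ∨ ∃ j, st ≤ j ∧ j < i ∧ e j = par (e i) := by
  rcases h.par_mem i h1 h2 with h3 | ⟨j, h3, h4, h5⟩
  · exact .inl h3
  · refine .inr ⟨j, h3, ?_, h5⟩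
    have h6 := hR.par_lt (e i) (by have := h.top_lt i h1 h2; omega) (h.lt i h1 h2)
    rw [← h5] at h6
    exact (h.mono_iff h3 h4 h1 h2).1 h6

theorem top_eq (h1 : st < en) : par (e st) = t := by
  rcases h.par_pos hR le_rfl h1 with h3 | ⟨j, h3, h4, h5⟩
  · exact h3
  · omega

omit hR in
theorem top_lt_n (h1 : st < en) : t < n := by
  have := h.top_lt st le_rfl h1
  have := h.lt st le_rfl h1
  omega

omit hR in
theorem inSeg_lt {x : ℕ} (h1 : st < en) (hx : InSeg e st en t x) : x < n := by
  rcases hx with rfl | ⟨j, h3, h4, rfl⟩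
  · exact h.top_lt_n h1
  · exact h.lt j h3 h4

end Seg

/-! ### Sizes of branches and the marked vertices. -/

/-- The weights of the highest members of a set that is closed under children add up to the size of
the set. -/
theorem sum_roots {par e sz : ℕ → ℕ} {I : Finset ℕ} (hinj : ∀ i ∈ I, ∀ j ∈ I, e i = e j → i = j)
    (hsz : ∀ i ∈ I, sz (e i) = 1 + ∑ k ∈ I, if par (e k) = e i then sz (e k) else 0)
    (P : ℕ → Prop) [DecidablePred P]
    (hmem : ∀ i ∈ I, P (par (e i)) → ∃ j ∈ I, e j = par (e i))
    (hP : ∀ i ∈ I, P (par (e i)) → P (e i)) :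
    (∑ i ∈ I, if P (e i) ∧ ¬ P (par (e i)) then sz (e i) else 0) =
      (I.filter fun i => P (e i)).card := by
  have e1 : ∑ i ∈ I, (if P (e i) then sz (e i) else 0) = (I.filter fun i => P (e i)).card +
      ∑ k ∈ I, if P (par (e k)) then sz (e k) else 0 := by
    have : ∀ i ∈ I, (if P (e i) then sz (e i) else 0) =
        (if P (e i) then 1 else 0) + ∑ k ∈ I,
          if P (e i) ∧ par (e k) = e i then sz (e k) else 0 := by
      intro i hi
      by_cases hp : P (e i)
      · rw [if_pos hp, if_pos hp, hsz i hi]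
        simp [hp]
      · simp [hp]
    rw [Finset.sum_congr rfl this, Finset.sum_add_distrib, Finset.sum_comm, Finset.card_filter]
    congr 1
    refine Finset.sum_congr rfl fun k hk => ?_
    by_cases hp : P (par (e k))
    · rw [if_pos hp]
      obtain ⟨j, h1, h3⟩ := hmem k hk hp
      rw [Finset.sum_eq_single j, if_pos ⟨h3 ▸ hp, h3.symm⟩]
      · intro i hi hne
        rw [if_neg]
        rintro ⟨-, h4⟩
        exact hne (hinj i hi j h1 (h4.symm.trans h3.symm))
      · intro hn
        exact absurd h1 hn
    · rw [if_neg hp]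
      refine Finset.sum_eq_zero fun i _ => if_neg ?_
      rintro ⟨h4, h5⟩
      exact hp (h5 ▸ h4)
  have e2 : ∑ i ∈ I, (if P (e i) then sz (e i) else 0) =
      (∑ i ∈ I, if P (e i) ∧ ¬ P (par (e i)) then sz (e i) else 0) +
      ∑ k ∈ I, if P (par (e k)) then sz (e k) else 0 := by
    rw [← Finset.sum_add_distrib]
    refine Finset.sum_congr rfl fun i hi => ?_
    by_cases h1 : P (par (e i))
    · simp [h1, hP i hi h1]
    · simp [h1]
  omega

/-- The results of the passes over a segment: the sizes of the branches, the centroid, and the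
marks of a third of the vertices below it. -/
structure Split (par e : ℕ → ℕ) (st en t c acc : ℕ) (sz mk : ℕ → ℕ) : Prop where
  size : ∀ x, InSeg e st en t x →
    sz x = 1 + ∑ k ∈ Finset.Ico st en, if par (e k) = x then sz (e k) else 0
  mem : InSeg e st en t c
  big : en - st ≤ 2 * (sz c - 1)
  small : ∀ i, st ≤ i → i < en → par (e i) = c → 2 * (sz (e i) - 1) < en - st
  mk_top : mk t = 0
  mk_le : ∀ i, st ≤ i → i < en → mk (e i) ≤ 1
  mk_par : ∀ i, st ≤ i → i < en → par (e i) ≠ c → mk (e i) = mk (par (e i))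
  acc_eq : acc = ∑ k ∈ Finset.Ico st en, if par (e k) = c ∧ mk (e k) = 1 then sz (e k) else 0
  acc_le : 6 * acc ≤ 5 * (en - st) + 1
  all : 3 * acc < en - st → ∀ i, st ≤ i → i < en → par (e i) = c → mk (e i) = 1

namespace Split
variable {n : ℕ} {par e : ℕ → ℕ} {st en t c acc : ℕ} {sz mk : ℕ → ℕ} {dep : ℕ → ℝ}
  (hS : Split par e st en t c acc sz mk) (h : Seg n par e st en t) (hR : RTree n par dep)
  (hlt : st < en)
include hS h hR

/-- Marks originate only at children of `c` and are otherwise copied from the parent. A vertex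
numbered at most `c` has a parent below `c`, so its mark goes back to the unmarked top. -/
theorem mk_of_le {i : ℕ} (h1 : st ≤ i) (h2 : i < en) (h3 : e i ≤ c) : mk (e i) = 0 := by
  induction i using Nat.strong_induction_on with
  | _ i ih =>
    have h4 := hR.par_lt (e i) (by have := h.top_lt i h1 h2; omega) (h.lt i h1 h2)
    rw [hS.mk_par i h1 h2 (by omega)]
    rcases h.par_pos hR h1 h2 with h5 | ⟨j, h5, h6, h7⟩
    · rw [h5, hS.mk_top]
    · rw [← h7]
      exact ih j h6 h5 (by omega) (by omega)

theorem mk_c : mk c = 0 := by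
  rcases hS.mem with h1 | ⟨j, h1, h2, h3⟩
  · rw [h1, hS.mk_top]
  · rw [← h3]
    exact hS.mk_of_le h hR h1 h2 h3.le

theorem lt_of_mk {i : ℕ} (h1 : st ≤ i) (h2 : i < en) (h3 : mk (e i) = 1) : c < e i := by
  by_contra h4
  have := hS.mk_of_le h hR h1 h2 (not_lt.1 h4)
  omega

theorem mk_child {i : ℕ} (h1 : st ≤ i) (h2 : i < en) (h3 : mk (par (e i)) = 1) : mk (e i) = 1 := by
  rw [hS.mk_par i h1 h2 fun h4 => by rw [h4, hS.mk_c h hR] at h3; omega]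
  exact h3

/-- The marked set is closed under children and its highest members are the marked children of `c`;
so `sum_roots` applies. -/
theorem card_marked : ((Finset.Ico st en).filter fun i => mk (e i) = 1).card = acc := by
  have hI := fun i (hi : i ∈ Finset.Ico st en) => Finset.mem_Ico.1 hi
  rw [← sum_roots (fun i hi j hj => h.inj (hI i hi).1 (hI i hi).2 (hI j hj).1 (hI j hj).2)
    (fun i hi => hS.size _ (.inr ⟨i, (hI i hi).1, (hI i hi).2, rfl⟩)) (fun x => mk x = 1) ?_
    (fun i hi => hS.mk_child h hR (hI i hi).1 (hI i hi).2), hS.acc_eq]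
  swap
  · intro i hi h1
    obtain ⟨j, h2, h3, h4⟩ := (h.par_mem i (hI i hi).1 (hI i hi).2).resolve_left
      fun h2 => by rw [h2, hS.mk_top] at h1; omega
    exact ⟨j, Finset.mem_Ico.2 ⟨h2, h3⟩, h4⟩
  refine Finset.sum_congr rfl fun k hk => ?_
  rw [Finset.mem_Ico] at hk
  refine if_congr ?_ rfl rfl
  constructor
  · rintro ⟨h1, h2⟩
    refine ⟨?_, h1⟩
    by_contra h3
    rw [hS.mk_par k hk.1 hk.2 h3] at h1
    exact h2 h1
  · rintro ⟨h1, h2⟩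
    rw [h1, hS.mk_c h hR]
    exact ⟨h2, by omega⟩

omit h hR in
-- If less than a third were marked, no branch would have been refused. Then everything below the
-- centroid is marked, which is at least half of the edges by `big`.
theorem le_acc : en - st ≤ 3 * acc := by
  by_contra hn
  have h1 := hS.all (by omega)
  have h2 : sz c = 1 + acc := by
    rw [hS.size c hS.mem, hS.acc_eq]
    congr 1
    refine Finset.sum_congr rfl fun k hk => ?_
    rw [Finset.mem_Ico] at hk
    by_cases h3 : par (e k) = c
    · simp [h3, h1 k hk.1 hk.2 h3]
    · simp [h3]
  have := hS.big
  omega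

include hlt

/-- A marked vertex lies below a marked child of the centroid, and no unmarked vertex does. -/
theorem exists_branch {i : ℕ} (h1 : st ≤ i) (h2 : i < en) (h3 : mk (e i) = 1) :
    ∃ w, 0 < w ∧ Anc par w (e i) ∧ par w = c ∧
      ∀ x, InSeg e st en t x → mk x ≠ 1 → ¬ Anc par w x := by
  have key : ∃ w, st ≤ w ∧ w < en ∧ mk (e w) = 1 ∧ Anc par (e w) (e i) ∧ par (e w) = c := by
    induction i using Nat.strong_induction_on with
    | _ i ih =>
      by_cases h4 : par (e i) = c
      · exact ⟨i, h1, h2, h3, .refl, h4⟩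
      · have h5 := hS.mk_par i h1 h2 h4
        rcases h.par_pos hR h1 h2 with h6 | ⟨j, h6, h7, h8⟩
        · rw [h5, h6, hS.mk_top] at h3
          omega
        · obtain ⟨w, h9, h10, h11, h12, h13⟩ := ih j h7 h6 (by omega) (by rw [h8, ← h5, h3])
          refine ⟨w, h9, h10, h11, .step _ ?_ (h8 ▸ h12), h13⟩
          have := h.top_lt i h1 h2
          omega
  obtain ⟨w, h4, h5, h6, h7, h8⟩ := key
  refine ⟨e w, by have := h.top_lt w h4 h5; omega, h7, h8, ?_⟩
  intro x hx hmk ha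
  apply hmk
  clear hmk
  induction ha with
  | refl => exact h6
  | step v hv ha ih =>
    have hw := h.top_lt w h4 h5
    have hvn := h.inSeg_lt hlt hx
    have hle := hR.anc_le ha (by have := hR.par_lt v hv hvn; omega)
    have hlt' := hR.par_lt v hv hvn
    rcases hx with rfl | ⟨j, h9, h10, rfl⟩
    · omega
    · exact hS.mk_child h hR h9 h10 (ih (h.par_mem j h9 h10))

/-- The path from a marked to an unmarked vertex passes through `c`. Moreover `c` is an ancestor of
the marked vertex, so the second summand is a difference of depths; this is why the columns are
sorted by their numbers alone. -/
theorem dist {i : ℕ} (h1 : st ≤ i) (h2 : i < en) (h3 : mk (e i) = 1) {x : ℕ}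
    (hx : InSeg e st en t x) (hmk : mk x ≠ 1) :
    rd par dep c x + rd par dep c (e i) = rd par dep x (e i) ∧
      rd par dep c (e i) = dep (e i) - dep c := by
  obtain ⟨w, h4, h5, h6, h7⟩ := hS.exists_branch h hR hlt h1 h2 h3
  have e1 := hR.rd_of_not_anc h4 h5 (h7 x hx hmk) (h.lt i h1 h2) (h.inSeg_lt hlt hx)
  have e2 := hR.rd_of_not_anc h4 h5 (h7 c hS.mem (by rw [hS.mk_c h hR]; omega)) (h.lt i h1 h2)
    (h.inSeg_lt hlt hS.mem)
  rw [h6, rd_self] at e2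
  rw [h6] at e1
  rw [rd_comm par dep x (e i), e1, rd_comm par dep c (e i), e2]
  constructor <;> ring

end Split

theorem Anc.par_left {par : ℕ → ℕ} {w v : ℕ} (h : Anc par w v) (hw : 0 < w) :
    Anc par (par w) v := by
  induction h with
  | refl => exact .step w hw .refl
  | step v hv _ ih => exact .step v hv ih

/-- The flags mark the ancestors of `c` in the subtree. -/
theorem Seg.flag_iff {n : ℕ} {par e : ℕ → ℕ} {st en t c : ℕ} {dep : ℕ → ℝ} {F : ℕ → ℕ}
    (h : Seg n par e st en t) (hR : RTree n par dep) (hlt : st < en) (hc : InSeg e st en t c)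
    (hFc : F c = 1) (hup : ∀ i, st ≤ i → i < en → F (e i) = 1 → F (par (e i)) = 1)
    (hdown : ∀ x, InSeg e st en t x → F x = 1 →
      x = c ∨ ∃ i, st ≤ i ∧ i < en ∧ par (e i) = x ∧ F (e i) = 1)
    {x : ℕ} (hx : InSeg e st en t x) : F x = 1 ↔ Anc par x c := by
  constructor
  · intro hF
    induction hN : n - x using Nat.strong_induction_on generalizing x with
    | _ N ih =>
      rcases hdown x hx hF with rfl | ⟨i, h1, h2, rfl, h4⟩
      · exact .refl
      · have h5 := h.top_lt i h1 h2
        have h6 := h.lt i h1 h2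
        have h7 := hR.par_lt (e i) (by omega) h6
        have h8 := ih (n - e i) (by omega) (.inr ⟨i, h1, h2, rfl⟩) h4 rfl
        exact h8.par_left (by omega)
  · intro ha
    have hxt : t ≤ x := by
      rcases hx with rfl | ⟨j, h1, h2, rfl⟩
      · exact le_rfl
      · exact (h.top_lt j h1 h2).le
    have key : ∀ v, Anc par x v → InSeg e st en t v → F v = 1 → F x = 1 := by
      intro v hv
      induction hv with
      | refl => exact fun _ h => h
      | step v hv0 hv ih =>
        intro hvs hF
        have hvn := h.inSeg_lt hlt hvs
        have hle := hR.anc_le hv ((hR.par_lt v hv0 hvn).trans hvn)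
        have := hR.par_lt v hv0 hvn
        rcases hvs with rfl | ⟨j, h1, h2, rfl⟩
        · omega
        · exact ih (h.par_mem j h1 h2) (hup j h1 h2 hF)
    exact key c ha hc hFc

/-- The distances from `c` follow from the flags. -/
theorem Seg.rd_step {n : ℕ} {par e : ℕ → ℕ} {st en t c : ℕ} {dep : ℕ → ℝ}
    (h : Seg n par e st en t) (hR : RTree n par dep) (hlt : st < en) (hc : InSeg e st en t c)
    {i : ℕ} (h1 : st ≤ i) (h2 : i < en) (ha : ¬ Anc par (e i) c) :
    rd par dep c (e i) = rd par dep c (par (e i)) + (dep (e i) - dep (par (e i))) := by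
  rw [rd_comm, hR.rd_of_not_anc (by have := h.top_lt i h1 h2; omega) .refl ha (h.lt i h1 h2)
    (h.inSeg_lt hlt hc), rd_comm]

end PartialCenter

set_option linter.unusedSimpArgs false

namespace PartialCenter

/-! ### The two parts of a segment. -/

/-- `e'` lists the unmarked members of a segment before position `q` and then the marked ones. -/
structure Parted (e e' : ℕ → ℕ) (st q en : ℕ) (mk : ℕ → ℕ) : Prop where
  mono₁ : ∀ i j, st ≤ i → i < j → j < q → e' i < e' j
  mono₂ : ∀ i j, q ≤ i → i < j → j < en → e' i < e' j
  mem₁ : ∀ x, (∃ j, st ≤ j ∧ j < q ∧ e' j = x) ↔ (∃ j, st ≤ j ∧ j < en ∧ e j = x) ∧ mk x ≠ 1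
  mem₂ : ∀ x, (∃ j, q ≤ j ∧ j < en ∧ e' j = x) ↔ (∃ j, st ≤ j ∧ j < en ∧ e j = x) ∧ mk x = 1

namespace Parted
variable {n : ℕ} {par e e' : ℕ → ℕ} {st q en t c acc : ℕ} {sz mk : ℕ → ℕ} {dep : ℕ → ℝ}
  (hP : Parted e e' st q en mk) (hS : Split par e st en t c acc sz mk) (h : Seg n par e st en t)
  (hR : RTree n par dep)
include hP hS h hR

omit hR in
theorem inSeg₁ (x : ℕ) : InSeg e' st q t x ↔ InSeg e st en t x ∧ mk x ≠ 1 := by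
  rw [InSeg, InSeg, hP.mem₁]
  constructor
  · rintro (rfl | h1)
    · exact ⟨.inl rfl, by rw [hS.mk_top]; omega⟩
    · exact ⟨.inr h1.1, h1.2⟩
  · rintro ⟨rfl | h1, h2⟩
    · exact .inl rfl
    · exact .inr ⟨h1, h2⟩

omit hR in
theorem inSeg₂ (x : ℕ) : InSeg e' q en c x ↔ x = c ∨ InSeg e st en t x ∧ mk x = 1 := by
  rw [InSeg, InSeg, hP.mem₂]
  refine or_congr_right ⟨fun h1 => ⟨.inr h1.1, h1.2⟩, ?_⟩
  rintro ⟨rfl | h1, h2⟩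
  · rw [hS.mk_top] at h2
    omega
  · exact ⟨h1, h2⟩

/-- The unmarked vertices stay connected to the top because the children of a marked vertex are
marked. -/
theorem seg₁ : Seg n par e' st q t := by
  refine ⟨fun i h1 h2 => ?_, hP.mono₁, fun i h1 h2 => ?_, fun i h1 h2 => ?_⟩
  all_goals obtain ⟨⟨j, h3, h4, h5⟩, h6⟩ := (hP.mem₁ (e' i)).1 ⟨i, h1, h2, rfl⟩
  · rw [← h5]; exact h.lt j h3 h4
  · rw [← h5]; exact h.top_lt j h3 h4
  · rw [← h5] at h6 ⊢
    refine (h.par_mem j h3 h4).imp_right fun h7 => (hP.mem₁ _).2 ⟨h7, fun h8 => h6 ?_⟩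
    exact hS.mk_child h hR h3 h4 h8

/-- The marked branches hang from `c`, which becomes the top of their part. Thus `c` belongs to both
parts and is their only common vertex. -/
theorem seg₂ : Seg n par e' q en c := by
  refine ⟨fun i h1 h2 => ?_, hP.mono₂, fun i h1 h2 => ?_, fun i h1 h2 => ?_⟩
  all_goals obtain ⟨⟨j, h3, h4, h5⟩, h6⟩ := (hP.mem₂ (e' i)).1 ⟨i, h1, h2, rfl⟩
  · rw [← h5]; exact h.lt j h3 h4
  · rw [← h5]; exact hS.lt_of_mk h hR h3 h4 (by rw [h5, h6])
  · rw [← h5] at h6 ⊢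
    by_cases h7 : par (e j) = c
    · exact .inl h7
    · right
      have h8 := hS.mk_par j h3 h4 h7
      refine (hP.mem₂ _).2 ⟨(h.par_mem j h3 h4).resolve_left fun h9 => ?_, by rw [← h8, h6]⟩
      rw [h8, h9, hS.mk_top] at h6
      omega

end Parted

/-! ## The work list -/

/-- The segments from the position `st` on, given by the list of their ends; `f` stores the end of
each segment at its start. -/
def Segs (n : ℕ) (par e f : ℕ → ℕ) : ℕ → List ℕ → Prop
  | st, [] => st + 1 = n
  | st, en :: l => f st = en ∧ st < en ∧ Seg n par e st en (par (e st)) ∧ Segs n par e f en l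

theorem Segs.lt {n : ℕ} {par e f : ℕ → ℕ} {st : ℕ} {l : List ℕ} (h : Segs n par e f st l) :
    st < n := by
  induction l generalizing st with
  | nil => rw [Segs] at h; omega
  | cons en l ih => exact h.2.1.trans (ih h.2.2.2)

theorem Segs.congr {n : ℕ} {par e f e' f' : ℕ → ℕ} {st : ℕ} {l : List ℕ}
    (h : Segs n par e f st l) (he : ∀ i, st ≤ i → e' i = e i) (hf : ∀ i, st ≤ i → f' i = f i) :
    Segs n par e' f' st l := by
  induction l generalizing st with
  | nil => exact h
  | cons en l ih =>
    obtain ⟨h1, h2, h3, h4⟩ := h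
    refine ⟨by rw [hf st le_rfl, h1], h2, ?_, ih h4 (fun i hi => he i (by omega))
      fun i hi => hf i (by omega)⟩
    rw [he st le_rfl]
    exact h3.congr fun i h5 _ => he i h5

/-- The bound for the size of the nodes that a segment with `m` edges gives rise to. -/
def cost (m : ℕ) : ℕ := m * (Nat.log 2 (m ^ 8) + 1)

/-- Both parts have at most `11 / 12` of the edges, and `2 * 11 ^ 8 ≤ 12 ^ 8`. So the eighth power
of the size at least halves and its logarithm drops by one, which frees `m` units. This is the
reason for the exponent in `cost`. -/
theorem cost_split {m x y : ℕ} (hm : x + y = m) (h1 : m ≤ 3 * y) (h2 : 6 * y ≤ 5 * m + 1)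
    (h3 : 2 ≤ m) : m + (cost x + cost y) ≤ cost m := by
  have key : ∀ z, 0 < z → 12 * z ≤ 11 * m → Nat.log 2 (z ^ 8) + 1 ≤ Nat.log 2 (m ^ 8) := by
    intro z hz h
    rw [← Nat.log_mul_base (by norm_num) (by positivity)]
    refine Nat.log_mono_right ?_
    have h4 := Nat.pow_le_pow_left h 8
    rw [Nat.mul_pow, Nat.mul_pow] at h4
    omega
  have kx := Nat.mul_le_mul_left x (key x (by omega) (by omega))
  have ky := Nat.mul_le_mul_left y (key y (by omega) (by omega))
  simp only [cost]
  calc m + (x * (Nat.log 2 (x ^ 8) + 1) + y * (Nat.log 2 (y ^ 8) + 1))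
      ≤ m + (x * Nat.log 2 (m ^ 8) + y * Nat.log 2 (m ^ 8)) := by omega
    _ = m * (Nat.log 2 (m ^ 8) + 1) := by rw [← hm]; ring

theorem cost_one : cost 1 = 1 := by simp [cost]

theorem cost_le {m L : ℕ} (h : m ≤ 2 ^ L) : cost m ≤ m * (8 * L + 1) := by
  refine Nat.mul_le_mul_left _ (Nat.add_le_add_right ?_ 1)
  refine (Nat.log_mono_right (Nat.pow_le_pow_left h 8)).trans ?_
  rw [← Nat.pow_mul, Nat.log_pow (by norm_num)]
  omega

/-- The bound for the size of the nodes that the segments of a list give rise to. -/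
def pot : ℕ → List ℕ → ℕ
  | _, [] => 0
  | st, en :: l => cost (en - st) + pot en l

open Classical in
/-- The number of the segments of a list that contain both `u` and `v`. -/
noncomputable def segHits (par e : ℕ → ℕ) (u v : ℕ) : ℕ → List ℕ → ℕ
  | _, [] => 0
  | st, en :: l => (if InSeg e st en (par (e st)) u ∧ InSeg e st en (par (e st)) v then 1 else 0) +
      segHits par e u v en l

theorem segHits_congr {par e e' : ℕ → ℕ} {u v : ℕ} {st : ℕ} {l : List ℕ} {n : ℕ} {f : ℕ → ℕ}
    (h : Segs n par e f st l) (he : ∀ i, st ≤ i → e' i = e i) :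
    segHits par e' u v st l = segHits par e u v st l := by
  induction l generalizing st with
  | nil => rfl
  | cons en l ih =>
    obtain ⟨-, h2, -, h4⟩ := h
    rw [segHits, segHits, ih h4 fun i hi => he i (by omega), he st le_rfl]
    rw [inSeg_congr (x := u) fun i h5 _ => he i h5, inSeg_congr (x := v) fun i h5 _ => he i h5]

/-! ## Adding a node -/

/-- The properties of the node `κ` of the tables. -/
structure NodeAt (n κ : ℕ) (oa ob a p b : ℕ → ℕ) (X Y : ℕ → ℝ) (d : ℕ → ℕ → ℝ) : Prop where
  oa_le : oa κ ≤ oa (κ + 1)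
  ob_le : ob κ ≤ ob (κ + 1)
  oa_len : oa (κ + 1) ≤ oa κ + n
  ob_len : ob (κ + 1) ≤ ob κ + n
  a_lt : ∀ i, oa κ ≤ i → i < oa (κ + 1) → a i < n
  b_lt : ∀ j, ob κ ≤ j → j < ob (κ + 1) → b j < n
  X_mono : ∀ i i', oa κ ≤ i → i ≤ i' → i' < oa (κ + 1) → X i ≤ X i'
  Y_mono : ∀ j j', ob κ ≤ j → j ≤ j' → j' < ob (κ + 1) → Y j ≤ Y j'
  p_le : ∀ i, oa κ ≤ i → i < oa (κ + 1) → ob κ + p i ≤ ob (κ + 1)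
  p_iff : ∀ i j, oa κ ≤ i → i < oa (κ + 1) → ob κ ≤ j → j < ob (κ + 1) →
    (j < ob κ + p i ↔ b j < a i)
  ne : ∀ i j, oa κ ≤ i → i < oa (κ + 1) → ob κ ≤ j → j < ob (κ + 1) → a i ≠ b j
  dist : ∀ i j, oa κ ≤ i → i < oa (κ + 1) → ob κ ≤ j → j < ob (κ + 1) → X i + Y j = d (a i) (b j)

theorem Nodes.at {n M : ℕ} {oa ob a p b : ℕ → ℕ} {X Y : ℕ → ℝ} {d : ℕ → ℕ → ℝ}
    (h : Nodes n M oa ob a p b X Y d) {κ : ℕ} (hκ : κ < M) : NodeAt n κ oa ob a p b X Y d :=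
  ⟨h.oa_le κ hκ, h.ob_le κ hκ, h.oa_len κ hκ, h.ob_len κ hκ, h.a_lt κ hκ, h.b_lt κ hκ,
    h.X_mono κ hκ, h.Y_mono κ hκ, h.p_le κ hκ, h.p_iff κ hκ, h.ne κ hκ, h.dist κ hκ⟩

theorem Nodes.of_at {n M : ℕ} {oa ob a p b : ℕ → ℕ} {X Y : ℕ → ℝ} {d : ℕ → ℕ → ℝ}
    (h0 : oa 0 = 0) (h0' : ob 0 = 0) (h : ∀ κ < M, NodeAt n κ oa ob a p b X Y d) :
    Nodes n M oa ob a p b X Y d :=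
  ⟨h0, h0', fun κ hκ => (h κ hκ).oa_le, fun κ hκ => (h κ hκ).ob_le, fun κ hκ => (h κ hκ).oa_len,
    fun κ hκ => (h κ hκ).ob_len, fun κ hκ => (h κ hκ).a_lt, fun κ hκ => (h κ hκ).b_lt,
    fun κ hκ => (h κ hκ).X_mono, fun κ hκ => (h κ hκ).Y_mono, fun κ hκ => (h κ hκ).p_le,
    fun κ hκ => (h κ hκ).p_iff, fun κ hκ => (h κ hκ).ne, fun κ hκ => (h κ hκ).dist⟩

theorem NodeAt.congr {n κ : ℕ} {oa ob a p b oa' ob' a' p' b' : ℕ → ℕ} {X Y X' Y' : ℕ → ℝ}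
    {d : ℕ → ℕ → ℝ} (h : NodeAt n κ oa ob a p b X Y d) (e1 : oa' κ = oa κ)
    (e2 : oa' (κ + 1) = oa (κ + 1)) (e3 : ob' κ = ob κ) (e4 : ob' (κ + 1) = ob (κ + 1))
    (ea : ∀ i < oa (κ + 1), a' i = a i ∧ p' i = p i ∧ X' i = X i)
    (eb : ∀ j < ob (κ + 1), b' j = b j ∧ Y' j = Y j) : NodeAt n κ oa' ob' a' p' b' X' Y' d := by
  obtain ⟨h1, h2, h3, h4, h5, h6, h7, h8, h9, h10, h11, h12⟩ := h
  constructor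
  all_goals rw [e1, e2] at *
  all_goals rw [e3, e4] at *
  · exact h1
  · exact h2
  · exact h3
  · exact h4
  · intro i k1 k2
    rw [(ea i k2).1]; exact h5 i k1 k2
  · intro j k1 k2
    rw [(eb j k2).1]; exact h6 j k1 k2
  · intro i i' k1 k2 k3
    rw [(ea i (by omega)).2.2, (ea i' k3).2.2]; exact h7 i i' k1 k2 k3
  · intro i i' k1 k2 k3
    rw [(eb i (by omega)).2, (eb i' k3).2]; exact h8 i i' k1 k2 k3
  · intro i k1 k2
    rw [(ea i k2).2.1]; exact h9 i k1 k2
  · intro i j k1 k2 k3 k4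
    rw [(ea i k2).1, (ea i k2).2.1, (eb j k4).1]; exact h10 i j k1 k2 k3 k4
  · intro i j k1 k2 k3 k4
    rw [(ea i k2).1, (eb j k4).1]; exact h11 i j k1 k2 k3 k4
  · intro i j k1 k2 k3 k4
    rw [(ea i k2).1, (ea i k2).2.2, (eb j k4).1, (eb j k4).2]; exact h12 i j k1 k2 k3 k4

/-- The tables with a new last node. -/
theorem Nodes.snoc {n M : ℕ} {oa ob a p b oa' ob' a' p' b' : ℕ → ℕ} {X Y X' Y' : ℕ → ℝ}
    {d : ℕ → ℕ → ℝ} (h : Nodes n M oa ob a p b X Y d) (eoa : ∀ κ ≤ M, oa' κ = oa κ)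
    (eob : ∀ κ ≤ M, ob' κ = ob κ) (ea : ∀ i < oa M, a' i = a i ∧ p' i = p i ∧ X' i = X i)
    (eb : ∀ j < ob M, b' j = b j ∧ Y' j = Y j) (hnew : NodeAt n M oa' ob' a' p' b' X' Y' d) :
    Nodes n (M + 1) oa' ob' a' p' b' X' Y' d := by
  refine .of_at (by rw [eoa 0 (Nat.zero_le _), h.oa_zero]) (by rw [eob 0 (Nat.zero_le _), h.ob_zero])
    fun κ hκ => ?_
  rcases Nat.lt_succ_iff_lt_or_eq.1 hκ with h1 | rfl
  · have h2 := h.oa_mono (κ := κ + 1) (κ' := M) h1 le_rfl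
    have h3 := h.ob_mono (κ := κ + 1) (κ' := M) h1 le_rfl
    exact (h.at h1).congr (eoa κ h1.le) (eoa _ h1) (eob κ h1.le) (eob _ h1)
      (fun i hi => ea i (by omega)) fun j hj => eb j (by omega)
  · exact hnew

theorem pairHits_congr {oa ob a b oa' ob' a' b' : ℕ → ℕ} {κ u v : ℕ} (e1 : oa' κ = oa κ)
    (e2 : oa' (κ + 1) = oa (κ + 1)) (e3 : ob' κ = ob κ) (e4 : ob' (κ + 1) = ob (κ + 1))
    (ea : ∀ i < oa (κ + 1), a' i = a i) (eb : ∀ j < ob (κ + 1), b' j = b j) :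
    pairHits oa' ob' a' b' κ u v = pairHits oa ob a b κ u v := by
  rw [pairHits, pairHits, e1, e2, e3, e4]
  refine Finset.sum_congr rfl fun i hi => Finset.sum_congr rfl fun j hj => ?_
  rw [Finset.mem_Ico] at hi
  rw [Finset.mem_range] at hj
  rw [ea i hi.2, eb _ (by omega)]

/-- The hits of a pair in a node, from the occurrences of its vertices. -/
theorem pairHits_eq {oa ob a b : ℕ → ℕ} {κ u v : ℕ} (huv : u ≠ v) :
    pairHits oa ob a b κ u v =
      (∑ i ∈ Finset.Ico (oa κ) (oa (κ + 1)), if a i = u then 1 else 0) *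
        (∑ j ∈ Finset.range (ob (κ + 1) - ob κ), if b (ob κ + j) = v then 1 else 0) +
      (∑ i ∈ Finset.Ico (oa κ) (oa (κ + 1)), if a i = v then 1 else 0) *
        (∑ j ∈ Finset.range (ob (κ + 1) - ob κ), if b (ob κ + j) = u then 1 else 0) := by
  rw [Finset.sum_mul_sum, Finset.sum_mul_sum, pairHits, ← Finset.sum_add_distrib]
  refine Finset.sum_congr rfl fun i _ => ?_
  rw [← Finset.sum_add_distrib]
  refine Finset.sum_congr rfl fun j _ => ?_
  by_cases h1 : a i = u
  · have h2 : a i ≠ v := fun h => huv (h1.symm.trans h)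
    simp [h1, huv]
  · simp only [h1, false_and, false_or, if_false, zero_mul, zero_add]
    by_cases h2 : a i = v <;> simp [h2]

end PartialCenter

set_option linter.unusedSimpArgs false

namespace PartialCenter

/-! ## The passes over a segment -/

/-- The memory during the passes over the segment from `st` to `en`. -/
structure SegMem (par e : ℕ → ℕ) (dep : ℕ → ℝ) (st en t : ℕ) (s : Mem) : Prop where
  par_eq : s.ints 31 = par
  e_eq : s.ints 40 = e
  st_eq : s.ints 47 0 = st
  en_eq : s.ints 48 0 = en
  t_eq : s.ints 49 0 = t
  dep_eq : s.reals 30 = dep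

theorem SegMem.of_same {par e : ℕ → ℕ} {dep : ℕ → ℝ} {st en t : ℕ} {s s' : Mem} {pr : Prog}
    (ht : SegMem par e dep st en t s) (h : Same pr s s')
    (hc : (([31, 40, 47, 48, 49].all fun a => !pr.wi.contains a) &&
      [30].all fun a => !pr.wr.contains a) = true := by rfl) :
    SegMem par e dep st en t s' := by
  simp only [Bool.and_eq_true, List.all_eq_true, Bool.not_eq_true', List.mem_cons,
    List.not_mem_nil, or_false] at hc
  have e : ∀ x ∈ [31, 40, 47, 48, 49], s'.ints x = s.ints x := fun x hx =>
    h.int x (hc.1 x (by simpa using hx))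
  have e' : ∀ x ∈ [30], s'.reals x = s.reals x := fun x hx =>
    h.real x (hc.2 x (by simpa using hx))
  obtain ⟨h1, h2, h3, h4, h5, h6⟩ := ht
  refine ⟨?_, ?_, ?_, ?_, ?_, ?_⟩
  iterate 5 · rw [e _ (by simp)]; assumption
  rw [e' _ (by simp)]; assumption

/-- The member of the segment at the position that the counter shows. -/
abbrev IExp.cur : IExp := .get 40 (.var 52)

/-- Reads the end and the top of a segment and clears the arrays of the passes. -/
def setupProg : Prog :=
  (.ivar 48 (.get 41 (.var 47)) ;; .ivar 49 (.get 31 (.get 40 (.var 47))) ;;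
    .iset 42 (.var 49) 1 ;; .iset 43 (.var 49) 0 ;; .iset 44 (.var 49) 0 ;; .ivar 52 (.var 47)) ;;
  .loop (.ilt (.var 52) (.var 48))
    (.iset 42 .cur 1 ;; .iset 43 .cur 0 ;; .ivar 52 (.var 52 + 1))

/-- Computes the sizes of the branches. -/
def sizeProg : Prog :=
  .ivar 52 (.var 48) ;;
  .loop (.ilt (.var 47) (.var 52))
    (.ivar 52 (.var 52 - 1) ;; .iset 42 (.get 31 .cur) (.get 42 (.get 31 .cur) + .get 42 .cur))

/-- Computes the centroid. -/
def centProg : Prog :=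
  (.ivar 50 (.var 49) ;; .ivar 52 (.var 47)) ;;
  .loop (.ilt (.var 52) (.var 48))
    (.ite (.ilt (2 * (.get 42 .cur - 1)) (.var 48 - .var 47)) .skip (.ivar 50 .cur) ;;
      .ivar 52 (.var 52 + 1))

/-- Flags the ancestors of the centroid. -/
def flagProg : Prog :=
  (.iset 43 (.var 50) 1 ;; .ivar 52 (.var 48)) ;;
  .loop (.ilt (.var 47) (.var 52))
    (.ivar 52 (.var 52 - 1) ;; .ite (.ieq (.get 43 .cur) 1) (.iset 43 (.get 31 .cur) 1) .skip)

/-- Decides the mark of a vertex. -/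
def markStep : Prog :=
  .ite (.ieq (.get 31 .cur) (.var 50))
    (.ite (.ilt (3 * .var 51) (.var 48 - .var 47))
      (.iset 44 .cur 1 ;; .ivar 51 (.var 51 + .get 42 .cur)) (.iset 44 .cur 0))
    (.iset 44 .cur (.get 44 (.get 31 .cur)))

/-- Computes the distance of a vertex from the centroid. -/
def distStep : Prog :=
  .ite (.ieq (.get 43 .cur) 1) (.rset 40 .cur (.get 30 (.var 50) - .get 30 .cur))
    (.rset 40 .cur (.get 40 (.get 31 .cur) + (.get 30 .cur - .get 30 (.get 31 .cur))))

/-- Marks the branches at the centroid and computes the distances from the centroid. -/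
def markProg : Prog :=
  (.ivar 51 0 ;; .rset 40 (.var 49) (.get 30 (.var 50) - .get 30 (.var 49)) ;; .ivar 52 (.var 47)) ;;
  .loop (.ilt (.var 52) (.var 48)) (markStep ;; distStep ;; .ivar 52 (.var 52 + 1))

section Passes
variable {W n : ℕ} {par e : ℕ → ℕ} {dep : ℕ → ℝ} {st en t : ℕ}

theorem setupProg_spec {s : Mem} (hseg : Seg n par e st en t) (hR : RTree n par dep) (hlt : st < en)
    (hen : en < n) (hW : 4 * n + 10 < W) (h31 : s.ints 31 = par) (h40 : s.ints 40 = e)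
    (h47 : s.ints 47 0 = st) (h41 : s.ints 41 st = en) (h30 : s.reals 30 = dep) :
    Ends W setupProg s fun s' τ => τ ≤ 60 * (en - st) + 100 ∧ SegMem par e dep st en t s' ∧
      s'.ints 44 t = 0 ∧ ∀ x, InSeg e st en t x → s'.ints 42 x = 1 ∧ s'.ints 43 x = 0 := by
  set init : Prog := .ivar 48 (.get 41 (.var 47)) ;; .ivar 49 (.get 31 (.get 40 (.var 47))) ;;
    .iset 42 (.var 49) 1 ;; .iset 43 (.var 49) 0 ;; .iset 44 (.var 49) 0 ;; .ivar 52 (.var 47)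
    with hinit
  have htop := hseg.top_eq hR hlt
  have h1W : 1 % W = 1 := Nat.mod_eq_of_lt (by omega)
  refine .seq (.flat rfl fun t1 ht1 => ?_)
  have e1 : init.time ≤ 60 := by decide
  have hm : SegMem par e dep st en t (Prog.exec W init s) := by
    refine ⟨?_, ?_, ?_, ?_, ?_, ?_⟩
    · rw [(exec_same W init s).int 31, h31]
    · rw [(exec_same W init s).int 40, h40]
    · rw [(exec_same W init s).int 47, h47]
    · simp [init, Prog.exec, h47, h41]
    · simp [init, Prog.exec, h31, h40, h47, htop]
    · rw [(exec_same W init s).real 30, h30]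
  have i1 : (Prog.exec W init s).ints 42 t = 1 := by
    simp [init, Prog.exec, h31, h40, h47, htop, h1W]
  have i2 : (Prog.exec W init s).ints 43 t = 0 := by
    simp [init, Prog.exec, h31, h40, h47, htop]
  have i3 : (Prog.exec W init s).ints 44 t = 0 := by
    simp [init, Prog.exec, h31, h40, h47, htop]
  have i4 : (Prog.exec W init s).ints 52 0 = st := by simp [init, Prog.exec, h47]
  rw [← hinit] at ht1
  generalize Prog.exec W _ s = s1 at hm i1 i2 i3 i4
  refine (Ends.count_flat (fun i s' => SegMem par e dep st en t s' ∧ s'.ints 52 0 = i ∧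
    s'.ints 42 t = 1 ∧ s'.ints 43 t = 0 ∧ s'.ints 44 t = 0 ∧
    ∀ j, st ≤ j → j < i → s'.ints 42 (e j) = 1 ∧ s'.ints 43 (e j) = 0) 40 st en hlt.le
    ⟨hm, i4, i1, i2, i3, fun j h1 h2 => by omega⟩ ?_ ?_).mono ?_
  · rintro i s' hi ⟨j1, j2, -⟩
    simp [j1.en_eq, j2]
  · rintro i s' hi ⟨j1, j2, j3, j4, j5, j6⟩ hs
    by_cases hst : st ≤ i
    · have ht := (hseg.top_lt i hst hi).ne
      refine ⟨j1.of_same (exec_same W _ s'), ?_, ?_, ?_, ?_, ?_⟩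
      · simp (disch := omega) [Prog.exec, j2, Nat.mod_eq_of_lt]
      · simp [Prog.exec, j1.e_eq, j2, j3, ht]
      · simp [Prog.exec, j1.e_eq, j2, j4, ht]
      · simp [Prog.exec, j5]
      · intro j h1 h2
        by_cases hj : j = i
        · simp [Prog.exec, j1.e_eq, j2, hj, h1W]
        · have hne := (hseg.mono j i h1 (by omega) hi).ne
          simpa [Prog.exec, j1.e_eq, j2, hne] using j6 j h1 (by omega)
    · refine ⟨j1.of_same (exec_same W _ s'), ?_, ?_, ?_, ?_, fun j h1 h2 => by omega⟩
      · simp (disch := omega) [Prog.exec, j2, Nat.mod_eq_of_lt]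
      · simp [Prog.exec, j1.e_eq, j2, j3, h1W]
      · simp [Prog.exec, j1.e_eq, j2, j4]
      · simp [Prog.exec, j5]
  · rintro s2 t2 - ⟨⟨j1, j2, j3, j4, j5, j6⟩, ht2⟩
    refine ⟨by omega, j1, j5, ?_⟩
    rintro x (rfl | ⟨j, h1, h2, rfl⟩)
    · exact ⟨j3, j4⟩
    · exact j6 j h1 h2

/-- The branches at the children of `x` are disjoint: the children are among the highest members of
the set of vertices above `x` in the numbering, so `sum_roots` bounds their sizes together. This
excludes overflow. -/
theorem sum_children_le {F : ℕ → ℕ} (hseg : Seg n par e st en t) (hR : RTree n par dep) {i : ℕ}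
    (hi : st ≤ i) (hF : ∀ j, i ≤ j → j < en →
      F (e j) = 1 + ∑ k ∈ Finset.Ico i en, if par (e k) = e j then F (e k) else 0) (x : ℕ) :
    (∑ k ∈ Finset.Ico i en, if par (e k) = x then F (e k) else 0) ≤ en - i := by
  classical
  have hI := fun j (hj : j ∈ Finset.Ico i en) => Finset.mem_Ico.1 hj
  have hlt : ∀ j ∈ Finset.Ico i en, par (e j) < e j := fun j hj => by
    have := hI j hj
    have := hseg.top_lt j (by omega) (by omega)
    exact hR.par_lt _ (by omega) (hseg.lt j (by omega) (by omega))
  have key := sum_roots (sz := F) (par := par) (I := Finset.Ico i en)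
    (fun j hj k hk h => hseg.inj (by have := hI j hj; omega) (hI j hj).2
      (by have := hI k hk; omega) (hI k hk).2 h) (fun j hj => hF j (hI j hj).1 (hI j hj).2)
    (fun y => (∃ j ∈ Finset.Ico i en, e j = y) ∧ x < y) (fun j _ h => h.1)
    (fun j hj h => ⟨⟨j, hj, rfl⟩, h.2.trans (hlt j hj)⟩)
  have h1 := Finset.card_filter_le (Finset.Ico i en)
    fun j => (∃ k ∈ Finset.Ico i en, e k = e j) ∧ x < e j
  rw [Nat.card_Ico] at h1
  refine le_trans (Finset.sum_le_sum fun k hk => ?_) (key.le.trans h1)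
  by_cases h2 : par (e k) = x
  · rw [if_pos h2, if_pos ⟨⟨⟨k, hk, rfl⟩, h2 ▸ hlt k hk⟩, fun h3 => h3.2.ne h2.symm⟩]
  · rw [if_neg h2]
    exact Nat.zero_le _

theorem sizeProg_spec {s : Mem} (hseg : Seg n par e st en t) (hR : RTree n par dep) (hlt : st < en)
    (hen : en < n) (hW : 4 * n + 10 < W) (hm : SegMem par e dep st en t s)
    (h1 : ∀ x, InSeg e st en t x → s.ints 42 x = 1) :
    Ends W sizeProg s fun s' τ => τ ≤ 60 * (en - st) + 100 ∧ SegMem par e dep st en t s' ∧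
      ∀ x, InSeg e st en t x → s'.ints 42 x =
        1 + ∑ k ∈ Finset.Ico st en, if par (e k) = x then s'.ints 42 (e k) else 0 := by
  refine .seq (.flat rfl fun t1 ht1 => ?_)
  have e1 : (Prog.ivar 52 (.var 48)).time ≤ 10 := by decide
  have hs1 := exec_same W (.ivar 52 (.var 48)) s
  have i1 : (Prog.exec W (.ivar 52 (.var 48)) s).ints 52 0 = en := by simp [Prog.exec, hm.en_eq]
  have hm1 := hm.of_same hs1
  generalize Prog.exec W _ s = s1 at hs1 hm1 i1
  -- Positions are handled from the back, so all children of a vertex have been added to it before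
  -- its own size is passed on. After `q` rounds the recursion holds for the children from position
  -- `en - q` on.
  refine (Ends.count_flat (fun q s' => SegMem par e dep st en t s' ∧ s'.ints 52 0 = en - q ∧
    ∀ x, InSeg e st en t x → s'.ints 42 x =
      1 + ∑ k ∈ Finset.Ico (en - q) en, if par (e k) = x then s'.ints 42 (e k) else 0) 60 0 (en - st)
    (Nat.zero_le _) ⟨hm1, i1, ?_⟩ ?_ ?_).mono ?_
  · intro x hx
    rw [hs1.int 42, h1 x hx]
    simp
  · rintro q s' hq ⟨j1, j2, -⟩
    simp [j1.st_eq, j2]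
    omega
  · rintro q s' hq ⟨j1, j2, j3⟩ -
    obtain ⟨i, hi⟩ : ∃ i, en - q = i + 1 := ⟨en - q - 1, by omega⟩
    have hi' : en - (q + 1) = i := by omega
    rw [hi] at j2 j3
    rw [hi']
    have hist : st ≤ i := by omega
    have hien : i < en := by omega
    have hb := sum_children_le hseg hR (i := i + 1) (F := s'.ints 42) (by omega)
      (fun j h2 h3 => j3 _ (.inr ⟨j, by omega, h3, rfl⟩))
    have hy : InSeg e st en t (e i) := .inr ⟨i, hist, hien, rfl⟩
    have hp : InSeg e st en t (par (e i)) := hseg.par_mem i hist hien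
    have b1 := hb (e i)
    have b2 := hb (par (e i))
    have c1 := j3 _ hy
    have c2 := j3 _ hp
    -- The parent is the top or stands before position `i`, so the update leaves the sizes of the
    -- later members unchanged.
    have hne : ∀ k, i ≤ k → k < en → e k ≠ par (e i) := by
      intro k h2 h3 h4
      rcases hseg.par_pos hR hist hien with h5 | ⟨j, h5, h6, h7⟩
      · have := hseg.top_lt k (by omega) h3; omega
      · have := hseg.inj h5 (by omega) (by omega) h3 (h7.trans h4.symm)
        omega
    have hval : ∀ x, (Prog.exec W (.ivar 52 (.var 52 - 1) ;; .iset 42 (.get 31 .cur)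
        (.get 42 (.get 31 .cur) + .get 42 .cur)) s').ints 42 x =
        if x = par (e i) then s'.ints 42 (par (e i)) + s'.ints 42 (e i) else s'.ints 42 x := by
      intro x
      simp (disch := omega) [Prog.exec, j1.e_eq, j1.par_eq, j2, Nat.mod_eq_of_lt]
    refine ⟨j1.of_same (exec_same W _ s'), ?_, ?_⟩
    · simp (disch := omega) [Prog.exec, j2, Nat.mod_eq_of_lt]
    · intro x hx
      have hsum : ∑ k ∈ Finset.Ico i en, (if par (e k) = x then (Prog.exec W (.ivar 52 (.var 52 - 1) ;;
          .iset 42 (.get 31 .cur) (.get 42 (.get 31 .cur) + .get 42 .cur)) s').ints 42 (e k) else 0) =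
          ∑ k ∈ Finset.Ico i en, if par (e k) = x then s'.ints 42 (e k) else 0 := by
        refine Finset.sum_congr rfl fun k hk => ?_
        rw [Finset.mem_Ico] at hk
        rw [hval, if_neg (hne k hk.1 hk.2)]
      rw [hsum, hval, Finset.sum_eq_sum_Ico_succ_bot hien]
      by_cases hxp : x = par (e i)
      · rw [if_pos hxp, if_pos hxp.symm, c2, hxp]
        ring
      · rw [if_neg hxp, if_neg (Ne.symm hxp), j3 x hx, zero_add]
  · rintro s2 t2 - ⟨⟨j1, j2, j3⟩, ht2⟩
    rw [show en - (en - st) = st by omega] at j3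
    exact ⟨by omega, j1, j3⟩

/-- The centroid is the last vertex with at least half of the edges below it. Its children have
larger numbers, so each of them was tested later and rejected. The top always qualifies. -/
theorem centProg_spec {s : Mem} {sz : ℕ → ℕ} (hseg : Seg n par e st en t) (hR : RTree n par dep)
    (hlt : st < en) (hen : en < n) (hW : 4 * n + 10 < W) (hm : SegMem par e dep st en t s)
    (hs42 : s.ints 42 = sz) (hsz : ∀ x, InSeg e st en t x → sz x =
        1 + ∑ k ∈ Finset.Ico st en, if par (e k) = x then sz (e k) else 0) :
    Ends W centProg s fun s' τ => τ ≤ 60 * (en - st) + 100 ∧ SegMem par e dep st en t s' ∧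
      ∃ c, s'.ints 50 0 = c ∧ InSeg e st en t c ∧ en - st ≤ 2 * (sz c - 1) ∧
        ∀ i, st ≤ i → i < en → par (e i) = c → 2 * (sz (e i) - 1) < en - st := by
  have hb := sum_children_le hseg hR (i := st) (F := sz) le_rfl
    fun j h2 h3 => hsz _ (.inr ⟨j, h2, h3, rfl⟩)
  -- All members lie below the top; `sum_roots` is applied to the set of all of them.
  have htop : sz t = 1 + (en - st) := by
    have key := sum_roots (sz := sz) (par := par) (I := Finset.Ico st en)
      (fun j hj k hk h => hseg.inj (Finset.mem_Ico.1 hj).1 (Finset.mem_Ico.1 hj).2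
        (Finset.mem_Ico.1 hk).1 (Finset.mem_Ico.1 hk).2 h)
      (fun j hj => hsz _ (.inr ⟨j, (Finset.mem_Ico.1 hj).1, (Finset.mem_Ico.1 hj).2, rfl⟩))
      (fun y => y ≠ t) (fun j hj h => by
        obtain ⟨k, h1, h2, h3⟩ := (hseg.par_mem j (Finset.mem_Ico.1 hj).1
          (Finset.mem_Ico.1 hj).2).resolve_left h
        exact ⟨k, Finset.mem_Ico.2 ⟨h1, h2⟩, h3⟩)
      (fun j hj _ => (hseg.top_lt j (Finset.mem_Ico.1 hj).1 (Finset.mem_Ico.1 hj).2).ne')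
    rw [Finset.filter_true_of_mem fun j hj =>
      (hseg.top_lt j (Finset.mem_Ico.1 hj).1 (Finset.mem_Ico.1 hj).2).ne', Nat.card_Ico] at key
    rw [hsz t (.inl rfl), ← key]
    congr 1
    refine Finset.sum_congr rfl fun k hk => ?_
    have := (hseg.top_lt k (Finset.mem_Ico.1 hk).1 (Finset.mem_Ico.1 hk).2).ne'
    simp [this]
  refine .seq (.flat rfl fun t1 ht1 => ?_)
  have e1 : Prog.time (.ivar 50 (.var 49) ;; .ivar 52 (.var 47)) ≤ 20 := by decide
  have hs1 := exec_same W (.ivar 50 (.var 49) ;; .ivar 52 (.var 47)) s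
  have i1 : (Prog.exec W (.ivar 50 (.var 49) ;; .ivar 52 (.var 47)) s).ints 52 0 = st := by
    simp [Prog.exec, hm.st_eq]
  have i2 : (Prog.exec W (.ivar 50 (.var 49) ;; .ivar 52 (.var 47)) s).ints 50 0 = t := by
    simp [Prog.exec, hm.t_eq]
  have hm1 := hm.of_same hs1
  generalize Prog.exec W _ s = s1 at hs1 hm1 i1 i2
  refine (Ends.count_flat (fun i s' => SegMem par e dep st en t s' ∧ s'.ints 52 0 = i ∧ st ≤ i ∧
    InSeg e st i t (s'.ints 50 0) ∧ en - st ≤ 2 * (sz (s'.ints 50 0) - 1) ∧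
    ∀ j, st ≤ j → j < i → s'.ints 50 0 < e j → 2 * (sz (e j) - 1) < en - st) 60 st en hlt.le
    ⟨hm1, i1, le_rfl, .inl i2, by rw [i2, htop]; omega, fun j h1 h2 => by omega⟩ ?_ ?_).mono ?_
  · rintro i s' hi ⟨j1, j2, -⟩
    simp [j1.en_eq, j2]
  · rintro i s' hi ⟨j1, j2, j3, j4, j5, j6⟩ hs
    have hs2 : s'.ints 42 = sz := by rw [hs.int 42, hs1.int 42, hs42]
    have b1 := hb (e i)
    have c1 := hsz (e i) (.inr ⟨i, j3, hi, rfl⟩)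
    have hiff : BExp.Holds W s' (.ilt (2 * (.get 42 .cur - 1)) (.var 48 - .var 47)) ↔
        2 * (sz (e i) - 1) < en - st := by
      simp (disch := omega) [j1.e_eq, j1.en_eq, j1.st_eq, j2, hs2, Nat.mod_eq_of_lt]
    refine ⟨j1.of_same (exec_same W _ s'), ?_, by omega, ?_⟩
    · by_cases hc : 2 * (sz (e i) - 1) < en - st
      · simp only [Prog.exec, if_pos (hiff.2 hc)]
        simp (disch := omega) [j2, Nat.mod_eq_of_lt]
      · simp only [Prog.exec, if_neg (mt hiff.1 hc)]
        simp (disch := omega) [j2, Nat.mod_eq_of_lt]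
    by_cases hc : 2 * (sz (e i) - 1) < en - st
    · have h50 : (Prog.exec W (.ite (.ilt (2 * (.get 42 .cur - 1)) (.var 48 - .var 47)) .skip
          (.ivar 50 .cur) ;; .ivar 52 (.var 52 + 1)) s').ints 50 0 = s'.ints 50 0 := by
        simp only [Prog.exec, if_pos (hiff.2 hc)]
        simp
      rw [h50]
      refine ⟨j4.imp_right ?_, j5, fun j h1 h2 h3 => ?_⟩
      · rintro ⟨j, h1, h2, h3⟩
        exact ⟨j, h1, by omega, h3⟩
      · rcases Nat.lt_succ_iff_lt_or_eq.1 h2 with h4 | rfl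
        · exact j6 j h1 h4 h3
        · exact hc
    · have h50 : (Prog.exec W (.ite (.ilt (2 * (.get 42 .cur - 1)) (.var 48 - .var 47)) .skip
          (.ivar 50 .cur) ;; .ivar 52 (.var 52 + 1)) s').ints 50 0 = e i := by
        simp only [Prog.exec, if_neg (mt hiff.1 hc)]
        simp [j1.e_eq, j2]
      rw [h50]
      refine ⟨.inr ⟨i, j3, by omega, rfl⟩, by omega, fun j h1 h2 h3 => ?_⟩
      have := (hseg.mono_iff j3 hi h1 (by omega)).1 h3
      omega
  · rintro s2 t2 - ⟨⟨j1, j2, j3, j4, j5, j6⟩, ht2⟩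
    refine ⟨by omega, j1, _, rfl, j4, j5, fun i h1 h2 h3 => j6 i h1 h2 ?_⟩
    rw [← h3]
    exact hR.par_lt _ (by have := hseg.top_lt i h1 h2; omega) (hseg.lt i h1 h2)

theorem flagProg_spec {s : Mem} {c : ℕ} (hseg : Seg n par e st en t) (hR : RTree n par dep)
    (hlt : st < en) (hen : en < n) (hW : 4 * n + 10 < W) (hm : SegMem par e dep st en t s)
    (h50 : s.ints 50 0 = c) (hc : InSeg e st en t c)
    (h43 : ∀ x, InSeg e st en t x → s.ints 43 x = 0) :
    Ends W flagProg s fun s' τ => τ ≤ 60 * (en - st) + 100 ∧ SegMem par e dep st en t s' ∧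
      ∀ x, InSeg e st en t x → (s'.ints 43 x = 1 ↔ Anc par x c) := by
  have h1W : 1 % W = 1 := Nat.mod_eq_of_lt (by omega)
  refine .seq (.flat rfl fun t1 ht1 => ?_)
  have e1 : Prog.time (.iset 43 (.var 50) 1 ;; .ivar 52 (.var 48)) ≤ 20 := by decide
  have hs1 := exec_same W (.iset 43 (.var 50) 1 ;; .ivar 52 (.var 48)) s
  have i1 : (Prog.exec W (.iset 43 (.var 50) 1 ;; .ivar 52 (.var 48)) s).ints 52 0 = en := by
    simp [Prog.exec, hm.en_eq]
  have i2 : ∀ x, (Prog.exec W (.iset 43 (.var 50) 1 ;; .ivar 52 (.var 48)) s).ints 43 x =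
      if x = c then 1 else s.ints 43 x := by
    intro x
    simp [Prog.exec, h50, h1W]
  have hm1 := hm.of_same hs1
  generalize Prog.exec W _ s = s1 at hs1 hm1 i1 i2
  refine (Ends.count_flat (fun q s' => SegMem par e dep st en t s' ∧ s'.ints 52 0 = en - q ∧
    s'.ints 43 c = 1 ∧ (∀ i, en - q ≤ i → i < en → s'.ints 43 (e i) = 1 → s'.ints 43 (par (e i)) = 1) ∧
    (∀ x, InSeg e st en t x → s'.ints 43 x = 1 →
      x = c ∨ ∃ i, st ≤ i ∧ i < en ∧ par (e i) = x ∧ s'.ints 43 (e i) = 1)) 60 0 (en - st)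
    (Nat.zero_le _) ⟨hm1, i1, by rw [i2, if_pos rfl], fun i h1 h2 => by omega, ?_⟩ ?_ ?_).mono ?_
  · intro x hx hF
    rw [i2] at hF
    by_contra hn
    push Not at hn
    rw [if_neg hn.1, h43 x hx] at hF
    omega
  · rintro q s' hq ⟨j1, j2, -⟩
    simp [j1.st_eq, j2]
    omega
  · rintro q s' hq ⟨j1, j2, j3, j4, j5⟩ -
    obtain ⟨i, hi⟩ : ∃ i, en - q = i + 1 := ⟨en - q - 1, by omega⟩
    have hi' : en - (q + 1) = i := by omega
    rw [hi] at j2 j4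
    rw [hi']
    have hist : st ≤ i := by omega
    have hien : i < en := by omega
    have hval : ∀ x, (Prog.exec W (.ivar 52 (.var 52 - 1) ;;
        .ite (.ieq (.get 43 .cur) 1) (.iset 43 (.get 31 .cur) 1) .skip) s').ints 43 x =
        if s'.ints 43 (e i) = 1 ∧ x = par (e i) then 1 else s'.ints 43 x := by
      intro x
      by_cases hF : s'.ints 43 (e i) = 1
      · simp [Prog.exec, j1.e_eq, j1.par_eq, j2, h1W, hF]
      · simp [Prog.exec, j1.e_eq, j1.par_eq, j2, h1W, hF]
    have hmono : ∀ x, s'.ints 43 x = 1 → (Prog.exec W (.ivar 52 (.var 52 - 1) ;;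
        .ite (.ieq (.get 43 .cur) 1) (.iset 43 (.get 31 .cur) 1) .skip) s').ints 43 x = 1 := by
      intro x hx
      rw [hval]
      split_ifs
      · rfl
      · exact hx
    have hne : ∀ k, i ≤ k → k < en → e k ≠ par (e i) := by
      intro k h2 h3 h4
      rcases hseg.par_pos hR hist hien with h5 | ⟨j, h5, h6, h7⟩
      · have := hseg.top_lt k (by omega) h3; omega
      · have := hseg.inj h5 (by omega) (by omega) h3 (h7.trans h4.symm)
        omega
    refine ⟨j1.of_same (exec_same W _ s'), ?_, hmono _ j3, ?_, ?_⟩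
    · by_cases hF : s'.ints 43 (e i) = 1
      · simp [Prog.exec, j1.e_eq, j1.par_eq, j2, h1W, hF]
      · simp [Prog.exec, j1.e_eq, j1.par_eq, j2, h1W, hF]
    · intro k h2 h3 h4
      rw [hval, if_neg fun h => hne k h2 h3 h.2] at h4
      rcases h2.lt_or_eq with h5 | rfl
      · exact hmono _ (j4 k h5 h3 h4)
      · rw [hval, if_pos ⟨h4, rfl⟩]
    · intro x hx h4
      rw [hval] at h4
      split_ifs at h4 with h5
      · exact .inr ⟨i, hist, hien, h5.2.symm, hmono _ h5.1⟩
      · refine (j5 x hx h4).imp_right ?_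
        rintro ⟨k, h6, h7, h8, h9⟩
        exact ⟨k, h6, h7, h8, hmono _ h9⟩
  · rintro s2 t2 - ⟨⟨j1, j2, j3, j4, j5⟩, ht2⟩
    rw [show en - (en - st) = st by omega] at j4
    exact ⟨by omega, j1, fun x hx => hseg.flag_iff hR hlt hc j3 j4 j5 hx⟩

/-- With `m` edges, branches are marked while `3 * acc < m`, and a branch at the centroid satisfies
`2 * sz ≤ m + 1`. The last addition therefore ends with `6 * acc ≤ 2 * (m - 1) + 3 * (m + 1) = 5 * m
+ 1`. Distances are computed downwards: an ancestor of `c` takes a difference of depths, any other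
vertex extends the distance of its parent. -/
theorem markProg_spec {s : Mem} {sz : ℕ → ℕ} {c : ℕ} (hseg : Seg n par e st en t)
    (hR : RTree n par dep) (hlt : st < en) (hen : en < n) (hW : 4 * n + 10 < W)
    (hm : SegMem par e dep st en t s)
    (hs42 : s.ints 42 = sz) (hsz : ∀ x, InSeg e st en t x → sz x =
        1 + ∑ k ∈ Finset.Ico st en, if par (e k) = x then sz (e k) else 0)
    (h50 : s.ints 50 0 = c) (hc : InSeg e st en t c) (hbig : en - st ≤ 2 * (sz c - 1))
    (hsmall : ∀ i, st ≤ i → i < en → par (e i) = c → 2 * (sz (e i) - 1) < en - st)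
    (h43 : ∀ x, InSeg e st en t x → (s.ints 43 x = 1 ↔ Anc par x c)) (h44 : s.ints 44 t = 0) :
    Ends W markProg s fun s' τ => τ ≤ 150 * (en - st) + 200 ∧ SegMem par e dep st en t s' ∧
      s'.ints 50 0 = c ∧ (∃ acc, Split par e st en t c acc sz (s'.ints 44)) ∧
      ∀ x, InSeg e st en t x → s'.reals 40 x = rd par dep c x := by
  have h1W : 1 % W = 1 := Nat.mod_eq_of_lt (by omega)
  have hcn := hseg.inSeg_lt hlt hc
  set init : Prog := .ivar 51 0 ;; .rset 40 (.var 49) (.get 30 (.var 50) - .get 30 (.var 49)) ;;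
    .ivar 52 (.var 47) with hinit
  refine .seq (.flat rfl fun t1 ht1 => ?_)
  have e1 : init.time ≤ 30 := by decide
  have hs1 : Same _ s _ := exec_same W init s
  have hm1 := hm.of_same hs1
  have i1 : (Prog.exec W init s).ints 52 0 = st := by simp [init, Prog.exec, hm.st_eq]
  have i2 : (Prog.exec W init s).ints 51 0 = 0 := by simp [init, Prog.exec]
  have i3 : (Prog.exec W init s).reals 40 t = rd par dep c t := by
    rw [rd_comm, hR.rd_anc ?_ hcn]
    · simp [init, Prog.exec, hm.t_eq, hm.dep_eq, h50]
    · have htt : ∀ x, InSeg e st en t x → Anc par t x := by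
        rintro x (rfl | ⟨j, h1, h2, rfl⟩)
        · exact .refl
        · induction j using Nat.strong_induction_on with
          | _ j ih =>
            refine .step _ (by have := hseg.top_lt j h1 h2; omega) ?_
            rcases hseg.par_pos hR h1 h2 with h3 | ⟨k, h3, h4, h5⟩
            · rw [h3]; exact .refl
            · rw [← h5]; exact ih k h4 h3 (by omega)
      exact htt c hc
  rw [← hinit] at ht1
  generalize Prog.exec W _ s = s1 at hs1 hm1 i1 i2 i3
  refine (Ends.count_flat (fun i s' => (SegMem par e dep st en t s' ∧ s'.ints 52 0 = i ∧ st ≤ i ∧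
      s'.reals 40 t = rd par dep c t ∧
      ∀ j, st ≤ j → j < i → s'.reals 40 (e j) = rd par dep c (e j)) ∧
    s'.ints 44 t = 0 ∧ (∀ j, st ≤ j → j < i → s'.ints 44 (e j) ≤ 1) ∧
    (∀ j, st ≤ j → j < i → par (e j) ≠ c → s'.ints 44 (e j) = s'.ints 44 (par (e j))) ∧
    s'.ints 51 0 = (∑ k ∈ Finset.Ico st i,
      if par (e k) = c ∧ s'.ints 44 (e k) = 1 then sz (e k) else 0) ∧
    6 * s'.ints 51 0 ≤ 5 * (en - st) + 1 ∧
    (3 * s'.ints 51 0 < en - st → ∀ j, st ≤ j → j < i → par (e j) = c → s'.ints 44 (e j) = 1))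
    130 st en hlt.le
    ⟨⟨hm1, i1, le_rfl, i3, fun j h1 h2 => by omega⟩, by rw [hs1.int 44, h44], fun j h1 h2 => by omega,
      fun j h1 h2 => by omega, by simp [i2], by omega, fun _ j h1 h2 => by omega⟩ ?_ ?_).mono ?_
  · rintro i s' hi ⟨⟨j1, j2, -⟩, -⟩
    simp [j1.en_eq, j2]
  · rintro i s' hi ⟨⟨j1, j2, j3, j4, j5⟩, k1, k2, k3, k4, k5, k6⟩ hs
    have g42 : s'.ints 42 = sz := by rw [hs.int 42, hs1.int 42, hs42]
    have g43 : s'.ints 43 = s.ints 43 := by rw [hs.int 43, hs1.int 43]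
    have g50 : s'.ints 50 0 = c := by rw [hs.int 50, hs1.int 50, h50]
    have hy : InSeg e st en t (e i) := .inr ⟨i, j3, hi, rfl⟩
    have hnt : e i ≠ t := (hseg.top_lt i j3 hi).ne'
    have hnj : ∀ j, st ≤ j → j < i → e j ≠ e i := fun j h1 h2 => (hseg.mono j i h1 h2 hi).ne
    have hpn : ∀ j, st ≤ j → j ≤ i → par (e j) ≠ e i := by
      intro j h1 h2
      rcases hseg.par_pos hR h1 (by omega) with h3 | ⟨k, h3, h4, h5⟩
      · rw [h3]; exact hnt.symm
      · rw [← h5]; exact hnj k h3 (by omega)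
    have hszle : sz (e i) ≤ 1 + (en - st) := by
      rw [hsz _ hy]
      exact Nat.add_le_add_left (sum_children_le hseg hR le_rfl
        (fun j h2 h3 => hsz _ (.inr ⟨j, h2, h3, rfl⟩)) _) 1
    obtain ⟨val, acc, ha, hv1, hv2, hv3, hv4, hv5, hv6⟩ : ∃ val acc,
        acc = s'.ints 51 0 + (if par (e i) = c ∧ val = 1 then sz (e i) else 0) ∧ val ≤ 1 ∧
        (par (e i) ≠ c → val = s'.ints 44 (par (e i))) ∧ 6 * acc ≤ 5 * (en - st) + 1 ∧
        (3 * acc < en - st → par (e i) = c → val = 1) ∧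
        (∀ x, (Prog.exec W markStep s').ints 44 x = if x = e i then val else s'.ints 44 x) ∧
        (Prog.exec W markStep s').ints 51 0 = acc := by
      by_cases hpc : par (e i) = c
      · have hsm := hsmall i j3 hi hpc
        by_cases hac : 3 * s'.ints 51 0 < en - st
        · refine ⟨1, s'.ints 51 0 + sz (e i), by simp [hpc], le_rfl, fun h => absurd hpc h, by omega,
            fun _ _ => rfl, fun x => ?_, ?_⟩
          · simp (disch := omega) [markStep, Prog.exec, j1.e_eq, j1.par_eq, j1.st_eq, j1.en_eq, j2, g50,
              hpc, hac, h1W, Nat.mod_eq_of_lt]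
          · simp (disch := omega) [markStep, Prog.exec, j1.e_eq, j1.par_eq, j1.st_eq, j1.en_eq, j2, g50,
              hpc, hac, h1W, g42, Nat.mod_eq_of_lt]
        · refine ⟨0, s'.ints 51 0, by simp, Nat.zero_le _, fun h => absurd hpc h, k5,
            fun h => absurd h hac, fun x => ?_, ?_⟩
          · simp (disch := omega) [markStep, Prog.exec, j1.e_eq, j1.par_eq, j1.st_eq, j1.en_eq, j2, g50,
              hpc, hac, h1W, Nat.mod_eq_of_lt]
          · simp (disch := omega) [markStep, Prog.exec, j1.e_eq, j1.par_eq, j1.st_eq, j1.en_eq, j2, g50,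
              hpc, hac, h1W, g42, Nat.mod_eq_of_lt]
      · have hle : s'.ints 44 (par (e i)) ≤ 1 := by
          rcases hseg.par_pos hR j3 hi with h3 | ⟨k, h3, h4, h5⟩
          · rw [h3, k1]; omega
          · rw [← h5]; exact k2 k h3 h4
        refine ⟨s'.ints 44 (par (e i)), s'.ints 51 0, by simp [hpc], hle, fun _ => rfl, k5,
          fun _ h => absurd h hpc, fun x => ?_, ?_⟩
        · simp [markStep, Prog.exec, j1.e_eq, j1.par_eq, j2, g50, hpc]
        · simp [markStep, Prog.exec, j1.e_eq, j1.par_eq, j2, g50, hpc]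
    have hsa := exec_same W markStep s'
    have hma := j1.of_same hsa
    have a52 : (Prog.exec W markStep s').ints 52 0 = i := by
      by_cases hpc : par (e i) = c
      · by_cases hac : 3 * s'.ints 51 0 < en - st <;>
          simp (disch := omega) [markStep, Prog.exec, j1.e_eq, j1.par_eq, j1.st_eq, j1.en_eq, j2, g50,
              hpc, hac, h1W, Nat.mod_eq_of_lt]
      · simp [markStep, Prog.exec, j1.e_eq, j1.par_eq, j2, g50, hpc]
    change (_ ∧ _) ∧ _
    simp only [show ∀ q r, Prog.exec W (markStep ;; q ;; r) s' =
      Prog.exec W r (Prog.exec W q (Prog.exec W markStep s')) from fun _ _ => rfl]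
    generalize Prog.exec W markStep s' = sa at hsa hma hv5 hv6 a52
    have b43 : sa.ints 43 = s.ints 43 := by rw [hsa.int 43, g43]
    have b50 : sa.ints 50 0 = c := by rw [hsa.int 50, g50]
    have hdist : ∀ x, (Prog.exec W distStep sa).reals 40 x =
        if x = e i then rd par dep c (e i) else s'.reals 40 x := by
      intro x
      by_cases hF : Anc par (e i) c
      · have := (h43 _ hy).2 hF
        rw [rd_comm, hR.rd_anc hF hcn]
        simp [distStep, Prog.exec, hma.e_eq, hma.dep_eq, a52, b43, b50, this, h1W, hsa.real 40]
      · have hne := mt (h43 _ hy).1 hF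
        have hp : s'.reals 40 (par (e i)) = rd par dep c (par (e i)) := by
          rcases hseg.par_pos hR j3 hi with h3 | ⟨k, h3, h4, h5⟩
          · rw [h3, j4]
          · rw [← h5]; exact j5 k h3 h4
        rw [hseg.rd_step hR hlt hc j3 hi hF]
        simp [distStep, Prog.exec, hma.e_eq, hma.par_eq, hma.dep_eq, a52, b43, b50, hne, h1W,
          hsa.real 40, hp]
    have hsb := exec_same W distStep sa
    have hmb := hma.of_same hsb
    have b44 : ∀ x, (Prog.exec W distStep sa).ints 44 x = if x = e i then val else s'.ints 44 x := by
      intro x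
      rw [hsb.int 44, hv5]
    have b51 : (Prog.exec W distStep sa).ints 51 0 = acc := by rw [hsb.int 51, hv6]
    have b52 : (Prog.exec W distStep sa).ints 52 0 = i := by rw [hsb.int 52, a52]
    generalize Prog.exec W distStep sa = sb at hsb hmb hdist b44 b51 b52
    have hsc := exec_same W (.ivar 52 (.var 52 + 1)) sb
    have c44 : ∀ j, st ≤ j → j < i → sb.ints 44 (e j) = s'.ints 44 (e j) := fun j h1 h2 => by
      rw [b44, if_neg (hnj j h1 h2)]
    have c44p : ∀ j, st ≤ j → j ≤ i → sb.ints 44 (par (e j)) = s'.ints 44 (par (e j)) :=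
      fun j h1 h2 => by rw [b44, if_neg (hpn j h1 h2)]
    have c44i : sb.ints 44 (e i) = val := by rw [b44, if_pos rfl]
    refine ⟨⟨hmb.of_same hsc, ?_, by omega, ?_, ?_⟩, ?_⟩
    · simp (disch := omega) [Prog.exec, b52, Nat.mod_eq_of_lt]
    · rw [hsc.real 40, hdist, if_neg hnt.symm, j4]
    · intro j h1 h2
      rw [hsc.real 40, hdist]
      split_ifs with h3
      · rw [h3]
      · rcases Nat.lt_succ_iff_lt_or_eq.1 h2 with h4 | rfl
        · exact j5 j h1 h4
        · exact absurd rfl h3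
    rw [hsc.int 44, hsc.int 51, b51]
    refine ⟨by rw [b44, if_neg hnt.symm, k1], fun j h1 h2 => ?_, fun j h1 h2 h3 => ?_, ?_, hv3,
      fun h0 j h1 h2 h3 => ?_⟩
    · rcases Nat.lt_succ_iff_lt_or_eq.1 h2 with h4 | rfl
      · rw [c44 j h1 h4]; exact k2 j h1 h4
      · rw [c44i]; exact hv1
    · rcases Nat.lt_succ_iff_lt_or_eq.1 h2 with h4 | rfl
      · rw [c44 j h1 h4, c44p j h1 h4.le]; exact k3 j h1 h4 h3
      · rw [c44i, c44p j h1 le_rfl]; exact hv2 h3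
    · rw [Finset.sum_Ico_succ_top j3, c44i, ha, k4]
      congr 1
      refine Finset.sum_congr rfl fun k hk => ?_
      rw [Finset.mem_Ico] at hk
      rw [c44 k hk.1 hk.2]
    · rcases Nat.lt_succ_iff_lt_or_eq.1 h2 with h4 | rfl
      · rw [c44 j h1 h4]; exact k6 (by omega) j h1 h4 h3
      · rw [c44i]; exact hv4 h0 h3
  · rintro s2 t2 hs2 ⟨⟨⟨j1, j2, j3, j4, j5⟩, k1, k2, k3, k4, k5, k6⟩, ht2⟩
    refine ⟨by omega, j1, by rw [hs2.int 50, hs1.int 50, h50], ⟨_, hsz, hc, hbig, hsmall, k1, k2, k3,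
      k4, k5, k6⟩, ?_⟩
    rintro x (rfl | ⟨j, h1, h2, rfl⟩)
    · exact j4
    · exact j5 j h1 h2

end Passes

end PartialCenter

set_option linter.unusedSimpArgs false

namespace PartialCenter

/-! ## Listing the node of a segment -/

/-- Appends a vertex with its distance to the list that is to be sorted. -/
def pushProg (x : IExp) : Prog :=
  .rset 10 (.var 12) (.get 40 x) ;; .iset 10 (.var 12) x ;; .ivar 12 (.var 12 + 1)

/-- Prepares the lists. -/
def emitInit : Prog :=
  .ivar 12 0 ;; .ite (.ieq (.var 49) (.var 50)) .skip (pushProg (.var 49)) ;;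
  .iset 45 (.var 49) 0 ;; .ivar 53 (.var 47) ;; .ivar 54 0 ;; .ivar 55 (.get 64 (.var 65)) ;;
  .ivar 52 (.var 47)

/-- Treats one vertex: a marked vertex becomes a column of the node, the others except the centroid
become rows, and the unmarked vertices are moved to the front. -/
def emitStep : Prog :=
  .iset 45 .cur (.var 54) ;;
  .ite (.ieq (.get 44 .cur) 1)
    (.iset 62 (.var 55 + .var 54) .cur ;; .rset 61 (.var 55 + .var 54) (.get 40 .cur) ;;
      .ivar 54 (.var 54 + 1))
    (.ite (.ieq .cur (.var 50)) .skip (pushProg .cur) ;;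
      .iset 40 (.var 53) .cur ;; .ivar 53 (.var 53 + 1)) ;;
  .ivar 52 (.var 52 + 1)

/-- Lists the rows and the columns of the node of a segment. -/
def emitProg : Prog :=
  emitInit ;; .loop (.ilt (.var 52) (.var 48)) emitStep

/-- The rows of a node, with their distances from the centroid, among the first members of the
segment. -/
noncomputable def rowsOf (par e mk : ℕ → ℕ) (dep : ℕ → ℝ) (st i t c : ℕ) : Multiset (ℝ × ℕ) :=
  (if t = c then 0 else {(rd par dep c t, t)}) +
    ∑ k ∈ Finset.Ico st i, if mk (e k) = 1 ∨ e k = c then 0 else {(rd par dep c (e k), e k)}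

/-- The invariant of the listing. -/
structure EmitInv (par e mk : ℕ → ℕ) (dep : ℕ → ℝ) (st i t c o : ℕ) (s₀ s : Mem) (q r : ℕ) :
    Prop where
  st_le : st ≤ i
  i_eq : s.ints 52 0 = i
  q_eq : s.ints 53 0 = q
  r_eq : s.ints 54 0 = r
  o_eq : s.ints 55 0 = o
  qr : q + r = i
  st_le_q : st ≤ q
  rest : ∀ j, i ≤ j → s.ints 40 j = e j
  mono₁ : ∀ j j', st ≤ j → j < j' → j' < q → s.ints 40 j < s.ints 40 j'
  mem₁ : ∀ x, (∃ j, st ≤ j ∧ j < q ∧ s.ints 40 j = x) ↔ (∃ j, st ≤ j ∧ j < i ∧ e j = x) ∧ mk x ≠ 1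
  mono₂ : ∀ j j', j < j' → j' < r → s.ints 62 (o + j) < s.ints 62 (o + j')
  mem₂ : ∀ x, (∃ j, j < r ∧ s.ints 62 (o + j) = x) ↔ (∃ j, st ≤ j ∧ j < i ∧ e j = x) ∧ mk x = 1
  dist : ∀ j < r, s.reals 61 (o + j) = rd par dep c (s.ints 62 (o + j))
  old : ∀ j < o, s.ints 62 j = s₀.ints 62 j ∧ s.reals 61 j = s₀.reals 61 j
  pc_top : s.ints 45 t = 0
  pc_le : ∀ k, st ≤ k → k < i → s.ints 45 (e k) ≤ r
  pc_iff : ∀ k, st ≤ k → k < i → ∀ j < r, (j < s.ints 45 (e k) ↔ s.ints 62 (o + j) < e k)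
  card : r = ((Finset.Ico st i).filter fun k => mk (e k) = 1).card
  len_le : s.ints 12 0 ≤ 1 + (i - st)
  rows : items (s.recs 10) 0 (s.ints 12 0) = rowsOf par e mk dep st i t c

section Emit
variable {W n : ℕ} {par e mk : ℕ → ℕ} {dep : ℕ → ℝ} {st en t c o : ℕ}

theorem emitInit_spec {s : Mem} (hW : 4 * n + 10 < W)
    (hm : SegMem par e dep st en t s) (h50 : s.ints 50 0 = c) (h64 : s.ints 64 (s.ints 65 0) = o)
    (hdt : s.reals 40 t = rd par dep c t) :
    EmitInv par e mk dep st st t c o s (Prog.exec W emitInit s) st 0 := by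
  have h1W : 1 % W = 1 := Nat.mod_eq_of_lt (by omega)
  by_cases htc : t = c
  · constructor
    case rows =>
      simp [emitInit, pushProg, Prog.exec, hm.t_eq, h50, htc, rowsOf]
      rfl
    all_goals try simp [emitInit, pushProg, Prog.exec, hm.t_eq, hm.st_eq, hm.e_eq, h50, htc, h64,
      h1W]
    all_goals intros
    all_goals omega
  · constructor
    case rows =>
      rw [show (Prog.exec W emitInit s).ints 12 0 = 1 by
        simp [emitInit, pushProg, Prog.exec, hm.t_eq, h50, htc, h1W]]
      simp [emitInit, pushProg, Prog.exec, hm.t_eq, h50, htc, rowsOf, items, hdt]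
    all_goals try simp [emitInit, pushProg, Prog.exec, hm.t_eq, hm.st_eq, hm.e_eq, h50, htc, h64,
      h1W]
    all_goals intros
    all_goals omega

/-- The unmarked vertices are moved to position `q ≤ i`, never beyond the reading position, so the
array can be compacted in place. Since vertices come in increasing order, the number `r` of columns
listed so far is the number of columns below the present vertex. -/
theorem emitStep_spec {s₀ s : Mem} {i q r : ℕ} (hseg : Seg n par e st en t) (hW : 4 * n + 10 < W)
    (hoW : o + n < W) (hen : en < n) (hi : i < en) (h : EmitInv par e mk dep st i t c o s₀ s q r)
    (h50 : s.ints 50 0 = c) (h44 : s.ints 44 = mk)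
    (hdc : ∀ x, InSeg e st en t x → s.reals 40 x = rd par dep c x) :
    ∃ q' r', EmitInv par e mk dep st (i + 1) t c o s₀ (Prog.exec W emitStep s) q' r' := by
  have h1W : 1 % W = 1 := Nat.mod_eq_of_lt (by omega)
  have hist := h.st_le
  have hqr := h.qr
  have hqst := h.st_le_q
  have hei : s.ints 40 i = e i := h.rest i le_rfl
  have hdi : s.reals 40 (e i) = rd par dep c (e i) := hdc _ (.inr ⟨i, hist, hi, rfl⟩)
  have hnt : e i ≠ t := (hseg.top_lt i hist hi).ne'
  have hlt : ∀ x, (∃ j, st ≤ j ∧ j < i ∧ e j = x) → x < e i := by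
    rintro x ⟨j, h1, h2, rfl⟩
    exact hseg.mono j i h1 h2 hi
  have hex : ∀ x, (∃ j, st ≤ j ∧ j < i + 1 ∧ e j = x) ↔
      (∃ j, st ≤ j ∧ j < i ∧ e j = x) ∨ e i = x := by
    intro x
    constructor
    · rintro ⟨j, h1, h2, h3⟩
      rcases Nat.lt_succ_iff_lt_or_eq.1 h2 with h4 | rfl
      · exact .inl ⟨j, h1, h4, h3⟩
      · exact .inr h3
    · rintro (⟨j, h1, h2, h3⟩ | h3)
      · exact ⟨j, h1, by omega, h3⟩
      · exact ⟨i, hist, by omega, h3⟩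
  have hlen := h.len_le
  by_cases hmk : mk (e i) = 1
  · have a45 : ∀ x, (Prog.exec W emitStep s).ints 45 x = if x = e i then r else s.ints 45 x := by
      intro x; simp [emitStep, pushProg, Prog.exec, h.i_eq, h.r_eq, hei, h44, hmk, h1W]
    have a62 : ∀ x, (Prog.exec W emitStep s).ints 62 x = if x = o + r then e i else s.ints 62 x := by
      intro x
      simp (disch := omega) [emitStep, pushProg, Prog.exec, h.i_eq, h.r_eq, h.o_eq, hei, h44, hmk, h1W,
        Nat.mod_eq_of_lt]
    have a61 : ∀ x, (Prog.exec W emitStep s).reals 61 x =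
        if x = o + r then rd par dep c (e i) else s.reals 61 x := by
      intro x
      simp (disch := omega) [emitStep, pushProg, Prog.exec, h.i_eq, h.r_eq, h.o_eq, hei, h44, hmk, h1W,
        Nat.mod_eq_of_lt, hdi]
    have a40 : (Prog.exec W emitStep s).ints 40 = s.ints 40 := by
      funext x
      simp (disch := omega) [emitStep, pushProg, Prog.exec, h.i_eq, h.r_eq, h.o_eq, hei, h44, hmk, h1W,
        Nat.mod_eq_of_lt, hdi]
    have a10 : (Prog.exec W emitStep s).recs 10 = s.recs 10 := by
      funext x
      simp (disch := omega) [emitStep, pushProg, Prog.exec, h.i_eq, h.r_eq, h.o_eq, hei, h44, hmk, h1W,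
        Nat.mod_eq_of_lt, hdi]
    have a0 : (Prog.exec W emitStep s).ints 52 0 = i + 1 ∧ (Prog.exec W emitStep s).ints 53 0 = q ∧
        (Prog.exec W emitStep s).ints 54 0 = r + 1 ∧ (Prog.exec W emitStep s).ints 55 0 = o ∧
        (Prog.exec W emitStep s).ints 12 0 = s.ints 12 0 := by
      simp (disch := omega) [emitStep, pushProg, Prog.exec, h.i_eq, h.q_eq, h.r_eq, h.o_eq, hei, h44,
        hmk, h1W, Nat.mod_eq_of_lt, hdi]
    obtain ⟨a52, a53, a54, a55, a12⟩ := a0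
    generalize Prog.exec W emitStep s = s' at *
    have hne : ∀ j < r, o + j ≠ o + r := fun j hj => by omega
    refine ⟨q, r + 1, ⟨by omega, a52, a53, a54, a55, by omega, hqst, ?_, ?_, ?_, ?_, ?_, ?_, ?_, ?_, ?_,
      ?_, ?_, by omega, ?_⟩⟩
    · intro j hj
      rw [a40, h.rest j (by omega)]
    · rw [a40]
      exact h.mono₁
    · intro x
      rw [a40, h.mem₁, hex]
      constructor
      · exact fun h1 => ⟨.inl h1.1, h1.2⟩
      · rintro ⟨h1 | rfl, h2⟩
        · exact ⟨h1, h2⟩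
        · exact absurd hmk h2
    · intro j j' h1 h2
      rw [a62, a62, if_neg (by omega)]
      split_ifs with h3
      · exact hlt _ ((h.mem₂ _).1 ⟨j, by omega, rfl⟩).1
      · exact h.mono₂ j j' h1 (by omega)
    · intro x
      rw [hex]
      constructor
      · rintro ⟨j, h1, h2⟩
        rw [a62] at h2
        split_ifs at h2 with h3
        · exact ⟨.inr h2, h2 ▸ hmk⟩
        · have := (h.mem₂ x).1 ⟨j, by omega, h2⟩
          exact ⟨.inl this.1, this.2⟩
      · rintro ⟨h1 | h1, h2⟩
        · obtain ⟨j, h3, h4⟩ := (h.mem₂ x).2 ⟨h1, h2⟩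
          exact ⟨j, by omega, by rw [a62, if_neg (hne j h3), h4]⟩
        · exact ⟨r, by omega, by rw [a62, if_pos rfl, h1]⟩
    · intro j hj
      rw [a61, a62]
      split_ifs with h3
      · rfl
      · exact h.dist j (by omega)
    · intro j hj
      rw [a61, a62, if_neg (by omega), if_neg (by omega)]
      exact h.old j hj
    · rw [a45, if_neg hnt.symm, h.pc_top]
    · intro k h1 h2
      rw [a45]
      split_ifs with h3
      · omega
      · have : k ≠ i := fun h4 => h3 (by rw [h4])
        have := h.pc_le k h1 (by omega)
        omega
    · intro k h1 h2 j hj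
      rw [a45, a62]
      rcases Nat.lt_succ_iff_lt_or_eq.1 h2 with h4 | rfl
      · have hki := hseg.mono k i h1 h4 hi
        rw [if_neg hki.ne]
        split_ifs with h5
        · have := h.pc_le k h1 h4
          omega
        · exact h.pc_iff k h1 h4 j (by omega)
      · rw [if_pos rfl]
        split_ifs with h5
        · omega
        · have : j < r := by omega
          have := hlt _ ((h.mem₂ _).1 ⟨j, this, rfl⟩).1
          omega
    · rw [Finset.card_filter, Finset.sum_Ico_succ_top hist, ← Finset.card_filter, ← h.card, if_pos hmk]
    · rw [a10, a12, h.rows, rowsOf, rowsOf, Finset.sum_Ico_succ_top hist, 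
        if_pos (Or.inl hmk : mk (e i) = 1 ∨ e i = c), add_zero]
  · have a45 : ∀ x, (Prog.exec W emitStep s).ints 45 x = if x = e i then r else s.ints 45 x := by
      intro x
      rcases (em (e i = c)).imp eq_true eq_false with hc | hc <;>
        simp [emitStep, pushProg, Prog.exec, h.i_eq, h.r_eq, hei, h44, hmk, h1W, h50, hc]
    have a62 : (Prog.exec W emitStep s).ints 62 = s.ints 62 := by
      funext x
      rcases (em (e i = c)).imp eq_true eq_false with hc | hc <;>
        simp [emitStep, pushProg, Prog.exec, h.i_eq, h.r_eq, hei, h44, hmk, h1W, h50, hc]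
    have a61 : (Prog.exec W emitStep s).reals 61 = s.reals 61 := by
      funext x
      rcases (em (e i = c)).imp eq_true eq_false with hc | hc <;>
        simp [emitStep, pushProg, Prog.exec, h.i_eq, h.r_eq, hei, h44, hmk, h1W, h50, hc]
    have a40 : ∀ x, (Prog.exec W emitStep s).ints 40 x = if x = q then e i else s.ints 40 x := by
      intro x
      rcases (em (e i = c)).imp eq_true eq_false with hc | hc <;>
        simp [emitStep, pushProg, Prog.exec, h.i_eq, h.r_eq, h.q_eq, hei, h44, hmk, h1W, h50, hc]
    have a0 : (Prog.exec W emitStep s).ints 52 0 = i + 1 ∧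
        (Prog.exec W emitStep s).ints 53 0 = q + 1 ∧
        (Prog.exec W emitStep s).ints 54 0 = r ∧ (Prog.exec W emitStep s).ints 55 0 = o := by
      rcases (em (e i = c)).imp eq_true eq_false with hc | hc <;>
        simp (disch := omega) [emitStep, pushProg, Prog.exec, h.i_eq, h.q_eq, h.r_eq, h.o_eq, hei, h44,
        hmk, h1W, Nat.mod_eq_of_lt, hdi, h50, hc]
    have arow : (Prog.exec W emitStep s).ints 12 0 ≤ 1 + (i + 1 - st) ∧
        items ((Prog.exec W emitStep s).recs 10) 0 ((Prog.exec W emitStep s).ints 12 0) =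
          rowsOf par e mk dep st (i + 1) t c := by
      rw [rowsOf, Finset.sum_Ico_succ_top hist, ← add_assoc, ← rowsOf, ← h.rows]
      rcases (em (e i = c)).imp eq_true eq_false with hc | hc
      · have b12 : (Prog.exec W emitStep s).ints 12 0 = s.ints 12 0 := by
          simp [emitStep, pushProg, Prog.exec, h.i_eq, h.r_eq, hei, h44, hmk, h1W, h50, hc]
        rw [b12, if_pos (.inr (of_eq_true hc)), add_zero]
        refine ⟨by omega, items_congr fun x _ _ => ?_⟩
        simp [emitStep, pushProg, Prog.exec, h.i_eq, h.r_eq, hei, h44, hmk, h1W, h50, hc]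
      · have b12 : (Prog.exec W emitStep s).ints 12 0 = s.ints 12 0 + 1 := by
          simp (disch := omega) [emitStep, pushProg, Prog.exec, h.i_eq, h.r_eq, hei, h44, hmk, h1W, h50,
            hc, Nat.mod_eq_of_lt]
        rw [b12, if_neg (by simp [hmk, hc]), items_succ (Nat.zero_le _)]
        refine ⟨by omega, ?_⟩
        congr 1
        · refine items_congr fun x _ hx => ?_
          have : x ≠ s.ints 12 0 := by omega
          simp [emitStep, pushProg, Prog.exec, h.i_eq, h.r_eq, hei, h44, hmk, h1W, h50, hc, this]
        · simp [emitStep, pushProg, Prog.exec, h.i_eq, h.r_eq, hei, h44, hmk, h1W, h50, hc, hdi]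
    obtain ⟨a52, a53, a54, a55⟩ := a0
    generalize Prog.exec W emitStep s = s' at *
    refine ⟨q + 1, r, ⟨by omega, a52, a53, a54, a55, by omega, by omega, ?_, ?_, ?_, ?_, ?_, ?_, ?_, ?_,
      ?_, ?_, ?_, arow.1, arow.2⟩⟩
    · intro j hj
      rw [a40, if_neg (by omega), h.rest j (by omega)]
    · intro j j' h1 h2 h3
      rw [a40, a40, if_neg (by omega)]
      split_ifs with h4
      · exact hlt _ ((h.mem₁ _).1 ⟨j, h1, by omega, rfl⟩).1
      · exact h.mono₁ j j' h1 h2 (by omega)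
    · intro x
      rw [hex]
      constructor
      · rintro ⟨j, h1, h2, h3⟩
        rw [a40] at h3
        split_ifs at h3 with h4
        · exact ⟨.inr h3, h3 ▸ hmk⟩
        · have := (h.mem₁ x).1 ⟨j, h1, by omega, h3⟩
          exact ⟨.inl this.1, this.2⟩
      · rintro ⟨h1 | h1, h2⟩
        · obtain ⟨j, h3, h4, h5⟩ := (h.mem₁ x).2 ⟨h1, h2⟩
          exact ⟨j, h3, by omega, by rw [a40, if_neg (by omega), h5]⟩
        · exact ⟨q, hqst, by omega, by rw [a40, if_pos rfl, h1]⟩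
    · rw [a62]
      exact h.mono₂
    · intro x
      rw [a62, h.mem₂, hex]
      constructor
      · exact fun h1 => ⟨.inl h1.1, h1.2⟩
      · rintro ⟨h1 | rfl, h2⟩
        · exact ⟨h1, h2⟩
        · exact absurd h2 hmk
    · rw [a62, a61]
      exact h.dist
    · rw [a62, a61]
      exact h.old
    · rw [a45, if_neg hnt.symm, h.pc_top]
    · intro k h1 h2
      rw [a45]
      split_ifs with h3
      · exact le_rfl
      · have : k ≠ i := fun h4 => h3 (by rw [h4])
        exact h.pc_le k h1 (by omega)
    · intro k h1 h2 j hj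
      rw [a45, a62]
      rcases Nat.lt_succ_iff_lt_or_eq.1 h2 with h4 | rfl
      · have hki := hseg.mono k i h1 h4 hi
        rw [if_neg hki.ne]
        exact h.pc_iff k h1 h4 j hj
      · rw [if_pos rfl]
        have := hlt _ ((h.mem₂ _).1 ⟨j, hj, rfl⟩).1
        omega
    · rw [Finset.card_filter, Finset.sum_Ico_succ_top hist, ← Finset.card_filter, ← h.card, if_neg hmk,
        add_zero]

theorem emitProg_spec {s : Mem} (hseg : Seg n par e st en t) (hW : 4 * n + 10 < W)
    (hoW : o + n < W) (hlt : st < en) (hen : en < n) (hm : SegMem par e dep st en t s)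
    (h50 : s.ints 50 0 = c) (h64 : s.ints 64 (s.ints 65 0) = o) (h44 : s.ints 44 = mk)
    (hdc : ∀ x, InSeg e st en t x → s.reals 40 x = rd par dep c x) :
    Ends W emitProg s fun s' τ => τ ≤ 120 * (en - st) + 200 ∧
      ∃ q r, EmitInv par e mk dep st en t c o s s' q r := by
  refine .seq (.flat rfl fun t1 ht1 => ?_)
  have e1 : emitInit.time ≤ 70 := by decide
  have hs1 := exec_same W emitInit s
  have hI := emitInit_spec (mk := mk) hW hm h50 h64 (hdc t (.inl rfl))
  generalize Prog.exec W _ s = s1 at hs1 hI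
  refine (Ends.count_flat (fun i s' => s'.ints 48 0 = en ∧
    ∃ q r, EmitInv par e mk dep st i t c o s s' q r) 120 st en hlt.le
    ⟨by rw [hs1.int 48, hm.en_eq], _, _, hI⟩ ?_ ?_).mono ?_
  · rintro i s' hi ⟨j1, q, r, j2⟩
    simp [j1, j2.i_eq]
  · rintro i s' hi ⟨j1, q, r, j2⟩ hs
    refine ⟨by rw [(exec_same W emitStep s').int 48, j1], ?_⟩
    refine emitStep_spec hseg hW hoW hen hi j2 ?_ ?_ ?_
    · rw [hs.int 50, hs1.int 50, h50]
    · rw [hs.int 44, hs1.int 44, h44]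
    · intro x hx
      rw [hs.real 40, hs1.real 40, hdc x hx]
  · rintro s2 t2 - ⟨⟨-, j2⟩, ht2⟩
    exact ⟨by omega, j2⟩

end Emit

end PartialCenter

set_option linter.unusedSimpArgs false

namespace PartialCenter

/-! ## Closing the node of a segment -/

/-! ### The rows of a node, counted. -/

section Rows
variable {n : ℕ} {par e mk sz : ℕ → ℕ} {dep : ℕ → ℝ} {st en t c acc : ℕ}

theorem of_mem_rowsOf (hmt : mk t ≠ 1) {x : ℝ × ℕ} (hx : x ∈ rowsOf par e mk dep st en t c) :
    x.1 = rd par dep c x.2 ∧ InSeg e st en t x.2 ∧ mk x.2 ≠ 1 ∧ x.2 ≠ c := by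
  rw [rowsOf, Multiset.mem_add, Multiset.mem_sum] at hx
  rcases hx with hx | ⟨k, hk, hx⟩
  · split_ifs at hx with h
    · simp at hx
    · rw [Multiset.mem_singleton] at hx
      rw [hx]
      exact ⟨rfl, .inl rfl, hmt, h⟩
  · split_ifs at hx with h
    · simp at hx
    · rw [Multiset.mem_singleton] at hx
      rw [Finset.mem_Ico] at hk
      rw [hx]
      push Not at h
      exact ⟨rfl, .inr ⟨k, hk.1, hk.2, rfl⟩, h.1, h.2⟩

open Classical in
theorem Seg.sum_eq (h : Seg n par e st en t) (P : ℕ → Prop) [DecidablePred P] (u : ℕ) :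
    (∑ k ∈ Finset.Ico st en, if P (e k) ∧ e k = u then 1 else 0) =
      if P u ∧ ∃ j, st ≤ j ∧ j < en ∧ e j = u then 1 else 0 := by
  by_cases hu : ∃ j, st ≤ j ∧ j < en ∧ e j = u
  · obtain ⟨j, h1, h2, rfl⟩ := hu
    rw [Finset.sum_eq_single j]
    · refine if_congr ⟨fun h3 => ⟨h3.1, j, h1, h2, rfl⟩, fun h3 => ⟨h3.1, rfl⟩⟩ rfl rfl
    · intro k hk hne
      rw [Finset.mem_Ico] at hk
      exact if_neg fun h3 => hne (h.inj hk.1 hk.2 h1 h2 h3.2)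
    · exact fun hn => absurd (Finset.mem_Ico.2 ⟨h1, h2⟩) hn
  · rw [if_neg fun h3 => hu h3.2]
    refine Finset.sum_eq_zero fun k hk => if_neg fun h3 => hu ?_
    rw [Finset.mem_Ico] at hk
    exact ⟨k, hk.1, hk.2, h3.2⟩

open Classical in
-- The members of a segment are distinct and the top is not among them, so no vertex is listed
-- twice.
theorem count_rowsOf (h : Seg n par e st en t) (hmt : mk t ≠ 1) (u : ℕ) :
    ((rowsOf par e mk dep st en t c).map fun x => if x.2 = u then 1 else 0).sum =
      if InSeg e st en t u ∧ mk u ≠ 1 ∧ u ≠ c then 1 else 0 := by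
  rw [rowsOf, Multiset.map_add, Multiset.sum_add, sum_map_sum]
  have e1 : ∑ k ∈ Finset.Ico st en, (Multiset.map (fun x : ℝ × ℕ => if x.2 = u then 1 else 0)
      (if mk (e k) = 1 ∨ e k = c then 0 else {(rd par dep c (e k), e k)})).sum =
      ∑ k ∈ Finset.Ico st en, if ¬ (mk (e k) = 1 ∨ e k = c) ∧ e k = u then 1 else 0 := by
    refine Finset.sum_congr rfl fun k _ => ?_
    by_cases h1 : mk (e k) = 1 ∨ e k = c
    · simp [h1]
    · rw [if_neg h1]
      simp only [Multiset.map_singleton, Multiset.sum_singleton]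
      simp only [h1, not_false_eq_true, true_and]
  have e3 := h.sum_eq (fun x => ¬ (mk x = 1 ∨ x = c)) u
  beta_reduce at e3
  rw [e1, e3]
  by_cases hut : u = t
  · subst hut
    have hn : ¬ ∃ j, st ≤ j ∧ j < en ∧ e j = u := by
      rintro ⟨j, h1, h2, h3⟩
      have := h.top_lt j h1 h2
      omega
    rw [if_neg (fun h3 => hn h3.2 : ¬ (¬ (mk u = 1 ∨ u = c) ∧ ∃ j, st ≤ j ∧ j < en ∧ e j = u))]
    by_cases htc : u = c
    · rw [if_pos htc, if_neg fun h3 => h3.2.2 htc]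
      rfl
    · rw [if_neg htc, if_pos ⟨.inl rfl, hmt, htc⟩]
      simp
  · have e2 : (Multiset.map (fun x : ℝ × ℕ => if x.2 = u then 1 else 0)
        (if t = c then 0 else {(rd par dep c t, t)})).sum = 0 := by
      split_ifs <;> simp [Ne.symm hut]
    rw [e2, zero_add]
    refine if_congr ?_ rfl rfl
    simp only [InSeg, hut, false_or, not_or]
    tauto

/-- A segment has one vertex more than it has edges, and the centroid is neither a row nor a column.
So a node has no more rows and columns together than its segment has edges. -/
theorem card_rowsOf (hS : Split par e st en t c acc sz mk) (h : Seg n par e st en t)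
    (hR : RTree n par dep) : (rowsOf par e mk dep st en t c).card + acc ≤ en - st := by
  have e1 : (rowsOf par e mk dep st en t c).card = (if t = c then 0 else 1) +
      ((Finset.Ico st en).filter fun k => ¬ (mk (e k) = 1 ∨ e k = c)).card := by
    rw [rowsOf, Multiset.card_add, Multiset.card_sum, Finset.card_filter]
    congr 1
    · split_ifs <;> simp
    · refine Finset.sum_congr rfl fun k _ => ?_
      by_cases h1 : mk (e k) = 1 ∨ e k = c
      · simp [h1]
      · rw [if_neg h1, if_pos h1]
        simp
  have e2 := Finset.card_filter_add_card_filter_not (s := Finset.Ico st en)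
    (fun k => mk (e k) = 1 ∨ e k = c)
  have e3 := hS.card_marked h hR
  rw [Nat.card_Ico] at e2
  have e4 : acc + (if t = c then 0 else 1) ≤
      ((Finset.Ico st en).filter fun k => mk (e k) = 1 ∨ e k = c).card := by
    split_ifs with htc
    · rw [← e3, add_zero]
      exact Finset.card_le_card fun k hk => by
        rw [Finset.mem_filter] at hk ⊢
        exact ⟨hk.1, .inl hk.2⟩
    · obtain ⟨j, h1, h2, h3⟩ := hS.mem.resolve_left (Ne.symm htc)
      rw [← e3, ← Finset.card_insert_of_notMem (a := j)]
      · refine Finset.card_le_card fun k hk => ?_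
        rw [Finset.mem_insert, Finset.mem_filter] at hk
        rw [Finset.mem_filter]
        rcases hk with rfl | hk
        · exact ⟨Finset.mem_Ico.2 ⟨h1, h2⟩, .inr h3⟩
        · exact ⟨hk.1, .inl hk.2⟩
      · intro hj
        have h4 := (Finset.mem_filter.1 hj).2
        rw [h3, hS.mk_c h hR] at h4
        omega
  omega

end Rows

/-! ### Completing a node and replacing its segment by the two parts. -/

/-- Moves the marked vertices behind the unmarked ones. -/
def backProg : Prog :=
  .ivar 52 0 ;;
  .loop (.ilt (.var 52) (.var 54))
    (.iset 40 (.var 53 + .var 52) (.get 62 (.var 55 + .var 52)) ;; .ivar 52 (.var 52 + 1))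

/-- Copies the sorted rows to the tables. -/
def copyRows : Prog :=
  (.ivar 52 0 ;; .ivar 56 (.get 63 (.var 65))) ;;
  .loop (.ilt (.var 52) (.var 12))
    (.iset 60 (.var 56 + .var 52) (.get 10 (.var 52)) ;;
      .rset 60 (.var 56 + .var 52) (.get 10 (.var 52)) ;;
      .iset 61 (.var 56 + .var 52) (.get 45 (.get 10 (.var 52))) ;; .ivar 52 (.var 52 + 1))

/-- Ends the node and splits the segment. -/
def closeNode : Prog :=
  .iset 63 (.var 65 + 1) (.var 56 + .var 12) ;; .iset 64 (.var 65 + 1) (.var 55 + .var 54) ;;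
  .iset 41 (.var 47) (.var 53) ;; .iset 41 (.var 53) (.var 48) ;; .ivar 65 (.var 65 + 1)

/-- Sorts and stores the rows of a node, and splits the segment. -/
def finishProg : Prog := backProg ;; sortProg ;; copyRows ;; closeNode

section Finish
variable {W n : ℕ} {par e mk sz : ℕ → ℕ} {dep : ℕ → ℝ} {st en t c acc o : ℕ}

theorem backProg_spec {s₀ s : Mem} {q r : ℕ} (hW : 4 * n + 10 < W) (hoW : o + n < W)
    (hen : en < n) (h : EmitInv par e mk dep st en t c o s₀ s q r) :
    Ends W backProg s fun s' τ => τ ≤ 40 * (en - st) + 60 ∧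
      Parted e (s'.ints 40) st q en mk ∧ ∀ j, en ≤ j → s'.ints 40 j = e j := by
  have h1W : 1 % W = 1 := Nat.mod_eq_of_lt (by omega)
  have hqr := h.qr
  have hqst := h.st_le_q
  refine .seq (.flat rfl fun t1 ht1 => ?_)
  have e1 : (Prog.ivar 52 0).time ≤ 10 := by decide
  have hs1 := exec_same W (.ivar 52 0) s
  have i1 : (Prog.exec W (.ivar 52 0) s).ints 52 0 = 0 := by simp [Prog.exec]
  generalize Prog.exec W _ s = s1 at hs1 i1
  refine (Ends.count_flat (fun i s' => s'.ints 52 0 = i ∧ s'.ints 53 0 = q ∧ s'.ints 54 0 = r ∧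
    s'.ints 55 0 = o ∧ s'.ints 62 = s.ints 62 ∧ ∀ x, s'.ints 40 x =
      if q ≤ x ∧ x < q + i then s.ints 62 (o + (x - q)) else s.ints 40 x) 40 0 r (Nat.zero_le _)
    ⟨i1, by rw [hs1.int 53, h.q_eq], by rw [hs1.int 54, h.r_eq], by rw [hs1.int 55, h.o_eq],
      hs1.int 62, fun x => by rw [hs1.int 40, if_neg (by omega)]⟩ ?_ ?_).mono ?_
  · rintro i s' hi ⟨j1, j2, j3, -⟩
    simp [j1, j3]
  · rintro i s' hi ⟨j1, j2, j3, j4, j5, j6⟩ -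
    refine ⟨?_, ?_, ?_, ?_, ?_, ?_⟩
    · simp (disch := omega) [Prog.exec, j1, Nat.mod_eq_of_lt]
    · simp [Prog.exec, j2]
    · simp [Prog.exec, j3]
    · simp [Prog.exec, j4]
    · rw [(exec_same W _ s').int 62, j5]
    · intro x
      by_cases hx : x = q + i
      · simp (disch := omega) [Prog.exec, j1, j2, j4, j5, hx, Nat.mod_eq_of_lt]
      · have : (q ≤ x ∧ x < q + (i + 1)) ↔ (q ≤ x ∧ x < q + i) := by omega
        simp (disch := omega) [Prog.exec, j1, j2, j4, j5, hx, Nat.mod_eq_of_lt, j6, this]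
  · rintro s2 t2 - ⟨⟨j1, j2, j3, j4, j5, j6⟩, ht2⟩
    have f1 : ∀ j < q, s2.ints 40 j = s.ints 40 j := fun j hj => by rw [j6, if_neg (by omega)]
    have f2 : ∀ j < r, s2.ints 40 (q + j) = s.ints 62 (o + j) := fun j hj => by
      rw [j6, if_pos (by omega), Nat.add_sub_cancel_left]
    refine ⟨by omega, ⟨?_, ?_, ?_, ?_⟩, ?_⟩
    · intro i j h1 h2 h3
      rw [f1 i (by omega), f1 j h3]
      exact h.mono₁ i j h1 h2 h3
    · intro i j h1 h2 h3
      obtain ⟨i, rfl⟩ := Nat.exists_eq_add_of_le h1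
      obtain ⟨j, rfl⟩ := Nat.exists_eq_add_of_le (h1.trans h2.le)
      rw [f2 i (by omega), f2 j (by omega)]
      exact h.mono₂ i j (by omega) (by omega)
    · intro x
      rw [← h.mem₁ x]
      refine exists_congr fun j => ⟨fun h1 => ⟨h1.1, h1.2.1, ?_⟩, fun h1 => ⟨h1.1, h1.2.1, ?_⟩⟩
      · rw [← f1 j h1.2.1, h1.2.2]
      · rw [f1 j h1.2.1, h1.2.2]
    · intro x
      rw [← h.mem₂ x]
      constructor
      · rintro ⟨j, h1, h2, h3⟩
        obtain ⟨j, rfl⟩ := Nat.exists_eq_add_of_le h1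
        exact ⟨j, by omega, by rw [← f2 j (by omega), h3]⟩
      · rintro ⟨j, h1, h3⟩
        exact ⟨q + j, by omega, by omega, by rw [f2 j h1, h3]⟩
    · intro j hj
      rw [j6, if_neg (by omega), h.rest j hj]

theorem copyRows_spec {s : Mem} {oM len : ℕ} (hoW : oM + len < W) (h12 : s.ints 12 0 = len)
    (h63 : s.ints 63 (s.ints 65 0) = oM) :
    Ends W copyRows s fun s' τ => τ ≤ 60 * len + 90 ∧ s'.ints 56 0 = oM ∧
      (∀ x < oM, s'.ints 60 x = s.ints 60 x ∧ s'.ints 61 x = s.ints 61 x ∧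
        s'.reals 60 x = s.reals 60 x) ∧
      ∀ x < len, s'.ints 60 (oM + x) = s.ints 10 x ∧ s'.reals 60 (oM + x) = s.reals 10 x ∧
        s'.ints 61 (oM + x) = s.ints 45 (s.ints 10 x) := by
  refine .seq (.flat rfl fun t1 ht1 => ?_)
  have e1 : Prog.time (.ivar 52 0 ;; .ivar 56 (.get 63 (.var 65))) ≤ 20 := by decide
  have hs1 := exec_same W (.ivar 52 0 ;; .ivar 56 (.get 63 (.var 65))) s
  have i1 : (Prog.exec W (.ivar 52 0 ;; .ivar 56 (.get 63 (.var 65))) s).ints 52 0 = 0 := by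
    simp [Prog.exec]
  have i2 : (Prog.exec W (.ivar 52 0 ;; .ivar 56 (.get 63 (.var 65))) s).ints 56 0 = oM := by
    simp [Prog.exec, h63]
  generalize Prog.exec W _ s = s1 at hs1 i1 i2
  refine (Ends.count_flat (fun i s' => s'.ints 52 0 = i ∧ s'.ints 56 0 = oM ∧ s'.ints 12 0 = len ∧
    (∀ x < oM, s'.ints 60 x = s.ints 60 x ∧ s'.ints 61 x = s.ints 61 x ∧
        s'.reals 60 x = s.reals 60 x) ∧
    ∀ x < i, s'.ints 60 (oM + x) = s.ints 10 x ∧ s'.reals 60 (oM + x) = s.reals 10 x ∧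
        s'.ints 61 (oM + x) = s.ints 45 (s.ints 10 x)) 60 0 len (Nat.zero_le _)
    ⟨i1, i2, by rw [hs1.int 12, h12], fun x _ => by rw [hs1.int 60, hs1.int 61, hs1.real 60]; simp,
      fun x hx => by omega⟩ ?_ ?_).mono ?_
  · rintro i s' hi ⟨j1, j2, j3, -⟩
    simp [j1, j3]
  · rintro i s' hi ⟨j1, j2, j3, j4, j5⟩ hs
    have g10 : s'.ints 10 = s.ints 10 := by rw [hs.int 10, hs1.int 10]
    have r10 : s'.reals 10 = s.reals 10 := by rw [hs.real 10, hs1.real 10]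
    have g45 : s'.ints 45 = s.ints 45 := by rw [hs.int 45, hs1.int 45]
    refine ⟨?_, ?_, ?_, ?_, ?_⟩
    · simp (disch := omega) [Prog.exec, j1, Nat.mod_eq_of_lt]
    · simp [Prog.exec, j2]
    · simp [Prog.exec, j3]
    · intro x hx
      have : x ≠ oM + i := by omega
      simpa (disch := omega) [Prog.exec, j1, j2, this, Nat.mod_eq_of_lt] using j4 x hx
    · intro x hx
      by_cases hxi : x = i
      · simp (disch := omega) [Prog.exec, j1, j2, hxi, g10, r10, g45, Nat.mod_eq_of_lt]
      · simpa (disch := omega) [Prog.exec, j1, j2, hxi, Nat.mod_eq_of_lt] using j5 x (by omega)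
  · rintro s2 t2 - ⟨⟨j1, j2, j3, j4, j5⟩, ht2⟩
    exact ⟨by omega, j2, j4, j5⟩

/-- What is known after a node is closed. -/
structure Closed (par e mk : ℕ → ℕ) (dep : ℕ → ℝ) (st en t c o q r oM len M : ℕ) (s s' : Mem) :
    Prop where
  parted : Parted e (s'.ints 40) st q en mk
  rest : ∀ j, en ≤ j → s'.ints 40 j = e j
  ends : ∀ x, s'.ints 41 x = if x = q then en else if x = st then q else s.ints 41 x
  oa : ∀ x, s'.ints 63 x = if x = M + 1 then oM + len else s.ints 63 x
  ob : ∀ x, s'.ints 64 x = if x = M + 1 then o + r else s.ints 64 x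
  M_eq : s'.ints 65 0 = M + 1
  old : ∀ x < oM, s'.ints 60 x = s.ints 60 x ∧ s'.ints 61 x = s.ints 61 x ∧
    s'.reals 60 x = s.reals 60 x
  b : s'.ints 62 = s.ints 62
  Y : s'.reals 61 = s.reals 61
  p : ∀ x < len, s'.ints 61 (oM + x) = s.ints 45 (s'.ints 60 (oM + x))
  rows : items (fun x => (s'.reals 60 (oM + x), s'.ints 60 (oM + x))) 0 len =
    rowsOf par e mk dep st en t c
  sorted : ∀ x y, x ≤ y → y < len → s'.reals 60 (oM + x) ≤ s'.reals 60 (oM + y)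

theorem finishProg_spec {s₀ s : Mem} {q r oM M L : ℕ} (hW : 4 * n + 10 < W) (hoW : o + n < W)
    (hoMW : oM + n < W) (hMW : M + 2 < W) (hst : st < q)
    (hen : en < n) (h : EmitInv par e mk dep st en t c o s₀ s q r) (hlen : s.ints 12 0 ≤ n)
    (hL : n ≤ 2 ^ L) (h47 : s.ints 47 0 = st) (h48 : s.ints 48 0 = en) (h65 : s.ints 65 0 = M)
    (h63 : s.ints 63 M = oM) :
    Ends W finishProg s fun s' τ => τ ≤ 40 * (en - st) + 500 * (s.ints 12 0 + 1) * (L + 1) + 200 ∧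
      Closed par e mk dep st en t c o q r oM (s.ints 12 0) M s s' := by
  set len := s.ints 12 0 with hlen'
  have hqr := h.qr
  refine .seq ((backProg_spec hW hoW hen h).mono ?_)
  rintro s1 t1 hs1 ⟨ht1, hP, hrest⟩
  have h12 : s1.ints 12 0 = len := by rw [hs1.int 12]
  refine .seq ((sortProg_spec (W := W) (len := len) (L := L) (by omega) h12 (by omega)).mono ?_)
  rintro s2 t2 hs2 ⟨ht2, hrec, hsort⟩
  have k65 : s2.ints 65 0 = M := by rw [hs2.int 65, hs1.int 65, h65]
  have k63 : s2.ints 63 M = oM := by rw [hs2.int 63, hs1.int 63, h63]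
  refine .seq ((copyRows_spec (W := W) (oM := oM) (len := len) (by omega) (by rw [hs2.int 12, h12])
    (by rw [k65, k63])).mono ?_)
  rintro s3 t3 hs3 ⟨ht3, m56, mold, mnew⟩
  have l12 : s3.ints 12 0 = len := by rw [hs3.int 12, hs2.int 12, h12]
  have l65 : s3.ints 65 0 = M := by rw [hs3.int 65, k65]
  have l47 : s3.ints 47 0 = st := by rw [hs3.int 47, hs2.int 47, hs1.int 47, h47]
  have l48 : s3.ints 48 0 = en := by rw [hs3.int 48, hs2.int 48, hs1.int 48, h48]
  have l53 : s3.ints 53 0 = q := by rw [hs3.int 53, hs2.int 53, hs1.int 53, h.q_eq]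
  have l54 : s3.ints 54 0 = r := by rw [hs3.int 54, hs2.int 54, hs1.int 54, h.r_eq]
  have l55 : s3.ints 55 0 = o := by rw [hs3.int 55, hs2.int 55, hs1.int 55, h.o_eq]
  have l41 : s3.ints 41 = s.ints 41 := by rw [hs3.int 41, hs2.int 41, hs1.int 41]
  have l63 : s3.ints 63 = s.ints 63 := by rw [hs3.int 63, hs2.int 63, hs1.int 63]
  have l64 : s3.ints 64 = s.ints 64 := by rw [hs3.int 64, hs2.int 64, hs1.int 64]
  have hs4 := exec_same W closeNode s3
  have hle := h.st_le_q
  refine .flat rfl fun t4 ht4 => ⟨?_, ?_⟩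
  · have e1 : closeNode.time ≤ 70 := by decide
    have e3 : (len + 1) * 1 ≤ (len + 1) * (L + 1) := Nat.mul_le_mul_left _ (by omega)
    rw [mul_assoc] at ht2 ⊢
    omega
  refine ⟨?_, ?_, ?_, ?_, ?_, ?_, ?_, ?_, ?_, ?_, ?_, ?_⟩
  · rw [hs4.int 40, hs3.int 40, hs2.int 40]
    exact hP
  · intro j hj
    rw [hs4.int 40, hs3.int 40, hs2.int 40, hrest j hj]
  · intro x
    simp (disch := omega) [closeNode, Prog.exec, l47, l48, l53, l41, l65, Nat.mod_eq_of_lt]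
  · intro x
    simp (disch := omega) [closeNode, Prog.exec, m56, l12, l63, l65, Nat.mod_eq_of_lt]
  · intro x
    simp (disch := omega) [closeNode, Prog.exec, l54, l55, l64, l65, Nat.mod_eq_of_lt]
  · simp (disch := omega) [closeNode, Prog.exec, l65, Nat.mod_eq_of_lt]
  · intro x hx
    rw [hs4.int 60, hs4.int 61, hs4.real 60, (mold x hx).1, (mold x hx).2.1, (mold x hx).2.2,
      hs2.int 60, hs2.int 61, hs2.real 60, hs1.int 60, hs1.int 61, hs1.real 60]
    simp
  · rw [hs4.int 62, hs3.int 62, hs2.int 62, hs1.int 62]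
  · rw [hs4.real 61, hs3.real 61, hs2.real 61, hs1.real 61]
  · intro x hx
    rw [hs4.int 60, hs4.int 61, (mnew x hx).2.2, (mnew x hx).1, hs2.int 45, hs1.int 45]
  · rw [hs4.int 60, hs4.real 60, ← h.rows]
    have e1 : items (s1.recs 10) 0 len = items (s.recs 10) 0 len := items_congr fun x _ _ => by
      simp only [Mem.recs]
      rw [hs1.int 10, hs1.real 10]
    rw [← e1, ← hrec]
    exact items_congr fun x _ hx => by rw [(mnew x hx).1, (mnew x hx).2.1]
  · intro x y h1 h2
    rw [hs4.real 60, (mnew x (by omega)).2.1, (mnew y h2).2.1]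
    exact hsort x y h1 h2

open Classical in
theorem EmitInv.count_cols {s₀ s : Mem} {q r : ℕ} (h : EmitInv par e mk dep st en t c o s₀ s q r)
    (v : ℕ) : (∑ j ∈ Finset.range r, if s.ints 62 (o + j) = v then 1 else 0) =
      if (∃ j, st ≤ j ∧ j < en ∧ e j = v) ∧ mk v = 1 then 1 else 0 := by
  have hinj : ∀ i < r, ∀ j < r, s.ints 62 (o + i) = s.ints 62 (o + j) → i = j := by
    intro i hi j hj hij
    rcases lt_trichotomy i j with h1 | h1 | h1
    · have := h.mono₂ i j h1 hj; omega
    · exact h1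
    · have := h.mono₂ j i h1 hi; omega
  split_ifs with hv
  · obtain ⟨j, h1, h2⟩ := (h.mem₂ v).2 hv
    rw [Finset.sum_eq_single j, if_pos h2]
    · intro i hi hne
      exact if_neg fun h3 => hne (hinj i (Finset.mem_range.1 hi) j h1 (h3.trans h2.symm))
    · exact fun hn => absurd (Finset.mem_range.2 h1) hn
  · exact Finset.sum_eq_zero fun j hj => if_neg fun h3 =>
      hv ((h.mem₂ v).1 ⟨j, Finset.mem_range.1 hj, h3⟩)

open Classical in
/-- The new node has the required properties. -/
theorem Closed.nodeAt {s₀ s s' : Mem} {q r oM M : ℕ} (hseg : Seg n par e st en t)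
    (hR : RTree n par dep) (hlt : st < en) (hS : Split par e st en t c acc sz mk)
    (h : EmitInv par e mk dep st en t c o s₀ s q r) (hen : en < n)
    (hC : Closed par e mk dep st en t c o q r oM (s.ints 12 0) M s s')
    (h63 : s.ints 63 M = oM) (h64 : s.ints 64 M = o) :
    NodeAt n M (s'.ints 63) (s'.ints 64) (s'.ints 60) (s'.ints 61) (s'.ints 62) (s'.reals 60)
      (s'.reals 61) (rd par dep) ∧ s.ints 12 0 + r ≤ en - st ∧ r = acc ∧ ∀ u v, u ≠ v →
      pairHits (s'.ints 63) (s'.ints 64) (s'.ints 60) (s'.ints 62) M u v +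
      ((if InSeg (s'.ints 40) st q t u ∧ InSeg (s'.ints 40) st q t v then 1 else 0) +
          if InSeg (s'.ints 40) q en c u ∧ InSeg (s'.ints 40) q en c v then 1 else 0) =
      if InSeg e st en t u ∧ InSeg e st en t v then 1 else 0 := by
  have hmt : mk t ≠ 1 := by rw [hS.mk_top]; omega
  have hr : r = acc := by rw [h.card, hS.card_marked hseg hR]
  have hcard := card_rowsOf hS hseg hR
  rw [← hC.rows, card_items] at hcard
  set len := s.ints 12 0 with hlen
  have a1 : s'.ints 63 M = oM := by rw [hC.oa, if_neg (by omega), h63]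
  have a2 : s'.ints 63 (M + 1) = oM + len := by rw [hC.oa, if_pos rfl]
  have b1 : s'.ints 64 M = o := by rw [hC.ob, if_neg (by omega), h64]
  have b2 : s'.ints 64 (M + 1) = o + r := by rw [hC.ob, if_pos rfl]
  have hrow : ∀ x < len, s'.reals 60 (oM + x) = rd par dep c (s'.ints 60 (oM + x)) ∧
      InSeg e st en t (s'.ints 60 (oM + x)) ∧ mk (s'.ints 60 (oM + x)) ≠ 1 := by
    intro x hx
    have h1 : (s'.reals 60 (oM + x), s'.ints 60 (oM + x)) ∈ rowsOf par e mk dep st en t c := by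
      rw [← hC.rows]
      exact mem_items.2 ⟨x, Nat.zero_le _, hx, rfl⟩
    have h2 := of_mem_rowsOf hmt h1
    exact ⟨h2.1, h2.2.1, h2.2.2.1⟩
  have hcol : ∀ j < r, ∃ k, st ≤ k ∧ k < en ∧ e k = s'.ints 62 (o + j) ∧ mk (e k) = 1 := by
    intro j hj
    rw [hC.b]
    obtain ⟨⟨k, h1, h2, h3⟩, h4⟩ := (h.mem₂ _).1 ⟨j, hj, rfl⟩
    exact ⟨k, h1, h2, h3, by rw [h3, h4]⟩
  have hY : ∀ j < r, s'.reals 61 (o + j) = rd par dep c (s'.ints 62 (o + j)) := by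
    intro j hj
    rw [hC.b, hC.Y, h.dist j hj]
  have hdist : ∀ j < r, ∀ x, InSeg e st en t x → mk x ≠ 1 →
      rd par dep c x + rd par dep c (s'.ints 62 (o + j)) = rd par dep x (s'.ints 62 (o + j)) ∧
        s'.reals 61 (o + j) = dep (s'.ints 62 (o + j)) - dep c := by
    intro j hj x hx hmk
    obtain ⟨k, h1, h2, h3, h4⟩ := hcol j hj
    rw [hY j hj, ← h3]
    exact hS.dist hseg hR hlt h1 h2 h4 hx hmk
  have hmono : ∀ i j, i ≤ j → j < r → s'.ints 62 (o + i) ≤ s'.ints 62 (o + j) := by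
    intro i j hij hj
    rcases hij.eq_or_lt with rfl | h1
    · exact le_rfl
    · rw [hC.b]
      exact (h.mono₂ i j h1 hj).le
  refine ⟨⟨by omega, by omega, by omega, by omega, ?_, ?_, ?_, ?_, ?_, ?_, ?_, ?_⟩, by omega, hr, ?_⟩
  all_goals try rw [a1, a2]
  all_goals try rw [b1, b2]
  · intro i h1 h2
    obtain ⟨x, rfl⟩ := Nat.exists_eq_add_of_le h1
    exact hseg.inSeg_lt hlt (hrow x (by omega)).2.1
  · intro j h1 h2
    obtain ⟨y, rfl⟩ := Nat.exists_eq_add_of_le h1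
    obtain ⟨k, h3, h4, h5, -⟩ := hcol y (by omega)
    rw [← h5]
    exact hseg.lt k h3 h4
  · intro i i' h1 h2 h3
    obtain ⟨x, rfl⟩ := Nat.exists_eq_add_of_le h1
    obtain ⟨y, rfl⟩ := Nat.exists_eq_add_of_le (h1.trans h2)
    exact hC.sorted x y (by omega) (by omega)
  · intro i i' h1 h2 h3
    obtain ⟨x, rfl⟩ := Nat.exists_eq_add_of_le h1
    obtain ⟨y, rfl⟩ := Nat.exists_eq_add_of_le (h1.trans h2)
    rw [(hdist x (by omega) t (.inl rfl) hmt).2, (hdist y (by omega) t (.inl rfl) hmt).2]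
    obtain ⟨k, h4, h5, h6, -⟩ := hcol y (by omega)
    -- The columns are in the order of their numbers, hence of their depths, and the distances from
    -- `c` differ from the depths by a constant.
    have := hR.mono (s'.ints 62 (o + x)) (s'.ints 62 (o + y)) (hmono x y (by omega) (by omega))
      (by rw [← h6]; exact hseg.lt k h4 h5)
    linarith
  · intro i h1 h2
    obtain ⟨x, rfl⟩ := Nat.exists_eq_add_of_le h1
    rw [hC.p x (by omega)]
    rcases (hrow x (by omega)).2.1 with h3 | ⟨k, h3, h4, h5⟩
    · rw [h3, h.pc_top]
      omega
    · rw [← h5]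
      have := h.pc_le k h3 h4
      omega
  · intro i j h1 h2 h3 h4
    obtain ⟨x, rfl⟩ := Nat.exists_eq_add_of_le h1
    obtain ⟨y, rfl⟩ := Nat.exists_eq_add_of_le h3
    rw [hC.p x (by omega), Nat.add_lt_add_iff_left]
    rcases (hrow x (by omega)).2.1 with h5 | ⟨k, h5, h6, h7⟩
    · rw [h5, h.pc_top]
      obtain ⟨k, h6, h7, h8, -⟩ := hcol y (by omega)
      have := hseg.top_lt k h6 h7
      omega
    · rw [← h7, hC.b]
      exact h.pc_iff k h5 h6 y (by omega)
  · intro i j h1 h2 h3 h4 h5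
    obtain ⟨x, rfl⟩ := Nat.exists_eq_add_of_le h1
    obtain ⟨y, rfl⟩ := Nat.exists_eq_add_of_le h3
    obtain ⟨k, -, -, h6, h7⟩ := hcol y (by omega)
    exact (hrow x (by omega)).2.2 (by rw [h5, ← h6, h7])
  · intro i j h1 h2 h3 h4
    obtain ⟨x, rfl⟩ := Nat.exists_eq_add_of_le h1
    obtain ⟨y, rfl⟩ := Nat.exists_eq_add_of_le h3
    obtain ⟨h5, h6, h7⟩ := hrow x (by omega)
    rw [h5, hY y (by omega)]
    exact (hdist y (by omega) _ h6 h7).1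
  · intro u v huv
    have cr : ∀ w, (∑ i ∈ Finset.Ico oM (oM + len), if s'.ints 60 i = w then 1 else 0) =
        if InSeg e st en t w ∧ mk w ≠ 1 ∧ w ≠ c then 1 else 0 := by
      intro w
      rw [← count_rowsOf (dep := dep) hseg hmt w, ← hC.rows, sum_items, Finset.sum_Ico_eq_sum_range,
        Nat.add_sub_cancel_left, ← Finset.range_eq_Ico]
    have cc : ∀ w, (∑ j ∈ Finset.range r, if s'.ints 62 (o + j) = w then 1 else 0) =
        if InSeg e st en t w ∧ mk w = 1 then 1 else 0 := by
      intro w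
      rw [hC.b, h.count_cols]
      refine if_congr (and_congr_left fun h1 => ⟨.inr, ?_⟩) rfl rfl
      rintro (rfl | h2)
      · exact absurd h1 hmt
      · exact h2
    rw [pairHits_eq huv, a1, a2, b1, b2, Nat.add_sub_cancel_left, cr, cr, cc, cc,
      hC.parted.inSeg₁ hS hseg, hC.parted.inSeg₁ hS hseg, hC.parted.inSeg₂ hS hseg, hC.parted.inSeg₂ hS hseg]
    have hc1 := hS.mem
    have hc2 : mk c ≠ 1 := by rw [hS.mk_c hseg hR]; omega
    -- The pair of `c` and another vertex is no entry of the node; it lies in exactly one part,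
    -- according to the mark of the other vertex. A pair without `c` is an entry if its marks
    -- differ, and otherwise lies in the part given by the common mark.
    by_cases h1 : u = c
    · have h2 : v ≠ c := fun h2 => huv (h1.trans h2.symm)
      by_cases h3 : InSeg e st en t v <;> by_cases h4 : mk v = 1 <;> simp [h1, h2, h3, h4, hc1, hc2]
    · by_cases h2 : v = c
      · by_cases h3 : InSeg e st en t u <;> by_cases h4 : mk u = 1 <;>
          simp [h1, h2, h3, h4, hc1, hc2]
      · by_cases h3 : InSeg e st en t u <;> by_cases h4 : mk u = 1 <;>
        by_cases h5 : InSeg e st en t v <;> by_cases h6 : mk v = 1 <;>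
          simp [h1, h2, h3, h4, h5, h6]

end Finish

end PartialCenter

set_option linter.unusedSimpArgs false

namespace PartialCenter

/-! ## The decomposition -/

/-- Treats a segment with at least two edges. -/
def segProg : Prog :=
  setupProg ;; sizeProg ;; centProg ;; flagProg ;; markProg ;; emitProg ;; finishProg

/-- Treats a segment with one edge. -/
def baseProg : Prog :=
  .ivar 50 (.get 40 (.var 47)) ;; .ivar 49 (.get 31 (.var 50)) ;; .ivar 56 (.get 63 (.var 65)) ;;
  .ivar 55 (.get 64 (.var 65)) ;; .iset 60 (.var 56) (.var 49) ;; .iset 61 (.var 56) 0 ;;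
  .rset 60 (.var 56) .zero ;; .iset 62 (.var 55) (.var 50) ;;
  .rset 61 (.var 55) (.get 30 (.var 50) - .get 30 (.var 49)) ;;
  .iset 63 (.var 65 + 1) (.var 56 + 1) ;; .iset 64 (.var 65 + 1) (.var 55 + 1) ;;
  .ivar 65 (.var 65 + 1) ;; .ivar 47 (.var 47 + 1)

/-- Lists the segment that consists of all the edges. -/
def decompInit : Prog :=
  (.ivar 52 0 ;; .ivar 65 0 ;; .ivar 47 0 ;; .iset 63 0 0 ;; .iset 64 0 0 ;;
    .iset 41 0 (.var 0 - 1)) ;;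
  .loop (.ilt (.var 52) (.var 0)) (.iset 40 (.var 52) (.var 52 + 1) ;; .ivar 52 (.var 52 + 1))

/-- Computes the tables. -/
def decompProg : Prog :=
  decompInit ;; .loop (.ilt (.var 47 + 1) (.var 0))
    (.ite (.ilt (.var 47 + 1) (.get 41 (.var 47))) segProg baseProg)

theorem Segs.add_length_le {n : ℕ} {par e f : ℕ → ℕ} {st : ℕ} {l : List ℕ}
    (h : Segs n par e f st l) : st + l.length + 1 ≤ n := by
  induction l generalizing st with
  | nil => rw [Segs] at h; simp; omega
  | cons en l ih =>
    have := ih h.2.2.2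
    have := h.2.1
    simp only [List.length_cons]
    omega

/-- The invariant of the decomposition: the nodes so far, and the segments that are left. -/
structure Decomp (n : ℕ) (par : ℕ → ℕ) (dep : ℕ → ℝ) (st : ℕ) (l : List ℕ) (M : ℕ) (s : Mem) :
    Prop where
  n_eq : s.ints 0 0 = n
  par_eq : s.ints 31 = par
  dep_eq : s.reals 30 = dep
  st_eq : s.ints 47 0 = st
  M_eq : s.ints 65 0 = M
  segs : Segs n par (s.ints 40) (s.ints 41) st l
  nodes : Nodes n M (s.ints 63) (s.ints 64) (s.ints 60) (s.ints 61) (s.ints 62) (s.reals 60)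
    (s.reals 61) (rd par dep)
  cover : ∀ u v, v < u → u < n → (∑ κ ∈ Finset.range M,
    pairHits (s.ints 63) (s.ints 64) (s.ints 60) (s.ints 62) κ u v) +
      segHits par (s.ints 40) u v st l = 1
  size : s.ints 63 M + s.ints 64 M + 2 * pot st l ≤ 2 * cost (n - 1)
  M_le : M ≤ 2 * st + l.length

section Decomposition
variable {W n : ℕ} {par : ℕ → ℕ} {dep : ℕ → ℝ} {st en M : ℕ} {l : List ℕ}

/-- The `m` units freed by `cost_split`, multiplied by `L + 1`, pay for sorting the rows and for the
linear passes. -/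
theorem segProg_time {m x y L len : ℕ} (hm : x + y = m) (h1 : m ≤ 3 * y) (h2 : 6 * y ≤ 5 * m + 1)
    (h3 : 2 ≤ m) (hlen : len ≤ m) (p : ℕ) :
    600 * m + 1100 + 500 * (len + 1) * (L + 1) + 2000 * (L + 1) * (cost x + (cost y + p)) ≤
      2000 * (L + 1) * (cost m + p) := by
  have h4 := Nat.mul_le_mul_left (2000 * (L + 1)) (cost_split hm h1 h2 h3)
  have h5 : 1 * m ≤ (L + 1) * m := Nat.mul_le_mul_right _ (by omega)
  have h6 : (L + 1) * 2 ≤ (L + 1) * m := Nat.mul_le_mul_left _ h3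
  have h7 : (L + 1) * len ≤ (L + 1) * m := Nat.mul_le_mul_left _ hlen
  have h8 : 1 ≤ L + 1 := by omega
  have h9 := h5
  generalize L + 1 = K at *
  nlinarith

theorem segProg_spec {s : Mem} {L : ℕ} (hR : RTree n par dep) (hL : n ≤ 2 ^ L)
    (hW : 2 * cost (n - 1) + 4 * n + 12 < W) (hD : Decomp n par dep st (en :: l) M s)
    (h2 : st + 1 < en) :
    Ends W segProg s fun s' τ => ∃ q, Decomp n par dep st (q :: en :: l) (M + 1) s' ∧
      τ + 30 + 2000 * (L + 1) * pot st (q :: en :: l) ≤ 2000 * (L + 1) * pot st (en :: l) := by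
  classical
  obtain ⟨hf, hlt, hseg, hrest⟩ := hD.segs
  have hen := hrest.lt
  have hsz := hD.size
  have hMle := hD.M_le
  have hlen := hD.segs.add_length_le
  set e := s.ints 40 with he
  set t := par (e st) with ht
  set oM := s.ints 63 M with hoM
  set o := s.ints 64 M with ho
  refine Ends.mono (Q := fun s' τ => ∃ q, Segs n par (s'.ints 40) (s'.ints 41) st (q :: en :: l) ∧
    Nodes n (M + 1) (s'.ints 63) (s'.ints 64) (s'.ints 60) (s'.ints 61) (s'.ints 62) (s'.reals 60)
      (s'.reals 61) (rd par dep) ∧ (∀ u v, v < u → u < n → (∑ κ ∈ Finset.range (M + 1),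
      pairHits (s'.ints 63) (s'.ints 64) (s'.ints 60) (s'.ints 62) κ u v) +
      segHits par (s'.ints 40) u v st (q :: en :: l) = 1) ∧
      s'.ints 63 (M + 1) + s'.ints 64 (M + 1) + 2 * pot st (q :: en :: l) ≤ 2 * cost (n - 1) ∧
      s'.ints 65 0 = M + 1 ∧
      τ + 30 + 2000 * (L + 1) * pot st (q :: en :: l) ≤ 2000 * (L + 1) * pot st (en :: l)) ?_ ?_
  swap
  · rintro s' τ hs ⟨q, h3, h4, h5, h6, h7, h8⟩
    refine ⟨q, ⟨by rw [hs.int 0, hD.n_eq], by rw [hs.int 31, hD.par_eq], by rw [hs.real 30, hD.dep_eq],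
      by rw [hs.int 47, hD.st_eq], h7, h3, h4, h5, h6, ?_⟩, h8⟩
    simp only [List.length_cons] at hMle ⊢
    omega
  have hW4 : 4 * n + 10 < W := by omega
  refine .seq ((setupProg_spec hseg hR hlt hen hW4 hD.par_eq rfl hD.st_eq hf hD.dep_eq).mono ?_)
  rintro s1 t1 hs1 ⟨ht1, hm1, g44, g1⟩
  refine .seq ((sizeProg_spec hseg hR hlt hen hW4 hm1 fun x hx => (g1 x hx).1).mono ?_)
  rintro s2 t2 hs2 ⟨ht2, hm2, gsz⟩
  refine .seq ((centProg_spec hseg hR hlt hen hW4 hm2 rfl gsz).mono ?_)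
  rintro s3 t3 hs3 ⟨ht3, hm3, c, g50, hc, hbig, hsmall⟩
  refine .seq ((flagProg_spec hseg hR hlt hen hW4 hm3 g50 hc fun x hx => ?_).mono ?_)
  · rw [hs3.int 43, hs2.int 43, (g1 x hx).2]
  rintro s4 t4 hs4 ⟨ht4, hm4, g43⟩
  refine .seq ((markProg_spec (sz := s2.ints 42) hseg hR hlt hen hW4 hm4 ?_ gsz ?_ hc hbig hsmall
    g43 ?_).mono ?_)
  · rw [hs4.int 42, hs3.int 42]
  · rw [hs4.int 50, g50]
  · rw [hs4.int 44, hs3.int 44, hs2.int 44, g44]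
  rintro s5 t5 hs5 ⟨ht5, hm5, k50, ⟨acc, hS⟩, k40⟩
  have k65 : s5.ints 65 = s.ints 65 := by
    rw [hs5.int 65, hs4.int 65, hs3.int 65, hs2.int 65, hs1.int 65]
  have k64 : s5.ints 64 = s.ints 64 := by
    rw [hs5.int 64, hs4.int 64, hs3.int 64, hs2.int 64, hs1.int 64]
  refine .seq ((emitProg_spec (o := o) hseg hW4 (by omega) hlt hen hm5 k50
    (by rw [k65, k64, hD.M_eq]) rfl k40).mono ?_)
  rintro s6 t6 hs6 ⟨ht6, q, r, hE⟩
  have hqr := hE.qr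
  have hr : r = acc := by rw [hE.card, hS.card_marked hseg hR]
  have hacc1 := hS.le_acc
  have hacc2 := hS.acc_le
  have hlen6 := hE.len_le
  have c65 : s6.ints 65 0 = M := by rw [hs6.int 65, k65, hD.M_eq]
  have c63 : s6.ints 63 = s.ints 63 := by
    rw [hs6.int 63, hs5.int 63, hs4.int 63, hs3.int 63, hs2.int 63, hs1.int 63]
  have c64 : s6.ints 64 = s.ints 64 := by rw [hs6.int 64, k64]
  have c60 : s6.ints 60 = s.ints 60 := by
    rw [hs6.int 60, hs5.int 60, hs4.int 60, hs3.int 60, hs2.int 60, hs1.int 60]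
  have c61 : s6.ints 61 = s.ints 61 := by
    rw [hs6.int 61, hs5.int 61, hs4.int 61, hs3.int 61, hs2.int 61, hs1.int 61]
  have d60 : s6.reals 60 = s.reals 60 := by
    rw [hs6.real 60, hs5.real 60, hs4.real 60, hs3.real 60, hs2.real 60, hs1.real 60]
  have c62 : s5.ints 62 = s.ints 62 := by
    rw [hs5.int 62, hs4.int 62, hs3.int 62, hs2.int 62, hs1.int 62]
  have d61 : s5.reals 61 = s.reals 61 := by
    rw [hs5.real 61, hs4.real 61, hs3.real 61, hs2.real 61, hs1.real 61]
  have c41 : s6.ints 41 = s.ints 41 := by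
    rw [hs6.int 41, hs5.int 41, hs4.int 41, hs3.int 41, hs2.int 41, hs1.int 41]
  refine (finishProg_spec (oM := oM) (L := L) hW4 (o := o) (by omega) (by omega) (M := M)
    (by omega) (by omega) hen hE (by omega) hL ?_ ?_ c65 (by rw [c63])).mono ?_
  · rw [hs6.int 47, hm5.st_eq]
  · rw [hs6.int 48, hm5.en_eq]
  rintro s7 t7 hs7 ⟨ht7, hC⟩
  obtain ⟨hN, hsum, -, hhit⟩ := hC.nodeAt hseg hR hlt hS hE hen (by rw [c63]) (by rw [c64])
  have hstq : st < q := by omega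
  have hqen : q < en := by omega
  have hs₁ := hC.parted.seg₁ hS hseg hR
  have hs₂ := hC.parted.seg₂ hS hseg hR
  have ht₁ := hs₁.top_eq hR hstq
  have ht₂ := hs₂.top_eq hR hqen
  -- The drop of the potential also pays for the size of the new node, which has at most `en - st`
  -- rows and columns.
  have hcost := cost_split (m := en - st) (x := q - st) (y := en - q) (by omega) (by omega)
    (by omega) (by omega)
  refine ⟨q, ⟨?_, hstq, ?_, ?_, hqen, ?_, ?_⟩, ?_, ?_, ?_, hC.M_eq, ?_⟩
  · rw [hC.ends, if_neg (by omega), if_pos rfl]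
  · rw [ht₁]
    exact hs₁
  · rw [hC.ends, if_pos rfl]
  · rw [ht₂]
    exact hs₂
  · refine hrest.congr hC.rest fun i hi => ?_
    rw [hC.ends, if_neg (by omega), if_neg (by omega), c41]
  · refine hD.nodes.snoc (fun κ hκ => ?_) (fun κ hκ => ?_) (fun i hi => ?_) (fun j hj => ?_) hN
    · rw [hC.oa, if_neg (by omega), c63]
    · rw [hC.ob, if_neg (by omega), c64]
    · rw [(hC.old i hi).1, (hC.old i hi).2.1, (hC.old i hi).2.2, c60, c61, d60]
      simp
    · rw [hC.b, hC.Y, (hE.old j hj).1, (hE.old j hj).2, c62, d61]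
      simp
  · intro u v hvu hu
    have h1 := hD.cover u v hvu hu
    have h2 := hhit u v (by omega)
    rw [segHits] at h1
    rw [segHits, segHits, segHits_congr hrest hC.rest, Finset.sum_range_succ, ht₁, ht₂]
    rw [← he, ← ht, ← h2] at h1
    have h3 : ∑ κ ∈ Finset.range M, pairHits (s7.ints 63) (s7.ints 64) (s7.ints 60) (s7.ints 62) κ u v
        = ∑ κ ∈ Finset.range M, pairHits (s.ints 63) (s.ints 64) (s.ints 60) (s.ints 62) κ u v := by
      refine Finset.sum_congr rfl fun κ hκ => ?_
      rw [Finset.mem_range] at hκ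
      have h4 := hD.nodes.oa_mono (κ := κ + 1) (κ' := M) hκ le_rfl
      have h5 := hD.nodes.ob_mono (κ := κ + 1) (κ' := M) hκ le_rfl
      refine pairHits_congr ?_ ?_ ?_ ?_ (fun i hi => ?_) fun j hj => ?_
      · rw [hC.oa, if_neg (by omega), c63]
      · rw [hC.oa, if_neg (by omega), c63]
      · rw [hC.ob, if_neg (by omega), c64]
      · rw [hC.ob, if_neg (by omega), c64]
      · rw [(hC.old i (by omega)).1, c60]
      · rw [hC.b, (hE.old j (by omega)).1, c62]
    rw [h3]
    omega
  · rw [hC.oa, hC.ob, if_pos rfl, if_pos rfl]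
    simp only [pot] at hsz ⊢
    omega
  · have h3 := segProg_time (m := en - st) (x := q - st) (y := en - q) (L := L)
      (len := s6.ints 12 0) (by omega) (by omega) (by omega) (by omega) (by omega) (pot en l)
    simp only [pot]
    omega

/-- A single edge becomes a node with its upper end as the only row, at distance 0, and its lower
end as the only column. It is a separate case because `cost_split` needs two edges. -/
theorem baseProg_spec {s : Mem} {L : ℕ} (hR : RTree n par dep)
    (hW : 2 * cost (n - 1) + 4 * n + 12 < W) (hD : Decomp n par dep st (en :: l) M s)
    (h2 : en = st + 1) :
    Ends W baseProg s fun s' τ => Decomp n par dep en l (M + 1) s' ∧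
      τ + 30 + 2000 * (L + 1) * pot en l ≤ 2000 * (L + 1) * pot st (en :: l) := by
  classical
  obtain ⟨hf, hlt, hseg, hrest⟩ := hD.segs
  have hen := hrest.lt
  have hsz := hD.size
  have hMle := hD.M_le
  have hlen := hD.segs.add_length_le
  simp only [List.length_cons] at hMle hlen
  have hpot : pot st (en :: l) = 1 + pot en l := by
    rw [pot, h2, Nat.add_sub_cancel_left, cost_one]
  rw [hpot] at hsz
  have h1W : 1 % W = 1 := Nat.mod_eq_of_lt (by omega)
  have hMW : (M + 1) % W = M + 1 := Nat.mod_eq_of_lt (by omega)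
  have htop := hseg.top_lt st le_rfl hlt
  have hvn := hseg.lt st le_rfl hlt
  have hbase : ∀ x, InSeg (s.ints 40) st en (par (s.ints 40 st)) x ↔
      x = par (s.ints 40 st) ∨ s.ints 40 st = x := by
    intro x
    refine or_congr_right ⟨?_, fun h => ⟨st, le_rfl, hlt, h⟩⟩
    rintro ⟨j, h3, h4, h5⟩
    rw [← h5, show j = st by omega]
  set oM := s.ints 63 M with hoM
  set o := s.ints 64 M with ho
  set v := s.ints 40 st with hv
  set t := par v with ht
  have hs1 := exec_same W baseProg s
  have a60 : ∀ x, (Prog.exec W baseProg s).ints 60 x = if x = oM then t else s.ints 60 x := by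
    intro x
    simp [baseProg, Prog.exec, hD.st_eq, hD.M_eq, hD.par_eq, ← hv, ← ht, ← hoM, ← ho, h1W, hMW]
  have a61 : ∀ x, (Prog.exec W baseProg s).ints 61 x = if x = oM then 0 else s.ints 61 x := by
    intro x
    simp [baseProg, Prog.exec, hD.st_eq, hD.M_eq, hD.par_eq, ← hv, ← ht, ← hoM, ← ho, h1W, hMW]
  have a62 : ∀ x, (Prog.exec W baseProg s).ints 62 x = if x = o then v else s.ints 62 x := by
    intro x
    simp [baseProg, Prog.exec, hD.st_eq, hD.M_eq, hD.par_eq, ← hv, ← ht, ← hoM, ← ho, h1W, hMW]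
  have b60 : ∀ x, (Prog.exec W baseProg s).reals 60 x = if x = oM then 0 else s.reals 60 x := by
    intro x
    simp [baseProg, Prog.exec, hD.st_eq, hD.M_eq, hD.par_eq, ← hv, ← ht, ← hoM, ← ho, h1W, hMW]
  have b61 : ∀ x, (Prog.exec W baseProg s).reals 61 x =
      if x = o then dep v - dep t else s.reals 61 x := by
    intro x
    simp [baseProg, Prog.exec, hD.st_eq, hD.M_eq, hD.par_eq, hD.dep_eq, ← hv, ← ht, ← hoM, ← ho, h1W,
      hMW]
  have a63 : ∀ x, (Prog.exec W baseProg s).ints 63 x = if x = M + 1 then oM + 1 else s.ints 63 x := by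
    intro x
    simp (disch := omega) [baseProg, Prog.exec, hD.st_eq, hD.M_eq, hD.par_eq, ← hv, ← ht, ← hoM, ← ho,
      h1W, hMW, Nat.mod_eq_of_lt]
  have a64 : ∀ x, (Prog.exec W baseProg s).ints 64 x = if x = M + 1 then o + 1 else s.ints 64 x := by
    intro x
    simp (disch := omega) [baseProg, Prog.exec, hD.st_eq, hD.M_eq, hD.par_eq, ← hv, ← ht, ← hoM, ← ho,
      h1W, hMW, Nat.mod_eq_of_lt]
  have a0 : (Prog.exec W baseProg s).ints 65 0 = M + 1 ∧
      (Prog.exec W baseProg s).ints 47 0 = en := by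
    simp (disch := omega) [baseProg, Prog.exec, hD.st_eq, hD.M_eq, h1W, hMW, Nat.mod_eq_of_lt, h2]
  refine .flat rfl fun τ hτ => ?_
  have e1 : baseProg.time ≤ 200 := by decide
  generalize Prog.exec W baseProg s = s' at *
  have c1 : s'.ints 63 M = oM := by rw [a63, if_neg (by omega)]
  have c2 : s'.ints 63 (M + 1) = oM + 1 := by rw [a63, if_pos rfl]
  have c3 : s'.ints 64 M = o := by rw [a64, if_neg (by omega)]
  have c4 : s'.ints 64 (M + 1) = o + 1 := by rw [a64, if_pos rfl]
  have c5 : s'.ints 60 oM = t := by rw [a60, if_pos rfl]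
  have c6 : s'.ints 62 o = v := by rw [a62, if_pos rfl]
  have c7 : s'.ints 61 oM = 0 := by rw [a61, if_pos rfl]
  have c8 : s'.reals 60 oM = 0 := by rw [b60, if_pos rfl]
  have c9 : s'.reals 61 o = dep v - dep t := by rw [b61, if_pos rfl]
  have hN : NodeAt n M (s'.ints 63) (s'.ints 64) (s'.ints 60) (s'.ints 61) (s'.ints 62) (s'.reals 60)
      (s'.reals 61) (rd par dep) := by
    have hi : ∀ i, oM ≤ i → i < oM + 1 → i = oM := fun i h1 h2 => by omega
    have hj : ∀ i, o ≤ i → i < o + 1 → i = o := fun i h1 h2 => by omega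
    refine ⟨by omega, by omega, by omega, by omega, ?_, ?_, ?_, ?_, ?_, ?_, ?_, ?_⟩
    all_goals try rw [c1, c2]
    all_goals try rw [c3, c4]
    · intro i h3 h4
      rw [hi i h3 h4, c5]
      omega
    · intro i h3 h4
      rw [hj i h3 h4, c6]
      omega
    · intro i j h3 h4 h5
      rw [hi i h3 (by omega), hi j (by omega) h5]
    · intro i j h3 h4 h5
      rw [hj i h3 (by omega), hj j (by omega) h5]
    · intro i h3 h4
      rw [hi i h3 h4, c7]
      omega
    · intro i j h3 h4 h5 h6
      rw [hi i h3 h4, hj j h5 h6, c7, c5, c6]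
      omega
    · intro i j h3 h4 h5 h6
      rw [hi i h3 h4, hj j h5 h6, c5, c6]
      omega
    · intro i j h3 h4 h5 h6
      rw [hi i h3 h4, hj j h5 h6, c5, c6, c8, c9, hR.rd_right htop hvn,
        ← ht, rd_self]
  refine ⟨⟨by rw [hs1.int 0, hD.n_eq], by rw [hs1.int 31, hD.par_eq], by rw [hs1.real 30, hD.dep_eq],
    a0.2, a0.1, ?_, ?_, ?_, ?_, by omega⟩, ?_⟩
  · rw [hs1.int 40, hs1.int 41]
    exact hrest
  · refine hD.nodes.snoc (fun κ hκ => ?_) (fun κ hκ => ?_) (fun i hi => ?_) (fun j hj => ?_) hN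
    · rw [a63, if_neg (by omega)]
    · rw [a64, if_neg (by omega)]
    · have : i ≠ oM := hi.ne
      rw [a60, a61, b60, if_neg this, if_neg this, if_neg this]
      simp
    · have : j ≠ o := hj.ne
      rw [a62, b61, if_neg this, if_neg this]
      simp
  · intro u w hwu hu
    have h1 := hD.cover u w hwu hu
    rw [segHits] at h1
    rw [← hv, ← ht, hbase, hbase] at h1
    have h3 : ∑ κ ∈ Finset.range M, pairHits (s'.ints 63) (s'.ints 64) (s'.ints 60) (s'.ints 62) κ u w
        = ∑ κ ∈ Finset.range M, pairHits (s.ints 63) (s.ints 64) (s.ints 60) (s.ints 62) κ u w := by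
      refine Finset.sum_congr rfl fun κ hκ => ?_
      rw [Finset.mem_range] at hκ
      have h4 := hD.nodes.oa_mono (κ := κ + 1) (κ' := M) hκ le_rfl
      have h5 := hD.nodes.ob_mono (κ := κ + 1) (κ' := M) hκ le_rfl
      refine pairHits_congr ?_ ?_ ?_ ?_ (fun i hi => ?_) fun j hj => ?_
      · rw [a63, if_neg (by omega)]
      · rw [a63, if_neg (by omega)]
      · rw [a64, if_neg (by omega)]
      · rw [a64, if_neg (by omega)]
      · rw [a60, if_neg (by omega)]
      · rw [a62, if_neg (by omega)]
    rw [hs1.int 40, Finset.sum_range_succ, h3, add_assoc, ← h1]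
    congr 2
    rw [pairHits_eq hwu.ne', c1, c2, c3, c4]
    simp only [Nat.Ico_succ_singleton, Finset.sum_singleton, Nat.add_sub_cancel_left,
      Finset.sum_range_one, add_zero, c5, c6]
    have hne : t ≠ v := htop.ne
    by_cases h6 : t = u
    · have h7 : t ≠ w := fun h => hwu.ne' (h6.symm.trans h)
      have h8 : v ≠ u := fun h => hne (h6.trans h.symm)
      simp [h6.symm, h7, h7.symm, hne.symm]
    · by_cases h7 : t = w
      · simp [h7.symm, h6, Ne.symm h6, hne, hne.symm]
      · by_cases h8 : v = u
        · have : v ≠ w := fun h => hwu.ne' (h8.symm.trans h)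
          simp [h6, h7, this, Ne.symm h7]
        · simp [h6, h7, h8, Ne.symm h6]
  · rw [c2, c4]
    omega
  · rw [hpot, mul_add (2000 * (L + 1))]
    omega

theorem decompProg_spec {s : Mem} {L : ℕ} (hR : RTree n par dep) (hn : 0 < n) (hL : n ≤ 2 ^ L)
    (hW : 2 * cost (n - 1) + 4 * n + 12 < W) (h0 : s.ints 0 0 = n) (h31 : s.ints 31 = par)
    (h30 : s.reals 30 = dep) :
    Ends W decompProg s fun s' τ => τ ≤ 2000 * (L + 1) * cost (n - 1) + 40 * n + 200 ∧
      ∃ M, Decomp n par dep (n - 1) [] M s' := by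
  classical
  have h1W : 1 % W = 1 := Nat.mod_eq_of_lt (by omega)
  refine .seq (Ends.mono (Q := fun s' τ => τ ≤ 40 * n + 100 ∧ ∃ l, Decomp n par dep 0 l 0 s' ∧
    pot 0 l ≤ cost (n - 1)) (.seq (.flat rfl fun t1 ht1 => ?_)) ?_)
  · set init : Prog := .ivar 52 0 ;; .ivar 65 0 ;; .ivar 47 0 ;; .iset 63 0 0 ;; .iset 64 0 0 ;;
      .iset 41 0 (.var 0 - 1) with hinit
    have e1 : init.time ≤ 50 := by decide
    have hs1 := exec_same W init s
    have i1 : (Prog.exec W init s).ints 52 0 = 0 ∧ (Prog.exec W init s).ints 65 0 = 0 ∧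
        (Prog.exec W init s).ints 47 0 = 0 ∧ (Prog.exec W init s).ints 63 0 = 0 ∧
        (Prog.exec W init s).ints 64 0 = 0 ∧ (Prog.exec W init s).ints 41 0 = n - 1 := by
      simp [init, Prog.exec, h0, h1W]
    obtain ⟨i1, i2, i3, i4, i5, i6⟩ := i1
    generalize Prog.exec W init s = s1 at *
    refine (Ends.count_flat (fun i s' => s'.ints 52 0 = i ∧ s'.ints 0 0 = n ∧
      ∀ x < i, s'.ints 40 x = x + 1) 40 0 n (Nat.zero_le _)
      ⟨i1, by rw [hs1.int 0, h0], fun x hx => by omega⟩ ?_ ?_).mono ?_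
    · rintro i s' hi ⟨j1, j2, -⟩
      simp [j1, j2]
    · rintro i s' hi ⟨j1, j2, j3⟩ -
      refine ⟨?_, ?_, ?_⟩
      · simp (disch := omega) [Prog.exec, j1, Nat.mod_eq_of_lt]
      · simp [Prog.exec, j2]
      · intro x hx
        by_cases hxi : x = i
        · simp (disch := omega) [Prog.exec, j1, hxi, Nat.mod_eq_of_lt]
        · simpa [Prog.exec, j1, hxi] using j3 x (by omega)
    · rintro s2 t2 hs2 ⟨⟨-, j2, j3⟩, ht2⟩
      -- Position `x` holds vertex `x + 1`: the root is the top of the first segment and not a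
      -- member. A single vertex has no edges and gives no segment.
      refine ⟨by omega, if n = 1 then [] else [n - 1], ⟨j2, by rw [hs2.int 31, hs1.int 31, h31],
        by rw [hs2.real 30, hs1.real 30, h30], by rw [hs2.int 47, i3], by rw [hs2.int 65, i2], ?_, ?_,
        ?_, ?_, by omega⟩, ?_⟩
      · split_ifs with h1
        · rw [Segs, h1]
        · refine ⟨by rw [hs2.int 41, i6], by omega, ?_, by rw [Segs]; omega⟩
          have hp : par (s2.ints 40 0) = 0 := by
            rw [j3 0 hn]
            have := hR.par_lt 1 (by omega) (by omega)
            simpa using this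
          rw [hp]
          refine ⟨fun i _ h3 => ?_, fun i j _ h3 h4 => ?_, fun i _ h3 => ?_, fun i _ h3 => ?_⟩
          · rw [j3 i (by omega)]; omega
          · rw [j3 i (by omega), j3 j (by omega)]; omega
          · rw [j3 i (by omega)]; omega
          · rw [j3 i (by omega)]
            have := hR.par_lt (i + 1) (by omega) (by omega)
            by_cases h4 : par (i + 1) = 0
            · exact .inl h4
            · exact .inr ⟨par (i + 1) - 1, Nat.zero_le _, by omega, by
                rw [j3 _ (by omega)]; omega⟩
      · exact .of_at (by rw [hs2.int 63, i4]) (by rw [hs2.int 64, i5]) fun κ hκ => by omega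
      · intro u v hvu hu
        rw [Finset.range_zero, Finset.sum_empty, zero_add, if_neg (by omega), segHits, segHits,
          if_pos, add_zero]
        have hp : par (s2.ints 40 0) = 0 := by
          rw [j3 0 hn]
          have := hR.par_lt 1 (by omega) (by omega)
          simpa using this
        have key : ∀ x < n, InSeg (s2.ints 40) 0 (n - 1) 0 x := by
          intro x hx
          by_cases h4 : x = 0
          · exact .inl h4
          · exact .inr ⟨x - 1, Nat.zero_le _, by omega, by rw [j3 _ (by omega)]; omega⟩
        rw [hp]
        exact ⟨key u hu, key v (by omega)⟩
      · rw [hs2.int 63, hs2.int 64, i4, i5]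
        split_ifs
        · simp [pot]
        · simp [pot]
      · split_ifs
        · simp [pot]
        · simp [pot]
  · rintro s1 t1 - ⟨ht1, l, hD, hpot⟩
    refine (Ends.loop (fun (g : ℕ × List ℕ × ℕ) s' => Decomp n par dep g.1 g.2.1 g.2.2 s')
      (fun g => 2000 * (L + 1) * pot g.1 g.2.1) (0, l, 0) hD ?_).mono ?_
    · rintro ⟨st, l, M⟩ s' hD' hb -
      simp only at hD'
      have hln := hD'.segs.lt
      simp (disch := omega) only [holds_ilt, val_add, val_get, val_num, hD'.st_eq, Nat.zero_mod,
        Nat.mod_eq_of_lt, hD'.n_eq] at hb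
      cases l with
      | nil =>
        have := hD'.segs
        rw [Segs] at this
        omega
      | cons en l =>
        have hen := hD'.segs.2.2.2.lt
        have hlt := hD'.segs.2.1
        have e41 := hD'.segs.1
        have hcost : BExp.cost (.ilt (.var 47 + 1) (.get 41 (.var 47))) ≤ 10 := by decide
        have hcost' : BExp.cost (.ilt (.var 47 + 1) (.var 0)) ≤ 10 := by decide
        refine .ite (fun h => ?_) fun h => ?_
        · simp (disch := omega) only [holds_ilt, val_add, val_get, val_num, hD'.st_eq, Nat.zero_mod,
            Nat.mod_eq_of_lt, e41] at h
          refine (segProg_spec hR hL hW hD' h).mono ?_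
          rintro s2 t2 - ⟨q, h3, h4⟩
          refine ⟨(st, q :: en :: l, M + 1), h3, ?_⟩
          simp only
          omega
        · simp (disch := omega) only [holds_ilt, val_add, val_get, val_num, hD'.st_eq, Nat.zero_mod,
            Nat.mod_eq_of_lt, e41] at h
          refine (baseProg_spec (L := L) hR hW hD' (by omega)).mono ?_
          rintro s2 t2 - ⟨h3, h4⟩
          refine ⟨(en, l, M + 1), h3, ?_⟩
          simp only
          omega
    · rintro s2 t2 - ⟨⟨st, l', M⟩, hD', hb, ht2⟩
      simp only at hD' ht2
      have hln := hD'.segs.lt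
      have hcost' : BExp.cost (.ilt (.var 47 + 1) (.var 0)) ≤ 10 := by decide
      have h5 := Nat.mul_le_mul_left (2000 * (L + 1)) hpot
      refine ⟨by omega, M, ?_⟩
      simp (disch := omega) only [holds_ilt, val_add, val_get, val_num, hD'.st_eq, Nat.zero_mod,
        Nat.mod_eq_of_lt, hD'.n_eq] at hb
      have hst : st = n - 1 := by omega
      cases l' with
      | nil => exact hst ▸ hD'
      | cons en l =>
        have := hD'.segs.2.1
        have := hD'.segs.2.2.2.lt
        omega

end Decomposition

end PartialCenter

set_option linter.unusedSimpArgs false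

namespace PartialCenter

/-! ## Rooting a tree -/

/-- The edges with the ends `A i`, `B i` and the lengths `ℓ i` join the vertices `σ i` to their
parents in a tree with root `0`; the height `h` is smaller at the parent. -/
structure Rooting (n : ℕ) (A B : ℕ → ℕ) (ℓ : ℕ → ℝ) (σ tp h : ℕ → ℕ) (pl : ℕ → ℝ) : Prop where
  σ_pos : ∀ i < n - 1, 0 < σ i
  σ_lt : ∀ i < n - 1, σ i < n
  σ_inj : ∀ i < n - 1, ∀ j < n - 1, σ i = σ j → i = j
  σ_surj : ∀ w, 0 < w → w < n → ∃ i < n - 1, σ i = w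
  tp_lt : ∀ w, 0 < w → w < n → tp w < n
  h_lt : ∀ w, 0 < w → w < n → h (tp w) < h w
  ends : ∀ i < n - 1, (A i = σ i ∧ B i = tp (σ i)) ∨ (B i = σ i ∧ A i = tp (σ i))
  len : ∀ i < n - 1, ℓ i = pl (σ i)
  pl_pos : ∀ w, 0 < w → w < n → 0 < pl w

/-- Each edge has a unique lower end, so sums over the edge list become sums over the vertices other
than the root. -/
theorem Rooting.sum_eq {n : ℕ} {A B : ℕ → ℕ} {ℓ : ℕ → ℝ} {σ tp h : ℕ → ℕ} {pl : ℕ → ℝ}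
    (hr : Rooting n A B ℓ σ tp h pl) {β : Type*} [AddCommMonoid β] (f : ℕ → β) :
    ∑ i ∈ Finset.range (n - 1), f (σ i) = ∑ w ∈ Finset.Ico 1 n, f w := by
  refine Finset.sum_bij (fun i _ => σ i) (fun i hi => ?_) (fun i hi j hj hij => ?_)
    (fun w hw => ?_) fun _ _ => rfl
  · rw [Finset.mem_range] at hi
    exact Finset.mem_Ico.2 ⟨hr.σ_pos i hi, hr.σ_lt i hi⟩
  · exact hr.σ_inj i (Finset.mem_range.1 hi) j (Finset.mem_range.1 hj) hij
  · rw [Finset.mem_Ico] at hw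
    obtain ⟨i, h1, h2⟩ := hr.σ_surj w hw.1 hw.2
    exact ⟨i, Finset.mem_range.2 h1, h2⟩

theorem exists_closer {V : Type*} {T : SimpleGraph V} (hT : T.Connected) {v r : V} (h : v ≠ r) :
    ∃ w, T.Adj v w ∧ T.dist w r < T.dist v r := by
  obtain ⟨p, hp⟩ := hT.exists_walk_length_eq_dist v r
  cases p with
  | nil => exact absurd rfl h
  | cons hadj q =>
    refine ⟨_, hadj, ?_⟩
    rw [← hp, SimpleGraph.Walk.length_cons]
    exact Nat.lt_succ_of_le (SimpleGraph.dist_le q)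

/-- The edges of a tree correspond to its vertices except the root. -/
theorem exists_child {n : ℕ} {T : SimpleGraph (Fin n)} (hT : T.IsTree) (r : Fin n)
    {ends : Fin (n - 1) → Fin n × Fin n} (hE : IsEdgeList T ends) :
    ∃ (σ : Fin (n - 1) → Fin n) (tp : Fin n → Fin n), (∀ i, σ i ≠ r) ∧ Function.Injective σ ∧
      (∀ w, w ≠ r → ∃ i, σ i = w) ∧ (∀ w, w ≠ r → T.dist (tp w) r < T.dist w r) ∧
      ∀ i, ends i = (σ i, tp (σ i)) ∨ ends i = (tp (σ i), σ i) := by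
  have hadj : ∀ i, T.Adj (ends i).1 (ends i).2 := fun i => (hE _ _).2 ⟨i, .inl rfl⟩
  -- In a tree the ends of an edge have different distances from the root, which tells the child
  -- from the parent.
  have key : ∀ i, ∃ c p : Fin n, T.dist p r < T.dist c r ∧ (ends i = (c, p) ∨ ends i = (p, c)) := by
    intro i
    rcases lt_or_gt_of_ne (hT.dist_ne_of_adj r (hadj i)) with h | h
    · rw [SimpleGraph.dist_comm, SimpleGraph.dist_comm (u := r)] at h
      exact ⟨_, _, h, .inr rfl⟩
    · rw [SimpleGraph.dist_comm, SimpleGraph.dist_comm (u := r)] at h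
      exact ⟨_, _, h, .inl rfl⟩
  choose σ q hσ hends using key
  have hne : ∀ i, σ i ≠ r := by
    intro i h
    have := hσ i
    rw [h, SimpleGraph.dist_self] at this
    omega
  have hsurj : ∀ w, w ≠ r → ∃ i, σ i = w := by
    intro w hw
    obtain ⟨v, h1, h2⟩ := exists_closer hT.connected hw
    obtain ⟨i, hi⟩ := (hE w v).1 h1
    refine ⟨i, ?_⟩
    have h3 := hσ i
    rcases hends i with h4 | h4 <;> rcases hi with h5 | h5 <;> rw [h4, Prod.mk.injEq] at h5
    · exact h5.1
    · rw [h5.1, h5.2] at h3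
      omega
    · rw [h5.1, h5.2] at h3
      omega
    · exact h5.2
  -- Every vertex except the root is the lower end of some edge, and there are as many edges as such
  -- vertices; so the surjection is a bijection.
  have hinj : Function.Injective σ := by
    have h1 : Function.Surjective fun i => (⟨σ i, hne i⟩ : {w : Fin n // w ≠ r}) := fun w => by
      obtain ⟨i, hi⟩ := hsurj w.1 w.2
      exact ⟨i, Subtype.ext hi⟩
    have h2 : Fintype.card (Fin (n - 1)) = Fintype.card {w : Fin n // w ≠ r} := by
      simp [Fintype.card_subtype_compl]
    have h3 := ((Fintype.bijective_iff_surjective_and_card _).2 ⟨h1, h2⟩).1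
    intro i j hij
    exact h3 (Subtype.ext hij)
  classical
  refine ⟨σ, fun w => if hw : ∃ i, σ i = w then q hw.choose else w, hne, hinj, hsurj, ?_, ?_⟩
  · intro w hw
    have h1 := hsurj w hw
    simp only [dif_pos h1]
    have h2 := hσ h1.choose
    rwa [h1.choose_spec] at h2
  · intro i
    have h1 : ∃ j, σ j = σ i := ⟨i, rfl⟩
    have h2 : h1.choose = i := hinj h1.choose_spec
    simp only [dif_pos h1, h2]
    exact hends i

/-- A tree has a rooting. -/
theorem exists_rooting {n k : ℕ} {T : SimpleGraph (Fin n)} {len : Sym2 (Fin n) → ℝ} (hT : T.IsTree)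
    (hn : 0 < n) (hlen : ∀ e ∈ T.edgeSet, 0 < len e)
    {ends : Fin (n - 1) → Fin n × Fin n} (hE : IsEdgeList T ends) :
    ∃ (σ tp h : ℕ → ℕ) (pl : ℕ → ℝ), Rooting n ((inputMem k len ends).ints 2)
      ((inputMem k len ends).ints 3) ((inputMem k len ends).reals 0) σ tp h pl ∧
      (∀ u v : Fin n, T.Adj u v ↔ (0 < (v : ℕ) ∧ tp v = u) ∨ (0 < (u : ℕ) ∧ tp u = v)) ∧
      ∀ u v : Fin n, 0 < (v : ℕ) → tp v = u → pl v = len s(u, v) := by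
  obtain ⟨σ, tp, h1, h2, h3, h4, h5⟩ := exists_child hT ⟨0, hn⟩ hE
  have hpos : ∀ v : Fin n, v ≠ ⟨0, hn⟩ ↔ 0 < (v : ℕ) := fun v => by
    rw [Ne, Fin.ext_iff]
    exact Nat.pos_iff_ne_zero.symm
  have hadj : ∀ w, w ≠ ⟨0, hn⟩ → T.Adj (tp w) w := by
    intro w hw
    obtain ⟨i, rfl⟩ := h3 w hw
    exact (hE _ _).2 ⟨i, (h5 i).symm⟩
  refine ⟨fun i => if hi : i < n - 1 then σ ⟨i, hi⟩ else 0, fun w => if hw : w < n then tp ⟨w, hw⟩ else 0,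
    fun w => if hw : w < n then T.dist ⟨w, hw⟩ ⟨0, hn⟩ else 0,
    fun w => if hw : w < n then len s(tp ⟨w, hw⟩, ⟨w, hw⟩) else 0, ⟨?_, ?_, ?_, ?_, ?_, ?_, ?_, ?_, ?_⟩, ?_, ?_⟩
  · intro i hi
    rw [dif_pos hi]
    exact (hpos _).1 (h1 _)
  · intro i hi
    rw [dif_pos hi]
    exact (σ _).2
  · intro i hi j hj hij
    rw [dif_pos hi, dif_pos hj, ← Fin.ext_iff] at hij
    simpa using h2 hij
  · intro w hw hwn
    obtain ⟨i, hi⟩ := h3 ⟨w, hwn⟩ ((hpos _).2 hw)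
    exact ⟨i, i.2, by rw [dif_pos i.2, hi]⟩
  · intro w hw hwn
    rw [dif_pos hwn]
    exact (tp _).2
  · intro w hw hwn
    rw [dif_pos hwn, dif_pos (tp _).2, dif_pos hwn]
    exact h4 _ ((hpos _).2 hw)
  · intro i hi
    have hn1 : n ≠ 1 := by omega
    simp only [dif_pos hi, dif_pos (σ ⟨i, hi⟩).2]
    rcases h5 ⟨i, hi⟩ with h6 | h6
    · left
      simp [inputMem, hi, h6]
    · right
      simp [inputMem, hi, h6]
  · intro i hi
    simp only [dif_pos hi, dif_pos (σ ⟨i, hi⟩).2]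
    rcases h5 ⟨i, hi⟩ with h6 | h6
    · simp [inputMem, hi, h6, Sym2.eq_swap]
    · simp [inputMem, hi, h6]
  · intro w hw hwn
    rw [dif_pos hwn]
    exact hlen _ (hadj _ ((hpos _).2 hw))
  · intro u v
    simp only [dif_pos u.2, dif_pos v.2, ← Fin.ext_iff, ← hpos]
    constructor
    · intro h
      obtain ⟨i, hi⟩ := (hE u v).1 h
      have h7 := h1 i
      rcases hi with hi | hi <;> rcases h5 i with h6 | h6 <;> rw [h6, Prod.mk.injEq] at hi <;>
        obtain ⟨rfl, rfl⟩ := hi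
      · exact .inr ⟨h7, rfl⟩
      · exact .inl ⟨h7, rfl⟩
      · exact .inl ⟨h7, rfl⟩
      · exact .inr ⟨h7, rfl⟩
    · rintro (⟨h6, rfl⟩ | ⟨h6, rfl⟩)
      · exact hadj v h6
      · exact (hadj u h6).symm
  · intro u v _ h6
    simp only [dif_pos v.2] at h6 ⊢
    rw [← Fin.ext h6]

/-- A tree is presented by its vertices in the order of their depths. -/
theorem Models.of_rooting {n : ℕ} {T : SimpleGraph (Fin n)} {len : Sym2 (Fin n) → ℝ}
    {A B σ tp h : ℕ → ℕ} {ℓ pl D dep : ℕ → ℝ} {lb rk par : ℕ → ℕ} (hn : 0 < n)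
    (hr : Rooting n A B ℓ σ tp h pl)
    (hadj : ∀ u v : Fin n, T.Adj u v ↔ (0 < (v : ℕ) ∧ tp v = u) ∨ (0 < (u : ℕ) ∧ tp u = v))
    (hpl : ∀ u v : Fin n, 0 < (v : ℕ) → tp v = u → pl v = len s(u, v))
    (hD0 : D 0 = 0) (hD : ∀ w, 0 < w → w < n → D w = D (tp w) + pl w)
    (hlb : ∀ j < n, lb j < n) (hrk : ∀ w < n, rk w < n ∧ lb (rk w) = w)
    (hrk' : ∀ j < n, rk (lb j) = j) (hdep : ∀ j < n, dep j = D (lb j))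
    (hsort : ∀ x y, x ≤ y → y < n → dep x ≤ dep y)
    (hpar : ∀ j < n, 0 < lb j → par j = rk (tp (lb j))) :
    ∃ lab : Fin n ≃ Fin n, Models T len lab par dep ∧ ∀ i : Fin n, (lab i : ℕ) = lb i := by
  -- The induction is on the height, since the original numbers say nothing about the order of
  -- parents and children.
  have hDnn : ∀ N w, h w < N → w < n → 0 ≤ D w ∧ (0 < w → 0 < D w) := by
    intro N
    induction N with
    | zero => intro w hw; omega
    | succ N ih =>
      intro w hw hwn
      rcases Nat.eq_zero_or_pos w with rfl | h0
      · exact ⟨hD0.ge, fun h => by omega⟩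
      · have h1 := (ih (tp w) (by have := hr.h_lt w h0 hwn; omega) (hr.tp_lt w h0 hwn)).1
        have h2 := hr.pl_pos w h0 hwn
        rw [hD w h0 hwn]
        exact ⟨by linarith, fun _ => by linarith⟩
  have hDpos : ∀ w, 0 < w → w < n → 0 < D w := fun w h0 hw => (hDnn _ w (Nat.lt_succ_self _) hw).2 h0
  -- The root is the only vertex of depth 0, so sorting by depth puts it first.
  have hlb0 : lb 0 = 0 := by
    by_contra h0
    have h1 := hDpos (lb 0) (by omega) (hlb 0 hn)
    have h2 := hsort 0 (rk 0) (Nat.zero_le _) (hrk 0 hn).1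
    rw [hdep 0 hn, hdep _ (hrk 0 hn).1, (hrk 0 hn).2, hD0] at h2
    linarith
  have hlbpos : ∀ j < n, 0 < j → 0 < lb j := by
    intro j hj h0
    by_contra h1
    have h2 := hrk' j hj
    rw [show lb j = lb 0 by omega, hrk' 0 hn] at h2
    omega
  have hdeppar : ∀ j, 0 < j → j < n → par j < n ∧ dep j = dep (par j) + pl (lb j) ∧
      lb (par j) = tp (lb j) := by
    intro j h0 hj
    have h1 := hlbpos j hj h0
    have h2 := hr.tp_lt _ h1 (hlb j hj)
    rw [hpar j hj h1]
    refine ⟨(hrk _ h2).1, ?_, (hrk _ h2).2⟩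
    rw [hdep j hj, hD _ h1 (hlb j hj), hdep _ (hrk _ h2).1, (hrk _ h2).2]
  have hdlt : ∀ j, 0 < j → j < n → dep (par j) < dep j := by
    intro j h0 hj
    have := hr.pl_pos _ (hlbpos j hj h0) (hlb j hj)
    rw [(hdeppar j h0 hj).2.1]
    linarith
  have hinj : ∀ i < n, ∀ j < n, lb i = lb j → i = j := fun i hi j hj hij => by
    rw [← hrk' i hi, hij, hrk' j hj]
  refine ⟨⟨fun i => ⟨lb i, hlb i i.2⟩, fun w => ⟨rk w, (hrk w w.2).1⟩,
    fun i => Fin.ext (hrk' i i.2), fun w => Fin.ext (hrk w w.2).2⟩, ⟨⟨?_, hdlt, hsort, ?_⟩, ?_, ?_⟩,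
    fun _ => rfl⟩
  · intro j h0 hj
    -- Ties in the sorting are harmless: a parent is strictly less deep than its child, so it must
    -- come first.
    by_contra h1
    have h2 := hsort j (par j) (by omega) (hdeppar j h0 hj).1
    have h3 := hdlt j h0 hj
    linarith
  · rw [hdep 0 hn, hlb0, hD0]
  · have key : ∀ i j : Fin n, (0 < (j : ℕ) ∧ par j = i) ↔ (0 < lb j ∧ tp (lb j) = lb i) := by
      intro i j
      constructor
      · rintro ⟨h0, h1⟩
        exact ⟨hlbpos j j.2 h0, by rw [← h1, (hdeppar j h0 j.2).2.2]⟩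
      · rintro ⟨h0, h1⟩
        have h2 : 0 < (j : ℕ) := by
          by_contra h3
          rw [show (j : ℕ) = 0 by omega, hlb0] at h0
          omega
        refine ⟨h2, hinj _ (hdeppar j h2 j.2).1 _ i.2 ?_⟩
        rw [(hdeppar j h2 j.2).2.2, h1]
    intro i j
    rw [hadj, key i j, key j i]
    rfl
  · intro i j h0 h1
    have h2 := hdeppar j h0 j.2
    have h3 := hpl ⟨lb i, hlb i i.2⟩ ⟨lb j, hlb j j.2⟩ (hlbpos j j.2 h0) (by rw [← h2.2.2, h1])
    rw [h2.2.1, h1]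
    change len s(⟨lb i, hlb i i.2⟩, ⟨lb j, hlb j j.2⟩) = _
    rw [← h3]
    ring

end PartialCenter

set_option linter.unusedSimpArgs false

namespace PartialCenter

/-! ## Finding the parents by removing leaves -/

/-- Adds the neighbour `y` of `x` and the length of the current edge to the sums of `x`. -/
def addEnd (x y : IExp) : Prog :=
  .iset 20 x (.get 20 x + 1) ;; .iset 21 x (.get 21 x + y) ;;
  .rset 20 x (.get 20 x + .get 0 (.var 24))

/-- Computes the degree of every vertex, the sum of its neighbours and the total length of its
edges. -/
def degProg : Prog :=
  .ivar 24 0 ;; .loop (.ilt (.var 24 + 1) (.var 0))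
    (addEnd (.get 2 (.var 24)) (.get 3 (.var 24)) ;; addEnd (.get 3 (.var 24)) (.get 2 (.var 24)) ;;
      .ivar 24 (.var 24 + 1))

/-- Lists the leaves. -/
def leafProg : Prog :=
  (.ivar 24 1 ;; .ivar 25 0 ;; .ivar 26 0) ;; .loop (.ilt (.var 24) (.var 0))
    (.ite (.ieq (.get 20 (.var 24)) 1)
      (.iset 22 (.var 26) (.var 24) ;; .ivar 26 (.var 26 + 1)) .skip ;;
      .ivar 24 (.var 24 + 1))

/-- Removes a leaf. -/
def leafStep : Prog :=
  .ivar 24 (.get 22 (.var 25)) ;; .ivar 27 (.get 21 (.var 24)) ;;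
  .iset 20 (.var 27) (.get 20 (.var 27) - 1) ;;
  .iset 21 (.var 27) (.get 21 (.var 27) - .var 24) ;;
  .rset 20 (.var 27) (.get 20 (.var 27) - .get 20 (.var 24)) ;;
  .ite (.and (.ieq (.get 20 (.var 27)) 1) (.ilt 0 (.var 27)))
    (.iset 22 (.var 26) (.var 27) ;; .ivar 26 (.var 26 + 1)) .skip ;;
  .ivar 25 (.var 25 + 1)

/-- Computes the parents and an order in which children precede their parents. -/
def leavesProg : Prog := degProg ;; leafProg ;; .loop (.ilt (.var 25) (.var 26)) leafStep

/-- The sums of the vertices when `R` is the set of the remaining vertices other than the root. -/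
structure Sums (n : ℕ) (tp : ℕ → ℕ) (pl : ℕ → ℝ) (R : Finset ℕ) (s : Mem) : Prop where
  deg : ∀ v < n, s.ints 20 v = (if v = 0 then 0 else 1) + ∑ w ∈ R, if tp w = v then 1 else 0
  sum : ∀ v < n, s.ints 21 v = (if v = 0 then 0 else tp v) + ∑ w ∈ R, if tp w = v then w else 0
  len : ∀ v < n, s.reals 20 v = (if v = 0 then 0 else pl v) + ∑ w ∈ R, if tp w = v then pl w else 0

/-- The invariant of the removal of leaves. -/
structure Leaves (n : ℕ) (tp : ℕ → ℕ) (pl : ℕ → ℝ) (i q : ℕ) (R : Finset ℕ) (s : Mem) : Prop where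
  n_eq : s.ints 0 0 = n
  i_eq : s.ints 25 0 = i
  q_eq : s.ints 26 0 = q
  R_sub : R ⊆ Finset.Ico 1 n
  card : R.card + i = n - 1
  sums : Sums n tp pl R s
  up : ∀ w ∈ R, tp w ≠ 0 → tp w ∈ R
  inj : ∀ j < q, ∀ j' < q, s.ints 22 j = s.ints 22 j' → j = j'
  mem : ∀ j < q, s.ints 22 j ∈ Finset.Ico 1 n
  leaf : ∀ j, i ≤ j → j < q → s.ints 22 j ∈ R ∧ ∀ x ∈ R, tp x ≠ s.ints 22 j
  out : ∀ j < i, s.ints 22 j ∉ R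
  i_le : i ≤ q
  all : ∀ w ∈ R, (∀ x ∈ R, tp x ≠ w) → ∃ j, i ≤ j ∧ j < q ∧ s.ints 22 j = w
  order : ∀ j < i, ∀ j' ≤ j, s.ints 22 j' ≠ tp (s.ints 22 j)

section LeafRemoval
variable {W n : ℕ} {A B : ℕ → ℕ} {ℓ : ℕ → ℝ} {σ tp h : ℕ → ℕ} {pl : ℕ → ℝ}

/-- The contribution of the edge above `w` to a sum at `v`. -/
def contrib {β : Type} [AddCommMonoid β] (tp : ℕ → ℕ) (f g : ℕ → β) (v w : ℕ) : β :=
  (if w = v then f w else 0) + if tp w = v then g w else 0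

theorem Rooting.sum_contrib {β : Type} [AddCommMonoid β] (hr : Rooting n A B ℓ σ tp h pl)
    (f g : ℕ → β) {v : ℕ} (hv : v < n) :
    ∑ j ∈ Finset.range (n - 1), contrib tp f g v (σ j) =
      (if v = 0 then 0 else f v) + ∑ w ∈ Finset.Ico 1 n, if tp w = v then g w else 0 := by
  rw [hr.sum_eq (contrib tp f g v)]
  simp only [contrib]
  rw [Finset.sum_add_distrib, Finset.sum_ite_eq']
  congr 1
  by_cases h0 : v = 0
  · rw [if_pos h0, if_neg (by rw [Finset.mem_Ico]; omega)]
  · rw [if_neg h0, if_pos (Finset.mem_Ico.2 ⟨by omega, hv⟩)]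

theorem degProg_spec {s : Mem} (hr : Rooting n A B ℓ σ tp h pl) (hW : n * (2 * n) + 4 * n + 10 < W)
    (h0 : s.ints 0 0 = n) (h2 : s.ints 2 = A) (h3 : s.ints 3 = B) (hℓ : s.reals 0 = ℓ)
    (h20 : ∀ v < n, s.ints 20 v = 0) (h21 : ∀ v < n, s.ints 21 v = 0)
    (hr20 : ∀ v < n, s.reals 20 v = 0) :
    Ends W degProg s fun s' t => t ≤ 100 * n + 200 ∧ Sums n tp pl (Finset.Ico 1 n) s' := by
  have h1W : 1 % W = 1 := Nat.mod_eq_of_lt (by omega)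
  refine .seq (.flat rfl fun t1 ht1 => ?_)
  have e1 : (Prog.ivar 24 0).time ≤ 10 := by decide
  have hs1 := exec_same W (.ivar 24 0) s
  have i1 : (Prog.exec W (.ivar 24 0) s).ints 24 0 = 0 := by simp [Prog.exec]
  generalize Prog.exec W _ s = s1 at hs1 i1
  refine (Ends.count_flat (fun i s' => s'.ints 24 0 = i ∧ s'.ints 0 0 = n ∧
    (∀ v < n, s'.ints 20 v ≤ 2 * i ∧ s'.ints 21 v ≤ i * (2 * n)) ∧ ∀ v < n,
      s'.ints 20 v = ∑ j ∈ Finset.range i, contrib tp (fun _ => 1) (fun _ => 1) v (σ j) ∧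
      s'.ints 21 v = ∑ j ∈ Finset.range i, contrib tp tp (fun w => w) v (σ j) ∧
      s'.reals 20 v = ∑ j ∈ Finset.range i, contrib tp pl pl v (σ j)) 90 0 (n - 1) (Nat.zero_le _)
    ⟨i1, by rw [hs1.int 0, h0], fun v hv => ?_, fun v hv => ?_⟩ ?_ ?_).mono ?_
  · rw [hs1.int 20, hs1.int 21, h20 v hv, h21 v hv]
    simp
  · rw [hs1.int 20, hs1.int 21, hs1.real 20, h20 v hv, h21 v hv, hr20 v hv]
    simp
  · rintro i s' hi ⟨j1, j2, -⟩
    simp (disch := omega) [j1, j2, Nat.mod_eq_of_lt]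
    omega
  · rintro i s' hi ⟨j1, j2, j3, j4⟩ hs
    have hA : s'.ints 2 = A := by rw [hs.int 2, hs1.int 2, h2]
    have hB : s'.ints 3 = B := by rw [hs.int 3, hs1.int 3, h3]
    have hℓ' : s'.reals 0 = ℓ := by rw [hs.real 0, hs1.real 0, hℓ]
    have p1 := hr.σ_pos i hi
    have p2 := hr.σ_lt i hi
    have p3 := hr.tp_lt _ p1 p2
    have p4 : σ i ≠ tp (σ i) := fun h1 => by
      have := hr.h_lt _ p1 p2
      rw [← h1] at this
      omega
    have hAn : A i < n := by rcases hr.ends i hi with h1 | h1 <;> omega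
    have hBn : B i < n := by rcases hr.ends i hi with h1 | h1 <;> omega
    have hAB : A i ≠ B i := by rcases hr.ends i hi with h1 | h1 <;> omega
    -- An edge adds at most `2 * n` to a sum of neighbours, so the sums fit into words of quadratic
    -- range.
    have hin : (i + 1) * (2 * n) ≤ n * (2 * n) := Nat.mul_le_mul_right _ (by omega)
    have hin' : (i + 1) * (2 * n) = i * (2 * n) + 2 * n := by ring
    set body : Prog := addEnd (.get 2 (.var 24)) (.get 3 (.var 24)) ;;
      addEnd (.get 3 (.var 24)) (.get 2 (.var 24)) ;; .ivar 24 (.var 24 + 1) with hbody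
    have k20 : ∀ v < n, (Prog.exec W body s').ints 20 v = s'.ints 20 v +
        ((if A i = v then 1 else 0) + if B i = v then 1 else 0) := by
      intro v hv
      have hb := (j3 v hv).1
      have hm : (s'.ints 20 v + 1) % W = s'.ints 20 v + 1 := Nat.mod_eq_of_lt (by omega)
      by_cases hvA : A i = v
      · have hvB : B i ≠ v := fun h1 => hAB (hvA.trans h1.symm)
        simp [body, addEnd, Prog.exec, j1, hA, hB, hvA, hvB, hvB.symm, h1W, hm]
      · by_cases hvB : B i = v
        · simp [body, addEnd, Prog.exec, j1, hA, hB, hvA, Ne.symm hvA, hvB, h1W, hm]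
        · simp [body, addEnd, Prog.exec, j1, hA, hB, hvA, Ne.symm hvA, hvB, Ne.symm hvB]
    have k21 : ∀ v < n, (Prog.exec W body s').ints 21 v = s'.ints 21 v +
        ((if A i = v then B i else 0) + if B i = v then A i else 0) := by
      intro v hv
      have hb := (j3 v hv).2
      have hm : (s'.ints 21 v + B i) % W = s'.ints 21 v + B i := Nat.mod_eq_of_lt (by omega)
      have hm' : (s'.ints 21 v + A i) % W = s'.ints 21 v + A i := Nat.mod_eq_of_lt (by omega)
      by_cases hvA : A i = v
      · have hvB : B i ≠ v := fun h1 => hAB (hvA.trans h1.symm)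
        simp [body, addEnd, Prog.exec, j1, hA, hB, hvA, hvB, hvB.symm, h1W, hm]
      · by_cases hvB : B i = v
        · simp [body, addEnd, Prog.exec, j1, hA, hB, hvA, Ne.symm hvA, hvB, h1W, hm']
        · simp [body, addEnd, Prog.exec, j1, hA, hB, hvA, Ne.symm hvA, hvB, Ne.symm hvB]
    have kr : ∀ v, (Prog.exec W body s').reals 20 v = s'.reals 20 v +
        ((if A i = v then ℓ i else 0) + if B i = v then ℓ i else 0) := by
      intro v
      by_cases hvA : A i = v
      · have hvB : B i ≠ v := fun h1 => hAB (hvA.trans h1.symm)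
        simp [body, addEnd, Prog.exec, j1, hA, hB, hvA, hvB, hvB.symm, h1W, hℓ']
      · by_cases hvB : B i = v
        · simp [body, addEnd, Prog.exec, j1, hA, hB, hvA, Ne.symm hvA, hvB, h1W, hℓ']
        · simp [body, addEnd, Prog.exec, j1, hA, hB, hvA, Ne.symm hvA, hvB, Ne.symm hvB]
    have k24 : (Prog.exec W body s').ints 24 0 = i + 1 := by
      simp (disch := omega) [body, addEnd, Prog.exec, j1, Nat.mod_eq_of_lt]
    have k0 : (Prog.exec W body s').ints 0 0 = n := by rw [(exec_same W body s').int 0, j2]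
    generalize Prog.exec W body s' = s2 at *
    refine ⟨k24, k0, fun v hv => ⟨?_, ?_⟩, fun v hv => ⟨?_, ?_, ?_⟩⟩
    · have := (j3 v hv).1
      rw [k20 v hv]
      split_ifs <;> omega
    · have := (j3 v hv).2
      rw [k21 v hv, hin']
      split_ifs <;> omega
    · rw [k20 v hv, (j4 v hv).1, Finset.sum_range_succ, contrib]
      rcases hr.ends i hi with ⟨h1, h2⟩ | ⟨h1, h2⟩ <;> rw [h1, h2]
      rw [add_comm (if tp (σ i) = v then 1 else 0)]
    · rw [k21 v hv, (j4 v hv).2.1, Finset.sum_range_succ, contrib]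
      rcases hr.ends i hi with ⟨h1, h2⟩ | ⟨h1, h2⟩ <;> rw [h1, h2]
      rw [add_comm (if tp (σ i) = v then σ i else 0)]
    · rw [kr v, (j4 v hv).2.2, Finset.sum_range_succ, contrib, hr.len i hi]
      rcases hr.ends i hi with ⟨h1, h2⟩ | ⟨h1, h2⟩ <;> rw [h1, h2]
      rw [add_comm (if tp (σ i) = v then pl (σ i) else 0)]
  · rintro s2 t2 - ⟨⟨-, -, -, j4⟩, ht2⟩
    refine ⟨by omega, fun v hv => ?_, fun v hv => ?_, fun v hv => ?_⟩
    · rw [(j4 v hv).1, hr.sum_contrib _ _ hv]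
    · rw [(j4 v hv).2.1, hr.sum_contrib _ _ hv]
    · rw [(j4 v hv).2.2, hr.sum_contrib _ _ hv]

theorem leafProg_spec {s : Mem} (hr : Rooting n A B ℓ σ tp h pl) (hn : 0 < n)
    (hW : n * (2 * n) + 4 * n + 10 < W) (h0 : s.ints 0 0 = n)
    (hS : Sums n tp pl (Finset.Ico 1 n) s) :
    Ends W leafProg s fun s' t => t ≤ 50 * n + 100 ∧
      ∃ q, Leaves n tp pl 0 q (Finset.Ico 1 n) s' := by
  have h1W : 1 % W = 1 := Nat.mod_eq_of_lt (by omega)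
  -- A vertex other than the root always has the edge to its parent, so degree one means that it has
  -- no children.
  have hleaf : ∀ v, 0 < v → v < n →
      (s.ints 20 v = 1 ↔ ∀ x ∈ Finset.Ico 1 n, tp x ≠ v) := by
    intro v hv hvn
    rw [hS.deg v hvn, if_neg (by omega)]
    constructor
    · intro h1 x hx hxv
      have h2 : ∑ w ∈ Finset.Ico 1 n, (if tp w = v then 1 else 0) = 0 := by omega
      have h3 := Finset.sum_eq_zero_iff.1 h2 x hx
      rw [if_pos hxv] at h3
      omega
    · intro h1
      rw [Finset.sum_eq_zero fun x hx => if_neg (h1 x hx), add_zero]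
  refine .seq (.flat rfl fun t1 ht1 => ?_)
  set init : Prog := .ivar 24 1 ;; .ivar 25 0 ;; .ivar 26 0 with hinit
  have e1 : init.time ≤ 20 := by decide
  have hs1 := exec_same W init s
  have i1 : (Prog.exec W init s).ints 24 0 = 1 ∧ (Prog.exec W init s).ints 25 0 = 0 ∧
      (Prog.exec W init s).ints 26 0 = 0 := by simp [init, Prog.exec, h1W]
  obtain ⟨i1, i2, i3⟩ := i1
  generalize Prog.exec W init s = s1 at *
  refine (Ends.count_flat (fun i s' => s'.ints 24 0 = i ∧ s'.ints 0 0 = n ∧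
    ∃ q < i, s'.ints 26 0 = q ∧ (∀ j < q, ∀ j' < q, s'.ints 22 j = s'.ints 22 j' → j = j') ∧
      (∀ j < q, 0 < s'.ints 22 j ∧ s'.ints 22 j < i ∧ ∀ x ∈ Finset.Ico 1 n, tp x ≠ s'.ints 22 j) ∧
      ∀ w, 0 < w → w < i → (∀ x ∈ Finset.Ico 1 n, tp x ≠ w) → ∃ j < q, s'.ints 22 j = w)
    50 1 n hn ⟨i1, by rw [hs1.int 0, h0], 0, by omega, i3, by omega, by omega, by omega⟩ ?_ ?_).mono ?_
  · rintro i s' hi ⟨j1, j2, -⟩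
    simp [j1, j2]
  · rintro i s' hi ⟨j1, j2, q, j3, j4, j5, j6, j7⟩ hs
    have hd : s'.ints 20 = s.ints 20 := by rw [hs.int 20, hs1.int 20]
    set body : Prog := .ite (.ieq (.get 20 (.var 24)) 1)
      (.iset 22 (.var 26) (.var 24) ;; .ivar 26 (.var 26 + 1)) .skip ;;
      .ivar 24 (.var 24 + 1) with hbody
    have hi0 : 0 < i := by omega
    by_cases hc : s.ints 20 i = 1
    · have k22 : ∀ x, (Prog.exec W body s').ints 22 x = if x = q then i else s'.ints 22 x := by
        intro x; simp [body, Prog.exec, j1, j4, hd, hc, h1W]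
      have k : (Prog.exec W body s').ints 24 0 = i + 1 ∧ (Prog.exec W body s').ints 26 0 = q + 1 ∧
          (Prog.exec W body s').ints 0 0 = n := by
        simp (disch := omega) [body, Prog.exec, j1, j2, j4, hd, hc, h1W, Nat.mod_eq_of_lt]
      obtain ⟨k24, k26, k0⟩ := k
      generalize Prog.exec W body s' = s2 at *
      have hold : ∀ j < q, s2.ints 22 j = s'.ints 22 j := fun j hj => by rw [k22, if_neg hj.ne]
      have hnew : s2.ints 22 q = i := by rw [k22, if_pos rfl]
      refine ⟨k24, k0, q + 1, by omega, k26, ?_, ?_, ?_⟩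
      · intro j hj j' hj' hjj
        rcases Nat.lt_succ_iff_lt_or_eq.1 hj with h1 | rfl <;>
          rcases Nat.lt_succ_iff_lt_or_eq.1 hj' with h2 | rfl
        · rw [hold j h1, hold j' h2] at hjj
          exact j5 j h1 j' h2 hjj
        · rw [hold j h1, hnew] at hjj
          have := (j6 j h1).2.1
          omega
        · rw [hold j' h2, hnew] at hjj
          have := (j6 j' h2).2.1
          omega
        · rfl
      · intro j hj
        rcases Nat.lt_succ_iff_lt_or_eq.1 hj with h1 | rfl
        · rw [hold j h1]
          have := j6 j h1
          exact ⟨this.1, by omega, this.2.2⟩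
        · rw [hnew]
          exact ⟨hi0, by omega, (hleaf i hi0 hi).1 hc⟩
      · intro w hw0 hw hx
        rcases Nat.lt_succ_iff_lt_or_eq.1 hw with h1 | rfl
        · obtain ⟨j, h2, h3⟩ := j7 w hw0 h1 hx
          exact ⟨j, by omega, by rw [hold j h2, h3]⟩
        · exact ⟨q, by omega, hnew⟩
    · have k22 : (Prog.exec W body s').ints 22 = s'.ints 22 := by
        funext x; simp [body, Prog.exec, j1, j4, hd, hc, h1W]
      have k : (Prog.exec W body s').ints 24 0 = i + 1 ∧ (Prog.exec W body s').ints 26 0 = q ∧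
          (Prog.exec W body s').ints 0 0 = n := by
        simp (disch := omega) [body, Prog.exec, j1, j2, j4, hd, hc, h1W, Nat.mod_eq_of_lt]
      obtain ⟨k24, k26, k0⟩ := k
      generalize Prog.exec W body s' = s2 at *
      refine ⟨k24, k0, q, by omega, k26, by rw [k22]; exact j5, fun j hj => ?_, ?_⟩
      · rw [k22]
        have := j6 j hj
        exact ⟨this.1, by omega, this.2.2⟩
      · intro w hw0 hw hx
        rw [k22]
        rcases Nat.lt_succ_iff_lt_or_eq.1 hw with h1 | rfl
        · exact j7 w hw0 h1 hx
        · exact absurd ((hleaf w hw0 hi).2 hx) hc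
  · rintro s2 t2 hs2 ⟨⟨j1, j2, q, j3, j4, j5, j6, j7⟩, ht2⟩
    have hmem : ∀ j < q, s2.ints 22 j ∈ Finset.Ico 1 n := fun j hj =>
      Finset.mem_Ico.2 ⟨(j6 j hj).1, (j6 j hj).2.1⟩
    refine ⟨by omega, q, j2, by rw [hs2.int 25, i2], j4, Finset.Subset.refl _, by simp, ?_, ?_, j5, hmem,
      fun j _ hj => ⟨hmem j hj, (j6 j hj).2.2⟩, by omega, Nat.zero_le _, ?_, by omega⟩
    · refine ⟨?_, ?_, ?_⟩
      · rw [hs2.int 20, hs1.int 20]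
        exact hS.deg
      · rw [hs2.int 21, hs1.int 21]
        exact hS.sum
      · rw [hs2.real 20, hs1.real 20]
        exact hS.len
    · intro w hw h1
      rw [Finset.mem_Ico] at hw ⊢
      exact ⟨by omega, hr.tp_lt w hw.1 hw.2⟩
    · intro w hw hx
      rw [Finset.mem_Ico] at hw
      obtain ⟨j, h1, h2⟩ := j7 w hw.1 hw.2 hx
      exact ⟨j, Nat.zero_le _, h1, h2⟩

/-- At a leaf the sum of the neighbours is the parent itself and the total length is the length of
the edge to it. Subtracting the leaf from the sums of its parent keeps them correct for the
remaining tree. The sums of the leaf are never changed again, so they store its parent for good. -/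
theorem leafStep_spec {s : Mem} {i q : ℕ} {R : Finset ℕ} (hr : Rooting n A B ℓ σ tp h pl) (hn : 0 < n)
    (hW : n * (2 * n) + 4 * n + 10 < W) (hL : Leaves n tp pl i q R s) (hi : i < q) :
    ∃ q', Leaves n tp pl (i + 1) q' (R.erase (s.ints 22 i)) (Prog.exec W leafStep s) := by
  -- The listed vertices are distinct and none is the root, so the list cannot outgrow the tree.
  have hq : q ≤ n - 1 := by
    have h1 := Finset.card_le_card_of_injOn (s := Finset.range q) (t := Finset.Ico 1 n) (s.ints 22)
      (fun j hj => hL.mem j (by simpa using hj))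
      (fun j hj j' hj' hjj => hL.inj j (by simpa using hj) j' (by simpa using hj') hjj)
    simpa using h1
  obtain ⟨huR, hleaf⟩ := hL.leaf i le_rfl hi
  have hRn : ∀ w ∈ R, 0 < w ∧ w < n := fun w hw => by
    have := Finset.mem_Ico.1 (hL.R_sub hw)
    exact ⟨this.1, this.2⟩
  set u := s.ints 22 i with hu
  obtain ⟨hu0, hun⟩ := hRn u huR
  set p := tp u with hp
  have hpn : p < n := hr.tp_lt u hu0 hun
  have hpu : p ≠ u := fun h1 => by
    have := hr.h_lt u hu0 hun
    rw [← hp, h1] at this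
    omega
  have hsum0 : ∀ {β : Type} [AddCommMonoid β] (f : ℕ → β), ∑ w ∈ R, (if tp w = u then f w else 0) = 0 :=
    fun f => Finset.sum_eq_zero fun w hw => if_neg (hleaf w hw)
  have h1W : 1 % W = 1 := Nat.mod_eq_of_lt (by omega)
  have d21 : s.ints 21 u = p := by
    rw [hL.sums.sum u hun, if_neg (by omega), hsum0, add_zero]
  have d20 : s.reals 20 u = pl u := by
    rw [hL.sums.len u hun, if_neg (by omega), hsum0, add_zero]
  have hE : ∀ {β : Type} [AddCommMonoid β] (f : ℕ → β) (v : ℕ),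
      (if p = v then f u else 0) + ∑ w ∈ R.erase u, (if tp w = v then f w else 0) =
        ∑ w ∈ R, if tp w = v then f w else 0 := fun f v =>
    Finset.add_sum_erase R (fun w => if tp w = v then f w else 0) huR
  have hdp := hL.sums.deg p hpn
  rw [← hE (fun _ => 1) p, if_pos rfl] at hdp
  -- Before the update, degree two at the parent means that the removed vertex was its last child.
  -- The root is never listed, whatever its degree.
  have hcond : (s.ints 20 p = 2 ∧ 0 < p) ↔ 0 < p ∧ ∀ x ∈ R.erase u, tp x ≠ p := by
    rw [and_comm]
    refine and_congr_right fun h0 => ?_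
    rw [hdp, if_neg (by omega)]
    constructor
    · intro h1 x hx hxp
      have h2 : ∑ w ∈ R.erase u, (if tp w = p then 1 else 0) = 0 := by omega
      have h3 := Finset.sum_eq_zero_iff.1 h2 x hx
      rw [if_pos hxp] at h3
      omega
    · intro h1
      rw [Finset.sum_eq_zero fun x hx => if_neg (h1 x hx)]
      rfl
  have a20 : ∀ x, (Prog.exec W leafStep s).ints 20 x =
      if x = p then s.ints 20 p - 1 else s.ints 20 x := by
    intro x
    by_cases hx : x = p <;> simp [leafStep, Prog.exec, hL.i_eq, ← hu, d21, h1W, hx] <;>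
      split_ifs <;> simp [hx]
  have a21 : ∀ x, (Prog.exec W leafStep s).ints 21 x =
      if x = p then s.ints 21 p - u else s.ints 21 x := by
    intro x
    by_cases hx : x = p <;> simp [leafStep, Prog.exec, hL.i_eq, ← hu, d21, h1W, hx] <;>
      split_ifs <;> simp [hx]
  have b20 : ∀ x, (Prog.exec W leafStep s).reals 20 x =
      if x = p then s.reals 20 p - pl u else s.reals 20 x := by
    intro x
    by_cases hx : x = p <;> simp [leafStep, Prog.exec, hL.i_eq, ← hu, d21, h1W, hx, d20] <;>
      split_ifs <;> simp [hx]
  have a22 : ∀ x, (Prog.exec W leafStep s).ints 22 x =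
      if (s.ints 20 p = 2 ∧ 0 < p) ∧ x = q then p else s.ints 22 x := by
    intro x
    by_cases hc : s.ints 20 p = 2 ∧ 0 < p <;>
      simp [leafStep, Prog.exec, hL.i_eq, hL.q_eq, ← hu, d21, h1W, hc]
  have a26 : (Prog.exec W leafStep s).ints 26 0 = if s.ints 20 p = 2 ∧ 0 < p then q + 1 else q := by
    by_cases hc : s.ints 20 p = 2 ∧ 0 < p <;>
      simp (disch := omega) [leafStep, Prog.exec, hL.i_eq, hL.q_eq, ← hu, d21, h1W, hc,
        Nat.mod_eq_of_lt]
  have a0 : (Prog.exec W leafStep s).ints 0 0 = n ∧ (Prog.exec W leafStep s).ints 25 0 = i + 1 := by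
    refine ⟨by rw [(exec_same W leafStep s).int 0, hL.n_eq], ?_⟩
    simp (disch := omega) [leafStep, Prog.exec, hL.i_eq, ← hu, d21, h1W]
    split_ifs <;> simp (disch := omega) [hL.i_eq, Nat.mod_eq_of_lt]
  obtain ⟨a0, a25⟩ := a0
  generalize Prog.exec W leafStep s = s' at *
  have hcard : (R.erase u).card + 1 = R.card := Finset.card_erase_add_one huR
  have hiq := hL.i_le
  have hS : Sums n tp pl (R.erase u) s' := by
    refine ⟨fun v hv => ?_, fun v hv => ?_, fun v hv => ?_⟩
    · have h1 := hL.sums.deg v hv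
      rw [← hE (fun _ => 1) v] at h1
      rw [a20]
      by_cases h2 : v = p
      · rw [h2, if_pos rfl] at h1
        rw [if_pos h2, h2, h1, add_left_comm, Nat.add_sub_cancel_left]
      · rw [if_neg h2, h1, if_neg (Ne.symm h2), zero_add]
    · have h1 := hL.sums.sum v hv
      rw [← hE (fun w => w) v] at h1
      rw [a21]
      by_cases h2 : v = p
      · rw [h2, if_pos rfl] at h1
        rw [if_pos h2, h2, h1, add_left_comm, Nat.add_sub_cancel_left]
      · rw [if_neg h2, h1, if_neg (Ne.symm h2), zero_add]
    · have h1 := hL.sums.len v hv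
      rw [← hE pl v] at h1
      rw [b20]
      by_cases h2 : v = p
      · rw [h2, if_pos rfl] at h1
        rw [if_pos h2, h2]
        rw [h1]
        ring
      · rw [if_neg h2, h1, if_neg (Ne.symm h2), zero_add]
  have hold : ∀ j < q, s'.ints 22 j = s.ints 22 j := fun j hj => by
    rw [a22, if_neg fun h1 => hj.ne h1.2]
  have hpR : 0 < p → p ∈ R := fun h0 => hL.up u huR (by omega)
  have hpout : 0 < p → ∀ j < q, s.ints 22 j ≠ p := by
    intro h0 j hj h1
    rcases lt_or_ge j i with h2 | h2
    · exact hL.out j h2 (h1 ▸ hpR h0)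
    · exact (hL.leaf j h2 hj).2 u huR h1.symm
  have hup : ∀ w ∈ R.erase u, tp w ≠ 0 → tp w ∈ R.erase u := by
    intro w hw h0
    rw [Finset.mem_erase] at hw ⊢
    exact ⟨hleaf w hw.2, hL.up w hw.2 h0⟩
  have horder : ∀ j < i + 1, ∀ j' ≤ j, s.ints 22 j' ≠ tp (s.ints 22 j) := by
    intro j hj j' hj'
    rcases Nat.lt_succ_iff_lt_or_eq.1 hj with h1 | rfl
    · exact hL.order j h1 j' hj'
    · rw [← hu, ← hp]
      rcases Nat.eq_zero_or_pos p with h0 | h0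
      · have := Finset.mem_Ico.1 (hL.mem j' (by omega))
        omega
      · exact hpout h0 j' (by omega)
  have hne : ∀ j < q, i + 1 ≤ j → s.ints 22 j ≠ u := fun j hj h1 h2 => by
    have := hL.inj j hj i hi h2
    omega
  have hout : ∀ j < i + 1, s.ints 22 j ∉ R.erase u := by
    intro j hj h1
    rw [Finset.mem_erase] at h1
    rcases Nat.lt_succ_iff_lt_or_eq.1 hj with h2 | rfl
    · exact hL.out j h2 h1.2
    · exact h1.1 rfl
  have hall : ∀ w ∈ R.erase u, (∀ x ∈ R.erase u, tp x ≠ w) → w ≠ p →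
      ∃ j, i + 1 ≤ j ∧ j < q ∧ s'.ints 22 j = w := by
    intro w hw hx hwp
    rw [Finset.mem_erase] at hw
    obtain ⟨j, h1, h2, h3⟩ := hL.all w hw.2 fun x hxR hxw => by
      by_cases hxu : x = u
      · exact hwp (by rw [← hxw, hxu])
      · exact hx x (Finset.mem_erase.2 ⟨hxu, hxR⟩) hxw
    have : j ≠ i := fun h4 => hw.1 (by rw [← h3, h4])
    exact ⟨j, by omega, h2, by rw [hold j h2, h3]⟩
  by_cases hc : s.ints 20 p = 2 ∧ 0 < p
  · have hnew : s'.ints 22 q = p := by rw [a22, if_pos ⟨hc, rfl⟩]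
    have hc2 := hcond.1 hc
    refine ⟨q + 1, a0, a25, by rw [a26, if_pos hc], (Finset.erase_subset _ _).trans hL.R_sub,
      by have := hL.card; omega, hS, hup, ?_, ?_, ?_, ?_, by omega, ?_, ?_⟩
    · intro j hj j' hj' hjj
      rcases Nat.lt_succ_iff_lt_or_eq.1 hj with h1 | rfl <;>
        rcases Nat.lt_succ_iff_lt_or_eq.1 hj' with h2 | rfl
      · rw [hold j h1, hold j' h2] at hjj
        exact hL.inj j h1 j' h2 hjj
      · rw [hold j h1, hnew] at hjj
        exact absurd hjj (hpout hc.2 j h1)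
      · rw [hold j' h2, hnew] at hjj
        exact absurd hjj.symm (hpout hc.2 j' h2)
      · rfl
    · intro j hj
      rcases Nat.lt_succ_iff_lt_or_eq.1 hj with h1 | rfl
      · rw [hold j h1]
        exact hL.mem j h1
      · rw [hnew]
        exact hL.R_sub (hpR hc.2)
    · intro j hj1 hj2
      rcases Nat.lt_succ_iff_lt_or_eq.1 hj2 with h1 | rfl
      · rw [hold j h1]
        have h2 := hL.leaf j (by omega) h1
        exact ⟨Finset.mem_erase.2 ⟨hne j h1 hj1, h2.1⟩, fun x hx => h2.2 x (Finset.mem_of_mem_erase hx)⟩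
      · rw [hnew]
        exact ⟨Finset.mem_erase.2 ⟨hpu, hpR hc.2⟩, hc2.2⟩
    · intro j hj
      rw [hold j (by omega)]
      exact hout j hj
    · intro w hw hx
      by_cases hwp : w = p
      · exact ⟨q, by omega, by omega, by rw [hnew, hwp]⟩
      · obtain ⟨j, h1, h2, h3⟩ := hall w hw hx hwp
        exact ⟨j, h1, by omega, h3⟩
    · intro j hj j' hj'
      rw [hold j (by omega), hold j' (by omega)]
      exact horder j hj j' hj'
  · refine ⟨q, a0, a25, by rw [a26, if_neg hc], (Finset.erase_subset _ _).trans hL.R_sub,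
      by have := hL.card; omega, hS, hup, ?_, ?_, ?_, ?_, by omega, ?_, ?_⟩
    · intro j hj j' hj' hjj
      rw [hold j hj, hold j' hj'] at hjj
      exact hL.inj j hj j' hj' hjj
    · intro j hj
      rw [hold j hj]
      exact hL.mem j hj
    · intro j hj1 h1
      rw [hold j h1]
      have h2 := hL.leaf j (by omega) h1
      exact ⟨Finset.mem_erase.2 ⟨hne j h1 hj1, h2.1⟩, fun x hx => h2.2 x (Finset.mem_of_mem_erase hx)⟩
    · intro j hj
      rw [hold j (by omega)]
      exact hout j hj
    · intro w hw hx
      refine hall w hw hx fun hwp => hc (hcond.2 ⟨?_, hwp ▸ hx⟩)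
      rw [← hwp]
      exact (hRn w (Finset.mem_of_mem_erase hw)).1
    · intro j hj j' hj'
      rw [hold j (by omega), hold j' (by omega)]
      exact horder j hj j' hj'

theorem leavesProg_spec {s : Mem} (hr : Rooting n A B ℓ σ tp h pl) (hn : 0 < n)
    (hW : n * (2 * n) + 4 * n + 10 < W) (h0 : s.ints 0 0 = n) (h2 : s.ints 2 = A) (h3 : s.ints 3 = B)
    (hℓ : s.reals 0 = ℓ) (h20 : ∀ v < n, s.ints 20 v = 0) (h21 : ∀ v < n, s.ints 21 v = 0)
    (hr20 : ∀ v < n, s.reals 20 v = 0) :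
    Ends W leavesProg s fun s' t => t ≤ 250 * n + 500 ∧
      (∀ w, 0 < w → w < n → s'.ints 21 w = tp w ∧ s'.reals 20 w = pl w) ∧ s'.ints 21 0 = 0 ∧
      (∀ j < n - 1, 0 < s'.ints 22 j ∧ s'.ints 22 j < n) ∧
      (∀ j < n - 1, ∀ j' < n - 1, s'.ints 22 j = s'.ints 22 j' → j = j') ∧
      (∀ w, 0 < w → w < n → ∃ j < n - 1, s'.ints 22 j = w) ∧
      ∀ j < n - 1, ∀ j' ≤ j, s'.ints 22 j' ≠ tp (s'.ints 22 j) := by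
  refine .seq ((degProg_spec hr hW h0 h2 h3 hℓ h20 h21 hr20).mono ?_)
  rintro s1 t1 hs1 ⟨ht1, hS⟩
  refine .seq ((leafProg_spec hr hn hW (by rw [hs1.int 0, h0]) hS).mono ?_)
  rintro s2 t2 hs2 ⟨ht2, q, hL⟩
  -- As long as vertices remain, one of maximal height among them has no remaining child and hence
  -- waits in the list. So the loop does not stop early.
  have hlt : ∀ {i q : ℕ} {R : Finset ℕ} {s' : Mem}, Leaves n tp pl i q R s' → (i < q ↔ i < n - 1) := by
    intro i q R s' hL
    rw [← hL.card]
    constructor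
    · intro h1
      have := Finset.card_pos.2 ⟨_, (hL.leaf i le_rfl h1).1⟩
      omega
    · intro h1
      obtain ⟨w, hw, hmax⟩ := Finset.exists_max_image R h (Finset.card_pos.1 (by omega))
      obtain ⟨j, h2, h3, -⟩ := hL.all w hw fun x hx hxw => by
        have h4 := Finset.mem_Ico.1 (hL.R_sub hx)
        have h5 := hr.h_lt x h4.1 h4.2
        have h6 := hmax x hx
        rw [hxw] at h5
        omega
      omega
  refine (Ends.count_flat (fun i s' => ∃ q R, Leaves n tp pl i q R s') 90 0 (n - 1) (Nat.zero_le _)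
    ⟨q, _, hL⟩ ?_ ?_).mono ?_
  · rintro i s' hi ⟨q, R, hL⟩
    simp only [holds_ilt, val_get, val_num, Nat.zero_mod, hL.i_eq, hL.q_eq, hlt hL]
  · rintro i s' hi ⟨q, R, hL⟩ -
    obtain ⟨q', h1⟩ := leafStep_spec hr hn hW hL ((hlt hL).2 hi)
    exact ⟨q', _, h1⟩
  · rintro s3 t3 - ⟨⟨q, R, hL⟩, ht3⟩
    have hR : R = ∅ := Finset.card_eq_zero.1 (by have := hL.card; omega)
    have hq : q = n - 1 := by
      have := hL.i_le
      have := (hlt hL).1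
      omega
    subst hq
    have hmem := fun j hj => Finset.mem_Ico.1 (hL.mem j hj)
    refine ⟨by omega, fun w h1 h2 => ⟨?_, ?_⟩, ?_, fun j hj => hmem j hj, hL.inj, ?_, hL.order⟩
    · rw [hL.sums.sum w h2, if_neg (by omega), hR, Finset.sum_empty, add_zero]
    · rw [hL.sums.len w h2, if_neg (by omega), hR, Finset.sum_empty, add_zero]
    · rw [hL.sums.sum 0 hn, if_pos rfl, hR, Finset.sum_empty, add_zero]
    · intro w h1 h2
      have h3 := Finset.surj_on_of_inj_on_of_card_le (s := Finset.range (n - 1)) (t := Finset.Ico 1 n)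
        (fun j _ => s3.ints 22 j) (fun j hj => hL.mem j (Finset.mem_range.1 hj))
        (fun j j' hj hj' => hL.inj j (Finset.mem_range.1 hj) j' (Finset.mem_range.1 hj')) (by simp)
        w (Finset.mem_Ico.2 ⟨h1, h2⟩)
      obtain ⟨j, hj, h4⟩ := h3
      exact ⟨j, Finset.mem_range.1 hj, h4.symm⟩

end LeafRemoval

end PartialCenter

set_option linter.unusedSimpArgs false

namespace PartialCenter

/-! ## Renumbering the vertices by depth -/

/-- Computes the depths. -/
def depthProg : Prog :=
  (.ivar 27 (.var 0 - 1) ;; .rvar 21 .zero) ;; .loop (.ilt 0 (.var 27))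
    (.ivar 27 (.var 27 - 1) ;; .ivar 24 (.get 22 (.var 27)) ;;
      .rset 21 (.var 24) (.get 21 (.get 21 (.var 24)) + .get 20 (.var 24)))

/-- Prepares the sorting of the vertices by their depths. -/
def depthKeys : Prog :=
  (.ivar 12 0) ;; .loop (.ilt (.var 12) (.var 0))
    (.iset 10 (.var 12) (.var 12) ;; .rset 10 (.var 12) (.get 21 (.var 12)) ;;
      .ivar 12 (.var 12 + 1))

/-- Stores the order of the vertices. -/
def rankProg : Prog :=
  (.ivar 24 0) ;; .loop (.ilt (.var 24) (.var 0))
    (.iset 30 (.var 24) (.get 10 (.var 24)) ;; .rset 30 (.var 24) (.get 10 (.var 24)) ;;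
      .iset 32 (.get 10 (.var 24)) (.var 24) ;; .ivar 24 (.var 24 + 1))

/-- Stores the parents. -/
def parProg : Prog :=
  (.ivar 24 0) ;; .loop (.ilt (.var 24) (.var 0))
    (.iset 31 (.var 24) (.get 32 (.get 21 (.get 30 (.var 24)))) ;; .ivar 24 (.var 24 + 1))

/-- Roots the tree and renumbers the vertices. -/
def rootProg : Prog :=
  leavesProg ;; depthProg ;; depthKeys ;; sortProg ;; rankProg ;; parProg

/-! ### Depths, ranks and parents in the new numbering. -/

section Renumbering
variable {W n : ℕ}

/-- Children are removed before their parents, so reading the order of removal backwards meets each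
parent before its children. By `horder` no later round overwrites a depth that has been used. -/
theorem depthProg_spec {s : Mem} {tp Q : ℕ → ℕ} {pl : ℕ → ℝ} (hn : 0 < n) (hW : 4 * n + 10 < W)
    (h0 : s.ints 0 0 = n) (hQ : s.ints 22 = Q)
    (htp : ∀ w, 0 < w → w < n → s.ints 21 w = tp w ∧ s.reals 20 w = pl w)
    (hmem : ∀ j < n - 1, 0 < Q j ∧ Q j < n) (hinj : ∀ j < n - 1, ∀ j' < n - 1, Q j = Q j' → j = j')
    (hsurj : ∀ w, 0 < w → w < n → ∃ j < n - 1, Q j = w)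
    (horder : ∀ j < n - 1, ∀ j' ≤ j, Q j' ≠ tp (Q j)) (hself : ∀ w, 0 < w → w < n → tp w ≠ w) :
    Ends W depthProg s fun s' t => t ≤ 50 * n + 100 ∧ s'.reals 21 0 = 0 ∧
      ∀ w, 0 < w → w < n → s'.reals 21 w = s'.reals 21 (tp w) + pl w := by
  have h1W : 1 % W = 1 := Nat.mod_eq_of_lt (by omega)
  refine .seq (.flat rfl fun t1 ht1 => ?_)
  set init : Prog := .ivar 27 (.var 0 - 1) ;; .rvar 21 .zero with hinit
  have e1 : init.time ≤ 20 := by decide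
  have hs1 := exec_same W init s
  have i1 : (Prog.exec W init s).ints 27 0 = n - 1 ∧ (Prog.exec W init s).reals 21 0 = 0 := by
    simp [init, Prog.exec, h0, h1W]
  obtain ⟨i1, i2⟩ := i1
  generalize Prog.exec W init s = s1 at *
  refine (Ends.count_flat (fun i s' => s'.ints 27 0 = n - 1 - i ∧ s'.reals 21 0 = 0 ∧
    ∀ j, n - 1 - i ≤ j → j < n - 1 → s'.reals 21 (Q j) = s'.reals 21 (tp (Q j)) + pl (Q j))
    50 0 (n - 1) (Nat.zero_le _) ⟨i1, i2, by omega⟩ ?_ ?_).mono ?_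
  · rintro i s' hi ⟨j1, -⟩
    simp [j1]
  · rintro i s' hi ⟨j1, j2, j3⟩ hs
    have g22 : s'.ints 22 = Q := by rw [hs.int 22, hs1.int 22, hQ]
    have g21 : s'.ints 21 = s.ints 21 := by rw [hs.int 21, hs1.int 21]
    have r20 : s'.reals 20 = s.reals 20 := by rw [hs.real 20, hs1.real 20]
    obtain ⟨m1, m2⟩ := hmem (n - 1 - i - 1) (by omega)
    obtain ⟨m3, m4⟩ := htp _ m1 m2
    set body : Prog := .ivar 27 (.var 27 - 1) ;; .ivar 24 (.get 22 (.var 27)) ;;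
      .rset 21 (.var 24) (.get 21 (.get 21 (.var 24)) + .get 20 (.var 24)) with hbody
    have k27 : (Prog.exec W body s').ints 27 0 = n - 1 - (i + 1) := by
      simp [body, Prog.exec, j1, h1W]
      omega
    have k21 : ∀ x, (Prog.exec W body s').reals 21 x = if x = Q (n - 1 - i - 1) then
        s'.reals 21 (tp (Q (n - 1 - i - 1))) + pl (Q (n - 1 - i - 1)) else s'.reals 21 x := by
      intro x
      simp [body, Prog.exec, j1, h1W, g22, g21, r20, m3, m4]
    generalize Prog.exec W body s' = s2 at *
    refine ⟨k27, by rw [k21, if_neg (by omega), j2], fun j h1 h2 => ?_⟩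
    rw [k21, k21]
    rcases (show n - 1 - i - 1 ≤ j by omega).eq_or_lt with rfl | h3
    · rw [if_pos rfl, if_neg (hself _ m1 m2)]
    · rw [if_neg fun h4 => by have := hinj _ h2 _ (by omega) h4; omega,
        if_neg (horder j h2 _ h3.le).symm]
      exact j3 j (by omega) h2
  · rintro s2 t2 - ⟨⟨-, j2, j3⟩, ht2⟩
    refine ⟨by omega, j2, fun w h1 h2 => ?_⟩
    obtain ⟨j, h3, rfl⟩ := hsurj w h1 h2
    exact j3 j (by omega) h3

theorem depthKeys_spec {s : Mem} (hW : 4 * n + 10 < W) (h0 : s.ints 0 0 = n) :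
    Ends W depthKeys s fun s' t => t ≤ 50 * n + 100 ∧ s'.ints 12 0 = n ∧
      ∀ x < n, s'.recs 10 x = (s.reals 21 x, x) := by
  refine .seq (.flat rfl fun t1 ht1 => ?_)
  have e1 : (Prog.ivar 12 0).time ≤ 10 := by decide
  have hs1 := exec_same W (.ivar 12 0) s
  have i1 : (Prog.exec W (.ivar 12 0) s).ints 12 0 = 0 := by simp [Prog.exec]
  generalize Prog.exec W _ s = s1 at *
  refine (Ends.count_flat (fun i s' => s'.ints 12 0 = i ∧ s'.ints 0 0 = n ∧
    ∀ x < i, s'.recs 10 x = (s.reals 21 x, x)) 50 0 n (Nat.zero_le _)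
    ⟨i1, by rw [hs1.int 0, h0], by omega⟩ ?_ ?_).mono ?_
  · rintro i s' hi ⟨j1, j2, -⟩
    simp [j1, j2]
  · rintro i s' hi ⟨j1, j2, j3⟩ hs
    have r21 : s'.reals 21 = s.reals 21 := by rw [hs.real 21, hs1.real 21]
    refine ⟨?_, ?_, fun x hx => ?_⟩
    · simp (disch := omega) [Prog.exec, j1, Nat.mod_eq_of_lt]
    · simp [Prog.exec, j2]
    · have := j3 x
      simp only [Mem.recs] at this ⊢
      by_cases hxi : x = i
      · simp [Prog.exec, j1, hxi, r21]
      · simpa [Prog.exec, j1, hxi] using this (by omega)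
  · rintro s2 t2 - ⟨⟨j1, -, j3⟩, ht2⟩
    exact ⟨by omega, j1, j3⟩

theorem rankProg_spec {s : Mem} {lb : ℕ → ℕ} (hW : 4 * n + 10 < W) (h0 : s.ints 0 0 = n)
    (hlb : s.ints 10 = lb) (hinj : ∀ i < n, ∀ j < n, lb i = lb j → i = j) :
    Ends W rankProg s fun s' t => t ≤ 60 * n + 100 ∧
      ∀ j < n, s'.ints 30 j = lb j ∧ s'.reals 30 j = s.reals 10 j ∧ s'.ints 32 (lb j) = j := by
  refine .seq (.flat rfl fun t1 ht1 => ?_)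
  have e1 : (Prog.ivar 24 0).time ≤ 10 := by decide
  have hs1 := exec_same W (.ivar 24 0) s
  have i1 : (Prog.exec W (.ivar 24 0) s).ints 24 0 = 0 := by simp [Prog.exec]
  generalize Prog.exec W _ s = s1 at *
  refine (Ends.count_flat (fun i s' => s'.ints 24 0 = i ∧ s'.ints 0 0 = n ∧
    ∀ j < i, s'.ints 30 j = lb j ∧ s'.reals 30 j = s.reals 10 j ∧ s'.ints 32 (lb j) = j)
    60 0 n (Nat.zero_le _) ⟨i1, by rw [hs1.int 0, h0], by omega⟩ ?_ ?_).mono ?_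
  · rintro i s' hi ⟨j1, j2, -⟩
    simp [j1, j2]
  · rintro i s' hi ⟨j1, j2, j3⟩ hs
    have g10 : s'.ints 10 = lb := by rw [hs.int 10, hs1.int 10, hlb]
    have r10 : s'.reals 10 = s.reals 10 := by rw [hs.real 10, hs1.real 10]
    refine ⟨?_, ?_, fun x hx => ?_⟩
    · simp (disch := omega) [Prog.exec, j1, Nat.mod_eq_of_lt]
    · simp [Prog.exec, j2]
    · by_cases hxi : x = i
      · simp [Prog.exec, j1, hxi, r10, g10]
      · have h1 : lb x ≠ lb i := fun h1 => hxi (hinj x (by omega) i hi h1)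
        simpa [Prog.exec, j1, hxi, g10, h1] using j3 x (by omega)
  · rintro s2 t2 - ⟨⟨-, -, j3⟩, ht2⟩
    exact ⟨by omega, j3⟩

theorem parProg_spec {s : Mem} (hW : 4 * n + 10 < W) (h0 : s.ints 0 0 = n) :
    Ends W parProg s fun s' t => t ≤ 60 * n + 100 ∧
      ∀ j < n, s'.ints 31 j = s.ints 32 (s.ints 21 (s.ints 30 j)) := by
  refine .seq (.flat rfl fun t1 ht1 => ?_)
  have e1 : (Prog.ivar 24 0).time ≤ 10 := by decide
  have hs1 := exec_same W (.ivar 24 0) s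
  have i1 : (Prog.exec W (.ivar 24 0) s).ints 24 0 = 0 := by simp [Prog.exec]
  generalize Prog.exec W _ s = s1 at *
  refine (Ends.count_flat (fun i s' => s'.ints 24 0 = i ∧ s'.ints 0 0 = n ∧
    ∀ j < i, s'.ints 31 j = s.ints 32 (s.ints 21 (s.ints 30 j)))
    60 0 n (Nat.zero_le _) ⟨i1, by rw [hs1.int 0, h0], by omega⟩ ?_ ?_).mono ?_
  · rintro i s' hi ⟨j1, j2, -⟩
    simp [j1, j2]
  · rintro i s' hi ⟨j1, j2, j3⟩ hs
    have g32 : s'.ints 32 = s.ints 32 := by rw [hs.int 32, hs1.int 32]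
    have g21 : s'.ints 21 = s.ints 21 := by rw [hs.int 21, hs1.int 21]
    have g30 : s'.ints 30 = s.ints 30 := by rw [hs.int 30, hs1.int 30]
    refine ⟨?_, ?_, fun x hx => ?_⟩
    · simp (disch := omega) [Prog.exec, j1, Nat.mod_eq_of_lt]
    · simp [Prog.exec, j2]
    · by_cases hxi : x = i
      · simp [Prog.exec, j1, hxi, g32, g21, g30]
      · simpa [Prog.exec, j1, hxi] using j3 x (by omega)
  · rintro s2 t2 - ⟨⟨-, -, j3⟩, ht2⟩
    exact ⟨by omega, j3⟩

theorem rootProg_spec {k L : ℕ} {T : SimpleGraph (Fin n)} {len : Sym2 (Fin n) → ℝ} (hT : T.IsTree)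
    (hn : 0 < n) (hlen : ∀ e ∈ T.edgeSet, 0 < len e)
    {ends : Fin (n - 1) → Fin n × Fin n} (hE : IsEdgeList T ends)
    (hW : n * (2 * n) + 4 * n + 10 < W) (hL : n ≤ 2 ^ L) :
    Ends W rootProg (inputMem k len ends) fun s' t => t ≤ 1000 * (n + 1) * (L + 1) + 1000 ∧
      ∃ lab : Fin n ≃ Fin n, Models T len lab (s'.ints 31) (s'.reals 30) ∧
        ∀ i : Fin n, s'.ints 30 i = lab i := by
  obtain ⟨σ, tp, h, pl, hr, hadj, hpl⟩ := exists_rooting (k := k) hT hn hlen hE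
  set s₀ := inputMem k len ends with hs₀
  have h00 : s₀.ints 0 0 = n := by simp [hs₀, inputMem]
  refine .seq ((leavesProg_spec hr hn hW h00 rfl rfl rfl ?_ ?_ ?_).mono ?_)
  · intro v _
    simp [hs₀, inputMem]
  · intro v _
    simp [hs₀, inputMem]
  · intro v _
    simp [hs₀, inputMem]
  rintro s1 t1 hs1 ⟨ht1, htp, htp0, hmem, hinj, hsurj, horder⟩
  refine .seq ((depthProg_spec (n := n) (tp := tp) (pl := pl) hn (by omega) (by rw [hs1.int 0, h00])
    rfl htp hmem hinj hsurj horder fun w h1 h2 h3 => ?_).mono ?_)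
  · have := hr.h_lt w h1 h2
    rw [h3] at this
    omega
  rintro s2 t2 hs2 ⟨ht2, hD0, hD⟩
  have n2 : s2.ints 0 0 = n := by rw [hs2.int 0, hs1.int 0, h00]
  refine .seq ((depthKeys_spec (W := W) (by omega) n2).mono ?_)
  rintro s3 t3 hs3 ⟨ht3, h12, hrec⟩
  refine .seq ((sortProg_spec (W := W) (L := L) (by omega) h12 hL).mono ?_)
  rintro s4 t4 hs4 ⟨ht4, hperm, hsort⟩
  have hperm' : items (s4.recs 10) 0 n = items (fun x => (s2.reals 21 x, x)) 0 n := by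
    rw [hperm]
    exact items_congr fun x _ hx => hrec x hx
  -- Sorting permutes the pairs of depth and vertex as a multiset. This shows that the payloads
  -- enumerate the vertices and that each still carries its own depth.
  have hval : ∀ j < n, s4.ints 10 j < n ∧ s4.reals 10 j = s2.reals 21 (s4.ints 10 j) := by
    intro j hj
    have h1 : s4.recs 10 j ∈ items (s4.recs 10) 0 n := mem_items.2 ⟨j, Nat.zero_le _, hj, rfl⟩
    rw [hperm'] at h1
    obtain ⟨x, -, h2, h3⟩ := mem_items.1 h1
    simp only [Mem.recs, Prod.mk.injEq] at h3
    rw [← h3.2, ← h3.1]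
    exact ⟨h2, rfl⟩
  have hex : ∀ w < n, ∃ j < n, s4.ints 10 j = w := by
    intro w hw
    have h1 : (s2.reals 21 w, w) ∈ items (fun x => (s2.reals 21 x, x)) 0 n :=
      mem_items.2 ⟨w, Nat.zero_le _, hw, rfl⟩
    rw [← hperm'] at h1
    obtain ⟨j, -, h2, h3⟩ := mem_items.1 h1
    simp only [Mem.recs, Prod.mk.injEq] at h3
    exact ⟨j, h2, h3.2⟩
  have hinj4 : ∀ i < n, ∀ j < n, s4.ints 10 i = s4.ints 10 j → i = j := by
    have h1 : Function.Surjective fun i : Fin n => (⟨s4.ints 10 i, (hval i i.2).1⟩ : Fin n) := by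
      intro w
      obtain ⟨j, h2, h3⟩ := hex w w.2
      exact ⟨⟨j, h2⟩, Fin.ext h3⟩
    have h2 := Finite.injective_iff_surjective.2 h1
    intro i hi j hj hij
    have := @h2 ⟨i, hi⟩ ⟨j, hj⟩ (Fin.ext hij)
    simpa using this
  have n4 : s4.ints 0 0 = n := by rw [hs4.int 0, hs3.int 0, n2]
  refine .seq ((rankProg_spec (W := W) (by omega) n4 rfl hinj4).mono ?_)
  rintro s5 t5 hs5 ⟨ht5, hrk⟩
  refine (parProg_spec (W := W) (n := n) (by omega) (by rw [hs5.int 0, n4])).mono ?_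
  rintro s6 t6 hs6 ⟨ht6, hpar⟩
  have c30 : s6.ints 30 = s5.ints 30 := hs6.int 30
  have d30 : s6.reals 30 = s5.reals 30 := hs6.real 30
  have c21 : s5.ints 21 = s1.ints 21 := by
    rw [hs5.int 21, hs4.int 21, hs3.int 21, hs2.int 21]
  refine ⟨?_, ?_⟩
  · have h1 : (n + 1) * 1 ≤ (n + 1) * (L + 1) := Nat.mul_le_mul_left _ (by omega)
    rw [mul_assoc] at ht4 ⊢
    omega
  · obtain ⟨lab, h1, h2⟩ := Models.of_rooting (lb := s5.ints 30) (rk := s5.ints 32) (par := s6.ints 31)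
      (dep := s6.reals 30) (D := s2.reals 21) hn hr hadj hpl hD0 hD
      (fun j hj => by rw [(hrk j hj).1]; exact (hval j hj).1) (fun w hw => by
        obtain ⟨j, h1, rfl⟩ := hex w hw
        rw [(hrk j h1).2.2]
        exact ⟨h1, (hrk j h1).1⟩)
      (fun j hj => by rw [(hrk j hj).1, (hrk j hj).2.2])
      (fun j hj => by rw [d30, (hrk j hj).2.1, (hrk j hj).1, (hval j hj).2])
      (fun x y h1 h2 => by
        rw [d30, (hrk x (by omega)).2.1, (hrk y h2).2.1]
        exact hsort x y h1 h2)
      (fun j hj h0 => by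
        rw [hpar j hj, c21, (htp _ h0 (by rw [(hrk j hj).1]; exact (hval j hj).1)).1])
    exact ⟨lab, h1, fun i => by rw [c30, h2]⟩

end Renumbering

end PartialCenter

set_option linter.unusedSimpArgs false

namespace PartialCenter

/-! ## The output -/

/-- Flags the ancestors of the vertex `u` and finds the last one at distance at most `D / 2`. -/
def chainProg : Prog :=
  (.ivar 84 0) ;; .loop (.ilt (.var 84) (.var 0)) (.iset 43 (.var 84) 0 ;; .ivar 84 (.var 84 + 1)) ;;
  (.ivar 84 (.var 81) ;; .ivar 85 (.var 81) ;; .iset 43 (.var 81) 1) ;;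
  .loop (.ilt 0 (.var 84))
    (.ivar 84 (.get 31 (.var 84)) ;; .iset 43 (.var 84) 1 ;;
      .ite (.rlt (.half (.var 72)) (.get 30 (.var 81) - .get 30 (.var 84))) .skip
        (.ivar 85 (.var 84)))

/-- Computes the distances from `u` of the vertices up to `u`. -/
def distProg : Prog :=
  (.ivar 12 0) ;; .loop (.not (.ilt (.var 81) (.var 12)))
    (.iset 10 (.var 12) (.var 12) ;;
      .ite (.ieq (.get 43 (.var 12)) 1)
        (.rset 10 (.var 12) (.get 30 (.var 81) - .get 30 (.var 12)))
        (.rset 10 (.var 12) (.get 10 (.get 31 (.var 12)) +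
          (.get 30 (.var 12) - .get 30 (.get 31 (.var 12))))) ;;
      .ivar 12 (.var 12 + 1))

/-- Lists the vertices of the subtree. -/
def listProg : Prog :=
  (.ivar 84 0) ;; .loop (.ilt (.var 84) (.var 1))
    (.iset 6 (.var 84) (.get 30 (.get 10 (.var 84))) ;; .ivar 84 (.var 84 + 1))

/-- Stores the point and the value. -/
def pointProg : Prog :=
  .rvar 2 (.half (.var 72)) ;; .ivar 4 (.get 30 (.var 85)) ;;
  .ite (.ieq (.var 85) 0) (.ivar 5 (.var 4) ;; .rvar 1 .zero)
    (.ivar 5 (.get 30 (.get 31 (.var 85))) ;;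
      .rvar 1 (.half (.var 72) - (.get 30 (.var 81) - .get 30 (.var 85))))

/-- Computes the output from the optimal diameter. -/
def outProg : Prog :=
  .rvar 70 (.var 72) ;; decideProg ;; chainProg ;; distProg ;; sortProg ;; listProg ;; pointProg

/-! ### The center, the subtree and their correctness. -/

section Output
variable {W n u : ℕ} {par : ℕ → ℕ} {dep : ℕ → ℝ} {D : ℝ}

theorem RTree.anc_zero (hR : RTree n par dep) (hu : u < n) : Anc par 0 u := by
  induction u using Nat.strong_induction_on with
  | _ u ih =>
    rcases Nat.eq_zero_or_pos u with rfl | h0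
    · exact .refl
    · have := hR.par_lt u h0 hu
      exact .step u h0 (ih _ this (by omega))

/-- `w` is the last ancestor of `u` down to `x` whose distance from `u` is at most `r`. -/
def LastWithin (par : ℕ → ℕ) (dep : ℕ → ℝ) (u : ℕ) (r : ℝ) (x w : ℕ) : Prop :=
  dep u - dep w ≤ r ∧ Anc par w u ∧ (w = x ∨ (0 < w ∧ r < dep u - dep (par w) ∧ r < dep u - dep x))

theorem chainProg_spec {s : Mem} (hR : RTree n par dep) (hu : u < n) (hW : 4 * n + 10 < W)
    (h0 : s.ints 0 0 = n) (h31 : s.ints 31 = par) (h30 : s.reals 30 = dep) (h81 : s.ints 81 0 = u)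
    (h72 : s.reals 72 0 = D) (hD : 0 ≤ D) :
    Ends W chainProg s fun s' t => t ≤ 100 * n + 200 ∧ LastWithin par dep u (D / 2) 0 (s'.ints 85 0) ∧
      ∀ y < n, s'.ints 43 y = 1 ↔ Anc par y u := by
  have h1W : 1 % W = 1 := Nat.mod_eq_of_lt (by omega)
  refine .seq (.flat rfl fun t1 ht1 => ?_)
  have e1 : (Prog.ivar 84 0).time ≤ 10 := by decide
  have hs1 := exec_same W (.ivar 84 0) s
  have i1 : (Prog.exec W (.ivar 84 0) s).ints 84 0 = 0 := by simp [Prog.exec]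
  generalize Prog.exec W _ s = s1 at *
  refine .seq ((Ends.count_flat (fun i s' => s'.ints 84 0 = i ∧ s'.ints 0 0 = n ∧
    ∀ y < i, s'.ints 43 y = 0) 40 0 n (Nat.zero_le _)
    ⟨i1, by rw [hs1.int 0, h0], by omega⟩ ?_ ?_).mono ?_)
  · rintro i s' hi ⟨j1, j2, -⟩
    simp [j1, j2]
  · rintro i s' hi ⟨j1, j2, j3⟩ hs
    refine ⟨?_, ?_, fun y hy => ?_⟩
    · simp (disch := omega) [Prog.exec, j1, Nat.mod_eq_of_lt]
    · simp [Prog.exec, j2]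
    · by_cases hyi : y = i
      · simp [Prog.exec, j1, hyi]
      · simpa [Prog.exec, j1, hyi] using j3 y (by omega)
  rintro s2 t2 hs2 ⟨⟨-, -, j3⟩, ht2⟩
  have g81 : s2.ints 81 0 = u := by rw [hs2.int 81, hs1.int 81, h81]
  refine .seq (.flat rfl fun t3 ht3 => ?_)
  set init : Prog := .ivar 84 (.var 81) ;; .ivar 85 (.var 81) ;; .iset 43 (.var 81) 1 with hinit
  have e3 : init.time ≤ 20 := by decide
  have hs3 := exec_same W init s2
  have k : (Prog.exec W init s2).ints 84 0 = u ∧ (Prog.exec W init s2).ints 85 0 = u := by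
    simp [init, Prog.exec, g81]
  have k43 : ∀ y, (Prog.exec W init s2).ints 43 y = if y = u then 1 else s2.ints 43 y := by
    simp [init, Prog.exec, g81, h1W]
  obtain ⟨k84, k85⟩ := k
  generalize Prog.exec W init s2 = s3 at *
  refine (Ends.loop (fun x s' => s'.ints 84 0 = x ∧ Anc par x u ∧ x < n ∧
    -- The flagged set contains `u` and is closed under parents except at the current vertex. Once
    -- this is the root, it consists of all ancestors of `u`.
    LastWithin par dep u (D / 2) x (s'.ints 85 0) ∧ s'.ints 43 u = 1 ∧
    ∀ y < n, s'.ints 43 y = 1 → Anc par y u ∧ (y = x ∨ (0 < y → s'.ints 43 (par y) = 1)))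
    (fun x => 50 * x) u ⟨k84, .refl, hu, ?_, by rw [k43, if_pos rfl], fun y hy hy1 => ?_⟩ ?_).mono ?_
  · rw [k85]
    exact ⟨by linarith, .refl, .inl rfl⟩
  · rw [k43] at hy1
    split_ifs at hy1 with h1
    · exact ⟨h1 ▸ .refl, .inl h1⟩
    · rw [j3 y hy] at hy1
      omega
  · rintro x s' ⟨l1, l2, l3, l4, l5, l6⟩ hb hs
    have hx : 0 < x := by simpa [l1] using hb
    have m31 : s'.ints 31 = par := by rw [hs.int 31, hs3.int 31, hs2.int 31, hs1.int 31, h31]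
    have m81 : s'.ints 81 0 = u := by rw [hs.int 81, hs3.int 81, g81]
    have m30 : s'.reals 30 = dep := by rw [hs.real 30, hs3.real 30, hs2.real 30, hs1.real 30, h30]
    have m72 : s'.reals 72 0 = D := by rw [hs.real 72, hs3.real 72, hs2.real 72, hs1.real 72, h72]
    set body : Prog := .ivar 84 (.get 31 (.var 84)) ;; .iset 43 (.var 84) 1 ;;
      .ite (.rlt (.half (.var 72)) (.get 30 (.var 81) - .get 30 (.var 84))) .skip
        (.ivar 85 (.var 84)) with hbody
    refine .flat rfl fun t ht => ⟨par x, ?_, ?_⟩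
    swap
    · have := hR.par_lt x hx l3
      have : body.time + 10 ≤ 50 := by decide
      have : BExp.cost (.ilt 0 (.var 84)) ≤ 5 := by decide
      omega
    have a84 : (Prog.exec W body s').ints 84 0 = par x := by
      simp [body, Prog.exec, l1, m31]
      split_ifs <;> simp
    have a43 : ∀ y, (Prog.exec W body s').ints 43 y = if y = par x then 1 else s'.ints 43 y := by
      intro y
      simp [body, Prog.exec, l1, m31, h1W]
      split_ifs <;> simp [*]
    have a85 : (Prog.exec W body s').ints 85 0 =
        if D / 2 < dep u - dep (par x) then s'.ints 85 0 else par x := by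
      simp [body, Prog.exec, l1, m31, m81, m30, m72]
      split_ifs <;> simp [*]
    generalize Prog.exec W body s' = s4 at *
    have hpu := l2.par_left hx
    refine ⟨a84, hpu, (hR.par_lt x hx l3).trans l3, ?_, ?_, fun y hy hy1 => ?_⟩
    · rw [a85]
      split_ifs with hc
      · refine ⟨l4.1, l4.2.1, .inr ?_⟩
        rcases l4.2.2 with h1 | h1
        · rw [h1]
          exact ⟨hx, hc, hc⟩
        · exact ⟨h1.1, h1.2.1, hc⟩
      · exact ⟨not_lt.1 hc, hpu, .inl rfl⟩
    · rw [a43, l5, ite_self]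
    · rw [a43] at hy1 ⊢
      split_ifs at hy1 with h1
      · exact ⟨h1 ▸ hpu, .inl h1⟩
      · refine ⟨(l6 y hy hy1).1, .inr fun hy0 => ?_⟩
        split_ifs with h2
        · rfl
        · rcases (l6 y hy hy1).2 with h3 | h3
          · exact absurd (h3 ▸ rfl) h2
          · exact h3 hy0
  · rintro s5 t5 - ⟨x, ⟨l1, l2, l3, l4, l5, l6⟩, hb, ht5⟩
    have hx : x = 0 := by simpa [l1] using hb
    subst hx
    have : BExp.cost (.ilt 0 (.var 84)) ≤ 5 := by decide
    refine ⟨by omega, l4, fun y hy => ⟨fun h1 => (l6 y hy h1).1, fun ha => ?_⟩⟩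
    have key : ∀ v, Anc par y v → v < n → s5.ints 43 v = 1 → s5.ints 43 y = 1 := by
      intro v hv
      induction hv with
      | refl => exact fun _ h => h
      | step v hv0 hv ih =>
        intro hvn h1
        refine ih ((hR.par_lt v hv0 hvn).trans hvn) ?_
        rcases (l6 v hvn h1).2 with h2 | h2
        · omega
        · exact h2 hv0
    exact key u ha hu l5

theorem distProg_spec {s : Mem} (hR : RTree n par dep) (hu : u < n) (hW : 4 * n + 10 < W)
    (h31 : s.ints 31 = par) (h30 : s.reals 30 = dep) (h81 : s.ints 81 0 = u)
    (h43 : ∀ y < n, s.ints 43 y = 1 ↔ Anc par y u) :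
    Ends W distProg s fun s' t => t ≤ 80 * n + 200 ∧ s'.ints 12 0 = u + 1 ∧
      ∀ v ≤ u, s'.recs 10 v = (rd par dep u v, v) := by
  have h1W : 1 % W = 1 := Nat.mod_eq_of_lt (by omega)
  refine .seq (.flat rfl fun t1 ht1 => ?_)
  have e1 : (Prog.ivar 12 0).time ≤ 10 := by decide
  have hs1 := exec_same W (.ivar 12 0) s
  have i1 : (Prog.exec W (.ivar 12 0) s).ints 12 0 = 0 := by simp [Prog.exec]
  generalize Prog.exec W _ s = s1 at *
  refine (Ends.count_flat (fun i s' => s'.ints 12 0 = i ∧ s'.ints 81 0 = u ∧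
    ∀ v < i, s'.ints 10 v = v ∧ s'.reals 10 v = rd par dep u v) 80 0 (u + 1) (Nat.zero_le _)
    ⟨i1, by rw [hs1.int 81, h81], by omega⟩ ?_ ?_).mono ?_
  · rintro i s' hi ⟨j1, j2, -⟩
    simp [j1, j2]
  · rintro i s' hi ⟨j1, j2, j3⟩ hs
    have m31 : s'.ints 31 = par := by rw [hs.int 31, hs1.int 31, h31]
    have m30 : s'.reals 30 = dep := by rw [hs.real 30, hs1.real 30, h30]
    have m43 : s'.ints 43 i = 1 ↔ Anc par i u := by
      rw [hs.int 43, hs1.int 43]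
      exact h43 i (by omega)
    rcases (em (Anc par i u)).imp eq_true eq_false with ha | ha
    · refine ⟨?_, ?_, fun v hv => ?_⟩
      · simp (disch := omega) [Prog.exec, j1, h1W, m43, ha, Nat.mod_eq_of_lt]
      · simp [Prog.exec, j1, h1W, m43, ha, j2]
      · by_cases hvi : v = i
        · subst hvi
          rw [rd_comm, hR.rd_anc (of_eq_true ha) hu]
          simp [Prog.exec, j1, h1W, m43, ha, j2, m30]
        · simpa [Prog.exec, j1, h1W, m43, ha, hvi] using j3 v (by omega)
    · have hi0 : 0 < i := by
        by_contra h0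
        rw [show i = 0 by omega] at ha
        exact of_eq_false ha (hR.anc_zero hu)
      have hp := hR.par_lt i hi0 (by omega)
      refine ⟨?_, ?_, fun v hv => ?_⟩
      · simp (disch := omega) [Prog.exec, j1, h1W, m43, ha, Nat.mod_eq_of_lt]
      · simp [Prog.exec, j1, h1W, m43, ha, j2]
      · by_cases hvi : v = i
        · subst hvi
          rw [rd_comm, hR.rd_of_not_anc hi0 .refl (of_eq_false ha) (by omega) hu, rd_comm,
            ← (j3 _ hp).2]
          simp [Prog.exec, j1, h1W, m43, ha, j2, m30, m31]
        · simpa [Prog.exec, j1, h1W, m43, ha, hvi] using j3 v (by omega)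
  · rintro s2 t2 - ⟨⟨j1, -, j3⟩, ht2⟩
    refine ⟨by omega, j1, fun v hv => ?_⟩
    simp only [Mem.recs, (j3 v (by omega)).1, (j3 v (by omega)).2]

theorem listProg_spec {s : Mem} {k : ℕ} (hkn : k ≤ n) (hW : 4 * n + 10 < W) (h1 : s.ints 1 0 = k) :
    Ends W listProg s fun s' t => t ≤ 50 * n + 100 ∧
      ∀ i < k, s'.ints 6 i = s.ints 30 (s.ints 10 i) := by
  refine .seq (.flat rfl fun t1 ht1 => ?_)
  have e1 : (Prog.ivar 84 0).time ≤ 10 := by decide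
  have hs1 := exec_same W (.ivar 84 0) s
  have i1 : (Prog.exec W (.ivar 84 0) s).ints 84 0 = 0 := by simp [Prog.exec]
  generalize Prog.exec W _ s = s1 at *
  refine (Ends.count_flat (fun i s' => s'.ints 84 0 = i ∧ s'.ints 1 0 = k ∧
    ∀ j < i, s'.ints 6 j = s.ints 30 (s.ints 10 j)) 50 0 k (Nat.zero_le _)
    ⟨i1, by rw [hs1.int 1, h1], by omega⟩ ?_ ?_).mono ?_
  · rintro i s' hi ⟨j1, j2, -⟩
    simp [j1, j2]
  · rintro i s' hi ⟨j1, j2, j3⟩ hs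
    have m30 : s'.ints 30 = s.ints 30 := by rw [hs.int 30, hs1.int 30]
    have m10 : s'.ints 10 = s.ints 10 := by rw [hs.int 10, hs1.int 10]
    refine ⟨?_, ?_, fun x hx => ?_⟩
    · simp (disch := omega) [Prog.exec, j1, Nat.mod_eq_of_lt]
    · simp [Prog.exec, j2]
    · by_cases hxi : x = i
      · simp [Prog.exec, j1, hxi, m30, m10]
      · simpa [Prog.exec, j1, hxi] using j3 x (by omega)
  · rintro s2 t2 - ⟨⟨-, -, j3⟩, ht2⟩
    exact ⟨by omega, j3⟩

/-- The first `k` entries of a list sorted by distance from `u` are closed under strictly nearer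
vertices, and this is all that the construction of the subtree needs. -/
theorem OutputsSolution.of_sorted {T : SimpleGraph (Fin n)} {len : Sym2 (Fin n) → ℝ}
    {lab : Fin n ≃ Fin n} {k w : ℕ} {s : Mem} {ℓ : ℕ → ℕ} {q : ℕ → ℝ × ℕ}
    (h : Models T len lab par dep) (hT : T.IsTree) (hk : 1 ≤ k) (hℓ : ∀ i : Fin n, ℓ i = lab i)
    (hF : Feas n k par dep D u) (hmin : ∀ D' u', 0 ≤ D' → Feas n k par dep D' u' → D ≤ D')
    (hq : items q 0 (u + 1) = items (fun v => (rd par dep u v, v)) 0 (u + 1))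
    (hmono : ∀ x y, x ≤ y → y < u + 1 → (q x).1 ≤ (q y).1)
    (hw : LastWithin par dep u (D / 2) 0 w) (h6 : ∀ i < k, s.ints 6 i = ℓ (q i).2)
    (h4 : s.ints 4 0 = ℓ w) (h5 : s.ints 5 0 = if w = 0 then ℓ w else ℓ (par w))
    (h1 : s.reals 1 0 = if w = 0 then 0 else D / 2 - (dep u - dep w)) (h2 : s.reals 2 0 = D / 2) :
    OutputsSolution k T len s := by
  have hu := hF.1
  have hku : k ≤ u + 1 := by
    have := Finset.card_filter_le (Finset.range (u + 1)) fun v => rd par dep u v ≤ D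
    rw [Finset.card_range] at this
    exact hF.2.trans this
  have q1 : ∀ i ≤ u, (q i).2 ≤ u ∧ (q i).1 = rd par dep u (q i).2 := by
    intro i hi
    have hm : q i ∈ items q 0 (u + 1) := mem_items.2 ⟨i, i.zero_le, by omega, rfl⟩
    rw [hq] at hm
    obtain ⟨v, -, hv, e⟩ := mem_items.1 hm
    rw [← e]
    exact ⟨by omega, rfl⟩
  have q2 : ∀ v ≤ u, ∃ i ≤ u, (q i).2 = v := by
    intro v hv
    have hm : (rd par dep u v, v) ∈ items (fun v => (rd par dep u v, v)) 0 (u + 1) :=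
      mem_items.2 ⟨v, v.zero_le, by omega, rfl⟩
    rw [← hq] at hm
    obtain ⟨i, -, hi, e⟩ := mem_items.1 hm
    exact ⟨i, by omega, by rw [e]⟩
  -- The list covers all vertices up to `u` with as many entries, so nothing repeats and its first
  -- `k` entries give `k` vertices.
  have hinj : Set.InjOn (fun i => (q i).2) (Finset.range (u + 1) : Set ℕ) := by
    refine Finset.injOn_of_surjOn_of_card_le (t := Finset.range (u + 1)) _ (fun i hi => ?_)
      (fun v hv => ?_) le_rfl
    · have := (q1 i (by simp at hi; omega)).1
      simp
      omega
    · obtain ⟨i, hi, e⟩ := q2 v (by simp at hv; omega)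
      exact ⟨i, by simp; omega, e⟩
  set S := (Finset.range k).image fun i => (q i).2 with hSdef
  have hSc : S.card = k := by
    rw [hSdef, Finset.card_image_of_injOn, Finset.card_range]
    exact hinj.mono fun i hi => by simp at hi ⊢; omega
  have hS : ∀ v ∈ S, v ≤ u := by
    intro v hv
    obtain ⟨i, hi, rfl⟩ := Finset.mem_image.1 hv
    rw [Finset.mem_range] at hi
    exact (q1 i (by omega)).1
  have hcl : ∀ v ∈ S, ∀ w ≤ u, rd par dep u w < rd par dep u v → w ∈ S := by
    intro v hv w hw hlt
    obtain ⟨i, hi, rfl⟩ := Finset.mem_image.1 hv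
    obtain ⟨j, hj, rfl⟩ := q2 w hw
    rw [Finset.mem_range] at hi
    rw [← (q1 i (by omega)).2, ← (q1 j hj).2] at hlt
    refine Finset.mem_image.2 ⟨j, Finset.mem_range.2 ?_, rfl⟩
    by_contra hjk
    exact hlt.not_ge (hmono i j (by omega) (by omega))
  have key : ∀ x : Point T len, OutputsPoint s x →
      (∀ v : Fin n, (v : ℕ) ≤ u → rd par dep u v ≤ D → x.dist (lab v) ≤ D / 2) →
      OutputsSolution k T len s := by
    intro x hox hx
    obtain ⟨H, e1, e2, e3, e4⟩ := h.isPartialCenter hT hk hF hmin x hx hSc hS hcl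
    refine ⟨x, H, e1, e2, hox, by rw [h2, e3], fun v => ?_⟩
    obtain ⟨j, rfl⟩ := lab.surjective v
    rw [e4, hSdef, Finset.mem_image]
    refine exists_congr fun i => ?_
    rw [Finset.mem_range]
    refine and_congr_right fun hi => ?_
    have hl := hℓ ⟨(q i).2, by have := (q1 i (by omega)).1; omega⟩
    rw [h6 i hi, hl, Fin.val_inj, lab.apply_eq_iff_eq, Fin.ext_iff]
  obtain ⟨w1, w2, w3⟩ := hw
  have hwn : w < n := (h.tree.anc_le w2 hu).trans_lt hu
  rcases Nat.eq_zero_or_pos w with rfl | hw0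
  · rw [if_pos rfl] at h1 h5
    rw [h.tree.dep_zero, sub_zero] at w1
    refine key (.vertex (lab ⟨0, hwn⟩)) ⟨?_, ?_, h1⟩ fun v hv _ => h.dist_vertex_le hu w1 hwn v hv
    · rw [h4, ← hℓ]
    · rw [h5, ← hℓ]
  · rw [if_neg hw0.ne'] at h1 h5
    have hpn := (h.tree.par_lt w hw0 hwn).trans hwn
    have hadj : T.Adj (lab ⟨w, hwn⟩) (lab ⟨par w, hpn⟩) := (h.adj _ _).2 (.inr ⟨hw0, rfl⟩)
    -- The vertex `w` is within `D / 2` of `u` and its parent is not, so the point at height `D / 2`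
    -- above `u` falls on the edge between them.
    have hlt : D / 2 < dep u - dep (par w) := by
      rcases w3 with w3 | w3
      · omega
      · exact w3.2.1
    have hl := h.len_eq ⟨par w, hpn⟩ ⟨w, hwn⟩ hw0 rfl
    simp only at hl
    have ht1 : D / 2 - (dep u - dep w) ≤ len s(lab ⟨w, hwn⟩, lab ⟨par w, hpn⟩) := by
      rw [Sym2.eq_swap, hl]
      linarith
    refine key (.onEdge _ _ hadj _ (by linarith) ht1) ⟨?_, ?_, h1⟩ fun v hv hvD =>
      h.dist_onEdge_le hu hw0 hwn hpn w2 hadj _ _ v hv hvD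
    · rw [h4, ← hℓ]
    · rw [h5, ← hℓ]

theorem outProg_spec {T : SimpleGraph (Fin n)} {len : Sym2 (Fin n) → ℝ} {lab : Fin n ≃ Fin n}
    {k M L : ℕ} {oa ob a p b : ℕ → ℕ} {X Y : ℕ → ℝ} {s : Mem} (h : Models T len lab par dep)
    (hT : T.IsTree) (hk : 1 ≤ k) (hkn : k ≤ n) (hℓ : ∀ i : Fin n, s.ints 30 i = lab i)
    (hN : Nodes n M oa ob a p b X Y (rd par dep))
    (hcov : ∀ u v, v < u → u < n → ∑ κ ∈ Finset.range M, pairHits oa ob a b κ u v = 1)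
    (hW : 4 * n + M + 10 < W) (hoW : oa M + ob M < W) (hL : n ≤ 2 ^ L)
    (hTab : Tab n k M oa ob a p b X Y s) (h31 : s.ints 31 = par) (h30 : s.reals 30 = dep)
    (hD : 0 ≤ s.reals 72 0) (hF : ∃ u, Feas n k par dep (s.reals 72 0) u)
    (hmin : ∀ D' u', 0 ≤ D' → Feas n k par dep D' u' → s.reals 72 0 ≤ D') :
    Ends W outProg s fun s' t =>
      t ≤ 200 * oa M + 250 * ob M + 400 * M + 500 * n + 1000 + 300 * (n + 1) * (L + 1) ∧
        OutputsSolution k T len s' := by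
  refine .seq (.flat rfl fun t1 ht1 => ?_)
  have e1 : (Prog.rvar 70 (.var 72)).time ≤ 10 := by decide
  have hs1 := exec_same W (.rvar 70 (.var 72)) s
  have i1 : (Prog.exec W (.rvar 70 (.var 72)) s).reals 70 0 = s.reals 72 0 := by simp [Prog.exec]
  have T1 := hTab.of_same hs1
  generalize Prog.exec W _ s = s1 at *
  refine .seq ((decideProg_spec hN hcov hW.le hoW T1 i1 hD).mono ?_)
  rintro s2 t2 hs2 ⟨ht2, d1, d2⟩
  -- The decision procedure is run once more at the optimum, only to obtain a witness; the answer
  -- must be positive there.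
  replace d1 := d1 (by
    by_contra hne
    obtain ⟨u, hu⟩ := hF
    exact d2 hne u hu)
  clear d2
  have T2 := T1.of_same hs2
  generalize hu : s2.ints 81 0 = u at d1
  have hun := d1.1
  refine .seq ((chainProg_spec (D := s.reals 72 0) h.tree hun (by omega) T2.hn
    (by rw [hs2.int 31, hs1.int 31, h31]) (by rw [hs2.real 30, hs1.real 30, h30]) hu
    (by rw [hs2.real 72, hs1.real 72]) hD).mono ?_)
  rintro s3 t3 hs3 ⟨ht3, c1, c2⟩
  refine .seq ((distProg_spec h.tree hun (by omega)
    (by rw [hs3.int 31, hs2.int 31, hs1.int 31, h31])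
    (by rw [hs3.real 30, hs2.real 30, hs1.real 30, h30]) (by rw [hs3.int 81, hu]) c2).mono ?_)
  rintro s4 t4 hs4 ⟨ht4, f1, f2⟩
  refine .seq ((sortProg_spec (L := L) (by omega) f1 (by omega)).mono ?_)
  rintro s5 t5 hs5 ⟨ht5, g1, g2⟩
  rw [items_congr (g := fun v => (rd par dep u v, v)) fun x _ hx => f2 x (by omega)] at g1
  refine .seq ((listProg_spec (n := n) hkn (by omega)
    (by rw [hs5.int 1, hs4.int 1, hs3.int 1, T2.hk])).mono ?_)
  rintro s6 t6 hs6 ⟨ht6, l1⟩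
  have m30 : s5.ints 30 = s.ints 30 := by
    rw [hs5.int 30, hs4.int 30, hs3.int 30, hs2.int 30, hs1.int 30]
  have n30 : s6.ints 30 = s.ints 30 := by rw [hs6.int 30, m30]
  have n31 : s6.ints 31 = par := by
    rw [hs6.int 31, hs5.int 31, hs4.int 31, hs3.int 31, hs2.int 31, hs1.int 31, h31]
  have n81 : s6.ints 81 0 = u := by rw [hs6.int 81, hs5.int 81, hs4.int 81, hs3.int 81, hu]
  have n85 : s6.ints 85 0 = s3.ints 85 0 := by rw [hs6.int 85, hs5.int 85, hs4.int 85]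
  have r30 : s6.reals 30 = dep := by
    rw [hs6.real 30, hs5.real 30, hs4.real 30, hs3.real 30, hs2.real 30, hs1.real 30, h30]
  have r72 : s6.reals 72 0 = s.reals 72 0 := by
    rw [hs6.real 72, hs5.real 72, hs4.real 72, hs3.real 72, hs2.real 72, hs1.real 72]
  refine .flat rfl fun t7 ht7 => ⟨?_, ?_⟩
  · have : pointProg.time ≤ 60 := by decide
    have := Nat.mul_le_mul_right (L + 1) (Nat.mul_le_mul_left 300 (show u + 1 + 1 ≤ n + 1 by omega))
    omega
  refine .of_sorted h hT hk hℓ d1 hmin g1 g2 c1 (fun i hi => ?_) ?_ ?_ ?_ ?_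
  · rw [(exec_same W pointProg s6).int 6, l1 i hi, m30]
  all_goals
    rcases (em (s3.ints 85 0 = 0)).imp eq_true eq_false with hc | hc <;>
    simp [pointProg, Prog.exec, n30, n31, n81, n85, r30, r72, hc]

end Output

end PartialCenter

set_option linter.unusedSimpArgs false

namespace PartialCenter

/-! ## The whole program -/

/-- Solves the unweighted connected `k`-vertex one-center problem on trees. -/
def solveProg : Prog := rootProg ;; decompProg ;; searchProg ;; outProg

/-- Each term is at most a constant times `n * l ^ 2`. The size `o` of the nodes is of order `n *
l`, and both the decomposition and the search multiply this by another factor of order `l`. -/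
theorem solveProg_time {n l c M o : ℕ} (hn : 1 ≤ n) (hl : 1 ≤ l) (hc : c ≤ n * (8 * l + 1))
    (ho : o ≤ 2 * c) (hM : M ≤ 2 * n) :
    1000 * (n + 1) * (l + 1) + 1000 + (2000 * (l + 1) * c + 40 * n + 200 +
      (10000 * (2 * l + 7 + 1) * (o + (2 * l + 7 + 1) * (M + 1) + n + 1) +
        (250 * o + 400 * M + 500 * n + 1000 + 300 * (n + 1) * (l + 1)))) ≤
      5100000 * (n * l ^ 2) := by
  have h1 : n ≤ n * l := Nat.le_mul_of_pos_right _ hl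
  have h2 : n * l ≤ n * l ^ 2 := Nat.mul_le_mul_left _ (Nat.le_self_pow two_ne_zero l)
  have hc' : c ≤ 9 * (n * l) := by linarith
  have h3 : (n + 1) * (l + 1) ≤ (2 * n) * (2 * l) := Nat.mul_le_mul (by omega) (by omega)
  have h4 : (l + 1) * c ≤ (2 * l) * (9 * (n * l)) := Nat.mul_le_mul (by omega) hc'
  have h5 : (2 * l + 7 + 1) * (M + 1) ≤ (10 * l) * (3 * n) := Nat.mul_le_mul (by omega) (by omega)
  have h6 : (2 * l + 7 + 1) * (o + (2 * l + 7 + 1) * (M + 1) + n + 1) ≤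
      (10 * l) * (50 * (n * l)) := Nat.mul_le_mul (by omega) (by linarith)
  linarith

theorem solveProg_spec {n k : ℕ} {T : SimpleGraph (Fin n)} {len : Sym2 (Fin n) → ℝ}
    {ends : Fin (n - 1) → Fin n × Fin n} (hT : T.IsTree) (hlen : ∀ e ∈ T.edgeSet, 0 < len e)
    (hE : IsEdgeList T ends) (hk : 1 ≤ k) (hkn : k ≤ n) :
    Ends ((n + 1) ^ 16) solveProg (inputMem k len ends) fun s t =>
      t ≤ 5100000 * (n * (Nat.log 2 n + 1) ^ 2) ∧ OutputsSolution k T len s := by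
  have hn : 0 < n := by omega
  have hl : n < 2 ^ (Nat.log 2 n + 1) := Nat.lt_pow_succ_log_self one_lt_two n
  have hl' := Nat.pow_log_le_self 2 hn.ne'
  have hl0 : Nat.log 2 n + 1 < 2 ^ (Nat.log 2 n + 1) := Nat.lt_two_pow_self
  set l := Nat.log 2 n + 1 with hldef
  have hc := cost_le (show n - 1 ≤ 2 ^ l by omega)
  have hc' : cost (n - 1) ≤ n * (8 * l + 1) := hc.trans (Nat.mul_le_mul_right _ (by omega))
  have e7 : 2 ^ (2 * l + 7) = 2 ^ l * 2 ^ l * 128 := by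
    rw [pow_add, two_mul, pow_add]
    norm_num
  have h2l : 2 ^ l ≤ 2 * n := by
    rw [hldef, pow_succ]
    omega
  -- The logarithmic bound for the search has to cover eight times the size of the nodes, up to `16
  -- * (n * (8 * l + 1))`, together with their number. Since `2 ^ l` exceeds both `n` and `l`, the
  -- exponent `2 * l + 7` suffices.
  have hbig : n * (128 * l + 33) ≤ 2 ^ (2 * l + 7) := by
    rw [e7, mul_assoc]
    exact Nat.mul_le_mul hl.le (by omega)
  -- All indices, counters and sums are at most quadratic in `n` with moderate constants; the
  -- exponent 16 leaves room for these constants even at `n = 1`.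
  have hW : 4096 * (n + 1) ^ 2 ≤ (n + 1) ^ 16 := by
    have : 2 ^ 14 ≤ (n + 1) ^ 14 := Nat.pow_le_pow_left (by omega) 14
    calc 4096 * (n + 1) ^ 2 ≤ (n + 1) ^ 14 * (n + 1) ^ 2 := Nat.mul_le_mul_right _ (by omega)
      _ = _ := by rw [← pow_add]
  have hpow : 2 ^ (2 * l + 7) ≤ 512 * n ^ 2 := by
    have := Nat.mul_le_mul h2l h2l
    rw [e7]
    linarith
  generalize (n + 1) ^ 16 = W at *
  have hsq : (n + 1) ^ 2 = n ^ 2 + 2 * n + 1 := by ring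
  have hnn : n * (2 * n) = 2 * n ^ 2 := by ring
  have hnl : n * (128 * l + 33) = 16 * (n * (8 * l + 1)) + 17 * n := by ring
  refine .seq ((rootProg_spec (L := l) hT hn hlen hE (by omega) hl.le).mono ?_)
  rintro s1 t1 hs1 ⟨ht1, lab, hm, hlab⟩
  have h0 : s1.ints 0 0 = n := by rw [hs1.int 0]; simp [inputMem]
  have h1 : s1.ints 1 0 = k := by rw [hs1.int 1]; simp [inputMem]
  refine .seq ((decompProg_spec (L := l) hm.tree hn hl.le (by omega) h0 rfl rfl).mono ?_)
  rintro s2 t2 hs2 ⟨ht2, M, hd⟩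
  have hsize := hd.size
  have hM := hd.M_le
  have hcov := hd.cover
  simp only [segHits, add_zero] at hcov
  simp only [List.length_nil, add_zero] at hM
  have hTab : Tab n k M (s2.ints 63) (s2.ints 64) (s2.ints 60) (s2.ints 61) (s2.ints 62)
      (s2.reals 60) (s2.reals 61) s2 :=
    ⟨hd.n_eq, by rw [hs2.int 1, h1], rfl, rfl, rfl, rfl, rfl, hd.M_eq, rfl, rfl⟩
  have hp2 := hd.par_eq
  have hd2 := hd.dep_eq
  refine .seq ((searchProg_spec (L := 2 * l + 7) hm.tree hd.nodes hcov hk hkn hTab hd2 (by omega)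
    (by omega)).mono ?_)
  rintro s3 t3 hs3 ⟨ht3, h72, hF, hmin⟩
  refine (outProg_spec (L := l) hm hT hk hkn (fun i => ?_) hd.nodes hcov (by omega) (by omega) hl.le
    (hTab.of_same hs3) (by rw [hs3.int 31, hp2]) (by rw [hs3.real 30, hd2]) h72 hF hmin).mono ?_
  · rw [hs3.int 30, hs2.int 30, hlab]
  rintro s4 t4 - ⟨ht4, ho⟩
  refine ⟨?_, ho⟩
  have := solveProg_time (l := l) (M := M) (o := s2.ints 63 M + s2.ints 64 M) hn (by omega) hc'
    (by omega) (by omega)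
  omega

end PartialCenter

theorem mainTheorem4 :
    ∃ (P : PartialCenter.Prog) (c : ℕ) (C : ℝ),
      ∀ (n k : ℕ) (T : SimpleGraph (Fin n)) (len : Sym2 (Fin n) → ℝ)
        (ends : Fin (n - 1) → Fin n × Fin n),
        T.IsTree → (∀ e ∈ T.edgeSet, 0 < len e) → PartialCenter.IsEdgeList T ends →
        1 ≤ k → k ≤ n →
        ∃ (s : PartialCenter.Mem) (t : ℕ),
          PartialCenter.Runs ((n + 1) ^ c) P (PartialCenter.inputMem k len ends) s t ∧
          PartialCenter.OutputsSolution k T len s ∧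
          (2 ≤ n → (t : ℝ) ≤ C * (n * Real.log n ^ 2)) := by
  refine ⟨PartialCenter.solveProg, 16, 16 * 5100000, fun n k T len ends hT hlen hE hk hkn => ?_⟩
  obtain ⟨s, t, h, ht, hs⟩ := PartialCenter.solveProg_spec hT hlen hE hk hkn
  refine ⟨s, t, h, hs, fun hn => ?_⟩
  have hn' : (0 : ℝ) < n := by positivity
  have h2 := Real.log_two_gt_d9
  -- For `n ≥ 2` both the binary logarithm and 1 are at most `Real.log n / Real.log 2`, and `2 /
  -- Real.log 2 < 4`. Squaring gives the factor 16 in the constant.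
  have hlog : ((Nat.log 2 n + 1 : ℕ) : ℝ) ≤ 4 * Real.log n := by
    have h3 : (Nat.log 2 n : ℝ) * Real.log 2 ≤ Real.log n := by
      rw [← Real.log_pow]
      exact Real.log_le_log (by positivity) (by exact_mod_cast Nat.pow_log_le_self 2 (by omega))
    have h4 : Real.log 2 ≤ Real.log n := Real.log_le_log (by norm_num) (by exact_mod_cast hn)
    have h5 : (0 : ℝ) ≤ Nat.log 2 n := by positivity
    push_cast
    nlinarith
  have h6 : ((Nat.log 2 n + 1 : ℕ) : ℝ) ^ 2 ≤ (4 * Real.log n) ^ 2 :=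
    pow_le_pow_left₀ (by positivity) hlog 2
  calc (t : ℝ) ≤ 5100000 * (n * ((Nat.log 2 n + 1 : ℕ) : ℝ) ^ 2) := by exact_mod_cast ht
    _ ≤ 5100000 * (n * (4 * Real.log n) ^ 2) := by gcongr
    _ = _ := by ring
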